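/- Let $n\ge 1$ and let $\mathbf S^n\subset\mathbb R^{n+1}$ be the sphere of radius $\sqrt{2n}$ centered at the origin. Let $L=\Delta+1$, where $\Delta$ is the Laplace–Beltrami operator of $\mathbf S^n$, let $\lambda_j=\frac{j(j+n-1)}{2n}-1$ for $j=0,1,2,\dots$, let $E_j=\{\varphi\in C^\infty(\mathbf S^n): L\varphi=-\lambda_j\varphi\}$, and let $\pi_j$ be the $L^2$-orthogonal projection onto $E_j$. For an integer $\ell\ge 0$ put $\|u\|_{H^\ell}^2=\sum_j|\lambda_j|^\ell\|\pi_j u\|_{L^2}^2$ (a norm equivalent to the usual one of $H^\ell(\mathbf S^n)$; note $\lambda_j\ne0$). For an integer $k$ let $F_k=\bigoplus_{j\ge k}E_j$ be the subspace of those $u$ with $\pi_ju=0$ for all $j<k$, and let $\Pi_k$ be the orthogonal projection onto $F_k$. Let $N(u)=f(u,\nabla u)+\operatorname{trace}\big(B(u,\nabla u)\nabla^2u\big)$, where $f$ and $B$ (a scalar and an endomorphism of the tangent space, which may also depend on the point of $\mathbf S^n$) are smooth for $(u,\nabla u)$ near $(0,0)$, with $f(0,0)=0$, $df(0,0)=0$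 and $B(0,0)=0$. (The nonlinear term of the rescaled mean curvature flow $\partial_su=Lu+N(u)$ over $\mathbf S^n$ is of this form.) For an integer $r$ and $\sigma\in\mathbb R$ let $X_{r,\sigma}$ be the space of measurable paths $v$ on $[0,\infty)$ with values in $H^r(\mathbf S^n)$, and in $H^{r+1}(\mathbf S^n)$ for almost every time, for which $$\|v\|_{r,\sigma}=\Big(\int_0^\infty\|v(s)\|_{H^{r+1}}^2\,ds\Big)^{1/2}+\sup_{s\ge0}e^{\sigma s}\|v(s)\|_{H^r}$$ is finite. For $u_0\in F_k$ and a path $v$, let $T(v;u_0)$ be the path $T$ that solves $$(\partial_s-L)T(s)=N(v(s)),\qquad T(0)=u_0-\int_0^\infty e^{-L\tau}(1-\Pi_k)N(v(\tau))\,d\tau ,$$ where the equation is understood in the strong sense: $T$ is locally absolutely continuous with values in $L^2(\mathbf S^n)$ and, for almost every $s>0$, $T(s)$ and $v(s)$ are $C^2$ on $\mathbf S^n$ and the equation holds. **Theorem.** Let $k\ge2$ and $r>n/2+1$ be integers, and let $\sigma>0$ satisfy $\lambda_{k-1}<\sigma<\lambda_k$. There are constants $C>0$ and $\delta_0>0$,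 depending only on $n$, $N$, $r$, $\sigma$ and $k$, such that for every $\delta\in(0,\delta_0]$ there is $\varepsilon>0$ with the following property. Let $u_0\in F_k$ with $\|u_0\|_{H^r}\le\varepsilon$, and let $\mathcal B_\delta=\{v\in X_{r,\sigma}:\|v\|_{r,\sigma}\le\delta\}$. Then: 1. for every $v\in\mathcal B_\delta$ the integral defining $T(0)$ converges and the initial value problem above has exactly one solution $T(v;u_0)$; 2. $T(\cdot;u_0)$ maps $\mathcal B_\delta$ into itself; 3. for all $v,w\in\mathcal B_\delta$, $$\|T(v;u_0)-T(w;u_0)\|_{r,\sigma}\le C\big(\|v\|_{r,\sigma}+\|w\|_{r,\sigma}\big)\|v-w\|_{r,\sigma};$$ 4. $T(\cdot;u_0)$ is a contraction of $\mathcal B_\delta$: there is $q\in(0,1)$ with $\|T(v;u_0)-T(w;u_0)\|_{r,\sigma}\le q\,\|v-w\|_{r,\sigma}$ for all $v,w\in\mathcal B_\delta$; 5. $T(\cdot;u_0)$ has exactly one fixed point in $\mathcal B_\delta$. -/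

import Mathlib

open MeasureTheory Set
open scoped ContDiff Gradient InnerProductSpace

noncomputable section

/-- The ambient Euclidean space `ℝⁿ⁺¹`. -/
abbrev Amb (n : ℕ) : Type := EuclideanSpace ℝ (Fin (n + 1))

/-- The radius `√(2n)` of the sphere `𝐒ⁿ ⊂ ℝⁿ⁺¹`. -/
def sphereRadius (n : ℕ) : ℝ := Real.sqrt (2 * n)

/-- The sphere `𝐒ⁿ` of radius `√(2n)` centered at the origin. -/
def roundSphere (n : ℕ) : Set (Amb n) := Metric.sphere 0 (sphereRadius n)

/-- The surface measure of `𝐒ⁿ`, as a measure on `ℝⁿ⁺¹`: the image of the surface measure of the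
unit sphere under dilation by the radius, multiplied by the `n`-th power of the radius. -/
def surfaceMeasure (n : ℕ) : Measure (Amb n) :=
  ENNReal.ofReal (sphereRadius n ^ n) •
    Measure.map
      (fun x : Metric.sphere (0 : Amb n) 1 => sphereRadius n • (x : Amb n))
      (Measure.toSphere volume)

/-- The real Hilbert space `L²(𝐒ⁿ)`. -/
abbrev L2Sphere (n : ℕ) : Type := Lp ℝ 2 (surfaceMeasure n)

/-- A `C^m` function on the sphere, represented by its extension to `ℝⁿ⁺¹ ∖ {0}` that is constant
along rays (the value at `0` plays no role). For such `U` and `y ∈ 𝐒ⁿ`, the Euclidean gradient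
of `U` at `y` is tangent to the sphere and is the Riemannian gradient, the tangential block of the
Euclidean Hessian at `y` is the covariant Hessian, and the Euclidean Laplacian at `y` is the
Laplace--Beltrami operator of `𝐒ⁿ`. -/
def IsSphereFun {n : ℕ} (m : WithTop ℕ∞) (U : Amb n → ℝ) : Prop :=
  (∀ (c : ℝ) (x : Amb n), 0 < c → U (c • x) = U x) ∧ ContDiffOn ℝ m U {0}ᶜ

/-- Orthogonal projection of `ℝⁿ⁺¹` onto the tangent space `y^⊥` of the sphere at `y`. -/
def tangentProj {n : ℕ} (y : Amb n) : Amb n →L[ℝ] Amb n :=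
  ((ℝ ∙ y)ᗮ).starProjection

/-- The covariant Hessian `∇²U` at the point `y` of the sphere, as the endomorphism
`X ↦ ∇_X ∇U` of the tangent space, extended by zero in the normal direction. -/
def sphereHessian {n : ℕ} (U : Amb n → ℝ) (y : Amb n) : Amb n →L[ℝ] Amb n :=
  (tangentProj y).comp ((fderiv ℝ (fun x => ∇ U x) y).comp (tangentProj y))

/-- The linear operator `L = Δ + 1` on functions on the sphere. -/
def opL {n : ℕ} (U : Amb n → ℝ) (y : Amb n) : ℝ := Laplacian.laplacian U y + U y

/-- `λ_j = j (j + n - 1) / (2n) - 1`; the eigenvalues of `L` are the numbers `-λ_j`. -/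
def eigval (n j : ℕ) : ℝ := (j : ℝ) * ((j : ℝ) + (n : ℝ) - 1) / (2 * (n : ℝ)) - 1

/-- The eigenspace `E_j` of smooth functions with `L U = -λ_j U`, inside `L²(𝐒ⁿ)`. These functions
form a finite-dimensional subspace, so taking the span and the closure changes nothing;
it only makes `E_j` a closed subspace without a proof. -/
def eigenspaceE (n j : ℕ) : Submodule ℝ (L2Sphere n) :=
  (Submodule.span ℝ {u : L2Sphere n | ∃ U : Amb n → ℝ, IsSphereFun ∞ U ∧
    u =ᵐ[surfaceMeasure n] U ∧
      ∀ y ∈ roundSphere n, opL U y = -eigval n j * U y}).topologicalClosure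

/-- The `L²` orthogonal projection `π_j` onto `E_j`. -/
def eigProj (n j : ℕ) : L2Sphere n →L[ℝ] L2Sphere n :=
  haveI : CompleteSpace (eigenspaceE n j) := Submodule.topologicalClosure.completeSpace _
  (eigenspaceE n j).starProjection

/-- The Sobolev norm `‖u‖_{H^ℓ} = (∑_j |λ_j|^ℓ ‖π_j u‖²)^{1/2} ∈ [0, ∞]`, that is,
`⟨|L|^ℓ u, u⟩^{1/2}`. A function lies in `H^ℓ(𝐒ⁿ)` when this is finite. -/
def sobolevNorm {n : ℕ} (l : ℕ) (u : L2Sphere n) : ENNReal :=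
  (∑' j : ℕ, ENNReal.ofReal (|eigval n j| ^ l) * ‖eigProj n j u‖ₑ ^ 2) ^ (1 / 2 : ℝ)

/-- The closed subspace `⨁_{j ≥ k} E_j` of `L²(𝐒ⁿ)`; its elements of finite `H^r` norm form the
subspace `F_k` of `H^r(𝐒ⁿ)`. -/
def spaceF (n k : ℕ) : Submodule ℝ (L2Sphere n) :=
  (⨆ j : ℕ, ⨆ _ : k ≤ j, eigenspaceE n j).topologicalClosure

/-- The orthogonal projection `Π_k` onto `F_k`. -/
def projF (n k : ℕ) : L2Sphere n →L[ℝ] L2Sphere n :=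
  haveI : CompleteSpace (spaceF n k) := Submodule.topologicalClosure.completeSpace _
  (spaceF n k).starProjection

/-- `e^{-Lτ} (1 - Π_k) w`. On `⨁_{j<k} E_j`, the range of `1 - Π_k`, the operator `e^{-Lτ}` is
multiplication by `e^{λ_j τ}` on `E_j`. -/
def backwardLow (n k : ℕ) (τ : ℝ) (w : L2Sphere n) : L2Sphere n :=
  ∑ j ∈ Finset.range k, Real.exp (eigval n j * τ) • eigProj n j (w - projF n k w)

/-- A quasilinear term `N(u, ∇u, ∇²u) = f(u, ∇u) + trace (B(u, ∇u) ∇²u)` on the sphere. The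
coefficients may depend on the point `y ∈ 𝐒ⁿ` (`f` is a function on `ℝ × T𝐒ⁿ`), and are smooth
for `(u, ∇u)` near zero. They are written as functions of `(y, z, p)` with `p ∈ ℝⁿ⁺¹`;
only tangent `p` and the tangential block of `B` enter `N`. -/
structure QuasilinearTerm (n : ℕ) where
  f : Amb n × ℝ × Amb n → ℝ
  B : Amb n × ℝ × Amb n → (Amb n →L[ℝ] Amb n)
  /-- the open set on which the coefficients are smooth -/
  dom : Set (Amb n × ℝ × Amb n)
  isOpen_dom : IsOpen dom
  zero_mem_dom : ∀ y ∈ roundSphere n, (y, (0 : ℝ), (0 : Amb n)) ∈ dom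
  smooth_f : ContDiffOn ℝ ∞ f dom
  smooth_B : ContDiffOn ℝ ∞ B dom
  f_zero : ∀ y ∈ roundSphere n, f (y, 0, 0) = 0
  /-- the derivative of `f` in `(z, p)`, `p` tangent, vanishes at `(0, 0)` -/
  df_zero : ∀ y ∈ roundSphere n, ∀ (z : ℝ) (p : Amb n), ⟪y, p⟫_ℝ = 0 →
    fderiv ℝ (fun q : ℝ × Amb n => f (y, q)) 0 (z, p) = 0
  B_zero : ∀ y ∈ roundSphere n, B (y, 0, 0) = 0

/-- `N(U)` at the point `y` of the sphere. -/
def QuasilinearTerm.eval {n : ℕ} (N : QuasilinearTerm n) (U : Amb n → ℝ) (y : Amb n) : ℝ :=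
  N.f (y, U y, ∇ U y) +
    LinearMap.trace ℝ (Amb n)
      ((N.B (y, U y, ∇ U y)).comp (sphereHessian U y) : Amb n →L[ℝ] Amb n).toLinearMap

/-- `u` is (the class of) a `C²` function on the sphere, and `g = N(u)`. -/
def QuasilinearTerm.IsValue {n : ℕ} (N : QuasilinearTerm n) (u g : L2Sphere n) : Prop :=
  ∃ U : Amb n → ℝ, IsSphereFun 2 U ∧ u =ᵐ[surfaceMeasure n] U ∧
    g =ᵐ[surfaceMeasure n] N.eval U

/-- `u` is (the class of) a `C²` function on the sphere, and `h = L u`. -/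
def IsValueL {n : ℕ} (u h : L2Sphere n) : Prop :=
  ∃ U : Amb n → ℝ, IsSphereFun 2 U ∧ u =ᵐ[surfaceMeasure n] U ∧
    h =ᵐ[surfaceMeasure n] opL U

/-- The weighted norm
`‖v‖_{r,σ} = (∫₀^∞ ‖v(s)‖²_{H^{r+1}} ds)^{1/2} + sup_{s ≥ 0} e^{σ s} ‖v(s)‖_{H^r}` in `[0, ∞]`
of a path; only the times `s ≥ 0` matter. -/
def pathNorm {n : ℕ} (r : ℕ) (σ : ℝ) (v : ℝ → L2Sphere n) : ENNReal :=
  (∫⁻ s in Ioi (0 : ℝ), sobolevNorm (r + 1) (v s) ^ 2) ^ (1 / 2 : ℝ) +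
    ⨆ s : ℝ, ⨆ _ : 0 ≤ s, ENNReal.ofReal (Real.exp (σ * s)) * sobolevNorm r (v s)

/-- The closed ball of radius `δ` centered at the origin in the space `X_{r,σ}` of measurable
paths with finite `‖·‖_{r,σ}`. -/
def pathBall (n r : ℕ) (σ δ : ℝ) : Set (ℝ → L2Sphere n) :=
  {v | AEStronglyMeasurable v (volume.restrict (Ioi (0 : ℝ))) ∧
    pathNorm r σ v ≤ ENNReal.ofReal δ}

/-- The path `T`, on `[0, ∞)`, solves
`(∂_s - L) T = N(v)`, `T(0) = u₀ - ∫₀^∞ e^{-Lτ} (1 - Π_k) N(v(τ)) dτ`.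
The equation holds in the strong sense: `T` is locally absolutely continuous with values in `L²`,
at almost every time `T` and `v` are `C²` in space, and `∂_s T = L T + N(v)`
(here `g` is `N(v)` and `h` is `L T`). The convergence of the integrals is part of the
definition. -/
def IsSolutionPath {n : ℕ} (N : QuasilinearTerm n) (k : ℕ) (u₀ : L2Sphere n)
    (v T : ℝ → L2Sphere n) : Prop :=
  ∃ g h : ℝ → L2Sphere n,
    (∀ᵐ τ ∂(volume.restrict (Ioi (0 : ℝ))), N.IsValue (v τ) (g τ)) ∧
    (∀ᵐ τ ∂(volume.restrict (Ioi (0 : ℝ))), IsValueL (T τ) (h τ)) ∧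
    (∀ s : ℝ, 0 ≤ s →
      IntervalIntegrable (fun τ => h τ + g τ) volume 0 s ∧
        T s = T 0 + ∫ τ in (0 : ℝ)..s, (h τ + g τ)) ∧
    IntegrableOn (fun τ => backwardLow n k τ (g τ)) (Ioi (0 : ℝ)) ∧
    T 0 = u₀ - ∫ τ in Ioi (0 : ℝ), backwardLow n k τ (g τ)

end

/-! The equation decouples into modes. The component x of T in E_j satisfies x' = -λ_j x + a_j,
where a_j is the component of N(v), so it is given by Duhamel's formula (`duhamel`). For j ≥ k the
initial value comes from u₀ and the mode is propagated forward. For j < k the prescribed initial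
value is exactly the one that turns the formula into -∫_s^∞ e^{λ_j(τ-s)} a_j(τ) dτ, an integral from
infinity. After multiplication by e^{σs} the inhomogeneity is, in both cases, convolved with a
kernel bounded by e^{-κ_j|s-τ|}, κ_j = |λ_j - σ|, because λ_{k-1} < σ < λ_k. Cauchy-Schwarz and
Tonelli bound such a convolution: on squares the gain is 1/κ_j in the supremum and 1/κ_j² in L² of
time (`bounds_of_le_expKernel`). Since κ_j ≥ c|λ_j| (`exists_spectral_gap`), the solution gains one
order of differentiability in the supremum and two orders in L² of time (`tsum_solComp_le`).

Put m = r - 1, so that 2m > n. By the linear theory it remains to bound N(v) - N(w) in L²(e^{2σs}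
ds; H^m). The term N is affine in the second derivatives and vanishes to second order at zero. Hence
its differences in H^m are bounded by products of one norm of order m + 1 and one norm of order m +
2 (`QuasilinearTerm.exists_sobolev_estimate`). The weight e^{σs} goes to the factor of order m + 1,
which the supremum part of the path norm controls; the factor of order m + 2 is square integrable in
time (`weightSq_sub_le`). This is the quadratic difference estimate. On a small ball it gives the
contraction and, with w = 0 and small u₀, invariance of the ball.

The Sobolev estimate rests on the rotation fields D_i. On the sphere the Laplacian is a multiple of
∑ D_i², the D_i are skew-adjoint and they preserve spherical harmonics. Hence the norm of order l +
1 of f is controlled by the norms of order l of f and of the D_i f, and conversely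
(`sobolevNorm_succ_le`, `sobolevNorm_D_le`). L² bounds for products come from a dyadic decomposition
and from the reproducing kernel bound sup |f|² ≤ C (j+1)^n ‖f‖² for polynomials of degree j
(`exists_abs_le_of_mem_pol`); Leibniz' rule raises them to Sobolev norms (`exists_nrm_mul_le`). The
chain rule treats smooth functions of the first jet (`exists_nrm_comp_mul_le`), and Hadamard's lemma
turns vanishing at zero into quadratic bounds. These estimates are proved for polynomials on the
sphere and extended along truncated harmonic expansions, by lower semicontinuity of the norms.

A strong solution is unique since N(v) is determined by v, so that the difference of two solutions
satisfies x' = -λ_j x, x(0) = 0 in every mode (`IsSolutionPath.eqOn`). The fixed point is the limit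
of the Picard iterates, taken at each time in L²; lower semicontinuity of the path norm keeps the
limit in the ball (`exists_unique_fixed_path`). -/

open Filter Topology
open scoped ENNReal NNReal

set_option linter.unusedSectionVars false

noncomputable section

/-! ### The surface measure -/

section SurfaceMeasure

variable {n : ℕ}

/-- The action of a linear isometry on the unit sphere. -/
def unitSphereMap (g : Amb n ≃ₗᵢ[ℝ] Amb n) (x : Metric.sphere (0 : Amb n) 1) :
    Metric.sphere (0 : Amb n) 1 :=
  ⟨g x, by simp⟩

lemma continuous_unitSphereMap (g : Amb n ≃ₗᵢ[ℝ] Amb n) : Continuous (unitSphereMap g) :=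
  (g.continuous.comp continuous_subtype_val).subtype_mk _

-- `Measure.toSphere` measures a set by the volume of the cone over it, and a linear isometry maps
-- cones to cones and preserves volume.
open scoped Pointwise in
lemma map_unitSphereMap (g : Amb n ≃ₗᵢ[ℝ] Amb n) :
    Measure.map (unitSphereMap g) (Measure.toSphere (volume : Measure (Amb n))) =
      Measure.toSphere volume := by
  ext s hs
  have hm := (continuous_unitSphereMap g).measurable
  rw [Measure.map_apply hm hs, Measure.toSphere_apply' _ hs, Measure.toSphere_apply' _ (hm hs)]
  congr 1
  have : (Ioo (0 : ℝ) 1 • (Subtype.val '' (unitSphereMap g ⁻¹' s)) : Set (Amb n)) =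
      g ⁻¹' (Ioo (0 : ℝ) 1 • (Subtype.val '' s)) := by
    ext x
    simp only [Set.mem_smul, Set.mem_preimage, Set.mem_image]
    constructor
    · rintro ⟨c, hc, _, ⟨y, hy, rfl⟩, rfl⟩
      exact ⟨c, hc, g y, ⟨unitSphereMap g y, hy, rfl⟩, by simp⟩
    · rintro ⟨c, hc, _, ⟨y, hy, rfl⟩, h⟩
      refine ⟨c, hc, g.symm y, ⟨unitSphereMap g.symm y, ?_, rfl⟩, ?_⟩
      · have : unitSphereMap g (unitSphereMap g.symm y) = y := by
          ext1; simp [unitSphereMap]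
        simpa [this] using hy
      · rw [← map_smul, h]; simp
  rw [this]
  exact (g.measurePreserving).measure_preimage_equiv (f := g.toHomeomorph.toMeasurableEquiv) _

/-- Rotation invariance is the source of integration by parts: differentiated along one-parameter
groups it becomes `integral_rotDeriv`. -/
lemma measurePreserving_surfaceMeasure (g : Amb n ≃ₗᵢ[ℝ] Amb n) :
    MeasurePreserving g (surfaceMeasure n) (surfaceMeasure n) := by
  refine ⟨g.continuous.measurable, ?_⟩
  have hφ : Measurable fun x : Metric.sphere (0 : Amb n) 1 => sphereRadius n • (x : Amb n) :=
    (Continuous.const_smul continuous_subtype_val (sphereRadius n)).measurable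
  unfold surfaceMeasure
  rw [Measure.map_smul, Measure.map_map g.continuous.measurable hφ]
  congr 1
  conv_rhs => rw [← map_unitSphereMap g]
  rw [Measure.map_map hφ (continuous_unitSphereMap g).measurable]
  congr 1
  ext1 x
  simp [unitSphereMap]

instance : IsFiniteMeasure (surfaceMeasure n) := by
  unfold surfaceMeasure
  exact Measure.smul_finite _ ENNReal.ofReal_ne_top

lemma sphereRadius_nonneg : 0 ≤ sphereRadius n := Real.sqrt_nonneg _

lemma sphereRadius_pos [NeZero n] : 0 < sphereRadius n :=
  Real.sqrt_pos.2 (by have := NeZero.pos n; positivity)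

lemma sphereRadius_sq : sphereRadius n ^ 2 = 2 * n := Real.sq_sqrt (by positivity)

lemma norm_of_mem_roundSphere {y : Amb n} (hy : y ∈ roundSphere n) : ‖y‖ = sphereRadius n := by
  simpa [roundSphere] using hy

lemma mem_roundSphere_iff {y : Amb n} : y ∈ roundSphere n ↔ ‖y‖ = sphereRadius n := by
  simp [roundSphere]

lemma ne_zero_of_mem_roundSphere [NeZero n] {y : Amb n} (hy : y ∈ roundSphere n) : y ≠ 0 := by
  rintro rfl
  have := norm_of_mem_roundSphere hy
  simp only [norm_zero] at this
  exact sphereRadius_pos.ne this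

lemma isCompact_roundSphere : IsCompact (roundSphere n) := isCompact_sphere _ _

lemma ae_mem_roundSphere : ∀ᵐ y ∂(surfaceMeasure n), y ∈ roundSphere n := by
  unfold surfaceMeasure
  refine Measure.ae_smul_measure ?_ _
  rw [ae_map_iff (f := fun x : Metric.sphere (0 : Amb n) 1 => sphereRadius n • (x : Amb n))
    (p := fun y => y ∈ roundSphere n)
    (Continuous.const_smul continuous_subtype_val (sphereRadius n)).aemeasurable
    Metric.isClosed_sphere.measurableSet]
  refine Eventually.of_forall fun x => ?_
  simp [mem_roundSphere_iff, norm_smul, abs_of_nonneg (sphereRadius_nonneg (n := n))]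

/-- Nonempty relatively open subsets of the sphere have positive measure. -/
lemma surfaceMeasure_pos [NeZero n] {W : Set (Amb n)} (hW : IsOpen W)
    (hne : (W ∩ roundSphere n).Nonempty) : 0 < surfaceMeasure n W := by
  have hR := sphereRadius_pos (n := n)
  have hφ : Continuous fun x : Metric.sphere (0 : Amb n) 1 => sphereRadius n • (x : Amb n) :=
    Continuous.const_smul continuous_subtype_val (sphereRadius n)
  unfold surfaceMeasure
  rw [Measure.smul_apply, Measure.map_apply hφ.measurable hW.measurableSet, smul_eq_mul]
  refine ENNReal.mul_pos (by simpa using pow_pos hR n) ?_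
  refine ((hW.preimage hφ).measure_pos _ ?_).ne'
  obtain ⟨y, hyW, hy⟩ := hne
  refine ⟨⟨(sphereRadius n)⁻¹ • y, ?_⟩, ?_⟩
  · simp [norm_smul, norm_of_mem_roundSphere hy, abs_of_pos hR, hR.ne']
  · simpa [smul_smul, hR.ne'] using hyW

lemma surfaceMeasure_univ_pos [NeZero n] : 0 < surfaceMeasure n univ := by
  have hR := sphereRadius_pos (n := n)
  refine surfaceMeasure_pos isOpen_univ ⟨sphereRadius n • EuclideanSpace.single 0 1, trivial, ?_⟩
  simp [mem_roundSphere_iff, norm_smul, abs_of_pos hR]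

/-- Continuous functions on the sphere which agree almost everywhere are equal. -/
lemma eqOn_roundSphere_of_ae_eq [NeZero n] {U V : Amb n → ℝ} (hU : ContinuousOn U {0}ᶜ)
    (hV : ContinuousOn V {0}ᶜ) (h : U =ᵐ[surfaceMeasure n] V) : EqOn U V (roundSphere n) := by
  intro y hy
  by_contra hne
  have hopen : IsOpen ({0}ᶜ ∩ (fun x => U x - V x) ⁻¹' {0}ᶜ) :=
    (hU.sub hV).isOpen_inter_preimage isOpen_compl_singleton isOpen_compl_singleton
  have h1 := surfaceMeasure_pos hopen
    ⟨y, ⟨ne_zero_of_mem_roundSphere hy, by simpa [sub_eq_zero] using hne⟩, hy⟩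
  have h2 : surfaceMeasure n ({0}ᶜ ∩ (fun x => U x - V x) ⁻¹' {0}ᶜ) = 0 := by
    refine measure_mono_null ?_ (ae_iff.1 h)
    rintro x ⟨-, hx⟩
    simpa [sub_eq_zero] using hx
  exact h1.ne' h2

end SurfaceMeasure

/-! ### Functions which are constant along rays -/

section SphereFun

variable {n : ℕ}

lemma IsSphereFun.mono {m m' : WithTop ℕ∞} {U : Amb n → ℝ} (h : IsSphereFun m U) (hm : m' ≤ m) :
    IsSphereFun m' U := ⟨h.1, h.2.of_le hm⟩

lemma IsSphereFun.continuousOn {m : WithTop ℕ∞} {U : Amb n → ℝ} (h : IsSphereFun m U) :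
    ContinuousOn U {0}ᶜ := h.2.continuousOn

lemma IsSphereFun.contDiffAt {m : WithTop ℕ∞} {U : Amb n → ℝ} (h : IsSphereFun m U) {x : Amb n}
    (hx : x ≠ 0) : ContDiffAt ℝ m U x :=
  (h.2 x hx).contDiffAt (isOpen_compl_singleton.mem_nhds hx)

lemma IsSphereFun.differentiableAt {m : WithTop ℕ∞} {U : Amb n → ℝ} (h : IsSphereFun m U)
    (hm : 1 ≤ m) {x : Amb n} (hx : x ≠ 0) : DifferentiableAt ℝ U x :=
  (h.contDiffAt hx).differentiableAt (by intro h0; simp [h0] at hm)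

/-- Evaluation at a nonzero point reduces to evaluation on the sphere. -/
lemma exists_mem_roundSphere_smul [NeZero n] {x : Amb n} (hx : x ≠ 0) :
    ∃ c : ℝ, 0 < c ∧ c • x ∈ roundSphere n := by
  have hR := sphereRadius_pos (n := n)
  have hx' := norm_pos_iff.2 hx
  exact ⟨sphereRadius n / ‖x‖, by positivity, by
    rw [mem_roundSphere_iff, norm_smul, Real.norm_of_nonneg (by positivity)]; field_simp⟩

lemma IsSphereFun.eqOn_compl [NeZero n] {m m' : WithTop ℕ∞} {U V : Amb n → ℝ}
    (hU : IsSphereFun m U) (hV : IsSphereFun m' V) (h : EqOn U V (roundSphere n)) :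
    EqOn U V {0}ᶜ := by
  intro x hx
  obtain ⟨c, hc, hcx⟩ := exists_mem_roundSphere_smul (n := n) hx
  rw [← hU.1 c x hc, ← hV.1 c x hc, h hcx]

lemma IsSphereFun.exists_bound [NeZero n] {m : WithTop ℕ∞} {U : Amb n → ℝ}
    (hU : IsSphereFun m U) : ∃ C, 0 ≤ C ∧ ∀ x, x ≠ 0 → |U x| ≤ C := by
  obtain ⟨C, hC⟩ := isCompact_roundSphere.exists_bound_of_continuousOn (f := U)
    (hU.continuousOn.mono fun y hy => ne_zero_of_mem_roundSphere (n := n) hy)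
  refine ⟨max C 0, le_max_right _ _, fun x hx => ?_⟩
  obtain ⟨c, hc, hcx⟩ := exists_mem_roundSphere_smul (n := n) hx
  rw [← hU.1 c x hc]
  exact (hC _ hcx).trans (le_max_left _ _)

lemma ae_ne_zero [NeZero n] : ∀ᵐ y ∂(surfaceMeasure n), y ≠ 0 := by
  filter_upwards [ae_mem_roundSphere (n := n)] with y hy using ne_zero_of_mem_roundSphere hy

lemma ContinuousOn.aestronglyMeasurable_surfaceMeasure [NeZero n] {F : Type*}
    [NormedAddCommGroup F] {U : Amb n → F} (hU : ContinuousOn U {0}ᶜ) :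
    AEStronglyMeasurable U (surfaceMeasure n) := by
  have h0 : (surfaceMeasure n).restrict {0}ᶜ = surfaceMeasure n := by
    rw [Measure.restrict_eq_self_of_ae_mem]
    exact ae_ne_zero
  rw [← h0]
  exact hU.aestronglyMeasurable (measurableSet_singleton _).compl

lemma IsSphereFun.memLp [NeZero n] {m : WithTop ℕ∞} {U : Amb n → ℝ} (hU : IsSphereFun m U)
    (p : ℝ≥0∞) : MemLp U p (surfaceMeasure n) := by
  obtain ⟨C, -, hC⟩ := hU.exists_bound
  exact MemLp.of_bound hU.continuousOn.aestronglyMeasurable_surfaceMeasure C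
    (ae_ne_zero.mono fun x hx => hC x hx)

lemma IsSphereFun.integrable [NeZero n] {m : WithTop ℕ∞} {U : Amb n → ℝ} (hU : IsSphereFun m U) :
    Integrable U (surfaceMeasure n) := memLp_one_iff_integrable.1 (hU.memLp 1)

lemma IsSphereFun.mul {m : WithTop ℕ∞} {U V : Amb n → ℝ} (hU : IsSphereFun m U)
    (hV : IsSphereFun m V) : IsSphereFun m (U * V) :=
  ⟨fun c x hc => by simp [hU.1 c x hc, hV.1 c x hc], hU.2.mul hV.2⟩

lemma IsSphereFun.add {m : WithTop ℕ∞} {U V : Amb n → ℝ} (hU : IsSphereFun m U)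
    (hV : IsSphereFun m V) : IsSphereFun m (U + V) :=
  ⟨fun c x hc => by simp [hU.1 c x hc, hV.1 c x hc], hU.2.add hV.2⟩

/-- The fderiv of a function constant along rays is homogeneous of degree `-1`. -/
lemma IsSphereFun.fderiv_smul {m : WithTop ℕ∞} {U : Amb n → ℝ} (hU : IsSphereFun m U) {c : ℝ}
    (hc : 0 < c) (x : Amb n) : c • fderiv ℝ U (c • x) = fderiv ℝ U x := by
  rw [← fderiv_comp_smul]
  congr 1
  ext y
  exact hU.1 c y hc

/-- Euler's identity. -/
lemma IsSphereFun.fderiv_self {m : WithTop ℕ∞} {U : Amb n → ℝ} (hU : IsSphereFun m U)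
    (hm : 1 ≤ m) {x : Amb n} (hx : x ≠ 0) : fderiv ℝ U x x = 0 := by
  have h1 : HasDerivAt (fun t : ℝ => U ((1 + t) • x)) (fderiv ℝ U x x) 0 := by
    have hd : HasFDerivAt U (fderiv ℝ U x) ((1 + (0:ℝ)) • x) := by
      simpa using (hU.differentiableAt hm hx).hasFDerivAt
    have h2 : HasDerivAt (fun t : ℝ => (1 + t) • x) x 0 := by
      simpa using ((hasDerivAt_id (0:ℝ)).const_add 1).smul_const x
    exact hd.comp_hasDerivAt (0:ℝ) h2
  have h2 : (fun t : ℝ => U ((1 + t) • x)) =ᶠ[𝓝 0] fun _ => U x := by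
    filter_upwards [lt_mem_nhds (show (-1:ℝ) < 0 by norm_num)] with t ht
    exact hU.1 _ x (by linarith)
  exact h1.unique ((hasDerivAt_const (0:ℝ) (U x)).congr_of_eventuallyEq h2)

/-! ### Rotation fields -/

/-- Index set of the generators of rotations in the coordinate planes. -/
abbrev RotIdx (n : ℕ) : Type := Fin (n + 1) × Fin (n + 1)

/-- The vector field `x ↦ x_a e_b - x_b e_a`. -/
def rotGen (i : RotIdx n) : Amb n →L[ℝ] Amb n :=
  (EuclideanSpace.proj i.1).smulRight (EuclideanSpace.single i.2 (1 : ℝ)) -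
    (EuclideanSpace.proj i.2).smulRight (EuclideanSpace.single i.1 (1 : ℝ))

lemma rotGen_apply (i : RotIdx n) (x : Amb n) :
    rotGen i x = x i.1 • EuclideanSpace.single i.2 (1 : ℝ) -
      x i.2 • EuclideanSpace.single i.1 (1 : ℝ) := rfl

lemma inner_rotGen_self (i : RotIdx n) (x : Amb n) : ⟪x, rotGen i x⟫_ℝ = 0 := by
  simp [rotGen_apply, inner_sub_right, inner_smul_right, EuclideanSpace.inner_single_right]
  ring

/-- The one-parameter group of rotations generated by `rotGen i`. -/
def rotFlow (i : RotIdx n) (t : ℝ) : Amb n →L[ℝ] Amb n := NormedSpace.exp (t • rotGen i)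

lemma hasDerivAt_rotFlow (i : RotIdx n) (x : Amb n) (t : ℝ) :
    HasDerivAt (fun s => rotFlow i s x) (rotGen i (rotFlow i t x)) t :=
  (hasDerivAt_exp_smul_const' (𝕂 := ℝ) (rotGen i) t).clm_apply (hasDerivAt_const t x) |>.congr_deriv
    (by simp [rotFlow])

lemma rotFlow_zero (i : RotIdx n) (x : Amb n) : rotFlow i 0 x = x := by
  have h : rotFlow i 0 = NormedSpace.exp (0 : Amb n →L[ℝ] Amb n) :=
    congrArg NormedSpace.exp (zero_smul ℝ (rotGen i))
  rw [h, NormedSpace.exp_zero]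
  rfl

/-- The generator is skew (`inner_rotGen_self`), so the squared norm has zero derivative along the
flow. -/
lemma norm_rotFlow (i : RotIdx n) (t : ℝ) (x : Amb n) : ‖rotFlow i t x‖ = ‖x‖ := by
  have h : ∀ s, HasDerivAt (fun s => ⟪rotFlow i s x, rotFlow i s x⟫_ℝ) 0 s := fun s => by
    have := (hasDerivAt_rotFlow i x s).inner ℝ (hasDerivAt_rotFlow i x s)
    simpa [real_inner_comm, inner_rotGen_self] using this
  have := is_const_of_deriv_eq_zero (fun s => (h s).differentiableAt) (fun s => (h s).deriv) t 0
  simp only [real_inner_self_eq_norm_sq, rotFlow_zero] at this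
  exact (sq_eq_sq₀ (norm_nonneg _) (norm_nonneg _)).1 this

/-- The rotations as linear isometric equivalences. -/
def rotIso (i : RotIdx n) (t : ℝ) : Amb n ≃ₗᵢ[ℝ] Amb n :=
  LinearIsometry.toLinearIsometryEquiv ⟨(rotFlow i t).toLinearMap, norm_rotFlow i t⟩ rfl

/-- Differentiation along the rotation field `rotGen i`. -/
def rotDeriv (i : RotIdx n) (U : Amb n → ℝ) (x : Amb n) : ℝ := fderiv ℝ U x (rotGen i x)

lemma IsSphereFun.rotDeriv {m m' : WithTop ℕ∞} {U : Amb n → ℝ} (hU : IsSphereFun m U)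
    (hm : m' + 1 ≤ m) (i : RotIdx n) : IsSphereFun m' (rotDeriv i U) := by
  refine ⟨fun c x hc => ?_, ?_⟩
  · simp only [_root_.rotDeriv]
    rw [map_smul, map_smul, ← hU.fderiv_smul hc x]
    rfl
  · exact (hU.2.fderiv_of_isOpen isOpen_compl_singleton hm).clm_apply
      (rotGen i).contDiff.contDiffOn

lemma rotFlow_ne_zero (i : RotIdx n) (t : ℝ) {x : Amb n} (hx : x ≠ 0) : rotFlow i t x ≠ 0 := by
  rw [← norm_pos_iff, norm_rotFlow]
  exact norm_pos_iff.2 hx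

/-- By invariance of the measure the integral of `U (rotFlow i t x)` does not depend on `t`; its
derivative at `t = 0`, taken under the integral sign, is the integral of `rotDeriv i U`. -/
lemma integral_rotDeriv [NeZero n] {U : Amb n → ℝ} (hU : IsSphereFun 1 U) (i : RotIdx n) :
    ∫ x, rotDeriv i U x ∂(surfaceMeasure n) = 0 := by
  have hD := hU.rotDeriv (m' := 0) (by simp) i
  obtain ⟨C, -, hC⟩ := hD.exists_bound
  have hmeas : ∀ t, AEStronglyMeasurable (fun x => U (rotFlow i t x)) (surfaceMeasure n) :=
    fun t => ContinuousOn.aestronglyMeasurable_surfaceMeasure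
      (hU.continuousOn.comp (rotFlow i t).continuous.continuousOn
        fun x hx => rotFlow_ne_zero i t hx)
  have key := (hasDerivAt_integral_of_dominated_loc_of_deriv_le (μ := surfaceMeasure n)
    (F := fun t x => U (rotFlow i t x)) (F' := fun t x => rotDeriv i U (rotFlow i t x))
    (x₀ := (0:ℝ)) (bound := fun _ => C) (s := univ) univ_mem
    (Eventually.of_forall hmeas) (by simpa [rotFlow_zero] using hU.integrable)
    (by simpa [rotFlow_zero] using hD.continuousOn.aestronglyMeasurable_surfaceMeasure)
    (by
      filter_upwards [ae_ne_zero (n := n)] with x hx t _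
      exact hC _ (rotFlow_ne_zero i t hx))
    (integrable_const _)
    (by
      filter_upwards [ae_ne_zero (n := n)] with x hx t _
      exact (hU.differentiableAt le_rfl (rotFlow_ne_zero i t hx)).hasFDerivAt.comp_hasDerivAt t
        (hasDerivAt_rotFlow i x t))).2
  have hconst : (fun t => ∫ x, U (rotFlow i t x) ∂(surfaceMeasure n)) =
      fun _ => ∫ x, U x ∂(surfaceMeasure n) := by
    ext t
    exact (measurePreserving_surfaceMeasure (rotIso i t)).integral_comp
      (rotIso i t).toHomeomorph.measurableEmbedding U
  rw [hconst] at key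
  have := key.unique (hasDerivAt_const _ _)
  simpa [rotFlow_zero] using this

lemma rotDeriv_mul {m : WithTop ℕ∞} {U V : Amb n → ℝ} (hU : IsSphereFun m U)
    (hV : IsSphereFun m V) (hm : 1 ≤ m) (i : RotIdx n) {x : Amb n} (hx : x ≠ 0) :
    rotDeriv i (U * V) x = rotDeriv i U x * V x + U x * rotDeriv i V x := by
  simp only [rotDeriv]
  rw [fderiv_mul (hU.differentiableAt hm hx) (hV.differentiableAt hm hx)]
  simp
  ring

lemma integral_rotDeriv_mul [NeZero n] {U V : Amb n → ℝ} (hU : IsSphereFun 1 U)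
    (hV : IsSphereFun 1 V) (i : RotIdx n) :
    ∫ x, rotDeriv i U x * V x ∂(surfaceMeasure n) =
      -∫ x, U x * rotDeriv i V x ∂(surfaceMeasure n) := by
  have h0 := integral_rotDeriv (hU.mul hV) i
  have hU' := hU.rotDeriv (m' := 0) (by simp) i
  have hV' := hV.rotDeriv (m' := 0) (by simp) i
  have : ∫ x, rotDeriv i (U * V) x ∂(surfaceMeasure n) =
      ∫ x, (rotDeriv i U x * V x + U x * rotDeriv i V x) ∂(surfaceMeasure n) :=
    integral_congr_ae (ae_ne_zero.mono fun x hx => rotDeriv_mul hU hV le_rfl i hx)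
  rw [this, integral_add (f := fun x => rotDeriv i U x * V x)
    (g := fun x => U x * rotDeriv i V x) (hU'.mul (hV.mono zero_le_one)).integrable
    ((hU.mono zero_le_one).mul hV').integrable] at h0
  linarith

end SphereFun

/-! ### The Laplacian in terms of rotation fields -/

section Casimir

variable {n : ℕ}

/-- For a ≠ b the square of the generator is minus the projection onto the coordinate plane (a, b),
and every coordinate lies in 2n ordered pairs of this kind. -/
lemma sum_rotGen_rotGen (x : Amb n) :
    ∑ i : RotIdx n, rotGen i (rotGen i x) = -(2 * n : ℝ) • x := by
  ext c
  simp only [WithLp.ofLp_sum, Finset.sum_apply, Fintype.sum_prod_type]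
  simp [rotGen_apply, Finset.sum_sub_distrib]
  ring

lemma sum_smul_rotGen (x : Amb n) (b : Fin (n + 1)) :
    ∑ a, x a • rotGen (a, b) x = ‖x‖ ^ 2 • EuclideanSpace.single b (1 : ℝ) - x b • x := by
  ext c
  simp only [WithLp.ofLp_sum, Finset.sum_apply]
  simp [rotGen_apply, mul_sub, Finset.sum_sub_distrib, EuclideanSpace.norm_sq_eq]
  by_cases hc : c = b
  · simp [hc, pow_two]
  · simp [hc]; ring

/-- Expand `H` on x_a e_b - x_b e_a over all ordered pairs: each of the two diagonal terms
contributes |x|² times the trace, each of the two cross terms contributes -H(x, x). Symmetry of `H`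
plays no role. -/
lemma sum_bilin_rotGen (H : Amb n →L[ℝ] Amb n →L[ℝ] ℝ) (x : Amb n) :
    ∑ i : RotIdx n, H (rotGen i x) (rotGen i x) =
      2 * ‖x‖ ^ 2 * ∑ b, H (EuclideanSpace.single b (1 : ℝ)) (EuclideanSpace.single b (1 : ℝ))
        - 2 * H x x := by
  have hx : ∑ a, x a • EuclideanSpace.single a (1 : ℝ) = x := by
    ext c; simp [Pi.single_apply]
  have hH : H x x = ∑ a, ∑ b, x a * x b *
      H (EuclideanSpace.single b (1 : ℝ)) (EuclideanSpace.single a (1 : ℝ)) := by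
    conv_lhs => rw [← hx]
    simp only [map_sum, map_smul, _root_.sum_apply, _root_.smul_apply, smul_eq_mul, Finset.mul_sum]
    exact Finset.sum_congr rfl fun a _ => Finset.sum_congr rfl fun b _ => by ring
  have hH' : H x x = ∑ a, ∑ b, x a * x b *
      H (EuclideanSpace.single a (1 : ℝ)) (EuclideanSpace.single b (1 : ℝ)) := by
    rw [hH, Finset.sum_comm]
    exact Finset.sum_congr rfl fun a _ => Finset.sum_congr rfl fun b _ => by ring
  have h1 : ∑ a, ∑ b, x a ^ 2 * H (EuclideanSpace.single b (1 : ℝ)) (EuclideanSpace.single b 1) =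
      ‖x‖ ^ 2 * ∑ b, H (EuclideanSpace.single b (1 : ℝ)) (EuclideanSpace.single b 1) := by
    simp [EuclideanSpace.norm_sq_eq, Finset.sum_mul_sum]
  have h2 : ∑ a, ∑ b, x b ^ 2 * H (EuclideanSpace.single a (1 : ℝ)) (EuclideanSpace.single a 1) =
      ‖x‖ ^ 2 * ∑ b, H (EuclideanSpace.single b (1 : ℝ)) (EuclideanSpace.single b 1) := by
    rw [Finset.sum_comm, h1]
  rw [Fintype.sum_prod_type, show ∀ A B : ℝ, 2 * A * B - 2 * H x x =
    A * B + A * B - H x x - H x x by intros; ring, ← h1]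
  nth_rewrite 2 [h1]
  rw [← h2]
  nth_rewrite 1 [hH]
  rw [hH', ← Finset.sum_add_distrib, ← Finset.sum_sub_distrib, ← Finset.sum_sub_distrib]
  refine Finset.sum_congr rfl fun a _ => ?_
  rw [← Finset.sum_add_distrib, ← Finset.sum_sub_distrib, ← Finset.sum_sub_distrib]
  refine Finset.sum_congr rfl fun b _ => ?_
  simp only [rotGen_apply, map_sub, map_smul, _root_.sub_apply, _root_.smul_apply, smul_eq_mul]
  ring

lemma IsSphereFun.differentiableAt_fderiv {m : WithTop ℕ∞} {U : Amb n → ℝ}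
    (hU : IsSphereFun m U) (hm : 2 ≤ m) {x : Amb n} (hx : x ≠ 0) :
    DifferentiableAt ℝ (fderiv ℝ U) x :=
  ((hU.contDiffAt hx).fderiv_right (m := 1) (by rwa [one_add_one_eq_two])).differentiableAt
    one_ne_zero

lemma IsSphereFun.fderiv_fderiv_self {m : WithTop ℕ∞} {U : Amb n → ℝ}
    (hU : IsSphereFun m U) (hm : 2 ≤ m) {x : Amb n} (hx : x ≠ 0) :
    fderiv ℝ (fderiv ℝ U) x x x = 0 := by
  have hm1 : 1 ≤ m := le_trans (by norm_num) hm
  have h1 : HasFDerivAt (fun y => fderiv ℝ U y y) _ x :=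
    (hU.differentiableAt_fderiv hm hx).hasFDerivAt.clm_apply (hasFDerivAt_id x)
  have h2 : (fun y => fderiv ℝ U y y) =ᶠ[𝓝 x] fun _ => 0 := by
    filter_upwards [isOpen_compl_singleton.mem_nhds hx] with y hy using hU.fderiv_self hm1 hy
  have h3 := congrArg (fun L => L x) (h1.unique ((hasFDerivAt_const (0:ℝ) x).congr_of_eventuallyEq h2))
  simpa [hU.fderiv_self hm1 hx] using h3

lemma IsSphereFun.fderiv_rotDeriv {m : WithTop ℕ∞} {U : Amb n → ℝ}
    (hU : IsSphereFun m U) (hm : 2 ≤ m) {x : Amb n} (hx : x ≠ 0) (i : RotIdx n) (v : Amb n) :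
    fderiv ℝ (_root_.rotDeriv i U) x v =
      fderiv ℝ (fderiv ℝ U) x v (rotGen i x) + fderiv ℝ U x (rotGen i v) := by
  have h1 : HasFDerivAt (fun y => fderiv ℝ U y (rotGen i y)) _ x :=
    (hU.differentiableAt_fderiv hm hx).hasFDerivAt.clm_apply (rotGen i).hasFDerivAt
  have : fderiv ℝ (_root_.rotDeriv i U) x = _ := h1.fderiv
  rw [this]
  simp [add_comm]

lemma laplacian_eq_sum_fderiv (U : Amb n → ℝ) (x : Amb n) :
    Laplacian.laplacian U x = ∑ b, fderiv ℝ (fderiv ℝ U) x (EuclideanSpace.single b (1 : ℝ))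
      (EuclideanSpace.single b (1 : ℝ)) := by
  rw [InnerProductSpace.laplacian_eq_iteratedFDeriv_orthonormalBasis U
    (EuclideanSpace.basisFun (Fin (n + 1)) ℝ)]
  simp [iteratedFDeriv_two_apply]

/-- The sum of squares of rotation fields is the Hessian traced over the fields plus a first-order
term along `x`. For a function constant along rays the radial parts vanish, by Euler's identity and
its derivative, and the trace of the Hessian remains. The factor 2 counts each coordinate plane
twice. -/
lemma IsSphereFun.sum_rotDeriv_rotDeriv {m : WithTop ℕ∞} {U : Amb n → ℝ}
    (hU : IsSphereFun m U) (hm : 2 ≤ m) {x : Amb n} (hx : x ≠ 0) :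
    ∑ i, _root_.rotDeriv i (_root_.rotDeriv i U) x = 2 * ‖x‖ ^ 2 * Laplacian.laplacian U x := by
  have hm1 : 1 ≤ m := le_trans (by norm_num) hm
  have : ∀ i, _root_.rotDeriv i (_root_.rotDeriv i U) x =
      fderiv ℝ (fderiv ℝ U) x (rotGen i x) (rotGen i x) + fderiv ℝ U x (rotGen i (rotGen i x)) :=
    fun i => hU.fderiv_rotDeriv hm hx i _
  simp_rw [this]
  rw [Finset.sum_add_distrib, sum_bilin_rotGen, ← map_sum, sum_rotGen_rotGen, map_smul,
    hU.fderiv_self hm1 hx, hU.fderiv_fderiv_self hm hx, laplacian_eq_sum_fderiv]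
  simp

/-- Partial derivatives in terms of rotation fields. -/
lemma IsSphereFun.fderiv_single {m : WithTop ℕ∞} {U : Amb n → ℝ}
    (hU : IsSphereFun m U) (hm : 1 ≤ m) {x : Amb n} (hx : x ≠ 0) (b : Fin (n + 1)) :
    fderiv ℝ U x (EuclideanSpace.single b 1) =
      (‖x‖ ^ 2)⁻¹ * ∑ a, x a * _root_.rotDeriv (a, b) U x := by
  have h := congrArg (fderiv ℝ U x) (sum_smul_rotGen x b)
  simp only [map_sum, map_smul, map_sub, hU.fderiv_self hm hx, smul_eq_mul, mul_zero,
    sub_zero] at h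
  have hx' : ‖x‖ ^ 2 ≠ 0 := by simpa using hx
  rw [eq_inv_mul_iff_mul_eq₀ hx', ← h]
  rfl

/-- `opL` on the sphere in terms of rotation fields. -/
lemma IsSphereFun.opL_eq [NeZero n] {m : WithTop ℕ∞} {U : Amb n → ℝ}
    (hU : IsSphereFun m U) (hm : 2 ≤ m) {y : Amb n} (hy : y ∈ roundSphere n) :
    opL U y = (4 * n : ℝ)⁻¹ * ∑ i, _root_.rotDeriv i (_root_.rotDeriv i U) y + U y := by
  have hn : (n : ℝ) ≠ 0 := by exact_mod_cast NeZero.ne n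
  rw [opL, hU.sum_rotDeriv_rotDeriv hm (ne_zero_of_mem_roundSphere hy),
    norm_of_mem_roundSphere hy, sphereRadius_sq]
  field_simp
  ring

/-- Green's identity. -/
lemma integral_opL_mul [NeZero n] {U V : Amb n → ℝ} (hU : IsSphereFun 2 U)
    (hV : IsSphereFun 2 V) :
    ∫ x, opL U x * V x ∂(surfaceMeasure n) = ∫ x, U x * opL V x ∂(surfaceMeasure n) := by
  have hD : ∀ {W : Amb n → ℝ}, IsSphereFun 2 W → ∀ i, IsSphereFun 1 (rotDeriv i W) :=
    fun hW i => hW.rotDeriv (by rw [one_add_one_eq_two]) i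
  have hDD : ∀ {W : Amb n → ℝ}, IsSphereFun 2 W → ∀ i,
      IsSphereFun 0 (rotDeriv i (rotDeriv i W)) := fun hW i => (hD hW i).rotDeriv (by simp) i
  have h1 : ∀ {W : Amb n → ℝ}, IsSphereFun 2 W → IsSphereFun 1 W := fun h => h.mono (by norm_num)
  have h0 : ∀ {W : Amb n → ℝ}, IsSphereFun 2 W → IsSphereFun 0 W := fun h => h.mono (by norm_num)
  have key : ∀ {W Z : Amb n → ℝ}, IsSphereFun 2 W → IsSphereFun 2 Z →
      ∫ x, opL W x * Z x ∂(surfaceMeasure n) =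
      (4 * n : ℝ)⁻¹ * ∑ i, ∫ x, rotDeriv i (rotDeriv i W) x * Z x ∂(surfaceMeasure n) +
        ∫ x, W x * Z x ∂(surfaceMeasure n) := by
    intro W Z hW hZ
    have hi : ∀ i, Integrable (fun x => rotDeriv i (rotDeriv i W) x * Z x) (surfaceMeasure n) :=
      fun i => ((hDD hW i).mul (h0 hZ)).integrable
    have hi' : Integrable (fun x => W x * Z x) (surfaceMeasure n) := ((h0 hW).mul (h0 hZ)).integrable
    rw [← integral_finsetSum _ fun i _ => hi i, ← integral_const_mul, ← integral_add
      ((integrable_finsetSum _ fun i _ => hi i).const_mul _) hi']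
    refine integral_congr_ae ?_
    filter_upwards [ae_mem_roundSphere (n := n)] with x hx
    rw [hW.opL_eq le_rfl hx, add_mul, mul_assoc, Finset.sum_mul]
  have e : ∀ x, U x * opL V x = opL V x * U x := fun x => mul_comm _ _
  simp_rw [e]
  rw [key hU hV, key hV hU]
  congr 1
  · congr 1
    refine Finset.sum_congr rfl fun i _ => ?_
    rw [integral_rotDeriv_mul (hD hU i) (h1 hV), integral_rotDeriv_mul (hD hV i) (h1 hU)]
    simp_rw [mul_comm]
  · simp_rw [mul_comm]

end Casimir

/-! ### The algebra of smooth functions on the sphere -/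

section SF

variable {n : ℕ}

/-- The point `x`, with the origin replaced by a fixed nonzero point. -/
def nz (x : Amb n) : Amb n := if x = 0 then EuclideanSpace.single 0 1 else x

lemma nz_ne_zero (x : Amb n) : nz x ≠ 0 := by
  unfold nz
  split_ifs with h
  · simp
  · exact h

lemma nz_of_ne {x : Amb n} (hx : x ≠ 0) : nz x = x := if_neg hx

variable (n) in
/-- The algebra of smooth functions on the sphere, extended to be constant along rays, with a
normalized value at the origin. -/
def sphereAlgebra : Subalgebra ℝ (Amb n → ℝ) where
  -- The condition at the origin makes an element determined by its values on the sphere, so that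
  -- the algebra embeds into `L²`.
  carrier := {U | IsSphereFun ∞ U ∧ U 0 = U (nz 0)}
  mul_mem' ha hb := ⟨ha.1.mul hb.1, by simp [ha.2, hb.2]⟩
  add_mem' ha hb := ⟨ha.1.add hb.1, by simp [ha.2, hb.2]⟩
  algebraMap_mem' r := ⟨⟨fun _ _ _ => rfl, contDiffOn_const⟩, rfl⟩

variable (n) in
/-- The type of smooth functions on the sphere. -/
def SF : Type := sphereAlgebra n

instance : CommRing (SF n) := inferInstanceAs (CommRing (sphereAlgebra n))

instance : Algebra ℝ (SF n) := inferInstanceAs (Algebra ℝ (sphereAlgebra n))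

variable (n) in
/-- The inclusion of the smooth functions on the sphere into all functions. -/
def SF.coeHom : SF n →ₐ[ℝ] (Amb n → ℝ) := (sphereAlgebra n).val

instance : CoeFun (SF n) fun _ => Amb n → ℝ := ⟨fun f => SF.coeHom n f⟩

lemma SF.prop (f : SF n) : IsSphereFun ∞ f ∧ f 0 = f (nz 0) := Subtype.property f

/-- Constructor of smooth functions on the sphere. -/
def SF.mk (U : Amb n → ℝ) (h : IsSphereFun ∞ U ∧ U 0 = U (nz 0)) : SF n := Subtype.mk U h

@[simp] lemma SF.add_apply (f g : SF n) (x : Amb n) : (f + g) x = f x + g x := rfl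

@[simp] lemma SF.mul_apply (f g : SF n) (x : Amb n) : (f * g) x = f x * g x := rfl

@[simp] lemma SF.sub_apply (f g : SF n) (x : Amb n) : (f - g) x = f x - g x := rfl

@[simp] lemma SF.neg_apply (f : SF n) (x : Amb n) : (-f) x = -f x := rfl

@[simp] lemma SF.smul_apply (c : ℝ) (f : SF n) (x : Amb n) : (c • f) x = c * f x := rfl

@[simp] lemma SF.one_apply (x : Amb n) : (1 : SF n) x = 1 := rfl

@[simp] lemma SF.zero_apply (x : Amb n) : (0 : SF n) x = 0 := rfl

@[simp] lemma SF.sum_apply {ι : Type*} (s : Finset ι) (f : ι → SF n) (x : Amb n) :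
    (∑ i ∈ s, f i) x = ∑ i ∈ s, f i x := by
  rw [map_sum, Finset.sum_apply]

lemma SF.isSphereFun (f : SF n) : IsSphereFun ∞ f := f.prop.1

lemma SF.isSphereFun_nat (f : SF n) (m : ℕ) : IsSphereFun m f :=
  f.isSphereFun.mono (by exact_mod_cast le_top)

lemma SF.apply_nz (f : SF n) (x : Amb n) : f (nz x) = f x := by
  by_cases hx : x = 0
  · rw [hx, ← f.prop.2]
  · rw [nz_of_ne hx]

lemma SF.ext_of_ne {f g : SF n} (h : ∀ x, x ≠ 0 → f x = g x) : f = g :=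
  Subtype.ext (α := Amb n → ℝ) (funext fun x =>
    (f.apply_nz x).symm.trans ((h _ (nz_ne_zero x)).trans (g.apply_nz x)))

lemma SF.ext_sphere [NeZero n] {f g : SF n} (h : EqOn f g (roundSphere n)) : f = g :=
  SF.ext_of_ne fun _ hx => f.isSphereFun.eqOn_compl g.isSphereFun h hx

/-- Normalize the value at the origin. -/
def SF.mk' (U : Amb n → ℝ) (hU : IsSphereFun ∞ U) : SF n :=
  SF.mk (fun x => U (nz x)) (by
    have h : ∀ x : Amb n, x ≠ 0 → U (nz x) = U x := fun x hx => by rw [nz_of_ne hx]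
    refine ⟨⟨fun c x hc => ?_, ?_⟩, ?_⟩
    · by_cases hx : x = 0
      · simp [hx]
      · dsimp only
        rw [h _ (smul_ne_zero hc.ne' hx), h x hx, hU.1 c x hc]
    · exact hU.2.congr fun x hx => h x hx
    · rw [h _ (nz_ne_zero 0)])

lemma SF.mk'_apply {U : Amb n → ℝ} (hU : IsSphereFun ∞ U) {x : Amb n} (hx : x ≠ 0) :
    (SF.mk' U hU) x = U x := by
  show U (nz x) = U x
  rw [nz_of_ne hx]

lemma rotDeriv_congr {U V : Amb n → ℝ} (h : EqOn U V {0}ᶜ) (i : RotIdx n) {x : Amb n}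
    (hx : x ≠ 0) : rotDeriv i U x = rotDeriv i V x := by
  unfold rotDeriv
  rw [Filter.EventuallyEq.fderiv_eq]
  filter_upwards [isOpen_compl_singleton.mem_nhds hx] with y hy using h hy

/-- The rotation fields as derivations of the algebra of smooth functions on the sphere. -/
def SF.D (i : RotIdx n) : Derivation ℝ (SF n) (SF n) :=
  Derivation.mk'
    { toFun := fun f => SF.mk' (rotDeriv i f) (f.isSphereFun.rotDeriv (by simp) i)
      map_add' := fun f g => SF.ext_of_ne fun x hx => by
        have h1 := f.isSphereFun.differentiableAt (by simp) hx
        have h2 := g.isSphereFun.differentiableAt (by simp) hx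
        rw [SF.add_apply, SF.mk'_apply _ hx, SF.mk'_apply _ hx, SF.mk'_apply _ hx]
        rw [map_add, rotDeriv, rotDeriv, rotDeriv, fderiv_add h1 h2]
        rfl
      map_smul' := fun c f => SF.ext_of_ne fun x hx => by
        have h1 := f.isSphereFun.differentiableAt (by simp) hx
        rw [RingHom.id_apply, SF.smul_apply, SF.mk'_apply _ hx, SF.mk'_apply _ hx]
        rw [map_smul, rotDeriv, rotDeriv, fderiv_const_smul h1]
        rfl }
    (fun f g => SF.ext_of_ne fun x hx => by
      simp only [LinearMap.coe_mk, AddHom.coe_mk, smul_eq_mul, SF.add_apply, SF.mul_apply]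
      rw [SF.mk'_apply _ hx, SF.mk'_apply _ hx, SF.mk'_apply _ hx]
      rw [map_mul, rotDeriv_mul f.isSphereFun g.isSphereFun (by simp) i hx]
      ring)

lemma SF.D_apply (i : RotIdx n) (f : SF n) {x : Amb n} (hx : x ≠ 0) :
    (SF.D i f) x = rotDeriv i f x :=
  SF.mk'_apply (f.isSphereFun.rotDeriv (by simp) i) hx

lemma SF.D_mul (i : RotIdx n) (f g : SF n) : SF.D i (f * g) = SF.D i f * g + f * SF.D i g := by
  rw [Derivation.leibniz, smul_eq_mul, smul_eq_mul]; ring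

/-- Smooth functions of finitely many smooth functions. -/
def SF.comp {ι : Type} [Fintype ι] (G : (ι → ℝ) → ℝ) (hG : ContDiff ℝ ∞ G) (Φ : ι → SF n) : SF n :=
  SF.mk (fun x => G fun j => Φ j x) (⟨⟨fun c x hc => by simp only [(Φ _).isSphereFun.1 c x hc],
    hG.comp_contDiffOn (contDiffOn_pi.2 fun j => (Φ j).isSphereFun.2)⟩, by simp only [← (Φ _).prop.2]⟩)

/-- Partial derivatives of a function of finitely many variables. -/
def pder {ι : Type} [Fintype ι] [DecidableEq ι] (j : ι) (G : (ι → ℝ) → ℝ) (z : ι → ℝ) : ℝ :=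
  fderiv ℝ G z (Pi.single j 1)

lemma contDiff_pder {ι : Type} [Fintype ι] [DecidableEq ι] (j : ι) {G : (ι → ℝ) → ℝ}
    (hG : ContDiff ℝ ∞ G) : ContDiff ℝ ∞ (pder j G) :=
  (hG.fderiv_right (m := ∞) (by simp)).clm_apply contDiff_const

lemma SF.D_comp {ι : Type} [Fintype ι] [DecidableEq ι] (i : RotIdx n) (G : (ι → ℝ) → ℝ)
    (hG : ContDiff ℝ ∞ G) (Φ : ι → SF n) :
    SF.D i (SF.comp G hG Φ) =
      ∑ j, SF.comp (pder j G) (contDiff_pder j hG) Φ * SF.D i (Φ j) := by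
  refine SF.ext_of_ne fun x hx => ?_
  rw [SF.D_apply i _ hx]
  have h1 : HasFDerivAt (fun y j => (Φ j) y)
      (ContinuousLinearMap.pi fun j => fderiv ℝ (Φ j) x) x :=
    hasFDerivAt_pi.2 fun j => ((Φ j).isSphereFun.differentiableAt (by simp) hx).hasFDerivAt
  have h2 : HasFDerivAt (fun y => G fun j => (Φ j) y) _ x :=
    HasFDerivAt.comp (f := fun y j => (Φ j) y) x
      ((hG.differentiable (by simp)) fun j => (Φ j) x).hasFDerivAt h1
  replace h2 : HasFDerivAt (SF.comp G hG Φ) _ x := h2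
  rw [rotDeriv, h2.fderiv]
  have h3 : ∀ v : ι → ℝ, fderiv ℝ G (fun j => (Φ j) x) v =
      ∑ j, pder j G (fun j => (Φ j) x) * v j := fun v => by
    have : v = ∑ j, v j • Pi.single j (1 : ℝ) := by
      ext k; simp [Pi.single_apply]
    conv_lhs => rw [this]
    rw [map_sum]
    exact Finset.sum_congr rfl fun j _ => by rw [map_smul, smul_eq_mul, mul_comm]; rfl
  rw [ContinuousLinearMap.comp_apply, h3]
  rw [SF.sum_apply]
  refine Finset.sum_congr rfl fun j _ => ?_
  show _ = pder j G (fun j => (Φ j) x) * (SF.D i (Φ j)) x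
  rw [SF.D_apply i _ hx]
  rfl

/-- The operator `-R² Δ`, the Casimir operator of the rotation group. -/
def SF.cas : SF n →ₗ[ℝ] SF n :=
  -- The sum runs over ordered pairs and counts every coordinate plane twice, hence the factor 1/2.
  -(1 / 2 : ℝ) • ∑ i, (SF.D i).toLinearMap ∘ₗ (SF.D i).toLinearMap

lemma SF.cas_apply (f : SF n) : SF.cas f = -(1 / 2 : ℝ) • ∑ i, SF.D i (SF.D i f) := by
  simp [SF.cas]

variable [NeZero n]

/-- The class in `L²` of a smooth function on the sphere. -/
def SF.cls : SF n →ₗ[ℝ] L2Sphere n where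
  toFun f := (f.isSphereFun.memLp 2).toLp f
  map_add' _ _ := rfl
  map_smul' _ _ := rfl

lemma SF.coeFn_cls (f : SF n) : SF.cls f =ᵐ[surfaceMeasure n] f :=
  MemLp.coeFn_toLp (f.isSphereFun.memLp 2)

lemma SF.inner_cls (f g : SF n) :
    ⟪SF.cls f, SF.cls g⟫_ℝ = ∫ x, f x * g x ∂(surfaceMeasure n) := by
  rw [L2.inner_def]
  refine integral_congr_ae ?_
  filter_upwards [f.coeFn_cls, g.coeFn_cls] with x h1 h2
  rw [h1, h2]
  simp [mul_comm]

lemma SF.cls_injective : Function.Injective (SF.cls : SF n → L2Sphere n) := fun f g h =>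
  SF.ext_sphere (eqOn_roundSphere_of_ae_eq f.isSphereFun.continuousOn g.isSphereFun.continuousOn
    (f.coeFn_cls.symm.trans (h ▸ g.coeFn_cls)))

lemma SF.inner_cls_D (i : RotIdx n) (f g : SF n) :
    ⟪SF.cls (SF.D i f), SF.cls g⟫_ℝ = -⟪SF.cls f, SF.cls (SF.D i g)⟫_ℝ := by
  rw [SF.inner_cls, SF.inner_cls]
  have h := integral_rotDeriv_mul (f.isSphereFun.mono (m' := 1) (by simp))
    (g.isSphereFun.mono (m' := 1) (by simp)) i
  convert h using 1
  · exact integral_congr_ae (ae_ne_zero.mono fun x hx => by simp only [SF.D_apply i f hx])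
  · congr 1
    exact integral_congr_ae (ae_ne_zero.mono fun x hx => by simp only [SF.D_apply i g hx])

lemma SF.inner_cls_cas (f g : SF n) :
    ⟪SF.cls (SF.cas f), SF.cls g⟫_ℝ =
      (1 / 2) * ∑ i, ⟪SF.cls (SF.D i f), SF.cls (SF.D i g)⟫_ℝ := by
  rw [SF.cas_apply, map_smul, map_sum, real_inner_smul_left, sum_inner, neg_mul, ← mul_neg,
    ← Finset.sum_neg_distrib]
  congr 1
  exact Finset.sum_congr rfl fun i _ => by rw [SF.inner_cls_D, neg_neg]

lemma SF.inner_cls_cas_comm (f g : SF n) :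
    ⟪SF.cls (SF.cas f), SF.cls g⟫_ℝ = ⟪SF.cls f, SF.cls (SF.cas g)⟫_ℝ := by
  rw [SF.inner_cls_cas, real_inner_comm, SF.inner_cls_cas]
  simp_rw [real_inner_comm]

lemma SF.opL_eq (f : SF n) {y : Amb n} (hy : y ∈ roundSphere n) :
    opL f y = f y - (2 * n : ℝ)⁻¹ * (SF.cas f) y := by
  have hn : (n : ℝ) ≠ 0 := by exact_mod_cast NeZero.ne n
  have hy0 := ne_zero_of_mem_roundSphere hy
  rw [f.isSphereFun.opL_eq (WithTop.coe_le_coe.2 (le_top : (2 : ℕ∞) ≤ ⊤)) hy, SF.cas_apply]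
  have : ∀ i, rotDeriv i (rotDeriv i f) y = (SF.D i (SF.D i f)) y := fun i => by
    rw [SF.D_apply i _ hy0]
    exact (rotDeriv_congr (fun x hx => SF.D_apply i f hx) i hy0).symm
  simp_rw [this]
  rw [SF.smul_apply, SF.sum_apply]
  field_simp
  ring

end SF

/-! ### Polynomials on the sphere -/

section Polynomials

variable {n : ℕ}

/-- The coordinate functions on the sphere. -/
def SF.Y (c : Fin (n + 1)) : SF n :=
  SF.mk' (fun x => sphereRadius n * (x c * ‖x‖⁻¹)) (by
    refine ⟨fun t x ht => ?_, ?_⟩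
    · simp only [PiLp.smul_apply, smul_eq_mul, norm_smul, Real.norm_of_nonneg ht.le, mul_inv]
      field_simp
    · refine contDiffOn_const.mul (ContDiffOn.mul (EuclideanSpace.proj c : Amb n →L[ℝ] ℝ).contDiff.contDiffOn ?_)
      exact ContDiffOn.inv (fun x hx => (contDiffAt_norm ℝ hx).contDiffWithinAt)
        fun x hx => norm_ne_zero_iff.2 hx)

lemma SF.Y_apply (c : Fin (n + 1)) {x : Amb n} (hx : x ≠ 0) :
    SF.Y c x = sphereRadius n * (x c * ‖x‖⁻¹) := SF.mk'_apply _ hx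

lemma SF.Y_apply_sphere [NeZero n] (c : Fin (n + 1)) {x : Amb n} (hx : x ∈ roundSphere n) :
    SF.Y c x = x c := by
  rw [SF.Y_apply c (ne_zero_of_mem_roundSphere hx), norm_of_mem_roundSphere hx]
  have := (sphereRadius_pos (n := n)).ne'
  field_simp

lemma SF.D_Y (i : RotIdx n) (c : Fin (n + 1)) :
    SF.D i (SF.Y c) = (if c = i.2 then SF.Y i.1 else 0) - (if c = i.1 then SF.Y i.2 else 0) := by
  refine SF.ext_of_ne fun x hx => ?_
  rw [SF.D_apply i _ hx]
  have h1 : HasDerivAt (fun t => SF.Y c (rotFlow i t x)) (rotDeriv i (SF.Y c) x) 0 := by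
    have h := ((SF.Y c).isSphereFun.differentiableAt (by simp)
      (rotFlow_ne_zero i 0 hx)).hasFDerivAt.comp_hasDerivAt 0 (hasDerivAt_rotFlow i x 0)
    simp only [rotFlow_zero] at h
    exact h
  have h2 : HasDerivAt (fun t => SF.Y c (rotFlow i t x))
      (sphereRadius n * ((rotGen i x) c * ‖x‖⁻¹)) 0 := by
    have h := (EuclideanSpace.proj c : Amb n →L[ℝ] ℝ).hasFDerivAt.comp_hasDerivAt (0:ℝ)
      (hasDerivAt_rotFlow i x 0)
    simp only [rotFlow_zero] at h
    refine ((h.mul_const ‖x‖⁻¹).const_mul (sphereRadius n)).congr_of_eventuallyEq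
      (Eventually.of_forall fun t => ?_)
    simp only
    rw [SF.Y_apply c (rotFlow_ne_zero i t hx), norm_rotFlow]
    rfl
  rw [h1.unique h2, rotGen_apply, SF.sub_apply]
  obtain ⟨a, b⟩ := i
  dsimp only
  have e1 : (EuclideanSpace.single b (1:ℝ) : Amb n) c = if c = b then 1 else 0 := by simp
  have e2 : (EuclideanSpace.single a (1:ℝ) : Amb n) c = if c = a then 1 else 0 := by simp
  rw [PiLp.sub_apply, PiLp.smul_apply, PiLp.smul_apply, e1, e2]
  split_ifs <;> (simp [SF.Y_apply _ hx]; try ring)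

lemma SF.D_swap (a b : Fin (n + 1)) (f : SF n) : SF.D (a, b) f = -SF.D (b, a) f := by
  refine SF.ext_of_ne fun x hx => ?_
  rw [SF.neg_apply, SF.D_apply _ f hx, SF.D_apply _ f hx, rotDeriv, rotDeriv, ← map_neg]
  congr 1
  simp [rotGen_apply]

lemma SF.sum_Y_mul_Y : ∑ c, SF.Y c * SF.Y c = (2 * n : ℝ) • (1 : SF n) := by
  refine SF.ext_of_ne fun x hx => ?_
  have hx' : ‖x‖ ≠ 0 := norm_ne_zero_iff.2 hx
  rw [SF.sum_apply, SF.smul_apply, SF.one_apply, ← sphereRadius_sq]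
  have : ∑ c, x c ^ 2 = ‖x‖ ^ 2 := (EuclideanSpace.real_norm_sq_eq x).symm
  calc ∑ c, (SF.Y c * SF.Y c) x = ∑ c, sphereRadius n ^ 2 * (‖x‖ ^ 2)⁻¹ * x c ^ 2 :=
        Finset.sum_congr rfl fun c _ => by rw [SF.mul_apply, SF.Y_apply c hx]; field_simp
    _ = _ := by rw [← Finset.mul_sum, this]; field_simp

variable (n) in
/-- Restrictions to the sphere of homogeneous polynomials of degree `j`. -/
def homPol (j : ℕ) : Submodule ℝ (SF n) := Submodule.span ℝ (range SF.Y) ^ j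

lemma homPol_zero : homPol n 0 = Submodule.span ℝ {1} := by
  rw [homPol, pow_zero, Submodule.one_eq_span]

lemma Y_mem_homPol (c : Fin (n + 1)) : SF.Y c ∈ homPol n 1 := by
  rw [homPol, pow_one]
  exact Submodule.subset_span ⟨c, rfl⟩

lemma mul_mem_homPol {i j : ℕ} {f g : SF n} (hf : f ∈ homPol n i) (hg : g ∈ homPol n j) :
    f * g ∈ homPol n (i + j) := by
  rw [homPol, pow_add]
  exact Submodule.mul_mem_mul hf hg

lemma Y_mul_mem_homPol (c : Fin (n + 1)) {j : ℕ} {f : SF n} (hf : f ∈ homPol n j) :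
    SF.Y c * f ∈ homPol n (j + 1) := by
  rw [add_comm]
  exact mul_mem_homPol (Y_mem_homPol c) hf

/-- The induction principle on the degree: a property that defines a subspace need only be checked
on products of a coordinate with a polynomial of degree `j`. -/
lemma homPol_succ_le {j : ℕ} {S : Submodule ℝ (SF n)}
    (h : ∀ c, ∀ f ∈ homPol n j, SF.Y c * f ∈ S) : homPol n (j + 1) ≤ S := by
  rw [homPol, pow_succ', Submodule.mul_le]
  intro m hm f hf
  have : Submodule.span ℝ (range SF.Y) ≤ S.comap ((LinearMap.mul ℝ (SF n)).flip f) := by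
    rw [Submodule.span_le]
    rintro _ ⟨c, rfl⟩
    exact h c f hf
  exact this hm

lemma D_eq_zero_of_mem_homPol_zero {f : SF n} (hf : f ∈ homPol n 0) (i : RotIdx n) :
    SF.D i f = 0 := by
  rw [homPol_zero] at hf
  obtain ⟨c, rfl⟩ := Submodule.mem_span_singleton.1 hf
  simp

lemma D_mem_homPol (i : RotIdx n) {j : ℕ} {f : SF n} (hf : f ∈ homPol n j) :
    SF.D i f ∈ homPol n j := by
  induction j generalizing f with
  | zero => rw [D_eq_zero_of_mem_homPol_zero hf]; exact zero_mem _
  | succ j ih =>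
    have : homPol n (j + 1) ≤ (homPol n (j + 1)).comap (SF.D i).toLinearMap := by
      refine homPol_succ_le fun c g hg => ?_
      show SF.D i (SF.Y c * g) ∈ homPol n (j + 1)
      rw [SF.D_mul, SF.D_Y, sub_mul]
      refine add_mem (sub_mem ?_ ?_) (Y_mul_mem_homPol c (ih hg))
      · split_ifs
        · exact Y_mul_mem_homPol _ hg
        · rw [zero_mul]; exact zero_mem _
      · split_ifs
        · exact Y_mul_mem_homPol _ hg
        · rw [zero_mul]; exact zero_mem _
    exact this hf

/-- On the sphere ∑ Y_c² is the constant 2n, so multiplication by it raises the degree by two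
without changing the function up to a factor. -/
lemma homPol_le_add_two [NeZero n] (j : ℕ) : homPol n j ≤ homPol n (j + 2) := by
  intro f hf
  have hn : (2 * n : ℝ) ≠ 0 := by have := NeZero.ne n; positivity
  have h : f = (2 * n : ℝ)⁻¹ • ∑ c, SF.Y c * (SF.Y c * f) := by
    simp_rw [← mul_assoc]
    rw [← Finset.sum_mul, SF.sum_Y_mul_Y, smul_mul_assoc, one_mul, smul_smul,
      inv_mul_cancel₀ hn, one_smul]
  rw [h]
  exact Submodule.smul_mem _ _ (Submodule.sum_mem _ fun c _ =>
    Y_mul_mem_homPol c (Y_mul_mem_homPol c hf))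

variable (n) in
/-- Homogeneous polynomials of degree `j - k`, or zero if `j < k`. -/
def lowPol (k j : ℕ) : Submodule ℝ (SF n) := if k ≤ j then homPol n (j - k) else ⊥

lemma lowPol_succ (k j : ℕ) : lowPol n (k + 1) (j + 1) = lowPol n k j := by
  simp [lowPol]

lemma lowPol_zero (j : ℕ) : lowPol n 0 j = homPol n j := by simp [lowPol]

lemma Y_mul_mem_lowPol (c : Fin (n + 1)) {k j : ℕ} {f : SF n} (hf : f ∈ lowPol n k j) :
    SF.Y c * f ∈ lowPol n k (j + 1) := by
  unfold lowPol at hf ⊢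
  split_ifs at hf with h
  · rw [if_pos (by omega), show j + 1 - k = j - k + 1 by omega]
    exact Y_mul_mem_homPol c hf
  · rw [(Submodule.mem_bot ℝ).1 hf, mul_zero]
    exact zero_mem _

/-- The tangential part of `R² ∂_c`. -/
def tangDeriv (c : Fin (n + 1)) : SF n →ₗ[ℝ] SF n :=
  ∑ a, LinearMap.mulLeft ℝ (SF.Y a) ∘ₗ (SF.D (a, c)).toLinearMap

lemma tangDeriv_apply (c : Fin (n + 1)) (f : SF n) :
    tangDeriv c f = ∑ a, SF.Y a * SF.D (a, c) f := by
  simp [tangDeriv]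

lemma tangDeriv_Y_mul (c d : Fin (n + 1)) (f : SF n) :
    tangDeriv c (SF.Y d * f) =
      (if d = c then (2 * n : ℝ) • f else 0) - SF.Y d * (SF.Y c * f) + SF.Y d * tangDeriv c f := by
  simp only [tangDeriv_apply, SF.D_mul, SF.D_Y, mul_add, Finset.sum_add_distrib, Finset.mul_sum]
  congr 1
  · simp only [sub_mul, mul_sub, Finset.sum_sub_distrib, ite_mul, mul_ite, zero_mul, mul_zero,
      Finset.sum_ite_eq, Finset.mem_univ, if_true]
    congr 1
    split_ifs with h
    · simp_rw [← mul_assoc]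
      rw [← Finset.sum_mul, SF.sum_Y_mul_Y, smul_mul_assoc, one_mul]
    · simp
  · exact Finset.sum_congr rfl fun a _ => by ring

/-- For a homogeneous polynomial p of degree j, Euler's identity shows that the tangential part of
R²∂_c p is R²∂_c p - j Y_c p, and ∂_c p has degree j - 1. The induction replaces ∂_c by the product
rule `tangDeriv_Y_mul`, since polynomials occur here only through their restrictions. -/
lemma tangDeriv_add_mem (c : Fin (n + 1)) {j : ℕ} {f : SF n} (hf : f ∈ homPol n j) :
    tangDeriv c f + (j : ℝ) • (SF.Y c * f) ∈ lowPol n 1 j := by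
  induction j generalizing f with
  | zero =>
    have : tangDeriv c f = 0 := by
      simp [tangDeriv_apply, D_eq_zero_of_mem_homPol_zero hf]
    simp [this]
  | succ j ih =>
    have : homPol n (j + 1) ≤ (lowPol n 1 (j + 1)).comap
        (tangDeriv c + ((j + 1 : ℕ) : ℝ) • LinearMap.mulLeft ℝ (SF.Y c)) := by
      refine homPol_succ_le fun d g hg => ?_
      show tangDeriv c (SF.Y d * g) + ((j + 1 : ℕ) : ℝ) • (SF.Y c * (SF.Y d * g)) ∈ lowPol n 1 (j + 1)
      have e : tangDeriv c (SF.Y d * g) + ((j + 1 : ℕ) : ℝ) • (SF.Y c * (SF.Y d * g)) =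
          (if d = c then (2 * n : ℝ) • g else 0) +
            SF.Y d * (tangDeriv c g + (j : ℝ) • (SF.Y c * g)) := by
        rw [tangDeriv_Y_mul, mul_add, mul_smul_comm, mul_left_comm (SF.Y c)]
        push_cast
        module
      rw [e]
      refine add_mem ?_ (Y_mul_mem_lowPol d (ih hg))
      rw [lowPol_succ, lowPol_zero]
      split_ifs
      · exact Submodule.smul_mem _ _ hg
      · exact zero_mem _
    exact this hf

variable (n) in
/-- The eigenvalues of the Casimir operator. -/
def casEig (j : ℕ) : ℝ := (j : ℝ) * ((j : ℝ) + n - 1)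

lemma casEig_zero : casEig n 0 = 0 := by simp [casEig]

/-- The product rule for a second-order operator: the coordinate Y_c is an eigenfunction with
eigenvalue n, and the cross term ∑ D_i Y_c · D_i f equals twice `tangDeriv c f`. -/
lemma cas_Y_mul (c : Fin (n + 1)) (f : SF n) :
    SF.cas (SF.Y c * f) = (n : ℝ) • (SF.Y c * f) + SF.Y c * SF.cas f - (2 : ℝ) • tangDeriv c f := by
  have h1 : ∑ i, SF.D i (SF.Y c) * SF.D i f = (2 : ℝ) • tangDeriv c f := by
    simp only [SF.D_Y, sub_mul, Finset.sum_sub_distrib, Fintype.sum_prod_type, ite_mul, zero_mul,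
      Finset.sum_ite_eq, Finset.mem_univ, if_true, Finset.sum_ite_irrel, Finset.sum_const_zero]
    rw [tangDeriv_apply, two_smul, sub_eq_add_neg, ← Finset.sum_neg_distrib]
    congr 1
    exact Finset.sum_congr rfl fun b _ => by rw [SF.D_swap b c f, mul_neg]
  have h2 : ∑ i, SF.D i (SF.D i (SF.Y c)) = -(2 * n : ℝ) • SF.Y c := by
    have : ∀ i : RotIdx n, SF.D i (SF.D i (SF.Y c)) =
        ((if c = i.2 then (if i.1 = i.2 then SF.Y i.1 else 0) else 0) -
          (if c = i.2 then SF.Y c else 0)) -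
        ((if c = i.1 then SF.Y c else 0) - (if c = i.1 then
          (if i.1 = i.2 then SF.Y i.2 else 0) else 0)) := by
      rintro ⟨a, b⟩
      rw [SF.D_Y, map_sub]
      dsimp only
      by_cases h3 : c = b <;> by_cases h4 : c = a <;> by_cases h5 : a = b <;>
        simp_all [SF.D_Y, eq_comm]
    simp_rw [this]
    simp only [Finset.sum_sub_distrib, Fintype.sum_prod_type, Finset.sum_ite_irrel,
      Finset.sum_const_zero, Finset.sum_ite_eq, Finset.sum_ite_eq', Finset.mem_univ, if_true,
      Finset.sum_const, Finset.card_univ, Fintype.card_fin]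
    have h0 : ∑ a : Fin (n + 1), ∑ _b : Fin (n + 1), (if c = a then SF.Y c else 0) =
        (n + 1) • SF.Y c := by
      rw [Finset.sum_comm]
      simp
    rw [h0, ← Nat.cast_smul_eq_nsmul ℝ]
    push_cast
    module
  rw [SF.cas_apply, SF.cas_apply]
  have h3 : ∀ i : RotIdx n, SF.D i (SF.D i (SF.Y c * f)) = SF.D i (SF.D i (SF.Y c)) * f +
      (2 : ℝ) • (SF.D i (SF.Y c) * SF.D i f) + SF.Y c * SF.D i (SF.D i f) := fun i => by
    rw [SF.D_mul, map_add, SF.D_mul, SF.D_mul, two_smul]; abel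
  simp_rw [h3]
  rw [Finset.sum_add_distrib, Finset.sum_add_distrib, ← Finset.sum_mul, ← Finset.smul_sum, h1, h2,
    ← Finset.mul_sum, smul_mul_assoc, mul_smul_comm]
  module

/-- The Casimir operator is triangular with respect to the degree, with diagonal entries `casEig`;
the remainder corresponds to -R² times the Euclidean Laplacian of the polynomial, of degree j - 2.
In the induction the eigenvalue increment is casEig (j+1) - casEig j = 2j + n. -/
lemma cas_sub_mem {j : ℕ} {f : SF n} (hf : f ∈ homPol n j) :
    SF.cas f - casEig n j • f ∈ lowPol n 2 j := by
  induction j generalizing f with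
  | zero =>
    have : SF.cas f = 0 := by
      rw [SF.cas_apply]
      simp [D_eq_zero_of_mem_homPol_zero hf]
    simp [this, casEig_zero]
  | succ j ih =>
    have : homPol n (j + 1) ≤ (lowPol n 2 (j + 1)).comap
        (SF.cas - casEig n (j + 1) • LinearMap.id) := by
      refine homPol_succ_le fun c g hg => ?_
      show SF.cas (SF.Y c * g) - casEig n (j + 1) • (SF.Y c * g) ∈ lowPol n 2 (j + 1)
      have e : SF.cas (SF.Y c * g) - casEig n (j + 1) • (SF.Y c * g) =
          SF.Y c * (SF.cas g - casEig n j • g) -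
            (2 : ℝ) • (tangDeriv c g + (j : ℝ) • (SF.Y c * g)) := by
        rw [cas_Y_mul, mul_sub, mul_smul_comm, casEig, casEig]
        push_cast
        module
      rw [e]
      refine sub_mem (Y_mul_mem_lowPol c (ih hg)) (Submodule.smul_mem _ _ ?_)
      rw [lowPol_succ]
      exact tangDeriv_add_mem c hg
    exact this hf

variable (n) in
/-- Restrictions to the sphere of polynomials of degree at most `j`. -/
def pol (j : ℕ) : Submodule ℝ (SF n) := ⨆ i ≤ j, homPol n i

lemma homPol_le_pol {i j : ℕ} (h : i ≤ j) : homPol n i ≤ pol n j :=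
  le_iSup₂_of_le i h le_rfl

lemma pol_mono {i j : ℕ} (h : i ≤ j) : pol n i ≤ pol n j :=
  iSup₂_le fun _ hl => homPol_le_pol (hl.trans h)

lemma D_mem_pol (i : RotIdx n) {j : ℕ} {f : SF n} (hf : f ∈ pol n j) : SF.D i f ∈ pol n j := by
  have : pol n j ≤ (pol n j).comap (SF.D i).toLinearMap :=
    iSup₂_le fun l hl g hg => homPol_le_pol hl (D_mem_homPol i hg)
  exact this hf

lemma mul_mem_pol {i j : ℕ} {f g : SF n} (hf : f ∈ pol n i) (hg : g ∈ pol n j) :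
    f * g ∈ pol n (i + j) := by
  have h1 : pol n i ≤ (pol n (i + j)).comap ((LinearMap.mul ℝ (SF n)).flip g) := by
    refine iSup₂_le fun l hl f' hf' => ?_
    have h2 : pol n j ≤ (pol n (i + j)).comap (LinearMap.mulLeft ℝ f') :=
      iSup₂_le fun l' hl' g' hg' => homPol_le_pol (by omega) (mul_mem_homPol hf' hg')
    exact h2 hg
  exact h1 hf

/-- Raising degrees in steps of two, every degree up to j is absorbed by j or j - 1, according to
parity. This leaves only two homogeneous spaces in the dimension count. -/
lemma pol_le_sup [NeZero n] (j : ℕ) : pol n j ≤ homPol n j ⊔ homPol n (j - 1) := by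
  have key : ∀ d i, i + d = j → homPol n i ≤ homPol n j ⊔ homPol n (j - 1) := by
    intro d
    induction d using Nat.strong_induction_on with
    | _ d ih =>
      intro i hi
      match d, ih, hi with
      | 0, _, hi => exact (by simpa using hi : i = j) ▸ le_sup_left
      | 1, _, hi => exact (by omega : i = j - 1) ▸ le_sup_right
      | d + 2, ih, hi => exact (homPol_le_add_two i).trans (ih d (by omega) (i + 2) (by omega))
  exact iSup₂_le fun i hi => key (j - i) i (by omega)

/-! ### Dimension bounds for spaces of polynomials on the sphere. -/

lemma fg_homPol (j : ℕ) : (homPol n j).FG :=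
  (Submodule.fg_span (finite_range _)).pow j

instance (j : ℕ) : FiniteDimensional ℝ (homPol n j) := Module.Finite.of_fg (fg_homPol j)

instance [NeZero n] (j : ℕ) : FiniteDimensional ℝ (pol n j) :=
  Submodule.finiteDimensional_of_le (pol_le_sup j)

/-- The monomials on the sphere. -/
def sphMonomial (j : ℕ) (e : Fin n → ℕ) : SF n :=
  SF.Y 0 ^ (j - ∑ i, e i) * ∏ i : Fin n, SF.Y i.succ ^ e i

lemma homPol_le_span_sphMonomial (j : ℕ) :
    homPol n j ≤ Submodule.span ℝ (sphMonomial j '' {e | ∑ i, e i ≤ j}) := by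
  induction j with
  | zero =>
    rw [homPol_zero, Submodule.span_le, singleton_subset_iff]
    exact Submodule.subset_span ⟨0, by simp, by simp [sphMonomial]⟩
  | succ j ih =>
    refine homPol_succ_le fun c f hf => ?_
    have : Submodule.span ℝ (sphMonomial j '' {e | ∑ i, e i ≤ j}) ≤
        (Submodule.span ℝ (sphMonomial (j + 1) '' {e : Fin n → ℕ | ∑ i, e i ≤ j + 1})).comap
          (LinearMap.mulLeft ℝ (SF.Y c)) := by
      rw [Submodule.span_le]
      rintro _ ⟨e, he, rfl⟩
      refine Submodule.subset_span ?_
      simp only [mem_ofPred_eq] at he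
      refine Fin.cases ?_ (fun i => ?_) c
      · refine ⟨e, by simp only [mem_ofPred_eq]; omega, ?_⟩
        simp only [sphMonomial, LinearMap.mulLeft_apply]
        rw [show j + 1 - ∑ i, e i = j - ∑ i, e i + 1 by omega, pow_succ']
        ring
      · have hs : ∑ l, (e + Pi.single i 1 : Fin n → ℕ) l = ∑ l, e l + 1 := by
          simp [Finset.sum_add_distrib]
        refine ⟨e + Pi.single i 1, by simp only [mem_ofPred_eq, hs]; omega, ?_⟩
        simp only [sphMonomial, LinearMap.mulLeft_apply, hs]
        have hp : ∏ l : Fin n, SF.Y l.succ ^ ((e + Pi.single i 1 : Fin n → ℕ) l) =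
            SF.Y i.succ * ∏ l : Fin n, SF.Y (n := n) l.succ ^ e l := by
          simp_rw [Pi.add_apply, pow_add]
          rw [Finset.prod_mul_distrib, mul_comm]
          congr 1
          rw [Finset.prod_eq_single i]
          · simp
          · intro l _ hl
            simp [hl]
          · simp
        rw [hp, show j + 1 - (∑ l, e l + 1) = j - ∑ l, e l by omega]
        ring
    exact this (ih hf)

/-- A monomial of degree j is determined by the exponents of the last n coordinates, each at most j.
The crude count suffices, as the excess power of j + 1 would otherwise only shift constants in the
growth rate needed: n here yields exactly the Sobolev threshold n/2. -/
lemma finrank_homPol_le (j : ℕ) : Module.finrank ℝ (homPol n j) ≤ (j + 1) ^ n := by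
  classical
  set s : Finset (SF n) :=
    (Fintype.piFinset fun _ : Fin n => Finset.range (j + 1)).image (sphMonomial j)
  have h1 : homPol n j ≤ Submodule.span ℝ (s : Set (SF n)) := by
    refine (homPol_le_span_sphMonomial j).trans (Submodule.span_mono ?_)
    rintro _ ⟨e, he, rfl⟩
    simp only [s, Finset.coe_image]
    refine ⟨e, ?_, rfl⟩
    simp only [Finset.mem_coe, Fintype.mem_piFinset, Finset.mem_range]
    intro i
    have := Finset.single_le_sum (f := e) (fun _ _ => Nat.zero_le _) (Finset.mem_univ i)
    simp only [mem_ofPred_eq] at he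
    omega
  refine (Submodule.finrank_mono h1).trans ((finrank_span_finset_le_card s).trans ?_)
  refine Finset.card_image_le.trans ?_
  simp

lemma finrank_pol_le [NeZero n] (j : ℕ) : Module.finrank ℝ (pol n j) ≤ 2 * (j + 1) ^ n := by
  refine (Submodule.finrank_mono (pol_le_sup j)).trans
    ((Submodule.finrank_add_le_finrank_add_finrank _ _).trans ?_)
  have h1 := finrank_homPol_le (n := n) j
  have h2 := (finrank_homPol_le (n := n) (j - 1)).trans
    (Nat.pow_le_pow_left (show j - 1 + 1 ≤ j + 1 by omega) n)
  omega

end Polynomials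

/-! ### Spherical harmonics -/

section Harmonics

variable {n : ℕ}

variable (n) in
/-- Spherical harmonics of degree `j`. -/
def harm (j : ℕ) : Submodule ℝ (SF n) :=
  pol n j ⊓ LinearMap.ker (SF.cas - casEig n j • LinearMap.id)

lemma mem_harm {j : ℕ} {f : SF n} : f ∈ harm n j ↔ f ∈ pol n j ∧ SF.cas f = casEig n j • f := by
  simp [harm, sub_eq_zero]

variable [NeZero n]

lemma casEig_strictMono : StrictMono (casEig n) := by
  have hn : (1 : ℝ) ≤ n := by exact_mod_cast NeZero.one_le
  refine strictMono_nat_of_lt_succ fun j => ?_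
  simp only [casEig]
  push_cast
  nlinarith [(Nat.cast_nonneg j : (0 : ℝ) ≤ j)]

lemma casEig_nonneg (j : ℕ) : 0 ≤ casEig n j := by
  rw [← casEig_zero (n := n)]
  exact casEig_strictMono.monotone (Nat.zero_le j)

lemma eigval_eq (j : ℕ) : eigval n j = (2 * n : ℝ)⁻¹ * casEig n j - 1 := by
  rw [eigval, casEig]; ring

lemma harm_le_iSup {i j : ℕ} (h : i ≤ j) : harm n i ≤ ⨆ l ≤ j, harm n l :=
  le_iSup₂ (f := fun l (_ : l ≤ j) => harm n l) i h

/-- Triangularity and distinct eigenvalues diagonalize the Casimir operator. By induction the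
remainder of `cas_sub_mem` is a sum of lower harmonics, on which `SF.cas - casEig n j` is
invertible; a preimage s of the remainder makes f - s a harmonic of degree j. -/
lemma homPol_le_iSup_harm (j : ℕ) : homPol n j ≤ ⨆ i ≤ j, harm n i := by
  induction j using Nat.strong_induction_on with
  | _ j ih =>
    intro f hf
    have hq := cas_sub_mem hf
    by_cases hj : 2 ≤ j
    · rw [lowPol, if_pos hj] at hq
      set S : Submodule ℝ (SF n) := ⨆ i ≤ j - 2, harm n i with hS
      have hSmap : S ≤ S.map (SF.cas - casEig n j • LinearMap.id) := by
        refine iSup₂_le fun i hi h hh => ?_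
        have hne : casEig n i - casEig n j ≠ 0 :=
          sub_ne_zero.2 (casEig_strictMono.injective.ne (by omega))
        refine ⟨(casEig n i - casEig n j)⁻¹ • h,
          Submodule.smul_mem _ _ ((le_iSup₂_of_le i hi le_rfl : harm n i ≤ S) hh), ?_⟩
        rw [map_smul]
        simp only [LinearMap.sub_apply, LinearMap.smul_apply, LinearMap.id_apply,
          (mem_harm.1 hh).2]
        rw [← sub_smul, smul_smul, inv_mul_cancel₀ hne, one_smul]
      obtain ⟨s, hs, hsq⟩ := hSmap (ih (j - 2) (by omega) hq)
      have hSj : S ≤ ⨆ i ≤ j, harm n i :=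
        iSup₂_le fun i hi => le_iSup₂_of_le i (by omega) le_rfl
      have hSp : S ≤ pol n j :=
        iSup₂_le fun i hi h hh => pol_mono (by omega) (mem_harm.1 hh).1
      have hfs : f - s ∈ harm n j := by
        refine mem_harm.2 ⟨sub_mem (homPol_le_pol le_rfl hf) (hSp hs), ?_⟩
        simp only [LinearMap.sub_apply, LinearMap.smul_apply, LinearMap.id_apply] at hsq
        rw [map_sub, smul_sub]
        rw [sub_eq_sub_iff_sub_eq_sub] at hsq
        rw [← neg_sub (SF.cas s), hsq, neg_sub]
      have := Submodule.add_mem _ (harm_le_iSup le_rfl hfs) (hSj hs)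
      rwa [sub_add_cancel] at this
    · rw [lowPol, if_neg hj, Submodule.mem_bot, sub_eq_zero] at hq
      exact harm_le_iSup le_rfl (mem_harm.2 ⟨homPol_le_pol le_rfl hf, hq⟩)

lemma pol_le_iSup_harm (j : ℕ) : pol n j ≤ ⨆ i ≤ j, harm n i :=
  iSup₂_le fun i hi => (homPol_le_iSup_harm i).trans
    (iSup₂_le fun l hl => le_iSup₂_of_le l (hl.trans hi) le_rfl)

lemma inner_eq_zero_of_cas {f g : SF n} {a b : ℝ} (hf : SF.cas f = a • f)
    (hg : SF.cas g = b • g) (hab : a ≠ b) : ⟪SF.cls f, SF.cls g⟫_ℝ = 0 := by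
  have h := SF.inner_cls_cas_comm f g
  rw [hf, hg, map_smul, map_smul, real_inner_smul_left, real_inner_smul_right] at h
  have : (a - b) * ⟪SF.cls f, SF.cls g⟫_ℝ = 0 := by linarith
  exact (mul_eq_zero.1 this).resolve_left (sub_ne_zero.2 hab)

lemma inner_harm {i j : ℕ} (hij : i ≠ j) {f g : SF n} (hf : f ∈ harm n i) (hg : g ∈ harm n j) :
    ⟪SF.cls f, SF.cls g⟫_ℝ = 0 :=
  inner_eq_zero_of_cas (mem_harm.1 hf).2 (mem_harm.1 hg).2 (casEig_strictMono.injective.ne hij)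

variable (n) in
/-- The algebra of restrictions of polynomials to the sphere. -/
def polAlg : Subalgebra ℝ (SF n) where
  carrier := {f | ∃ j, f ∈ pol n j}
  mul_mem' := fun ⟨i, hi⟩ ⟨j, hj⟩ => ⟨i + j, mul_mem_pol hi hj⟩
  add_mem' := fun ⟨i, hi⟩ ⟨j, hj⟩ => ⟨max i j,
    add_mem (pol_mono (le_max_left _ _) hi) (pol_mono (le_max_right _ _) hj)⟩
  algebraMap_mem' r := ⟨0, homPol_le_pol le_rfl (by
    rw [homPol_zero, Algebra.algebraMap_eq_smul_one]
    exact Submodule.smul_mem _ _ (Submodule.mem_span_singleton_self _))⟩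

variable (n) in
/-- Restriction of smooth functions to the sphere, as continuous functions. -/
def restrictSphere : SF n →ₐ[ℝ] C(roundSphere n, ℝ) where
  toFun f := ⟨fun y => f y, continuousOn_iff_continuous_domRestrict.1
    (f.isSphereFun.continuousOn.mono fun _ hy => ne_zero_of_mem_roundSphere hy)⟩
  map_one' := rfl
  map_mul' _ _ := rfl
  map_zero' := rfl
  map_add' _ _ := rfl
  commutes' _ := rfl

/-- Stone-Weierstrass: the coordinate functions separate the points of the sphere. -/
lemma exists_polAlg_near {g : Amb n → ℝ} (hg : Continuous g) {ε : ℝ} (hε : 0 < ε) :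
    ∃ p ∈ polAlg n, ∀ y ∈ roundSphere n, |p y - g y| < ε := by
  have : CompactSpace (roundSphere n) := isCompact_iff_compactSpace.1 isCompact_roundSphere
  have hsep : ((polAlg n).map (restrictSphere n)).SeparatesPoints := by
    intro x y hxy
    have : ∃ c, (x : Amb n) c ≠ (y : Amb n) c := by
      by_contra! h
      exact hxy (Subtype.ext (by ext c; exact h c))
    obtain ⟨c, hc⟩ := this
    refine ⟨_, ⟨restrictSphere n (SF.Y c), ⟨SF.Y c,
      ⟨1, homPol_le_pol le_rfl (Y_mem_homPol c)⟩, rfl⟩, rfl⟩, ?_⟩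
    show SF.Y c x ≠ SF.Y c y
    rwa [SF.Y_apply_sphere c x.2, SF.Y_apply_sphere c y.2]
  obtain ⟨⟨_, p, hp, rfl⟩, h⟩ :=
    ContinuousMap.exists_mem_subalgebra_near_continuous_of_separatesPoints _ hsep
      (fun y : roundSphere n => g y) (hg.comp continuous_subtype_val) ε hε
  exact ⟨p, hp, fun y hy => h ⟨y, hy⟩⟩

lemma exists_polAlg_norm_sub_le (u : L2Sphere n) {ε : ℝ} (hε : 0 < ε) :
    ∃ p ∈ polAlg n, ‖u - SF.cls p‖ ≤ ε * (1 + (surfaceMeasure n univ).toReal ^ (1 / 2 : ℝ)) := by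
  obtain ⟨g, hg, hgm⟩ := (Lp.memLp u).exists_boundedContinuous_eLpNorm_sub_le (by simp)
    (ε := ENNReal.ofReal ε) (by simpa using hε)
  obtain ⟨p, hp, hpg⟩ := exists_polAlg_near g.continuous hε
  refine ⟨p, hp, ?_⟩
  have h1 : ‖u - hgm.toLp g‖ ≤ ε := by
    rw [Lp.norm_def]
    refine ENNReal.toReal_le_of_le_ofReal hε.le ((eLpNorm_congr_ae ?_).trans_le hg)
    filter_upwards [Lp.coeFn_sub u (hgm.toLp g), hgm.coeFn_toLp] with x h1 h2
    rw [h1, Pi.sub_apply, Pi.sub_apply, h2]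
  have h2 : ‖hgm.toLp g - SF.cls p‖ ≤ (surfaceMeasure n univ).toReal ^ (1 / 2 : ℝ) * ε := by
    rw [Lp.norm_def]
    have hb : eLpNorm (hgm.toLp g - SF.cls p : L2Sphere n) 2 (surfaceMeasure n) ≤
        surfaceMeasure n univ ^ (2 : ℝ≥0∞).toReal⁻¹ * ENNReal.ofReal ε := by
      refine eLpNorm_le_of_ae_bound ?_
      filter_upwards [Lp.coeFn_sub (hgm.toLp g) (SF.cls p), hgm.coeFn_toLp, p.coeFn_cls,
        ae_mem_roundSphere] with x h1 h2 h3 h4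
      rw [h1, Pi.sub_apply, h2, h3, norm_sub_rev]
      exact (hpg x h4).le
    refine (ENNReal.toReal_mono ?_ hb).trans_eq ?_
    · exact ENNReal.mul_ne_top (ENNReal.rpow_ne_top_of_nonneg (by positivity)
        (measure_ne_top _ _)) ENNReal.ofReal_ne_top
    · rw [ENNReal.toReal_mul, ENNReal.toReal_ofReal hε.le, ← ENNReal.toReal_rpow]
      norm_num
  calc ‖u - SF.cls p‖ = ‖(u - hgm.toLp g) + (hgm.toLp g - SF.cls p)‖ := by abel_nf
    _ ≤ _ := (norm_add_le _ _).trans (add_le_add h1 h2)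
    _ = _ := by ring

/-- Spherical harmonics are total in `L²`. -/
lemma eq_zero_of_inner_harm {u : L2Sphere n} (h : ∀ j, ∀ f ∈ harm n j, ⟪SF.cls f, u⟫_ℝ = 0) :
    u = 0 := by
  have hp : ∀ p ∈ polAlg n, ⟪SF.cls p, u⟫_ℝ = 0 := by
    rintro p ⟨j, hp⟩
    have : pol n j ≤ LinearMap.ker ((innerₗ (L2Sphere n)).flip u ∘ₗ SF.cls) :=
      (pol_le_iSup_harm j).trans (iSup₂_le fun i _ f hf => by simpa [real_inner_comm] using h i f hf)
    simpa [real_inner_comm] using this hp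
  set M := 1 + (surfaceMeasure n univ).toReal ^ (1 / 2 : ℝ)
  have hM : 0 < M := by positivity
  by_contra hu
  have hu' : 0 < ‖u‖ := norm_pos_iff.2 hu
  obtain ⟨p, hpp, hpu⟩ := exists_polAlg_norm_sub_le u (ε := ‖u‖ / (2 * M)) (by positivity)
  have h1 : ‖u‖ ^ 2 = ⟪u - SF.cls p, u⟫_ℝ := by
    rw [inner_sub_left, hp p hpp, sub_zero, real_inner_self_eq_norm_sq]
  have h2 := real_inner_le_norm (u - SF.cls p) u
  have h3 : ‖u‖ / (2 * M) * M = ‖u‖ / 2 := by field_simp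
  have h4 : ‖u - SF.cls p‖ ≤ ‖u‖ / 2 := hpu.trans_eq h3
  nlinarith

instance (j : ℕ) : FiniteDimensional ℝ (harm n j) :=
  Submodule.finiteDimensional_of_le (inf_le_left : harm n j ≤ pol n j)

lemma cas_eq_of_opL {f : SF n} {j : ℕ}
    (h : ∀ y ∈ roundSphere n, opL f y = -eigval n j * f y) : SF.cas f = casEig n j • f := by
  refine SF.ext_sphere fun y hy => ?_
  have hn : (n : ℝ) ≠ 0 := by exact_mod_cast NeZero.ne n
  have := h y hy
  rw [SF.opL_eq f hy, eigval_eq] at this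
  rw [SF.smul_apply]
  field_simp at this
  linarith

lemma opL_of_cas {f : SF n} {j : ℕ} (h : SF.cas f = casEig n j • f) {y : Amb n}
    (hy : y ∈ roundSphere n) : opL f y = -eigval n j * f y := by
  rw [SF.opL_eq f hy, eigval_eq, h, SF.smul_apply]
  ring

lemma opL_congr {U V : Amb n → ℝ} (h : EqOn U V {0}ᶜ) {y : Amb n} (hy : y ≠ 0) :
    opL U y = opL V y := by
  rw [opL, opL, h hy]
  congr 1
  refine (InnerProductSpace.laplacian_congr_nhds ?_).eq_of_nhds
  filter_upwards [isOpen_compl_singleton.mem_nhds hy] with z hz using h hz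

/-- The eigenspaces consist of the classes of spherical harmonics. -/
theorem eigenspaceE_eq (j : ℕ) : eigenspaceE n j = (harm n j).map SF.cls := by
  apply le_antisymm
  · refine Submodule.topologicalClosure_minimal _ ?_ (Submodule.closed_of_finiteDimensional _)
    rw [Submodule.span_le]
    rintro u ⟨U, hU, huU, hLU⟩
    set f : SF n := SF.mk' U hU
    have hfU : EqOn f U {0}ᶜ := fun x hx => SF.mk'_apply hU hx
    have hcas : SF.cas f = casEig n j • f := cas_eq_of_opL fun y hy => by
      have hy0 := ne_zero_of_mem_roundSphere hy
      rw [opL_congr hfU hy0, hLU y hy, hfU hy0]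
    have hu : u = SF.cls f := by
      refine Lp.ext (huU.trans ((f.coeFn_cls).trans ?_).symm)
      filter_upwards [ae_ne_zero (n := n)] with x hx using hfU hx
    -- The eigenfunction f is not known to be a polynomial. Its difference from its projection onto
    -- H is orthogonal to the harmonics of degree j by construction and to all others because the
    -- eigenvalues differ, so it vanishes by totality.
    set H := (harm n j).map SF.cls
    obtain ⟨h, hh, hhp⟩ := (H.starProjection_apply_mem u : H.starProjection u ∈ H)
    have hd : SF.cls (f - h) = 0 := by
      refine eq_zero_of_inner_harm fun i g hg => ?_
      by_cases hij : i = j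
      · subst hij
        have := Submodule.inner_right_of_mem_orthogonal
          (show SF.cls g ∈ H from ⟨g, hg, rfl⟩) (H.sub_starProjection_mem_orthogonal u)
        rwa [← hhp, hu, ← map_sub] at this
      · refine inner_eq_zero_of_cas (mem_harm.1 hg).2 (b := casEig n j) ?_
          (casEig_strictMono.injective.ne hij)
        rw [map_sub, hcas, (mem_harm.1 hh).2, smul_sub]
    rw [map_sub, sub_eq_zero] at hd
    exact ⟨h, hh, by rw [← hd, hu]⟩
  · rintro _ ⟨f, hf, rfl⟩
    exact Submodule.le_topologicalClosure _ (Submodule.subset_span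
      ⟨f, f.isSphereFun, f.coeFn_cls, fun y hy => opL_of_cas (mem_harm.1 hf).2 hy⟩)

lemma cls_mem_eigenspaceE {j : ℕ} {f : SF n} (hf : f ∈ harm n j) :
    SF.cls f ∈ eigenspaceE n j := by
  rw [eigenspaceE_eq]; exact ⟨f, hf, rfl⟩

/-- The rotation fields preserve spherical harmonics. -/
lemma D_mem_harm (i : RotIdx n) {j : ℕ} {f : SF n} (hf : f ∈ harm n j) :
    SF.D i f ∈ harm n j := by
  have hD : SF.D i f ∈ pol n j := D_mem_pol i (mem_harm.1 hf).1
  have hsplit : ∀ d, pol n d ≤ (⨆ l < d, harm n l) ⊔ harm n d := fun d =>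
    (pol_le_iSup_harm d).trans (iSup₂_le fun l hl => by
      rcases hl.lt_or_eq with h | rfl
      · exact (le_iSup₂_of_le l h le_rfl : harm n l ≤ _).trans le_sup_left
      · exact le_sup_right)
  -- Split D_i f = q + h with q of lower degree and h harmonic of degree j. Then ⟨q, D_i f⟩ = -⟨D_i
  -- q, f⟩ = 0, because D_i q again has lower degree; since also ⟨q, h⟩ = 0, it follows that q = 0.
  obtain ⟨q, hq, h, hh, hqh⟩ := Submodule.mem_sup.1 (hsplit j hD)
  have horth : ∀ d, d < j → ∀ p ∈ pol n d, ∀ g ∈ harm n j, ⟪SF.cls p, SF.cls g⟫_ℝ = 0 := by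
    intro d hd p hp g hg
    have : pol n d ≤ LinearMap.ker ((innerₗ (L2Sphere n)).flip (SF.cls g) ∘ₗ SF.cls) :=
      (pol_le_iSup_harm d).trans (iSup₂_le fun l hl f' hf' => by
        simpa [real_inner_comm] using inner_harm (by omega : l ≠ j) hf' hg)
    simpa [real_inner_comm] using this hp
  have hqpol : ∃ d, q ∈ pol n d ∧ (d < j ∨ q = 0) := by
    rcases Nat.eq_zero_or_pos j with rfl | hj
    · simp only [Nat.not_lt_zero, iSup_false, iSup_bot, Submodule.mem_bot] at hq
      exact ⟨0, hq ▸ zero_mem _, Or.inr hq⟩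
    · refine ⟨j - 1, ?_, Or.inl (by omega)⟩
      exact (iSup₂_le fun l hl g hg => pol_mono (by omega) (mem_harm.1 hg).1 :
        (⨆ l < j, harm n l) ≤ pol n (j - 1)) hq
  have hq0 : q = 0 := by
    obtain ⟨d, hqd, hd | h0⟩ := hqpol
    · have h1 : ⟪SF.cls q, SF.cls (SF.D i f)⟫_ℝ = 0 := by
        have := SF.inner_cls_D i q f
        rw [horth d hd _ (D_mem_pol i hqd) f hf] at this
        linarith
      rw [← hqh, map_add, inner_add_right, horth d hd q hqd h hh, add_zero] at h1
      exact SF.cls_injective (by rw [map_zero]; exact inner_self_eq_zero.1 h1)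
    · exact h0
  rw [← hqh, hq0, zero_add]
  exact hh

/-! ### Spectral projections -/

lemma eigProj_mem (j : ℕ) (u : L2Sphere n) : eigProj n j u ∈ eigenspaceE n j := by
  have : CompleteSpace (eigenspaceE n j) := Submodule.topologicalClosure.completeSpace _
  exact Submodule.starProjection_apply_mem _ _

lemma eigProj_eq_self {j : ℕ} {u : L2Sphere n} (hu : u ∈ eigenspaceE n j) :
    eigProj n j u = u := by
  have : CompleteSpace (eigenspaceE n j) := Submodule.topologicalClosure.completeSpace _
  exact Submodule.starProjection_eq_self_iff.2 hu

lemma inner_eigProj_left (j : ℕ) (u v : L2Sphere n) :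
    ⟪eigProj n j u, v⟫_ℝ = ⟪u, eigProj n j v⟫_ℝ := by
  have : CompleteSpace (eigenspaceE n j) := Submodule.topologicalClosure.completeSpace _
  exact Submodule.inner_starProjection_left_eq_right _ u v

lemma inner_eigenspaceE {i j : ℕ} (hij : i ≠ j) {u v : L2Sphere n} (hu : u ∈ eigenspaceE n i)
    (hv : v ∈ eigenspaceE n j) : ⟪u, v⟫_ℝ = 0 := by
  rw [eigenspaceE_eq] at hu hv
  obtain ⟨f, hf, rfl⟩ := hu
  obtain ⟨g, hg, rfl⟩ := hv
  exact inner_harm hij hf hg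

lemma eigProj_eq_of_inner {j : ℕ} {u w : L2Sphere n} (hw : w ∈ eigenspaceE n j)
    (h : ∀ f ∈ harm n j, ⟪SF.cls f, u⟫_ℝ = ⟪SF.cls f, w⟫_ℝ) : eigProj n j u = w := by
  have : CompleteSpace (eigenspaceE n j) := Submodule.topologicalClosure.completeSpace _
  refine (Submodule.eq_starProjection_of_mem_of_inner_eq_zero hw fun z hz => ?_)
  rw [eigenspaceE_eq] at hz
  obtain ⟨f, hf, rfl⟩ := hz
  rw [real_inner_comm, inner_sub_right, h f hf, sub_self]

lemma eigProj_of_ne {i j : ℕ} (hij : i ≠ j) {u : L2Sphere n} (hu : u ∈ eigenspaceE n i) :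
    eigProj n j u = 0 :=
  eigProj_eq_of_inner (zero_mem _) fun f hf => by
    rw [inner_zero_right, inner_eigenspaceE hij.symm (cls_mem_eigenspaceE hf) hu]

lemma eigProj_eigProj (i j : ℕ) (u : L2Sphere n) :
    eigProj n i (eigProj n j u) = if i = j then eigProj n i u else 0 := by
  split_ifs with h
  · subst h; exact eigProj_eq_self (eigProj_mem i u)
  · exact eigProj_of_ne (Ne.symm h) (eigProj_mem j u)

lemma norm_eigProj_sq (j : ℕ) (u : L2Sphere n) : ‖eigProj n j u‖ ^ 2 = ⟪eigProj n j u, u⟫_ℝ := by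
  rw [inner_eigProj_left, ← real_inner_self_eq_norm_sq, inner_eigProj_left,
    eigProj_eigProj, if_pos rfl]

lemma orthogonalFamily_eigenspaceE :
    OrthogonalFamily ℝ (fun j => eigenspaceE n j) fun j => (eigenspaceE n j).subtypeₗᵢ :=
  fun _ _ hij v w => inner_eigenspaceE hij v.2 w.2

lemma eq_of_eigProj_eq {u v : L2Sphere n} (h : ∀ j, eigProj n j u = eigProj n j v) : u = v := by
  rw [← sub_eq_zero]
  refine eq_zero_of_inner_harm fun j f hf => ?_
  rw [← eigProj_eq_self (cls_mem_eigenspaceE hf), inner_eigProj_left, map_sub, h j, sub_self,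
    inner_zero_right]

lemma summable_of_mem_eigenspaceE {t : ℕ → L2Sphere n} (ht : ∀ j, t j ∈ eigenspaceE n j)
    (hs : Summable fun j => ‖t j‖ ^ 2) : Summable t := by
  have := (orthogonalFamily_eigenspaceE (n := n)).summable_iff_norm_sq_summable
    (fun j => (⟨t j, ht j⟩ : eigenspaceE n j))
  exact this.2 hs

lemma eigProj_tsum {t : ℕ → L2Sphere n} (ht : ∀ j, t j ∈ eigenspaceE n j)
    (hs : Summable t) (i : ℕ) : eigProj n i (∑' j, t j) = t i := by
  rw [(eigProj n i).map_tsum hs, tsum_eq_single i]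
  · exact eigProj_eq_self (ht i)
  · exact fun j hj => eigProj_of_ne hj (ht j)

lemma sum_norm_eigProj_sq_le (s : Finset ℕ) (u : L2Sphere n) :
    ∑ j ∈ s, ‖eigProj n j u‖ ^ 2 ≤ ‖u‖ ^ 2 := by
  set P := ∑ j ∈ s, eigProj n j u
  have h1 : ⟪P, u⟫_ℝ = ∑ j ∈ s, ‖eigProj n j u‖ ^ 2 := by
    rw [sum_inner]; exact Finset.sum_congr rfl fun j _ => (norm_eigProj_sq j u).symm
  have h2 : ‖P‖ ^ 2 = ∑ j ∈ s, ‖eigProj n j u‖ ^ 2 := by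
    rw [← real_inner_self_eq_norm_sq, sum_inner]
    refine Finset.sum_congr rfl fun j hj => ?_
    rw [inner_eigProj_left, map_sum, Finset.sum_eq_single j, eigProj_eigProj, if_pos rfl,
      norm_eigProj_sq, inner_eigProj_left]
    · intro i _ hij
      rw [eigProj_eigProj, if_neg hij.symm]
    · exact fun h => absurd hj h
  have h3 := real_inner_le_norm P u
  have h4 : ‖P‖ ≤ ‖u‖ := by
    by_contra! hlt
    nlinarith [norm_nonneg P, norm_nonneg u]
  rw [← h2]
  gcongr

lemma summable_eigProj (u : L2Sphere n) : Summable fun j => eigProj n j u :=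
  summable_of_mem_eigenspaceE (fun j => eigProj_mem j u)
    (summable_of_sum_le (fun _ => by positivity) fun s => sum_norm_eigProj_sq_le s u)

lemma hasSum_eigProj (u : L2Sphere n) : HasSum (fun j => eigProj n j u) u := by
  have h := summable_eigProj u
  have : ∑' j, eigProj n j u = u := eq_of_eigProj_eq fun i =>
    eigProj_tsum (fun j => eigProj_mem j u) h i
  have h2 := h.hasSum
  rwa [this] at h2

lemma hasSum_norm_eigProj_sq (u : L2Sphere n) :
    HasSum (fun j => ‖eigProj n j u‖ ^ 2) (‖u‖ ^ 2) := by
  rw [← real_inner_self_eq_norm_sq]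
  simp_rw [norm_eigProj_sq]
  exact (hasSum_eigProj u).mapL ((innerSL ℝ).flip u)

/-- The spectral projection, as a spherical harmonic. -/
lemma exists_harm_eq (j : ℕ) (u : L2Sphere n) : ∃ f ∈ harm n j, SF.cls f = eigProj n j u := by
  have := eigProj_mem j u
  rw [eigenspaceE_eq] at this
  exact this

/-- The spectral projection with values in smooth functions. -/
def SF.proj (j : ℕ) : L2Sphere n →ₗ[ℝ] SF n where
  toFun u := (exists_harm_eq j u).choose
  map_add' u v := SF.cls_injective (by
    refine Eq.trans ?_ (SF.cls.map_add _ _).symm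
    exact (exists_harm_eq j _).choose_spec.2.trans (((eigProj n j).map_add u v).trans
      (congrArg₂ (· + ·) (exists_harm_eq j u).choose_spec.2
        (exists_harm_eq j v).choose_spec.2).symm))
  map_smul' c u := SF.cls_injective (by
    refine Eq.trans ?_ (SF.cls.map_smul _ _).symm
    exact (exists_harm_eq j _).choose_spec.2.trans (((eigProj n j).map_smul c u).trans
      (congrArg (c • ·) (exists_harm_eq j u).choose_spec.2).symm))

lemma SF.proj_mem (j : ℕ) (u : L2Sphere n) : SF.proj j u ∈ harm n j :=
  (exists_harm_eq j u).choose_spec.1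

lemma SF.cls_proj (j : ℕ) (u : L2Sphere n) : SF.cls (SF.proj j u) = eigProj n j u :=
  (exists_harm_eq j u).choose_spec.2

/-- The spectral projections commute with rotation fields, since these are skew-adjoint and preserve
each space of harmonics. -/
lemma eigProj_cls_D (i : RotIdx n) (j : ℕ) (f : SF n) :
    eigProj n j (SF.cls (SF.D i f)) = SF.cls (SF.D i (SF.proj j (SF.cls f))) := by
  refine eigProj_eq_of_inner (cls_mem_eigenspaceE (D_mem_harm i (SF.proj_mem j _))) fun g hg => ?_
  have h1 := SF.inner_cls_D i g f
  have h2 := SF.inner_cls_D i g (SF.proj j (SF.cls f))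
  rw [SF.cls_proj, ← inner_eigProj_left,
    eigProj_eq_self (cls_mem_eigenspaceE (D_mem_harm i hg))] at h2
  linarith

/-- The Dirichlet energy mode by mode. This identity is the link between the spectral Sobolev norms
and rotational derivatives. -/
lemma casEig_mul_norm_sq (j : ℕ) (f : SF n) :
    casEig n j * ‖eigProj n j (SF.cls f)‖ ^ 2 =
      1 / 2 * ∑ i, ‖eigProj n j (SF.cls (SF.D i f))‖ ^ 2 := by
  simp_rw [eigProj_cls_D, ← real_inner_self_eq_norm_sq]
  rw [← SF.inner_cls_cas, (mem_harm.1 (SF.proj_mem j _)).2, map_smul, real_inner_smul_left,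
    SF.cls_proj]

/-! ### The sup bound for polynomials -/

/-- Rotation fields span the tangent directions and f is constant along rays, so the differential
vanishes; the complement of the origin is connected because n + 1 ≥ 2. -/
lemma SF.exists_const {f : SF n} (h : ∀ i, SF.D i f = 0) : ∃ a, ∀ x, x ≠ 0 → f x = a := by
  have hrank : 1 < Module.rank ℝ (Amb n) := by
    rw [← Module.finrank_eq_rank, finrank_euclideanSpace_fin]
    exact_mod_cast Nat.lt_add_of_pos_left (NeZero.pos n)
  refine isOpen_compl_singleton.exists_is_const_of_fderiv_eq_zero (𝕜 := ℝ) (s := {0}ᶜ)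
    (isConnected_compl_singleton_of_one_lt_rank hrank 0).isPreconnected
    (fun x hx => (f.isSphereFun.differentiableAt (by simp) hx).differentiableWithinAt)
    fun x hx => ?_
  refine ContinuousLinearMap.coe_injective
    ((EuclideanSpace.basisFun (Fin (n + 1)) ℝ).toBasis.ext fun b => ?_)
  have hb := f.isSphereFun.fderiv_single (by simp) hx b
  have h0 : ∀ a, rotDeriv (a, b) f x = 0 := fun a => by
    rw [← SF.D_apply _ f hx, h, SF.zero_apply]
  simpa [h0] using hb

/-- The reproducing kernel bound: functions in a finite-dimensional rotation-invariant space are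
bounded by their `L²` norm and the dimension. -/
lemma sq_le_finrank_mul_norm_sq {W : Submodule ℝ (SF n)} [FiniteDimensional ℝ W]
    (hW : ∀ i, ∀ f ∈ W, SF.D i f ∈ W) {f : SF n} (hf : f ∈ W) {x : Amb n} (hx : x ≠ 0) :
    f x ^ 2 ≤ Module.finrank ℝ W / (surfaceMeasure n univ).toReal * ‖SF.cls f‖ ^ 2 := by
  set H : Submodule ℝ (L2Sphere n) := W.map SF.cls with hH
  set b := stdOrthonormalBasis ℝ H
  have hex : ∀ i, ∃ e ∈ W, SF.cls e = b i := fun i => (b i).2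
  choose e heW heb using hex
  have hexp : ∀ g ∈ W, g = ∑ i, ⟪SF.cls (e i), SF.cls g⟫_ℝ • e i := fun g hg => by
    apply SF.cls_injective
    have := congrArg (Subtype.val) (b.sum_repr' ⟨SF.cls g, ⟨g, hg, rfl⟩⟩)
    rw [map_sum]
    simp only [map_smul, heb]
    simp only [AddSubmonoidClass.coe_finsetSum, Submodule.coe_smul, Submodule.coe_inner] at this
    exact this.symm
  -- K is the reproducing kernel on the diagonal. The matrix of D_l in the orthonormal basis e is
  -- antisymmetric, so D_l K = 0 and K is constant; its integral is the dimension. Cauchy-Schwarz in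
  -- the expansion of f then gives the bound.
  set K : SF n := ∑ i, e i * e i with hK
  have hDK : ∀ l, SF.D l K = 0 := fun l => by
    have h1 : ∑ i, e i * SF.D l (e i) = 0 := by
      have h2 : ∑ i, e i * SF.D l (e i) =
          ∑ i, ∑ m, ⟪SF.cls (e m), SF.cls (SF.D l (e i))⟫_ℝ • (e i * e m) := by
        refine Finset.sum_congr rfl fun i _ => ?_
        conv_lhs => rw [hexp _ (hW l _ (heW i))]
        rw [Finset.mul_sum]
        exact Finset.sum_congr rfl fun m _ => mul_smul_comm _ _ _
      have h3 : ∑ i, e i * SF.D l (e i) = -∑ i, e i * SF.D l (e i) := by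
        conv_lhs => rw [h2, Finset.sum_comm]
        rw [h2, ← Finset.sum_neg_distrib]
        refine Finset.sum_congr rfl fun i _ => ?_
        rw [← Finset.sum_neg_distrib]
        refine Finset.sum_congr rfl fun m _ => ?_
        rw [mul_comm (e m), real_inner_comm, SF.inner_cls_D, neg_smul]
      have h4 : (2 : ℝ) • ∑ i, e i * SF.D l (e i) = 0 := by
        rw [two_smul]; nth_rewrite 2 [h3]; exact add_neg_cancel _
      exact (smul_eq_zero.1 h4).resolve_left two_ne_zero
    rw [hK, map_sum]
    simp only [SF.D_mul, Finset.sum_add_distrib]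
    have h5 : ∑ i, SF.D l (e i) * e i = ∑ i, e i * SF.D l (e i) :=
      Finset.sum_congr rfl fun i _ => mul_comm _ _
    rw [h5, h1, add_zero]
  obtain ⟨a, ha⟩ := SF.exists_const hDK
  have hμ : 0 < (surfaceMeasure n univ).toReal :=
    ENNReal.toReal_pos surfaceMeasure_univ_pos.ne' (measure_ne_top _ _)
  have hint : ∫ y, K y ∂(surfaceMeasure n) = Module.finrank ℝ H := by
    have h1 : ∀ y, K y = ∑ i, e i y * e i y := fun y => by simp [hK]
    simp_rw [h1]
    rw [integral_finsetSum _ fun i _ => show Integrable (fun y => e i y * e i y) _ from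
      ((e i).isSphereFun.mul (e i).isSphereFun).integrable]
    have h2 : ∀ i, ∫ y, e i y * e i y ∂(surfaceMeasure n) = 1 := fun i => by
      rw [← SF.inner_cls, heb, real_inner_self_eq_norm_sq]
      have := b.norm_eq_one i
      rw [Submodule.norm_coe, this, one_pow]
    simp [h2]
  have hconst : ∫ y, K y ∂(surfaceMeasure n) = (surfaceMeasure n univ).toReal * a := by
    rw [integral_congr_ae (ae_ne_zero.mono fun y hy => ha y hy), integral_const, smul_eq_mul]
    rfl
  have ha' : a = Module.finrank ℝ H / (surfaceMeasure n univ).toReal := by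
    rw [eq_div_iff hμ.ne', mul_comm, ← hconst, hint]
  have hle : Module.finrank ℝ H ≤ Module.finrank ℝ W := Submodule.finrank_map_le _ _
  have hfx : f x = ∑ i, ⟪SF.cls (e i), SF.cls f⟫_ℝ * e i x := by
    conv_lhs => rw [hexp f hf]
    simp
  have hnorm : ∑ i, ⟪SF.cls (e i), SF.cls f⟫_ℝ ^ 2 = ‖SF.cls f‖ ^ 2 := by
    have := b.sum_sq_norm_inner_right ⟨SF.cls f, ⟨f, hf, rfl⟩⟩
    simp only [Submodule.coe_inner, Submodule.coe_norm, Real.norm_eq_abs, sq_abs] at this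
    simp only [heb]
    exact this
  calc f x ^ 2 ≤ (∑ i, ⟪SF.cls (e i), SF.cls f⟫_ℝ ^ 2) * ∑ i, e i x ^ 2 := by
        rw [hfx]; exact Finset.sum_mul_sq_le_sq_mul_sq _ _ _
    _ = ‖SF.cls f‖ ^ 2 * a := by
        rw [hnorm, ← ha x hx, hK, SF.sum_apply]
        simp [pow_two]
    _ ≤ _ := by
        rw [ha', mul_comm]
        gcongr

/-- Nikolskii's inequality on the sphere. -/
lemma exists_abs_le_of_mem_pol : ∃ C : ℝ, 0 < C ∧ ∀ (j : ℕ) (f : SF n), f ∈ pol n j →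
    ∀ x, x ≠ 0 → f x ^ 2 ≤ C * (j + 1) ^ n * ‖SF.cls f‖ ^ 2 := by
  have hμ : 0 < (surfaceMeasure n univ).toReal :=
    ENNReal.toReal_pos surfaceMeasure_univ_pos.ne' (measure_ne_top _ _)
  refine ⟨2 / (surfaceMeasure n univ).toReal, by positivity, fun j f hf x hx => ?_⟩
  refine (sq_le_finrank_mul_norm_sq (fun i g hg => D_mem_pol i hg) hf hx).trans ?_
  have h : (Module.finrank ℝ (pol n j) : ℝ) ≤ 2 * (j + 1) ^ n := by
    exact_mod_cast finrank_pol_le (n := n) j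
  gcongr
  rw [div_mul_eq_mul_div]
  gcongr

end Harmonics

/-! ### Sobolev norms -/

section Sobolev

variable {n : ℕ}

lemma sobolevNorm_eq_eLpNorm (l : ℕ) (u : L2Sphere n) :
    sobolevNorm l u =
      eLpNorm (fun j => Real.sqrt (|eigval n j| ^ l) • eigProj n j u) 2 Measure.count := by
  rw [eLpNorm_eq_lintegral_rpow_enorm_toReal (by simp) (by simp), lintegral_count, sobolevNorm]
  congr 1
  refine tsum_congr fun j => ?_
  rw [enorm_smul, ENNReal.mul_rpow_of_nonneg _ _ (by simp), ENNReal.toReal_ofNat,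
    ENNReal.rpow_ofNat, ENNReal.rpow_ofNat, Real.enorm_of_nonneg (Real.sqrt_nonneg _),
    ← ENNReal.ofReal_pow (Real.sqrt_nonneg _), Real.sq_sqrt (by positivity)]

lemma sobolevNorm_add_le (l : ℕ) (u v : L2Sphere n) :
    sobolevNorm l (u + v) ≤ sobolevNorm l u + sobolevNorm l v := by
  simp only [sobolevNorm_eq_eLpNorm, map_add, smul_add]
  exact eLpNorm_add_le .of_discrete .of_discrete (by norm_num)

lemma sobolevNorm_neg (l : ℕ) (u : L2Sphere n) : sobolevNorm l (-u) = sobolevNorm l u := by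
  simp [sobolevNorm]

lemma sobolevNorm_sub_le (l : ℕ) (u v : L2Sphere n) :
    sobolevNorm l (u - v) ≤ sobolevNorm l u + sobolevNorm l v := by
  rw [sub_eq_add_neg, ← sobolevNorm_neg l v]
  exact sobolevNorm_add_le l u (-v)

lemma sobolevNorm_zero_right (l : ℕ) : sobolevNorm l (0 : L2Sphere n) = 0 := by
  simp [sobolevNorm]

lemma sobolevNorm_sq (l : ℕ) (u : L2Sphere n) :
    sobolevNorm l u ^ 2 =
      ∑' j, ENNReal.ofReal (|eigval n j| ^ l * ‖eigProj n j u‖ ^ 2) := by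
  rw [sobolevNorm, ← ENNReal.rpow_natCast, ← ENNReal.rpow_mul]
  rw [show (1 / 2 : ℝ) * ((2 : ℕ) : ℝ) = 1 by norm_num, ENNReal.rpow_one]
  refine tsum_congr fun j => ?_
  rw [ENNReal.ofReal_mul (by positivity), ENNReal.ofReal_pow (norm_nonneg _), ofReal_norm]

lemma sobolevNorm_le_of_sq_le {l : ℕ} {u : L2Sphere n} {A : ℝ≥0∞}
    (h : ∑' j, ENNReal.ofReal (|eigval n j| ^ l * ‖eigProj n j u‖ ^ 2) ≤ A ^ 2) :
    sobolevNorm l u ≤ A := by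
  rw [← sobolevNorm_sq] at h
  exact (ENNReal.pow_le_pow_left_iff two_ne_zero).1 h

variable [NeZero n]

lemma one_le_dim : (1 : ℝ) ≤ n := by exact_mod_cast NeZero.one_le

/-- The eigenvalues are -1 and -1/2 for j = 0, 1 and positive from j = 2 on, hence the three cases.
The constant 9n is attained at j = 2, where λ_2 = 1/n. -/
lemma sq_le_abs_eigval (j : ℕ) : ((j : ℝ) + 1) ^ 2 ≤ 9 * n * |eigval n j| := by
  have hn := one_le_dim (n := n)
  have e : eigval n j = ((j - 2) * n + j * (j - 1)) / (2 * n) := by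
    rw [eigval]; field_simp; ring
  match j with
  | 0 =>
    have h0 : eigval n 0 = -1 := by simp [eigval]
    rw [h0]; norm_num; linarith
  | 1 =>
    have h0 : eigval n 1 = -(1 / 2) := by rw [eigval]; push_cast; field_simp; ring
    rw [h0, abs_neg, abs_of_pos (by norm_num)]; push_cast; nlinarith
  | j + 2 =>
    have hj : (0 : ℝ) ≤ j := Nat.cast_nonneg j
    rw [abs_of_nonneg (by rw [e]; push_cast; ring_nf; positivity), e]
    push_cast
    rw [mul_div_assoc', le_div_iff₀ (by positivity)]
    nlinarith [mul_nonneg hj hj, mul_nonneg hj (by linarith : (0:ℝ) ≤ n - 1),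
      mul_nonneg (mul_nonneg hj hj) (by linarith : (0:ℝ) ≤ n - 1),
      mul_nonneg hj (mul_nonneg (by linarith : (0:ℝ) ≤ n - 1) (by linarith : (0:ℝ) ≤ n - 1))]

lemma abs_eigval_pos (j : ℕ) : 0 < |eigval n j| := by
  have h := sq_le_abs_eigval (n := n) j
  have hn := one_le_dim (n := n)
  have : (0 : ℝ) < ((j : ℝ) + 1) ^ 2 := by positivity
  by_contra! h0
  nlinarith

lemma one_le_abs_eigval (j : ℕ) : 1 ≤ 9 * n * |eigval n j| := by
  refine le_trans ?_ (sq_le_abs_eigval j)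
  nlinarith [(Nat.cast_nonneg j : (0:ℝ) ≤ j)]

lemma casEig_le_abs_eigval (j : ℕ) : casEig n j ≤ 9 * n ^ 2 * |eigval n j| := by
  have hn := one_le_dim (n := n)
  have hj : (0 : ℝ) ≤ j := Nat.cast_nonneg j
  have h := mul_le_mul_of_nonneg_left (sq_le_abs_eigval (n := n) j) (by linarith : (0:ℝ) ≤ n)
  refine le_trans ?_ (h.trans_eq (by ring))
  rw [casEig]
  nlinarith [mul_nonneg hj hj, mul_nonneg hj (by linarith : (0:ℝ) ≤ n - 1),
    mul_nonneg (mul_nonneg hj hj) (by linarith : (0:ℝ) ≤ n - 1)]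

lemma abs_eigval_le (j : ℕ) : |eigval n j| ≤ 1 + casEig n j := by
  have hn := one_le_dim (n := n)
  have hc := casEig_nonneg (n := n) j
  have h1 : (2 * n : ℝ)⁻¹ ≤ 1 := inv_le_one_of_one_le₀ (by linarith)
  have h2 : 0 ≤ (2 * n : ℝ)⁻¹ * casEig n j := by positivity
  rw [eigval_eq, abs_le]
  constructor <;> nlinarith

/-- A constant in the comparison of Sobolev norms. -/
def sobConst (n : ℕ) : ℝ := 18 * n ^ 2

lemma one_le_sobConst : 1 ≤ sobConst n := by
  have hn := one_le_dim (n := n)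
  unfold sobConst
  nlinarith

lemma nine_mul_le_sobConst : 9 * (n : ℝ) ≤ sobConst n := by
  have hn := one_le_dim (n := n)
  unfold sobConst
  nlinarith

lemma sobolevNorm_zero_left (u : L2Sphere n) : sobolevNorm 0 u = ‖u‖ₑ := by
  have h : sobolevNorm 0 u ^ 2 = ‖u‖ₑ ^ 2 := by
    rw [sobolevNorm_sq]
    simp only [pow_zero, one_mul]
    rw [← ENNReal.ofReal_tsum_of_nonneg (fun _ => by positivity)
      (hasSum_norm_eigProj_sq u).summable, (hasSum_norm_eigProj_sq u).tsum_eq,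
      ENNReal.ofReal_pow (norm_nonneg _), ofReal_norm]
  exact (ENNReal.pow_right_strictMono two_ne_zero).injective h

lemma sobolevNorm_le_succ (l : ℕ) (u : L2Sphere n) :
    sobolevNorm l u ≤ ENNReal.ofReal (sobConst n) * sobolevNorm (l + 1) u := by
  have hK := one_le_sobConst (n := n)
  have hK' := nine_mul_le_sobConst (n := n)
  refine sobolevNorm_le_of_sq_le ?_
  rw [mul_pow, sobolevNorm_sq, ← ENNReal.tsum_mul_left, ← ENNReal.ofReal_pow (by linarith)]
  refine ENNReal.tsum_le_tsum fun j => ?_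
  rw [← ENNReal.ofReal_mul (by positivity)]
  refine ENNReal.ofReal_le_ofReal ?_
  have h1 := one_le_abs_eigval (n := n) j
  have h2 : 1 ≤ sobConst n ^ 2 * |eigval n j| := by
    have := mul_le_mul_of_nonneg_right (hK'.trans (le_self_pow₀ hK two_ne_zero))
      (abs_nonneg (eigval n j))
    linarith
  calc |eigval n j| ^ l * ‖eigProj n j u‖ ^ 2
      ≤ (sobConst n ^ 2 * |eigval n j|) * (|eigval n j| ^ l * ‖eigProj n j u‖ ^ 2) :=
        le_mul_of_one_le_left (by positivity) h2
    _ = _ := by ring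

lemma sobolevNorm_mono {l l' : ℕ} (h : l ≤ l') (u : L2Sphere n) :
    sobolevNorm l u ≤ ENNReal.ofReal (sobConst n) ^ (l' - l) * sobolevNorm l' u := by
  obtain ⟨d, rfl⟩ := Nat.exists_eq_add_of_le h
  rw [Nat.add_sub_cancel_left]
  induction d with
  | zero => simp
  | succ d ih =>
    refine (ih (Nat.le_add_right _ _)).trans ?_
    rw [pow_succ, mul_assoc]
    gcongr
    exact sobolevNorm_le_succ _ _

lemma sum_sq_le_sq_sum_ennreal {ι : Type*} (s : Finset ι) (a : ι → ℝ≥0∞) :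
    ∑ i ∈ s, a i ^ 2 ≤ (∑ i ∈ s, a i) ^ 2 := by
  rw [pow_two, Finset.sum_mul]
  refine Finset.sum_le_sum fun i hi => ?_
  rw [pow_two]
  gcongr
  exact Finset.single_le_sum (f := a) (fun _ _ => zero_le) hi

/-- In each mode |λ_j| ≤ 1 + casEig j, and casEig j ‖π_j f‖² is half the sum of the ‖π_j D_i f‖².
Together with `sobolevNorm_D_le` this permits induction on the number of derivatives. -/
lemma sobolevNorm_succ_le (l : ℕ) (f : SF n) :
    sobolevNorm (l + 1) (SF.cls f) ≤
      sobolevNorm l (SF.cls f) + ∑ i, sobolevNorm l (SF.cls (SF.D i f)) := by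
  refine sobolevNorm_le_of_sq_le ?_
  have h1 : sobolevNorm l (SF.cls f) ^ 2 + ∑ i, sobolevNorm l (SF.cls (SF.D i f)) ^ 2 ≤
      (sobolevNorm l (SF.cls f) + ∑ i, sobolevNorm l (SF.cls (SF.D i f))) ^ 2 := by
    refine (add_le_add_right (sum_sq_le_sq_sum_ennreal _ _) _).trans ?_
    rw [add_sq]
    calc _ ≤ sobolevNorm l (SF.cls f) ^ 2 + (∑ i, sobolevNorm l (SF.cls (SF.D i f))) ^ 2 +
          2 * sobolevNorm l (SF.cls f) * ∑ i, sobolevNorm l (SF.cls (SF.D i f)) := le_self_add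
      _ = _ := by ring
  refine le_trans ?_ h1
  simp_rw [sobolevNorm_sq]
  rw [← Summable.tsum_finsetSum fun _ _ => ENNReal.summable, ← ENNReal.tsum_add]
  refine ENNReal.tsum_le_tsum fun j => ?_
  rw [← ENNReal.ofReal_sum_of_nonneg fun _ _ => by positivity,
    ← ENNReal.ofReal_add (by positivity) (Finset.sum_nonneg fun _ _ => by positivity)]
  refine ENNReal.ofReal_le_ofReal ?_
  rw [← Finset.mul_sum, ← mul_add, pow_succ, mul_assoc]
  gcongr
  have h2 := casEig_mul_norm_sq j f
  have h3 : 0 ≤ ∑ i, ‖eigProj n j (SF.cls (SF.D i f))‖ ^ 2 :=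
    Finset.sum_nonneg fun _ _ => by positivity
  have h4 := mul_le_mul_of_nonneg_right (abs_eigval_le (n := n) j)
    (sq_nonneg ‖eigProj n j (SF.cls f)‖)
  nlinarith

lemma sobolevNorm_D_le (l : ℕ) (i : RotIdx n) (f : SF n) :
    sobolevNorm l (SF.cls (SF.D i f)) ≤
      ENNReal.ofReal (sobConst n) * sobolevNorm (l + 1) (SF.cls f) := by
  have hK := one_le_sobConst (n := n)
  refine sobolevNorm_le_of_sq_le ?_
  rw [mul_pow, sobolevNorm_sq, ← ENNReal.tsum_mul_left, ← ENNReal.ofReal_pow (by linarith)]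
  refine ENNReal.tsum_le_tsum fun j => ?_
  rw [← ENNReal.ofReal_mul (by positivity)]
  refine ENNReal.ofReal_le_ofReal ?_
  have h1 : ‖eigProj n j (SF.cls (SF.D i f))‖ ^ 2 ≤
      2 * (casEig n j * ‖eigProj n j (SF.cls f)‖ ^ 2) := by
    rw [casEig_mul_norm_sq, ← mul_assoc, mul_one_div_cancel two_ne_zero, one_mul]
    exact Finset.single_le_sum (f := fun i => ‖eigProj n j (SF.cls (SF.D i f))‖ ^ 2)
      (fun _ _ => by positivity) (Finset.mem_univ i)
  -- This inequality is where the value 18 n² of `sobConst` comes from.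
  have h2 : 2 * casEig n j ≤ sobConst n * |eigval n j| := by
    have := casEig_le_abs_eigval (n := n) j
    unfold sobConst
    linarith
  have h3 : 2 * casEig n j ≤ sobConst n ^ 2 * |eigval n j| := h2.trans
    (mul_le_mul_of_nonneg_right (le_self_pow₀ hK two_ne_zero) (abs_nonneg _))
  calc |eigval n j| ^ l * ‖eigProj n j (SF.cls (SF.D i f))‖ ^ 2
      ≤ |eigval n j| ^ l * (2 * (casEig n j * ‖eigProj n j (SF.cls f)‖ ^ 2)) := by gcongr
    _ = (2 * casEig n j) * (|eigval n j| ^ l * ‖eigProj n j (SF.cls f)‖ ^ 2) := by ring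
    _ ≤ (sobConst n ^ 2 * |eigval n j|) * (|eigval n j| ^ l * ‖eigProj n j (SF.cls f)‖ ^ 2) := by
        gcongr
    _ = _ := by ring

/-- Smooth functions lie in every Sobolev space, by induction on the order: their rotational
derivatives are smooth and, at order zero, square integrable. -/
lemma sobolevNorm_cls_ne_top (l : ℕ) (f : SF n) : sobolevNorm l (SF.cls f) ≠ ⊤ := by
  induction l generalizing f with
  | zero => rw [sobolevNorm_zero_left]; exact enorm_ne_top
  | succ l ih =>
    refine ne_top_of_le_ne_top ?_ (sobolevNorm_succ_le l f)
    exact ENNReal.add_ne_top.2 ⟨ih f, ENNReal.sum_ne_top.2 fun i _ => ih _⟩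

/-- The Sobolev norm of a smooth function, as a real number. -/
def SF.nrm (l : ℕ) (f : SF n) : ℝ := (sobolevNorm l (SF.cls f)).toReal

lemma SF.ofReal_nrm (l : ℕ) (f : SF n) :
    ENNReal.ofReal (SF.nrm l f) = sobolevNorm l (SF.cls f) :=
  ENNReal.ofReal_toReal (sobolevNorm_cls_ne_top l f)

lemma SF.nrm_nonneg (l : ℕ) (f : SF n) : 0 ≤ SF.nrm l f := ENNReal.toReal_nonneg

lemma SF.nrm_add_le (l : ℕ) (f g : SF n) : SF.nrm l (f + g) ≤ SF.nrm l f + SF.nrm l g := by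
  unfold SF.nrm
  rw [map_add]
  exact ENNReal.toReal_le_add (sobolevNorm_add_le _ _ _) (sobolevNorm_cls_ne_top l f)
    (sobolevNorm_cls_ne_top l g)

lemma SF.nrm_zero_right (l : ℕ) : SF.nrm l (0 : SF n) = 0 := by
  simp [SF.nrm, sobolevNorm_zero_right]

lemma SF.nrm_sum_le {ι : Type*} (l : ℕ) (s : Finset ι) (f : ι → SF n) :
    SF.nrm l (∑ i ∈ s, f i) ≤ ∑ i ∈ s, SF.nrm l (f i) :=
  Finset.le_sum_of_subadditive _ (SF.nrm_zero_right l).le (SF.nrm_add_le l) s f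

lemma SF.nrm_zero_left (f : SF n) : SF.nrm 0 f = ‖SF.cls f‖ := by
  rw [SF.nrm, sobolevNorm_zero_left, toReal_enorm]

lemma SF.nrm_succ_le (l : ℕ) (f : SF n) :
    SF.nrm (l + 1) f ≤ SF.nrm l f + ∑ i, SF.nrm l (SF.D i f) := by
  unfold SF.nrm
  rw [← ENNReal.toReal_sum fun i _ => sobolevNorm_cls_ne_top l _]
  exact ENNReal.toReal_le_add (sobolevNorm_succ_le l f) (sobolevNorm_cls_ne_top l f)
    (ENNReal.sum_ne_top.2 fun i _ => sobolevNorm_cls_ne_top l _)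

lemma SF.nrm_D_le (l : ℕ) (i : RotIdx n) (f : SF n) :
    SF.nrm l (SF.D i f) ≤ sobConst n * SF.nrm (l + 1) f := by
  have hK := one_le_sobConst (n := n)
  unfold SF.nrm
  refine (ENNReal.toReal_mono (ENNReal.mul_ne_top ENNReal.ofReal_ne_top
    (sobolevNorm_cls_ne_top _ f)) (sobolevNorm_D_le l i f)).trans_eq ?_
  rw [ENNReal.toReal_mul, ENNReal.toReal_ofReal (by linarith)]

lemma SF.nrm_le_succ (l : ℕ) (f : SF n) : SF.nrm l f ≤ sobConst n * SF.nrm (l + 1) f := by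
  have hK := one_le_sobConst (n := n)
  unfold SF.nrm
  refine (ENNReal.toReal_mono (ENNReal.mul_ne_top ENNReal.ofReal_ne_top
    (sobolevNorm_cls_ne_top _ f)) (sobolevNorm_le_succ l _)).trans_eq ?_
  rw [ENNReal.toReal_mul, ENNReal.toReal_ofReal (by linarith)]

lemma SF.sum_le_nrm_sq (l : ℕ) (f : SF n) (s : Finset ℕ) :
    ∑ j ∈ s, |eigval n j| ^ l * ‖eigProj n j (SF.cls f)‖ ^ 2 ≤ SF.nrm l f ^ 2 := by
  have h : ENNReal.ofReal (∑ j ∈ s, |eigval n j| ^ l * ‖eigProj n j (SF.cls f)‖ ^ 2) ≤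
      ENNReal.ofReal (SF.nrm l f ^ 2) := by
    rw [ENNReal.ofReal_pow (SF.nrm_nonneg l f), SF.ofReal_nrm, sobolevNorm_sq,
      ENNReal.ofReal_sum_of_nonneg fun _ _ => by positivity]
    exact ENNReal.sum_le_tsum s
  exact (ENNReal.ofReal_le_ofReal_iff (by positivity)).1 h

lemma SF.norm_cls_mul_le {f g : SF n} {S : ℝ} (hS : ∀ x, x ≠ 0 → |f x| ≤ S) :
    ‖SF.cls (f * g)‖ ≤ S * ‖SF.cls g‖ := by
  refine Lp.norm_le_mul_norm_of_ae_le_mul ?_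
  filter_upwards [(f * g).coeFn_cls, g.coeFn_cls, ae_ne_zero] with x h1 h2 hx
  rw [h1, h2, SF.mul_apply, norm_mul]
  exact mul_le_mul_of_nonneg_right (hS x hx) (norm_nonneg _)

end Sobolev

/-! ### Dyadic decomposition and product estimates -/

section Products

variable {n : ℕ} [NeZero n]

lemma sum_proj_eq {J : ℕ} {f : SF n} (hf : f ∈ pol n J) {s : Finset ℕ} (hs : ∀ j ≤ J, j ∈ s) :
    ∑ j ∈ s, SF.proj j (SF.cls f) = f := by
  have h : pol n J ≤ LinearMap.ker ((∑ j ∈ s, SF.proj j ∘ₗ SF.cls) - LinearMap.id) := by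
    refine (pol_le_iSup_harm J).trans (iSup₂_le fun i hi g hg => ?_)
    rw [LinearMap.mem_ker, LinearMap.sub_apply, sub_eq_zero, LinearMap.sum_apply,
      Finset.sum_eq_single i]
    · refine SF.cls_injective ?_
      rw [LinearMap.comp_apply, SF.cls_proj, eigProj_eq_self (cls_mem_eigenspaceE hg)]
      rfl
    · intro j _ hj
      refine SF.cls_injective ?_
      rw [LinearMap.comp_apply, SF.cls_proj, eigProj_of_ne hj.symm (cls_mem_eigenspaceE hg),
        map_zero]
    · exact fun h => absurd (hs i hi) h
  have := h hf
  rw [LinearMap.mem_ker, LinearMap.sub_apply, sub_eq_zero, LinearMap.sum_apply] at this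
  exact this

/-- The dyadic block of frequencies `2^q ≤ j + 1 < 2^(q+1)`. -/
def SF.blk (q : ℕ) (f : SF n) : SF n :=
  ∑ j ∈ Finset.Ico (2 ^ q - 1) (2 ^ (q + 1) - 1), SF.proj j (SF.cls f)

lemma sum_blk (Q : ℕ) (f : SF n) :
    ∑ q ∈ Finset.range Q, SF.blk q f = ∑ j ∈ Finset.range (2 ^ Q - 1), SF.proj j (SF.cls f) := by
  induction Q with
  | zero => simp
  | succ Q ih =>
    rw [Finset.sum_range_succ, ih, SF.blk, Finset.range_eq_Ico, Finset.range_eq_Ico,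
      Finset.sum_Ico_consecutive _ (Nat.zero_le _)]
    exact Nat.sub_le_sub_right (Nat.pow_le_pow_right (by norm_num) (Nat.le_succ _)) 1

lemma exists_sum_blk_eq {f : SF n} (hf : f ∈ polAlg n) :
    ∃ Q, ∑ q ∈ Finset.range Q, SF.blk q f = f := by
  obtain ⟨J, hJ⟩ := hf
  refine ⟨J + 1, ?_⟩
  rw [sum_blk]
  refine sum_proj_eq hJ fun j hj => Finset.mem_range.2 ?_
  have : J + 1 < 2 ^ (J + 1) := Nat.lt_two_pow_self
  omega

lemma blk_mem_pol (q : ℕ) (f : SF n) : SF.blk q f ∈ pol n (2 ^ (q + 1)) := by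
  refine Submodule.sum_mem _ fun j hj => pol_mono ?_ (mem_harm.1 (SF.proj_mem j _)).1
  have := (Finset.mem_Ico.1 hj).2
  omega

lemma norm_cls_blk_sq (q : ℕ) (f : SF n) : ‖SF.cls (SF.blk q f)‖ ^ 2 =
    ∑ j ∈ Finset.Ico (2 ^ q - 1) (2 ^ (q + 1) - 1), ‖eigProj n j (SF.cls f)‖ ^ 2 := by
  set s := Finset.Ico (2 ^ q - 1) (2 ^ (q + 1) - 1)
  rw [SF.blk, map_sum, ← real_inner_self_eq_norm_sq, sum_inner]
  refine Finset.sum_congr rfl fun j hj => ?_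
  rw [inner_sum, Finset.sum_eq_single j, SF.cls_proj, real_inner_self_eq_norm_sq]
  · intro i _ hi
    exact inner_harm hi.symm (SF.proj_mem _ _) (SF.proj_mem _ _)
  · exact fun h => absurd hj h

/-- The dyadic ratio `2^(-1/4)`. -/
def dyadicRatio : ℝ := Real.sqrt (Real.sqrt (1 / 2))

lemma dyadicRatio_pos : 0 < dyadicRatio := Real.sqrt_pos.2 (Real.sqrt_pos.2 (by norm_num))

lemma dyadicRatio_pow_four : dyadicRatio ^ 4 = 1 / 2 := by
  rw [show (4 : ℕ) = 2 * 2 by rfl, pow_mul, dyadicRatio, Real.sq_sqrt (Real.sqrt_nonneg _),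
    Real.sq_sqrt (by norm_num)]

lemma dyadicRatio_lt_one : dyadicRatio < 1 := by
  by_contra! h
  have := one_le_pow₀ h (n := 4)
  rw [dyadicRatio_pow_four] at this
  norm_num at this

lemma sum_dyadicRatio_le (Q : ℕ) :
    ∑ q ∈ Finset.range Q, dyadicRatio ^ q ≤ (1 - dyadicRatio)⁻¹ := by
  rw [← tsum_geometric_of_lt_one dyadicRatio_pos.le dyadicRatio_lt_one]
  exact (summable_geometric_of_lt_one dyadicRatio_pos.le dyadicRatio_lt_one).sum_le_tsum _
    fun _ _ => pow_nonneg dyadicRatio_pos.le _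

/-- On the block q one has |λ_j| ≥ c 4^q, so a norm of order l yields the factor 2^{-lq}, written as
the power 4lq of `dyadicRatio`. The fourth root of 1/2 keeps exponents natural when the
half-integral power 2^{-nq/2}, the power 2nq of the ratio, is compared with it and something is left
over for summation. -/
lemma norm_cls_blk_le (l q : ℕ) (f : SF n) :
    ‖SF.cls (SF.blk q f)‖ ≤ sobConst n ^ l * dyadicRatio ^ (4 * l * q) * SF.nrm l f := by
  have hK := one_le_sobConst (n := n)
  have hρ := dyadicRatio_pos
  have h1 : ((2 : ℝ) ^ q) ^ (2 * l) * ‖SF.cls (SF.blk q f)‖ ^ 2 ≤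
      (sobConst n ^ l * SF.nrm l f) ^ 2 := by
    rw [norm_cls_blk_sq, Finset.mul_sum, mul_pow]
    have h2 := mul_le_mul_of_nonneg_left
      (SF.sum_le_nrm_sq l f (Finset.Ico (2 ^ q - 1) (2 ^ (q + 1) - 1)))
      (by positivity : 0 ≤ (sobConst n ^ l) ^ 2)
    refine le_trans ?_ h2
    rw [Finset.mul_sum]
    refine Finset.sum_le_sum fun j hj => ?_
    rw [← mul_assoc]
    refine mul_le_mul_of_nonneg_right ?_ (by positivity)
    have h3 : (2 : ℝ) ^ q ≤ j + 1 := by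
      have := (Finset.mem_Ico.1 hj).1
      exact_mod_cast (by omega : 2 ^ q ≤ j + 1)
    have h4 := sq_le_abs_eigval (n := n) j
    rw [pow_mul, ← pow_mul (sobConst n) l 2, mul_comm l 2, pow_mul (sobConst n), ← mul_pow]
    refine pow_le_pow_left₀ (by positivity) ?_ l
    calc ((2 : ℝ) ^ q) ^ 2 ≤ (j + 1) ^ 2 := by gcongr
      _ ≤ 9 * n * |eigval n j| := h4
      _ ≤ _ := mul_le_mul_of_nonneg_right (nine_mul_le_sobConst.trans
          (le_self_pow₀ hK two_ne_zero)) (abs_nonneg _)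
  have h5 : ((2 : ℝ) ^ q) ^ l * ‖SF.cls (SF.blk q f)‖ ≤ sobConst n ^ l * SF.nrm l f := by
    refine le_of_sq_le_sq ?_ (mul_nonneg (by positivity) (SF.nrm_nonneg _ _))
    rw [mul_pow, ← pow_mul _ l 2, mul_comm l 2]
    exact h1
  have h6 : dyadicRatio ^ (4 * l * q) * ((2 : ℝ) ^ q) ^ l = 1 := by
    rw [mul_assoc, pow_mul, dyadicRatio_pow_four, mul_comm l q, ← pow_mul, ← mul_pow]
    norm_num
  calc ‖SF.cls (SF.blk q f)‖
      = dyadicRatio ^ (4 * l * q) * (((2 : ℝ) ^ q) ^ l * ‖SF.cls (SF.blk q f)‖) := by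
        rw [← mul_assoc, h6, one_mul]
    _ ≤ dyadicRatio ^ (4 * l * q) * (sobConst n ^ l * SF.nrm l f) := by gcongr
    _ = _ := by ring

/-- Nikolskii's inequality on one block: sup ≤ C 2^{nq/2} ‖·‖, with the growing factor moved to the
left-hand side as a decaying one. -/
lemma exists_blk_sup : ∃ C : ℝ, 0 < C ∧ ∀ (q : ℕ) (f : SF n) (x : Amb n), x ≠ 0 →
    dyadicRatio ^ (2 * n * q) * |SF.blk q f x| ≤ C * ‖SF.cls (SF.blk q f)‖ := by
  obtain ⟨C, hC, h⟩ := exists_abs_le_of_mem_pol (n := n)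
  have hρ := dyadicRatio_pos
  refine ⟨Real.sqrt (C * 4 ^ n), by positivity, fun q f x hx => ?_⟩
  refine le_of_sq_le_sq ?_ (by positivity)
  rw [mul_pow, mul_pow, Real.sq_sqrt (by positivity), sq_abs]
  have h1 := h _ _ (blk_mem_pol q f) x hx
  have h2 : ((2 ^ (q + 1) : ℕ) : ℝ) + 1 ≤ 4 * 2 ^ q := by
    push_cast
    rw [pow_succ]
    have := one_le_pow₀ (one_le_two (α := ℝ)) (n := q)
    linarith
  have h3 : (dyadicRatio ^ (2 * n * q)) ^ 2 * (2 ^ q) ^ n = 1 := by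
    rw [← pow_mul, show 2 * n * q * 2 = 4 * (n * q) by ring, pow_mul, dyadicRatio_pow_four,
      mul_comm n q, ← pow_mul, ← mul_pow]
    norm_num
  calc (dyadicRatio ^ (2 * n * q)) ^ 2 * (SF.blk q f x) ^ 2
      ≤ (dyadicRatio ^ (2 * n * q)) ^ 2 * (C * (4 * 2 ^ q) ^ n * ‖SF.cls (SF.blk q f)‖ ^ 2) := by
        refine mul_le_mul_of_nonneg_left (h1.trans ?_) (by positivity)
        gcongr
    _ = (dyadicRatio ^ (2 * n * q)) ^ 2 * (2 ^ q) ^ n *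
          (C * 4 ^ n * ‖SF.cls (SF.blk q f)‖ ^ 2) := by rw [mul_pow]; ring
    _ = _ := by rw [h3, one_mul]

/-- The Sobolev embedding into bounded functions, for polynomials. -/
lemma exists_sup_le {m : ℕ} (hm : n + 1 ≤ 2 * m) : ∃ C : ℝ, 0 < C ∧ ∀ f ∈ polAlg n,
    ∀ x, x ≠ 0 → |f x| ≤ C * SF.nrm m f := by
  obtain ⟨C, hC, h⟩ := exists_blk_sup (n := n)
  have hK := one_le_sobConst (n := n)
  have hρ := dyadicRatio_pos
  have hρ1 := dyadicRatio_lt_one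
  have hρ2 : 0 < 1 - dyadicRatio := by linarith
  refine ⟨C * sobConst n ^ m * (1 - dyadicRatio)⁻¹, by positivity, fun f hf x hx => ?_⟩
  obtain ⟨Q, hQ⟩ := exists_sum_blk_eq hf
  have hN := SF.nrm_nonneg m f
  have key : ∀ q, |SF.blk q f x| ≤ C * sobConst n ^ m * SF.nrm m f * dyadicRatio ^ q := by
    intro q
    have h1 := (h q f x hx).trans (mul_le_mul_of_nonneg_left (norm_cls_blk_le m q f) hC.le)
    -- Since 4m ≥ 2n + 2, the decay of order m beats the loss n/2 of the sup bound and leaves a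
    -- summable geometric factor.
    have h2 : dyadicRatio ^ (4 * m * q) ≤ dyadicRatio ^ (2 * n * q) * dyadicRatio ^ q := by
      rw [← pow_add]
      refine pow_le_pow_of_le_one hρ.le hρ1.le ?_
      nlinarith
    have h3 : dyadicRatio ^ (2 * n * q) * |SF.blk q f x| ≤
        dyadicRatio ^ (2 * n * q) * (C * sobConst n ^ m * SF.nrm m f * dyadicRatio ^ q) := by
      calc _ ≤ C * (sobConst n ^ m * (dyadicRatio ^ (2 * n * q) * dyadicRatio ^ q) *
            SF.nrm m f) := h1.trans (by gcongr)
        _ = _ := by ring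
    exact le_of_mul_le_mul_left h3 (by positivity)
  calc |f x| = |∑ q ∈ Finset.range Q, SF.blk q f x| := by
        conv_lhs => rw [← hQ]
        rw [SF.sum_apply]
    _ ≤ ∑ q ∈ Finset.range Q, |SF.blk q f x| := Finset.abs_sum_le_sum_abs _ _
    _ ≤ ∑ q ∈ Finset.range Q, C * sobConst n ^ m * SF.nrm m f * dyadicRatio ^ q :=
        Finset.sum_le_sum fun q _ => key q
    _ ≤ C * sobConst n ^ m * SF.nrm m f * (1 - dyadicRatio)⁻¹ := by
        rw [← Finset.mul_sum]
        gcongr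
        exact sum_dyadicRatio_le Q
    _ = _ := by ring

/-- Decompose both factors dyadically and estimate each pair of blocks with the sup norm on the
block of lower frequency and the L² norm on the other. The double sum then converges as a product of
two geometric series. -/
lemma exists_norm_cls_mul_le_of_pos {a b : ℕ} (ha : 0 < a) (hb : 0 < b)
    (hm : n + 1 ≤ 2 * (a + b)) :
    ∃ C : ℝ, 0 < C ∧ ∀ f ∈ polAlg n, ∀ g ∈ polAlg n,
      ‖SF.cls (f * g)‖ ≤ C * SF.nrm a f * SF.nrm b g := by
  obtain ⟨C, hC, h⟩ := exists_blk_sup (n := n)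
  have hK := one_le_sobConst (n := n)
  have hρ := dyadicRatio_pos
  have hρ1 := dyadicRatio_lt_one
  have hρ2 : 0 < 1 - dyadicRatio := by linarith
  have key : ∀ {a b : ℕ}, 0 < b → n + 1 ≤ 2 * (a + b) → ∀ p q, p ≤ q → ∀ f g : SF n,
      ‖SF.cls (SF.blk p f * SF.blk q g)‖ ≤
        C * sobConst n ^ (a + b) * SF.nrm a f * SF.nrm b g *
          (dyadicRatio ^ p * dyadicRatio ^ q) := by
    intro a b hb hm p q hpq f g
    have hNf := SF.nrm_nonneg a f
    have hNg := SF.nrm_nonneg b g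
    have h1 : dyadicRatio ^ (2 * n * p) * ‖SF.cls (SF.blk p f * SF.blk q g)‖ ≤
        C * ‖SF.cls (SF.blk p f)‖ * ‖SF.cls (SF.blk q g)‖ := by
      have h2 : ∀ x, x ≠ 0 → |SF.blk p f x| ≤
          (dyadicRatio ^ (2 * n * p))⁻¹ * (C * ‖SF.cls (SF.blk p f)‖) := fun x hx => by
        rw [le_inv_mul_iff₀ (by positivity)]
        exact h p f x hx
      have h3 := SF.norm_cls_mul_le (g := SF.blk q g) h2
      rwa [mul_assoc, le_inv_mul_iff₀ (by positivity)] at h3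
    have h4 : dyadicRatio ^ (4 * a * p) * dyadicRatio ^ (4 * b * q) ≤
        dyadicRatio ^ (2 * n * p) * (dyadicRatio ^ p * dyadicRatio ^ q) := by
      rw [← pow_add, ← pow_add, ← pow_add]
      refine pow_le_pow_of_le_one hρ.le hρ1.le ?_
      -- With q = p + d the left exponent is 4(a+b)p + 4bd. The hypothesis on a + b pays for 2np +
      -- 2p, and b > 0 pays for d.
      obtain ⟨d, rfl⟩ := Nat.exists_eq_add_of_le hpq
      nlinarith [Nat.mul_le_mul_right p hm, Nat.mul_le_mul_right d hb]
    have h5 : dyadicRatio ^ (2 * n * p) * ‖SF.cls (SF.blk p f * SF.blk q g)‖ ≤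
        dyadicRatio ^ (2 * n * p) * (C * sobConst n ^ (a + b) * SF.nrm a f * SF.nrm b g *
          (dyadicRatio ^ p * dyadicRatio ^ q)) := by
      calc _ ≤ _ := h1
        _ ≤ C * (sobConst n ^ a * dyadicRatio ^ (4 * a * p) * SF.nrm a f) *
            (sobConst n ^ b * dyadicRatio ^ (4 * b * q) * SF.nrm b g) := by
          gcongr
          · exact norm_cls_blk_le a p f
          · exact norm_cls_blk_le b q g
        _ = C * sobConst n ^ (a + b) * SF.nrm a f * SF.nrm b g *
            (dyadicRatio ^ (4 * a * p) * dyadicRatio ^ (4 * b * q)) := by rw [pow_add]; ring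
        _ ≤ C * sobConst n ^ (a + b) * SF.nrm a f * SF.nrm b g *
            (dyadicRatio ^ (2 * n * p) * (dyadicRatio ^ p * dyadicRatio ^ q)) := by gcongr
        _ = _ := by ring
    exact le_of_mul_le_mul_left h5 (by positivity)
  refine ⟨C * sobConst n ^ (a + b) * ((1 - dyadicRatio)⁻¹ * (1 - dyadicRatio)⁻¹), by positivity,
    fun f hf g hg => ?_⟩
  have hNf := SF.nrm_nonneg a f
  have hNg := SF.nrm_nonneg b g
  have key' : ∀ p q, ‖SF.cls (SF.blk p f * SF.blk q g)‖ ≤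
        C * sobConst n ^ (a + b) * SF.nrm a f * SF.nrm b g *
          (dyadicRatio ^ p * dyadicRatio ^ q) := by
    intro p q
    rcases le_total p q with hpq | hpq
    · exact key hb hm p q hpq f g
    · have := key ha (by omega : n + 1 ≤ 2 * (b + a)) q p hpq g f
      rw [mul_comm (SF.blk p f)]
      refine this.trans_eq ?_
      rw [add_comm b a]
      ring
  obtain ⟨P, hP⟩ := exists_sum_blk_eq hf
  obtain ⟨Q, hQ⟩ := exists_sum_blk_eq hg
  calc ‖SF.cls (f * g)‖
      = ‖∑ p ∈ Finset.range P, ∑ q ∈ Finset.range Q, SF.cls (SF.blk p f * SF.blk q g)‖ := by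
        conv_lhs => rw [← hP, ← hQ, Finset.sum_mul_sum]
        simp only [map_sum]
    _ ≤ ∑ p ∈ Finset.range P, ∑ q ∈ Finset.range Q,
          C * sobConst n ^ (a + b) * SF.nrm a f * SF.nrm b g *
          (dyadicRatio ^ p * dyadicRatio ^ q) :=
        norm_sum_le_of_le _ fun p _ => norm_sum_le_of_le _ fun q _ => key' p q
    _ = C * sobConst n ^ (a + b) * SF.nrm a f * SF.nrm b g *
          ((∑ p ∈ Finset.range P, dyadicRatio ^ p) * ∑ q ∈ Finset.range Q, dyadicRatio ^ q) := by
        rw [Finset.sum_mul_sum, Finset.mul_sum]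
        exact Finset.sum_congr rfl fun p _ => by rw [Finset.mul_sum]
    _ ≤ C * sobConst n ^ (a + b) * SF.nrm a f * SF.nrm b g *
          ((1 - dyadicRatio)⁻¹ * (1 - dyadicRatio)⁻¹) := by
        have := Finset.sum_nonneg fun q (_ : q ∈ Finset.range Q) => pow_nonneg hρ.le q
        gcongr <;> exact sum_dyadicRatio_le _
    _ = _ := by ring

/-- If one order is zero, its blocks provide no decay and the dyadic sum cannot be used; but then
the other factor has more than n/2 derivatives and is bounded. -/
lemma exists_norm_cls_mul_le {a b : ℕ} (hm : n + 1 ≤ 2 * (a + b)) :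
    ∃ C : ℝ, 0 < C ∧ ∀ f ∈ polAlg n, ∀ g ∈ polAlg n,
      ‖SF.cls (f * g)‖ ≤ C * SF.nrm a f * SF.nrm b g := by
  rcases Nat.eq_zero_or_pos a with rfl | ha
  · obtain ⟨C, hC, h⟩ := exists_sup_le (n := n) (m := b) (by omega)
    refine ⟨C, hC, fun f hf g hg => ?_⟩
    rw [mul_comm f g, SF.nrm_zero_left]
    exact (SF.norm_cls_mul_le (h g hg)).trans_eq (by ring)
  rcases Nat.eq_zero_or_pos b with rfl | hb
  · obtain ⟨C, hC, h⟩ := exists_sup_le (n := n) (m := a) (by omega)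
    refine ⟨C, hC, fun f hf g hg => ?_⟩
    rw [SF.nrm_zero_left]
    exact SF.norm_cls_mul_le (h f hf)
  exact exists_norm_cls_mul_le_of_pos ha hb hm

lemma D_mem_polAlg (i : RotIdx n) {f : SF n} (hf : f ∈ polAlg n) : SF.D i f ∈ polAlg n := by
  obtain ⟨j, hj⟩ := hf
  exact ⟨j, D_mem_pol i hj⟩

/-- Products in Sobolev spaces above the critical exponent. -/
lemma exists_nrm_mul_le {m : ℕ} (hm : n + 1 ≤ 2 * m) (c : ℕ) : ∀ a b : ℕ, a + b + c = m →
    ∃ C : ℝ, 0 < C ∧ ∀ f ∈ polAlg n, ∀ g ∈ polAlg n,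
      SF.nrm c (f * g) ≤ C * SF.nrm (m - a) f * SF.nrm (m - b) g := by
  have hK := one_le_sobConst (n := n)
  induction c with
  | zero =>
    intro a b hab
    -- Here a + b = m, so the orders m - a and m - b of the two factors add up to m, which exceeds
    -- n/2.
    obtain ⟨C, hC, h⟩ := exists_norm_cls_mul_le (n := n) (a := m - a) (b := m - b) (by omega)
    exact ⟨C, hC, fun f hf g hg => by rw [SF.nrm_zero_left]; exact h f hf g hg⟩
  | succ c ih =>
    intro a b hab
    -- By Leibniz' rule one derivative of the product falls on one of the factors, which raises a or
    -- b by one and lowers c by one; the sum a + b + c is preserved.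
    obtain ⟨C₁, hC₁, h₁⟩ := ih (a + 1) b (by omega)
    obtain ⟨C₂, hC₂, h₂⟩ := ih a (b + 1) (by omega)
    refine ⟨sobConst n * C₁ + Fintype.card (RotIdx n) * (sobConst n * C₁ + sobConst n * C₂),
      by positivity, fun f hf g hg => ?_⟩
    set F := SF.nrm (m - a) f
    set G := SF.nrm (m - b) g
    have hF : 0 ≤ F := SF.nrm_nonneg _ _
    have hG : 0 ≤ G := SF.nrm_nonneg _ _
    have e1 : m - (a + 1) + 1 = m - a := by omega
    have e2 : m - (b + 1) + 1 = m - b := by omega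
    have i1 : SF.nrm (m - (a + 1)) f ≤ sobConst n * F := by
      have := SF.nrm_le_succ (m - (a + 1)) f
      rwa [e1] at this
    have i2 : ∀ i, SF.nrm (m - (a + 1)) (SF.D i f) ≤ sobConst n * F := fun i => by
      have := SF.nrm_D_le (m - (a + 1)) i f
      rwa [e1] at this
    have i3 : ∀ i, SF.nrm (m - (b + 1)) (SF.D i g) ≤ sobConst n * G := fun i => by
      have := SF.nrm_D_le (m - (b + 1)) i g
      rwa [e2] at this
    have j1 : SF.nrm c (f * g) ≤ sobConst n * C₁ * (F * G) :=
      (h₁ f hf g hg).trans (by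
        calc _ ≤ C₁ * (sobConst n * F) * G := by gcongr
          _ = _ := by ring)
    have j2 : ∀ i, SF.nrm c (SF.D i (f * g)) ≤
        (sobConst n * C₁ + sobConst n * C₂) * (F * G) := fun i => by
      rw [SF.D_mul]
      refine (SF.nrm_add_le _ _ _).trans ?_
      have k1 := h₁ _ (D_mem_polAlg i hf) g hg
      have k2 := h₂ f hf _ (D_mem_polAlg i hg)
      calc _ ≤ C₁ * (sobConst n * F) * G + C₂ * F * (sobConst n * G) := by
            refine add_le_add (k1.trans ?_) (k2.trans ?_)
            · gcongr; exact i2 i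
            · gcongr; exact i3 i
        _ = _ := by ring
    calc SF.nrm (c + 1) (f * g) ≤ SF.nrm c (f * g) + ∑ i, SF.nrm c (SF.D i (f * g)) :=
          SF.nrm_succ_le _ _
      _ ≤ sobConst n * C₁ * (F * G) +
          ∑ _i : RotIdx n, (sobConst n * C₁ + sobConst n * C₂) * (F * G) :=
          add_le_add j1 (Finset.sum_le_sum fun i _ => j2 i)
      _ = _ := by
          rw [Finset.sum_const, Finset.card_univ, nsmul_eq_mul]; ring

/-- Multiplication by a smooth function of bounded elements of `H^m`. -/
lemma exists_nrm_comp_mul_le {m : ℕ} (hm : n + 1 ≤ 2 * m) {ι : Type} [Fintype ι] [DecidableEq ι]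
    (M : ℝ) {c : ℕ} (hc : c ≤ m) : ∀ (G : (ι → ℝ) → ℝ) (hG : ContDiff ℝ ∞ G),
    ∃ C : ℝ, 0 < C ∧ ∀ Φ : ι → SF n, (∀ j, Φ j ∈ polAlg n ∧ SF.nrm m (Φ j) ≤ M) →
      ∀ f ∈ polAlg n, SF.nrm c (SF.comp G hG Φ * f) ≤ C * SF.nrm c f := by
  have hK := one_le_sobConst (n := n)
  induction c with
  | zero =>
    intro G hG
    obtain ⟨S, hS, hsup⟩ := exists_sup_le (n := n) hm
    -- The sup embedding confines the values of Φ to a fixed ball, on which G is bounded.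
    obtain ⟨C, hC⟩ := (isCompact_closedBall (0 : ι → ℝ) (S * |M|)).exists_bound_of_continuousOn
      hG.continuous.continuousOn
    refine ⟨max C 1, by positivity, fun Φ hΦ f hf => ?_⟩
    rw [SF.nrm_zero_left, SF.nrm_zero_left]
    refine SF.norm_cls_mul_le fun x hx => (hC _ ?_).trans (le_max_left _ _)
    rw [mem_closedBall_zero_iff, pi_norm_le_iff_of_nonneg (by positivity)]
    intro j
    refine (hsup _ (hΦ j).1 x hx).trans ?_
    gcongr
    exact (hΦ j).2.trans (le_abs_self M)
  | succ c ih =>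
    intro G hG
    obtain ⟨C₀, hC₀, h₀⟩ := ih (by omega) G hG
    -- A derivative of G(Φ) f is ∑ ∂_jG(Φ) · (DΦ_j f) + G(Φ) · Df. The induction hypothesis must
    -- therefore hold for all smooth G, in particular for the ∂_jG.
    choose C₁ hC₁ h₁ using fun j => ih (by omega) (pder j G) (contDiff_pder j hG)
    -- The product DΦ_j · f is estimated from the orders m - 1 and c + 1 into order c, the case a =
    -- 1, b = m - c - 1 of the product estimate.
    obtain ⟨C₂, hC₂, h₂⟩ := exists_nrm_mul_le (n := n) hm c 1 (m - c - 1) (by omega)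
    have hC₁' : 0 ≤ ∑ j, C₁ j := Finset.sum_nonneg fun j _ => (hC₁ j).le
    refine ⟨C₀ * sobConst n + Fintype.card (RotIdx n) *
      ((∑ j, C₁ j) * (C₂ * (sobConst n * |M|)) + C₀ * sobConst n), by positivity,
      fun Φ hΦ f hf => ?_⟩
    have hF : 0 ≤ SF.nrm (c + 1) f := SF.nrm_nonneg _ _
    have e1 : m - (m - c - 1) = c + 1 := by omega
    have e2 : m - 1 + 1 = m := by omega
    have i1 : ∀ i j, SF.nrm c (SF.comp (pder j G) (contDiff_pder j hG) Φ *
        (SF.D i (Φ j) * f)) ≤ C₁ j * (C₂ * (sobConst n * |M|)) * SF.nrm (c + 1) f := by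
      intro i j
      have hD := D_mem_polAlg i (hΦ j).1
      have k1 := h₁ j Φ hΦ (SF.D i (Φ j) * f) (mul_mem hD hf)
      have k2 := h₂ _ hD f hf
      rw [e1] at k2
      have k3 := SF.nrm_D_le (m - 1) i (Φ j)
      rw [e2] at k3
      have k4 : SF.nrm (m - 1) (SF.D i (Φ j)) ≤ sobConst n * |M| :=
        k3.trans (by gcongr; exact (hΦ j).2.trans (le_abs_self M))
      have hpos := (hC₁ j).le
      calc _ ≤ _ := k1
        _ ≤ C₁ j * (C₂ * (sobConst n * |M|) * SF.nrm (c + 1) f) := by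
            gcongr
            exact k2.trans (by gcongr)
        _ = _ := by ring
    have i2 : ∀ i, SF.nrm c (SF.D i (SF.comp G hG Φ * f)) ≤
        ((∑ j, C₁ j) * (C₂ * (sobConst n * |M|)) + C₀ * sobConst n) * SF.nrm (c + 1) f := by
      intro i
      have e3 : SF.D i (SF.comp G hG Φ * f) =
          (∑ j, SF.comp (pder j G) (contDiff_pder j hG) Φ * (SF.D i (Φ j) * f)) +
            SF.comp G hG Φ * SF.D i f := by
        rw [SF.D_mul, SF.D_comp, Finset.sum_mul]
        simp_rw [mul_assoc]
      rw [e3]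
      refine (SF.nrm_add_le _ _ _).trans ?_
      rw [add_mul, Finset.sum_mul, Finset.sum_mul]
      refine add_le_add ((SF.nrm_sum_le _ _ _).trans (Finset.sum_le_sum fun j _ => i1 i j)) ?_
      refine (h₀ Φ hΦ _ (D_mem_polAlg i hf)).trans ?_
      rw [mul_assoc]
      gcongr
      exact SF.nrm_D_le c i f
    calc _ ≤ SF.nrm c (SF.comp G hG Φ * f) + ∑ i, SF.nrm c (SF.D i (SF.comp G hG Φ * f)) :=
          SF.nrm_succ_le _ _
      _ ≤ C₀ * (sobConst n * SF.nrm (c + 1) f) + ∑ _i : RotIdx n,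
          ((∑ j, C₁ j) * (C₂ * (sobConst n * |M|)) + C₀ * sobConst n) * SF.nrm (c + 1) f := by
          refine add_le_add ((h₀ Φ hΦ f hf).trans ?_) (Finset.sum_le_sum fun i _ => i2 i)
          gcongr
          exact SF.nrm_le_succ c f
      _ = _ := by
          rw [Finset.sum_const, Finset.card_univ, nsmul_eq_mul]; ring

end Products

/-! ### Smooth dependence of integrals on parameters and the Hadamard lemma -/

section Hadamard

/-- Induction on the order by differentiation under the integral sign. The target V is quantified
inside the induction because the derivative takes values in `E →L[ℝ] V`. -/
lemma contDiff_nat_intervalIntegral {E : Type} [NormedAddCommGroup E] [NormedSpace ℝ E]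
    [FiniteDimensional ℝ E] (k : ℕ) : ∀ {V : Type} [NormedAddCommGroup V] [NormedSpace ℝ V]
    [CompleteSpace V] (F : E → ℝ → V), ContDiff ℝ k (Function.uncurry F) →
    ContDiff ℝ k (fun x => ∫ t in (0 : ℝ)..1, F x t) := by
  have : ProperSpace E := FiniteDimensional.proper ℝ E
  induction k with
  | zero =>
    intro V _ _ _ F hF
    rw [Nat.cast_zero, contDiff_zero] at hF ⊢
    exact intervalIntegral.continuous_parametric_intervalIntegral_of_continuous' hF 0 1
  | succ k ih =>
    intro V _ _ _ F hF
    have hF1 : ContDiff ℝ k (fderiv ℝ (Function.uncurry F)) :=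
      hF.fderiv_right (by push_cast; rfl)
    set F' : E → ℝ → E →L[ℝ] V := fun x t =>
      (fderiv ℝ (Function.uncurry F) (x, t)).comp (ContinuousLinearMap.inl ℝ E ℝ) with hF'
    have hF'c : ContDiff ℝ k (Function.uncurry F') :=
      hF1.clm_comp contDiff_const
    have hd : ∀ x t, HasFDerivAt (fun x => F x t) (F' x t) x := fun x t => by
      have h1 : HasFDerivAt (Function.uncurry F) _ (x, t) :=
        (hF.differentiable (by simp) (x, t)).hasFDerivAt
      exact HasFDerivAt.comp (f := fun e : E => (e, t)) x h1 (hasFDerivAt_prodMk_left x t)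
    refine contDiff_succ_iff_hasFDerivAt.2 ⟨fun x => ∫ t in (0 : ℝ)..1, F' x t, ih F' hF'c, ?_⟩
    intro x₀
    obtain ⟨C, hC⟩ := ((isCompact_closedBall x₀ 1).prod
      (isCompact_Icc (a := (0 : ℝ)) (b := 1))).exists_bound_of_continuousOn
        hF'c.continuous.continuousOn
    refine intervalIntegral.hasFDerivAt_integral_of_dominated_of_fderiv_le (bound := fun _ => C)
      (Metric.closedBall_mem_nhds x₀ one_pos) ?_ ?_ ?_ ?_ ?_ ?_
    · exact Eventually.of_forall fun x =>
        (hF.continuous.comp (Continuous.prodMk_right x)).aestronglyMeasurable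
    · exact (hF.continuous.comp (Continuous.prodMk_right x₀)).intervalIntegrable _ _
    · exact (hF'c.continuous.comp (Continuous.prodMk_right x₀)).aestronglyMeasurable
    · refine Eventually.of_forall fun t ht x hx => hC (x, t) ⟨hx, ?_⟩
      rw [uIoc_of_le zero_le_one] at ht
      exact ⟨ht.1.le, ht.2⟩
    · exact intervalIntegrable_const
    · exact Eventually.of_forall fun t _ x _ => hd x t

lemma contDiff_intervalIntegral {E V : Type} [NormedAddCommGroup E] [NormedSpace ℝ E]
    [FiniteDimensional ℝ E] [NormedAddCommGroup V] [NormedSpace ℝ V] [CompleteSpace V]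
    (F : E → ℝ → V) (hF : ContDiff ℝ ∞ (Function.uncurry F)) :
    ContDiff ℝ ∞ (fun x => ∫ t in (0 : ℝ)..1, F x t) :=
  contDiff_infty.2 fun k => contDiff_nat_intervalIntegral k F (contDiff_infty.1 hF k)

variable {ι : Type} [Fintype ι] [DecidableEq ι]

lemma fderiv_eq_sum_pder (G : (ι → ℝ) → ℝ) (z v : ι → ℝ) :
    fderiv ℝ G z v = ∑ k, v k * pder k G z := by
  conv_lhs => rw [← Finset.univ_sum_single v]
  rw [map_sum]
  refine Finset.sum_congr rfl fun k _ => ?_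
  rw [pder, ← smul_eq_mul, ← map_smul]
  congr 1
  ext j
  by_cases h : j = k
  · subst h; simp
  · simp [h]

/-- H_k is the mean of ∂_k G over the segment from z' to z, as a smooth function of the pair of
endpoints. Its value on the diagonal is needed to see that H_k vanishes at the zero jet when ∂_k G
does. -/
lemma exists_hadamard (G : (ι → ℝ) → ℝ) (hG : ContDiff ℝ ∞ G) :
    ∃ H : ι → (ι ⊕ ι → ℝ) → ℝ, (∀ k, ContDiff ℝ ∞ (H k)) ∧
      (∀ z z', G z - G z' = ∑ k, H k (Sum.elim z z') * (z k - z' k)) ∧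
      ∀ k z, H k (Sum.elim z z) = pder k G z := by
  let c : (ι ⊕ ι → ℝ) → ℝ → ι → ℝ := fun w t i =>
    w (Sum.inr i) + t * (w (Sum.inl i) - w (Sum.inr i))
  have hc : ContDiff ℝ ∞ (Function.uncurry c) := by
    refine contDiff_pi.2 fun i => ?_
    have h1 : ∀ j : ι ⊕ ι, ContDiff ℝ ∞ fun p : (ι ⊕ ι → ℝ) × ℝ => p.1 j := fun j =>
      (contDiff_apply ℝ ℝ j).comp contDiff_fst
    exact (h1 _).add (contDiff_snd.mul ((h1 _).sub (h1 _)))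
  have hH : ∀ k, ContDiff ℝ ∞ (Function.uncurry fun w t => pder k G (c w t)) := fun k =>
    (contDiff_pder k hG).comp hc
  refine ⟨fun k w => ∫ t in (0 : ℝ)..1, pder k G (c w t),
    fun k => contDiff_intervalIntegral _ (hH k), fun z z' => ?_, fun k z => ?_⟩
  · have hd : ∀ t ∈ uIcc (0 : ℝ) 1, HasDerivAt (fun t => G (c (Sum.elim z z') t))
        (∑ k, (z k - z' k) * pder k G (c (Sum.elim z z') t)) t := fun t _ => by
      rw [← fderiv_eq_sum_pder G _ fun k => z k - z' k]
      refine ((hG.differentiable (by simp) _).hasFDerivAt).comp_hasDerivAt t ?_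
      refine hasDerivAt_pi.2 fun i => ?_
      simpa [c] using ((hasDerivAt_id t).mul_const (z i - z' i)).const_add (z' i)
    have hcont : ∀ k, Continuous fun t => pder k G (c (Sum.elim z z') t) := fun k =>
      (hH k).continuous.comp (Continuous.prodMk_right (Sum.elim z z'))
    have h := intervalIntegral.integral_eq_sub_of_hasDerivAt hd
      (Continuous.intervalIntegrable (by fun_prop) _ _)
    have e1 : c (Sum.elim z z') 1 = z := by ext i; simp [c]
    have e0 : c (Sum.elim z z') 0 = z' := by ext i; simp [c]
    rw [e1, e0] at h
    rw [← h, intervalIntegral.integral_finsetSum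
      fun k _ => ((hcont k).const_mul _).intervalIntegrable _ _]
    refine Finset.sum_congr rfl fun k _ => ?_
    rw [intervalIntegral.integral_const_mul, mul_comm]
  · have : ∀ t, c (Sum.elim z z) t = z := fun t => by ext i; simp [c]
    simp [this]

variable {n : ℕ}

lemma SF.comp_apply (G : (ι → ℝ) → ℝ) (hG : ContDiff ℝ ∞ G) (Φ : ι → SF n) (x : Amb n) :
    SF.comp G hG Φ x = G fun j => Φ j x := rfl

lemma SF.exists_comp_sub_comp (G : (ι → ℝ) → ℝ) (hG : ContDiff ℝ ∞ G) :
    ∃ (H : ι → (ι ⊕ ι → ℝ) → ℝ) (hH : ∀ k, ContDiff ℝ ∞ (H k)),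
      (∀ Φ Ψ : ι → SF n, SF.comp G hG Φ - SF.comp G hG Ψ =
        ∑ k, SF.comp (H k) (hH k) (Sum.elim Φ Ψ) * (Φ k - Ψ k)) ∧
      ∀ k z, H k (Sum.elim z z) = pder k G z := by
  obtain ⟨H, hH, h1, h2⟩ := exists_hadamard G hG
  refine ⟨H, hH, fun Φ Ψ => SF.ext_of_ne fun x hx => ?_, h2⟩
  rw [SF.sub_apply, SF.sum_apply, SF.comp_apply, SF.comp_apply, h1]
  refine Finset.sum_congr rfl fun k _ => ?_
  rw [SF.mul_apply, SF.comp_apply, SF.sub_apply]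
  congr 2
  ext j
  cases j <;> rfl

end Hadamard

/-! ### The quasilinear term as a smooth function of jets -/

section Jets

open scoped Manifold in
-- Multiply f by a smooth cut-off that is 1 near K and 0 near the complement of s. The coefficients
-- of N, smooth only near the zero section, become globally smooth in this way.
lemma exists_contDiff_eq_nhdsSet {E V : Type} [NormedAddCommGroup E] [NormedSpace ℝ E]
    [FiniteDimensional ℝ E] [NormedAddCommGroup V] [NormedSpace ℝ V] {s K : Set E} (hs : IsOpen s)
    (hK : IsClosed K) (hKs : K ⊆ s) {f : E → V} (hf : ContDiffOn ℝ ∞ f s) :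
    ∃ g : E → V, ContDiff ℝ ∞ g ∧ ∀ᶠ x in 𝓝ˢ K, g x = f x := by
  obtain ⟨χ, h0, h1, -⟩ := exists_contMDiffMap_zero_one_nhds_of_isClosed (n := ⊤) 𝓘(ℝ, E)
    hs.isClosed_compl hK (disjoint_left.2 fun x hx hxK => hx (hKs hxK))
  refine ⟨fun x => χ x • f x, contDiff_iff_contDiffAt.2 fun x => ?_,
    h1.mono fun x hx => by simp only [hx, one_smul]⟩
  by_cases hx : x ∈ s
  · exact (contMDiff_iff_contDiff.1 χ.contMDiff).contDiffAt.smul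
      (hf.contDiffAt (hs.mem_nhds hx))
  · refine (contDiffAt_const (c := (0 : V))).congr_of_eventuallyEq ?_
    filter_upwards [mem_nhdsSet_iff_forall.1 h0 x hx] with y hy
    rw [show χ y = 0 from hy, zero_smul]

variable (n : ℕ)

/-- The index set for the position and the first jet of a function on the sphere. -/
abbrev JetIdx : Type := Fin (n + 1) ⊕ Option (RotIdx n)

variable {n}

/-- The position, the value and the rotational derivatives of a function at a point. -/
def jet (U : Amb n → ℝ) (y : Amb n) : JetIdx n → ℝ :=
  Sum.elim (fun c => y c) fun o => o.elim (U y) fun i => rotDeriv i U y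

/-- The jet of the zero function. -/
def jetZero (y : Amb n) : JetIdx n → ℝ := Sum.elim (fun c => y c) fun _ => 0

/-- The position of a jet. -/
def jetPos : (JetIdx n → ℝ) →L[ℝ] Amb n :=
  ∑ c, (ContinuousLinearMap.proj (Sum.inl c)).smulRight (EuclideanSpace.single c (1 : ℝ))

lemma jetPos_apply (z : JetIdx n → ℝ) (c : Fin (n + 1)) : jetPos z c = z (Sum.inl c) := by
  simp [jetPos, Pi.single_apply]

lemma jetPos_eq {z : JetIdx n → ℝ} {y : Amb n} (h : ∀ c, z (Sum.inl c) = y c) : jetPos z = y := by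
  ext c; rw [jetPos_apply, h]

/-- The formula for the projection onto the tangent space of the sphere. -/
def tproj (y : Amb n) : Amb n →L[ℝ] Amb n :=
  ContinuousLinearMap.id ℝ _ - (2 * n : ℝ)⁻¹ • (innerSL ℝ y).smulRight y

lemma tproj_apply (y p : Amb n) : tproj y p = p - (2 * n : ℝ)⁻¹ • ⟪y, p⟫_ℝ • y := by
  simp [tproj]

lemma contDiff_tproj : ContDiff ℝ ∞ (tproj : Amb n → Amb n →L[ℝ] Amb n) :=
  contDiff_const.sub (ContDiff.const_smul _ ((innerSL ℝ).contDiff.smulRight contDiff_id))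

/-- The gradient expressed through the rotational derivatives. -/
def jetGrad (z : JetIdx n → ℝ) : Amb n :=
  tproj (jetPos z) (∑ b, ((2 * n : ℝ)⁻¹ * ∑ a, z (Sum.inl a) * z (Sum.inr (some (a, b)))) •
    EuclideanSpace.single b (1 : ℝ))

/-- The arguments of the coefficients of a quasilinear term, as functions of the jet. -/
def jetArg (z : JetIdx n → ℝ) : Amb n × ℝ × Amb n := (jetPos z, z (Sum.inr none), jetGrad z)

lemma contDiff_jetArg : ContDiff ℝ ∞ (jetArg : (JetIdx n → ℝ) → _) := by
  have h : ∀ j : JetIdx n, ContDiff ℝ ∞ fun z : JetIdx n → ℝ => z j := fun j =>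
    contDiff_apply ℝ ℝ j
  refine jetPos.contDiff.prodMk ((h _).prodMk ?_)
  refine (contDiff_tproj.comp jetPos.contDiff).clm_apply (ContDiff.sum fun b _ => ?_)
  exact (contDiff_const.mul (ContDiff.sum fun a _ => (h _).mul (h _))).smul contDiff_const

lemma jetArg_of_zero {z : JetIdx n → ℝ} (h : ∀ k, z (Sum.inr k) = 0) :
    jetArg z = (jetPos z, 0, 0) := by
  simp [jetArg, jetGrad, h]

/-- The matrix with which a second order rotational derivative enters the Hessian. -/
def hessMat (w : RotIdx n × RotIdx n) (y : Amb n) : Amb n →L[ℝ] Amb n :=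
  ((2 * n : ℝ)⁻¹ * y w.2.1 * ((2 * n : ℝ)⁻¹ * y w.1.1)) •
    (EuclideanSpace.proj w.1.2).smulRight (EuclideanSpace.single w.2.2 (1 : ℝ))

lemma contDiff_hessMat (w : RotIdx n × RotIdx n) : ContDiff ℝ ∞ (hessMat w) := by
  have h : ∀ j, ContDiff ℝ ∞ fun y : Amb n => y j := fun j =>
    (EuclideanSpace.proj j : Amb n →L[ℝ] ℝ).contDiff
  exact ((contDiff_const.mul (h _)).mul (contDiff_const.mul (h _))).smul contDiff_const

lemma sum_smul_single (p : Amb n) : ∑ b, p b • EuclideanSpace.single b (1 : ℝ) = p := by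
  ext c
  simp [Finset.sum_apply, Pi.single_apply]

variable [NeZero n]

/-- Both agree because |y|² = 2n on the sphere. Unlike `tangentProj`, the right-hand side is
polynomial in y, hence smooth as a function of the jet. -/
lemma tangentProj_eq {y : Amb n} (hy : y ∈ roundSphere n) : tangentProj y = tproj y := by
  ext1 p
  rw [tangentProj, tproj_apply, Submodule.starProjection_orthogonal_val,
    Submodule.starProjection_singleton, norm_of_mem_roundSphere hy, sphereRadius_sq]
  simp [div_eq_inv_mul, smul_smul]

lemma tproj_self {y : Amb n} (hy : y ∈ roundSphere n) : tproj y y = 0 := by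
  have hn : (n : ℝ) ≠ 0 := by exact_mod_cast NeZero.ne n
  rw [tproj_apply, real_inner_self_eq_norm_sq, norm_of_mem_roundSphere hy, sphereRadius_sq,
    smul_smul, inv_mul_cancel₀ (by positivity), one_smul, sub_self]

lemma inner_tproj {y : Amb n} (hy : y ∈ roundSphere n) (p : Amb n) : ⟪y, tproj y p⟫_ℝ = 0 := by
  have hn : (n : ℝ) ≠ 0 := by exact_mod_cast NeZero.ne n
  rw [tproj_apply, inner_sub_right, real_inner_smul_right, real_inner_smul_right,
    real_inner_self_eq_norm_sq, norm_of_mem_roundSphere hy, sphereRadius_sq]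
  field_simp
  ring

lemma inner_gradient (U : Amb n → ℝ) (x v : Amb n) : ⟪∇ U x, v⟫_ℝ = fderiv ℝ U x v := by
  rw [gradient, InnerProductSpace.toDual_symm_apply]

lemma gradient_apply (U : Amb n → ℝ) (x : Amb n) (b : Fin (n + 1)) :
    ∇ U x b = fderiv ℝ U x (EuclideanSpace.single b 1) := by
  rw [← inner_gradient, real_inner_comm, EuclideanSpace.inner_single_left]
  simp

lemma jetArg_jet {m : WithTop ℕ∞} {U : Amb n → ℝ} (hU : IsSphereFun m U) (hm : 1 ≤ m) {y : Amb n}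
    (hy : y ∈ roundSphere n) : jetArg (jet U y) = (y, U y, ∇ U y) := by
  have hy0 := ne_zero_of_mem_roundSphere hy
  have h1 : jetPos (jet U y) = y := jetPos_eq fun c => rfl
  have h2 : ∑ b, ((2 * n : ℝ)⁻¹ * ∑ a, jet U y (Sum.inl a) * jet U y (Sum.inr (some (a, b)))) •
      EuclideanSpace.single b (1 : ℝ) = ∇ U y := by
    rw [← sum_smul_single (∇ U y)]
    refine Finset.sum_congr rfl fun b _ => ?_
    rw [gradient_apply, hU.fderiv_single hm hy0, norm_of_mem_roundSphere hy, sphereRadius_sq]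
    rfl
  have h3 : ⟪y, ∇ U y⟫_ℝ = 0 := by
    rw [real_inner_comm, inner_gradient, hU.fderiv_self hm hy0]
  rw [jetArg, jetGrad, h2, h1, tproj_apply, h3]
  simp [jet]

lemma IsSphereFun.fderiv_eq_sum {m : WithTop ℕ∞} {U : Amb n → ℝ} (hU : IsSphereFun m U)
    (hm : 1 ≤ m) {y : Amb n} (hy : y ∈ roundSphere n) (v : Amb n) :
    fderiv ℝ U y v = ∑ i : RotIdx n, (2 * n : ℝ)⁻¹ * y i.1 * v i.2 * _root_.rotDeriv i U y := by
  conv_lhs => rw [← sum_smul_single v]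
  rw [map_sum, Fintype.sum_prod_type_right]
  refine Finset.sum_congr rfl fun b _ => ?_
  rw [map_smul, hU.fderiv_single hm (ne_zero_of_mem_roundSphere hy), norm_of_mem_roundSphere hy,
    sphereRadius_sq, smul_eq_mul, Finset.mul_sum, Finset.mul_sum]
  refine Finset.sum_congr rfl fun a _ => ?_
  ring

/-- Euler's identity differentiated in the direction v. -/
lemma IsSphereFun.fderiv_fderiv_apply_self {m : WithTop ℕ∞} {U : Amb n → ℝ}
    (hU : IsSphereFun m U) (hm : 2 ≤ m) {x : Amb n} (hx : x ≠ 0) (v : Amb n) :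
    fderiv ℝ (fderiv ℝ U) x v x = -fderiv ℝ U x v := by
  have h1 : HasFDerivAt (fun y => fderiv ℝ U y y) _ x :=
    (hU.differentiableAt_fderiv hm hx).hasFDerivAt.clm_apply (hasFDerivAt_id x)
  have h2 : HasFDerivAt (fun y => fderiv ℝ U y y) (0 : Amb n →L[ℝ] ℝ) x := by
    refine (hasFDerivAt_const (0 : ℝ) x).congr_of_eventuallyEq ?_
    filter_upwards [isOpen_compl_singleton.mem_nhds hx] with y hy
    exact hU.fderiv_self (le_trans (by norm_num) hm) hy
  have h := congrArg (fun A : Amb n →L[ℝ] ℝ => A v) (h1.unique h2)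
  simp at h
  linarith

/-- Partial derivatives are combinations of rotational derivatives with coefficients depending on
the point. Differentiating this once more in a tangent direction v expresses the derivative of the
gradient through second rotational derivatives, up to a multiple of y, which the outer tangential
projection removes. -/
lemma sphereHessian_eq {U : Amb n → ℝ} (hU : IsSphereFun 2 U) {y : Amb n}
    (hy : y ∈ roundSphere n) :
    sphereHessian U y = ∑ w : RotIdx n × RotIdx n, rotDeriv w.1 (rotDeriv w.2 U) y •
      ((tproj y).comp ((hessMat w y).comp (tproj y))) := by
  have hn : (n : ℝ) ≠ 0 := by exact_mod_cast NeZero.ne n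
  have hy0 := ne_zero_of_mem_roundSphere hy
  have hG : ∀ v, ⟪y, v⟫_ℝ = 0 → fderiv ℝ (fun x => ∇ U x) y v =
      (∑ w : RotIdx n × RotIdx n, rotDeriv w.1 (rotDeriv w.2 U) y • hessMat w y v) -
        ((2 * n : ℝ)⁻¹ * fderiv ℝ U y v) • y := by
    intro v hv
    have hd : ∀ b : Fin (n + 1), HasFDerivAt (fun x => ∇ U x b)
        ((fderiv ℝ (fderiv ℝ U) y).flip (EuclideanSpace.single b 1)) y := fun b => by
      simp_rw [gradient_apply]
      exact ((hU.differentiableAt_fderiv le_rfl hy0).hasFDerivAt.clm_apply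
        (hasFDerivAt_const _ _)).congr_fderiv (by simp)
    have hD : DifferentiableAt ℝ (fun x => ∇ U x) y :=
      differentiableAt_euclidean.2 fun b => (hd b).differentiableAt
    ext b
    have e2 : (fderiv ℝ (fun x => ∇ U x) y v) b =
        fderiv ℝ (fderiv ℝ U) y v (EuclideanSpace.single b 1) :=
      congrArg (fun A : Amb n →L[ℝ] ℝ => A v)
        (((EuclideanSpace.proj b : Amb n →L[ℝ] ℝ).hasFDerivAt.comp y hD.hasFDerivAt).unique (hd b))
    have e3 : ∑ a, y a * fderiv ℝ (rotDeriv (a, b) U) y v =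
        2 * n * fderiv ℝ (fderiv ℝ U) y v (EuclideanSpace.single b 1) + y b * fderiv ℝ U y v := by
      have h1 : ∑ a, y a • rotGen (a, b) v = -(v b) • y := by
        simp_rw [rotGen_apply, smul_sub, smul_smul]
        rw [Finset.sum_sub_distrib, ← Finset.sum_smul]
        have : ∑ a, y a * v a = 0 := by
          rw [← hv, PiLp.inner_apply]
          exact Finset.sum_congr rfl fun a _ => by simp [mul_comm]
        rw [this, zero_smul, zero_sub, neg_smul]
        conv_rhs => rw [← sum_smul_single y, Finset.smul_sum]
        simp_rw [smul_smul, mul_comm]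
      have h2 : ∀ a, y a * fderiv ℝ (rotDeriv (a, b) U) y v =
          fderiv ℝ (fderiv ℝ U) y v (y a • rotGen (a, b) y) +
            fderiv ℝ U y (y a • rotGen (a, b) v) := fun a => by
        rw [hU.fderiv_rotDeriv le_rfl hy0, map_smul, map_smul, smul_eq_mul, smul_eq_mul, mul_add]
      simp_rw [h2]
      rw [Finset.sum_add_distrib, ← map_sum, ← map_sum, h1, sum_smul_rotGen, map_smul, map_sub,
        map_smul, map_smul, hU.fderiv_self (by norm_num) hy0,
        hU.fderiv_fderiv_apply_self le_rfl hy0, norm_of_mem_roundSphere hy, sphereRadius_sq]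
      simp
    have e4 : ∑ w : RotIdx n × RotIdx n, rotDeriv w.1 (rotDeriv w.2 U) y * (hessMat w y v) b =
        (2 * n : ℝ)⁻¹ * ∑ a, y a * fderiv ℝ (rotDeriv (a, b) U) y v := by
      have h1 : ∀ a, fderiv ℝ (rotDeriv (a, b) U) y v = _ := fun a =>
        (hU.rotDeriv (m' := 1) (by norm_num) (a, b)).fderiv_eq_sum le_rfl hy v
      simp_rw [h1]
      rw [Fintype.sum_prod_type_right, Fintype.sum_prod_type_right, Finset.sum_eq_single b,
        Finset.mul_sum]
      · refine Finset.sum_congr rfl fun a _ => ?_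
        rw [Finset.mul_sum, Finset.mul_sum]
        refine Finset.sum_congr rfl fun i _ => ?_
        simp [hessMat]
        ring
      · intro c _ hc
        refine Finset.sum_eq_zero fun a _ => Finset.sum_eq_zero fun i _ => ?_
        simp [hessMat, hc.symm]
      · simp
    have e5 : (∑ w : RotIdx n × RotIdx n, rotDeriv w.1 (rotDeriv w.2 U) y • hessMat w y v) b =
        ∑ w : RotIdx n × RotIdx n, rotDeriv w.1 (rotDeriv w.2 U) y * (hessMat w y v) b := by
      simp [Finset.sum_apply]
    rw [e2, PiLp.sub_apply, e5, e4, e3, PiLp.smul_apply, smul_eq_mul]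
    field_simp
    ring
  ext1 p
  rw [sphereHessian, tangentProj_eq hy]
  simp only [ContinuousLinearMap.comp_apply, sum_apply,
    smul_apply]
  rw [hG _ (inner_tproj hy p), map_sub, map_smul, tproj_self hy, smul_zero, sub_zero, map_sum]
  simp only [map_smul]

lemma contDiff_jetZero : ContDiff ℝ ∞ (jetZero : Amb n → JetIdx n → ℝ) := by
  refine contDiff_pi.2 fun j => ?_
  cases j with
  | inl c => exact (EuclideanSpace.proj c : Amb n →L[ℝ] ℝ).contDiff
  | inr k => exact contDiff_const

lemma jetArg_jetZero (y : Amb n) : jetArg (jetZero y) = (y, 0, 0) := by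
  rw [jetArg_of_zero fun k => rfl, jetPos_eq (y := y) fun c => rfl]

/-- The trace of an operator on the ambient space, as a continuous linear functional. -/
def traceCLM : (Amb n →L[ℝ] Amb n) →L[ℝ] ℝ :=
  LinearMap.toContinuousLinearMap
    ((LinearMap.trace ℝ (Amb n)) ∘ₗ (ContinuousLinearMap.coeLM ℝ))

lemma traceCLM_apply (A : Amb n →L[ℝ] Amb n) :
    traceCLM A = LinearMap.trace ℝ (Amb n) A.toLinearMap := rfl

/-- Moving the zero jet in a value or derivative direction moves the arguments of the coefficients
along a line t (z, p) with p tangent. Tangency is what makes the hypothesis on the derivative of f,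
which concerns tangent p only, applicable. -/
lemma jetZero_add_smul (y : Amb n) (k : Option (RotIdx n)) :
    ∃ (z : ℝ) (p : Amb n), (y ∈ roundSphere n → ⟪y, p⟫_ℝ = 0) ∧
      ∀ t : ℝ, jetArg (jetZero y + t • Pi.single (Sum.inr k) (1 : ℝ)) = (y, t • (z, p)) := by
  let e : JetIdx n → ℝ := Pi.single (Sum.inr k) 1
  refine ⟨e (Sum.inr none), tproj y (∑ b, ((2 * n : ℝ)⁻¹ *
    ∑ a, y a * e (Sum.inr (some (a, b)))) • EuclideanSpace.single b (1 : ℝ)),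
    fun hy => inner_tproj hy _, fun t => ?_⟩
  have h1 : jetPos (jetZero y + t • e) = y := jetPos_eq fun c => by simp [jetZero, e]
  have h2 : ∀ l, (jetZero y + t • e) (Sum.inr l) = t * e (Sum.inr l) := fun l => by
    simp [jetZero]
  have h3 : ∀ c, (jetZero y + t • e) (Sum.inl c) = y c := fun c => by simp [jetZero, e]
  show jetArg (jetZero y + t • e) = _
  simp only [jetArg, jetGrad, h1, h2, h3]
  refine Prod.ext rfl (Prod.ext rfl ?_)
  dsimp only
  rw [Prod.smul_snd, ← map_smul, Finset.smul_sum]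
  congr 1
  refine Finset.sum_congr rfl fun b _ => ?_
  rw [smul_smul]
  congr 1
  simp only [Finset.mul_sum]
  refine Finset.sum_congr rfl fun a _ => ?_
  ring

/-- After a cut-off the coefficients are global smooth functions of position, value and rotational
derivatives, and compactness of the sphere gives one ρ for all points. At zero jets F vanishes
together with its derivatives in the jet directions, and the G vanish; this is all that the
quadratic estimate uses. -/
theorem QuasilinearTerm.exists_jet_repr (N : QuasilinearTerm n) :
    ∃ (ρ : ℝ) (F : (JetIdx n → ℝ) → ℝ) (G : RotIdx n × RotIdx n → (JetIdx n → ℝ) → ℝ),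
      0 < ρ ∧ ContDiff ℝ ∞ F ∧ (∀ w, ContDiff ℝ ∞ (G w)) ∧
      (∀ y ∈ roundSphere n, F (jetZero y) = 0 ∧
        (∀ k, pder (Sum.inr k) F (jetZero y) = 0) ∧ ∀ w, G w (jetZero y) = 0) ∧
      ∀ U, IsSphereFun 2 U → ∀ y ∈ roundSphere n, (∀ k, |jet U y (Sum.inr k)| < ρ) →
        N.eval U y = F (jet U y) +
          ∑ w, G w (jet U y) * rotDeriv w.1 (rotDeriv w.2 U) y := by
  let K : Set (Amb n × ℝ × Amb n) := (fun y : Amb n => (y, (0 : ℝ), (0 : Amb n))) '' roundSphere n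
  have hK : IsCompact K := isCompact_roundSphere.image (by fun_prop)
  have hKd : K ⊆ N.dom := by
    rintro _ ⟨y, hy, rfl⟩
    exact N.zero_mem_dom y hy
  obtain ⟨f, hf, hf'⟩ := exists_contDiff_eq_nhdsSet N.isOpen_dom hK.isClosed hKd N.smooth_f
  obtain ⟨B, hB, hB'⟩ := exists_contDiff_eq_nhdsSet N.isOpen_dom hK.isClosed hKd N.smooth_B
  let F : (JetIdx n → ℝ) → ℝ := fun z => f (jetArg z)
  let G : RotIdx n × RotIdx n → (JetIdx n → ℝ) → ℝ := fun w z =>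
    traceCLM ((B (jetArg z)).comp ((tproj (jetPos z)).comp
      ((hessMat w (jetPos z)).comp (tproj (jetPos z)))))
  have hfK : ∀ y ∈ roundSphere n, ∀ᶠ a in 𝓝 (y, (0 : ℝ), (0 : Amb n)), f a = N.f a :=
    fun y hy => mem_nhdsSet_iff_forall.1 hf' _ ⟨y, hy, rfl⟩
  have hBK : ∀ y ∈ roundSphere n, ∀ᶠ a in 𝓝 (y, (0 : ℝ), (0 : Amb n)), B a = N.B a :=
    fun y hy => mem_nhdsSet_iff_forall.1 hB' _ ⟨y, hy, rfl⟩
  have hK' : IsCompact (jetZero '' roundSphere n) :=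
    isCompact_roundSphere.image contDiff_jetZero.continuous
  have hV : {z | f (jetArg z) = N.f (jetArg z) ∧ B (jetArg z) = N.B (jetArg z)} ∈
      𝓝ˢ (jetZero '' roundSphere n) := by
    refine mem_nhdsSet_iff_forall.2 ?_
    rintro _ ⟨y, hy, rfl⟩
    have h := (contDiff_jetArg (n := n)).continuous.tendsto (jetZero y)
    rw [jetArg_jetZero] at h
    exact h.eventually ((hfK y hy).and (hBK y hy))
  obtain ⟨V, hVo, hKV, hVs⟩ := mem_nhdsSet_iff_exists.1 hV
  obtain ⟨ρ, hρ, hρV⟩ := hK'.exists_thickening_subset_open hVo hKV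
  have htp : ContDiff ℝ ∞ fun z : JetIdx n → ℝ => tproj (jetPos z) :=
    contDiff_tproj.comp jetPos.contDiff
  refine ⟨ρ, F, G, hρ, hf.comp contDiff_jetArg, fun w => ?_, fun y hy => ⟨?_, fun k => ?_,
    fun w => ?_⟩, fun U hU y hy hsm => ?_⟩
  · exact traceCLM.contDiff.comp ((hB.comp contDiff_jetArg).clm_comp (htp.clm_comp
      (((contDiff_hessMat w).comp jetPos.contDiff).clm_comp htp)))
  · show f (jetArg (jetZero y)) = 0
    rw [jetArg_jetZero, (hfK y hy).self_of_nhds, N.f_zero y hy]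
  · obtain ⟨z, p, hp, hzp⟩ := jetZero_add_smul y k
    have hF : DifferentiableAt ℝ F (jetZero y) :=
      (hf.comp contDiff_jetArg).differentiable (by simp) _
    have h1 : HasDerivAt (fun t : ℝ => F (jetZero y + t • Pi.single (Sum.inr k) (1 : ℝ)))
        (pder (Sum.inr k) F (jetZero y)) 0 := hF.hasFDerivAt.hasLineDerivAt _
    have h2 : (fun t : ℝ => F (jetZero y + t • Pi.single (Sum.inr k) (1 : ℝ))) =
        fun t => f (y, t • (z, p)) := funext fun t => congrArg f (hzp t)
    have h3 : fderiv ℝ (fun q : ℝ × Amb n => f (y, q)) 0 =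
        fderiv ℝ (fun q : ℝ × Amb n => N.f (y, q)) 0 := by
      refine Filter.EventuallyEq.fderiv_eq ?_
      have hc : Tendsto (fun q : ℝ × Amb n => (y, q)) (𝓝 0) (𝓝 (y, (0 : ℝ), (0 : Amb n))) :=
        (Continuous.prodMk_right y).tendsto 0
      exact hc.eventually (hfK y hy)
    have hdf : DifferentiableAt ℝ (fun q : ℝ × Amb n => f (y, q)) 0 :=
      (hf.comp (contDiff_prodMk_right y)).differentiable (by simp) 0
    have h4 : HasDerivAt (fun t : ℝ => f (y, t • (z, p)))
        (fderiv ℝ (fun q : ℝ × Amb n => f (y, q)) 0 (z, p)) 0 := by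
      have h5 : HasDerivAt (fun t : ℝ => t • (z, p)) ((1 : ℝ) • (z, p)) 0 :=
        (hasDerivAt_id (0 : ℝ)).smul_const (z, p)
      rw [one_smul] at h5
      have h6 : HasFDerivAt (fun q : ℝ × Amb n => f (y, q))
        (fderiv ℝ (fun q : ℝ × Amb n => f (y, q)) 0) ((0 : ℝ) • (z, p)) := by
        rw [zero_smul]; exact hdf.hasFDerivAt
      exact h6.comp_hasDerivAt 0 h5
    rw [h2] at h1
    rw [h1.unique h4, h3, N.df_zero y hy z p (hp hy)]
  · show traceCLM _ = 0
    rw [jetArg_jetZero, (hBK y hy).self_of_nhds, N.B_zero y hy]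
    simp
  · have hz : jet U y ∈ V := by
      refine hρV (Metric.mem_thickening_iff.2 ⟨jetZero y, ⟨y, hy, rfl⟩, ?_⟩)
      refine (dist_pi_lt_iff hρ).2 fun j => ?_
      cases j with
      | inl c => simpa [jet, jetZero] using hρ
      | inr k => simpa [jetZero, Real.dist_eq] using hsm k
    obtain ⟨e1, e2⟩ := hVs hz
    have hA := jetArg_jet hU (by norm_num) hy
    have hP : jetPos (jet U y) = y := jetPos_eq fun c => rfl
    rw [QuasilinearTerm.eval, ← hA, ← e1, ← e2, sphereHessian_eq hU hy, ← traceCLM_apply]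
    congr 1
    rw [ContinuousLinearMap.comp_finsetSum, map_sum]
    refine Finset.sum_congr rfl fun w _ => ?_
    rw [ContinuousLinearMap.comp_smul, map_smul, smul_eq_mul, mul_comm]
    simp only [G, hP]

end Jets

/-! ### The difference estimate for smooth functions -/

section Nonlinearity

variable {n : ℕ} [NeZero n]

section Comp

variable {ι : Type} [Fintype ι] [DecidableEq ι]

/-- Hadamard's lemma writes the difference as ∑ H_k(Φ, Ψ)(Φ_k - Ψ_k). Multiplication by H_k(Φ, Ψ) is
bounded in order m, and order m is an algebra. -/
lemma exists_nrm_comp_sub_mul_le {m : ℕ} (hm : n + 1 ≤ 2 * m) (M : ℝ) (G : (ι → ℝ) → ℝ)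
    (hG : ContDiff ℝ ∞ G) : ∃ C : ℝ, 0 < C ∧ ∀ Φ Ψ : ι → SF n,
      (∀ j, Φ j ∈ polAlg n ∧ SF.nrm m (Φ j) ≤ M) → (∀ j, Ψ j ∈ polAlg n ∧ SF.nrm m (Ψ j) ≤ M) →
      ∀ h ∈ polAlg n, SF.nrm m ((SF.comp G hG Φ - SF.comp G hG Ψ) * h) ≤
        C * (∑ j, SF.nrm m (Φ j - Ψ j)) * SF.nrm m h := by
  obtain ⟨H, hH, hsub, -⟩ := SF.exists_comp_sub_comp (n := n) G hG
  obtain ⟨P, hP, hP'⟩ := exists_nrm_mul_le hm m 0 0 (by omega)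
  choose C hC hC' using fun k => exists_nrm_comp_mul_le (n := n) hm (ι := ι ⊕ ι) M le_rfl
    (H k) (hH k)
  have hS : 0 ≤ ∑ k, C k := Finset.sum_nonneg fun k _ => (hC k).le
  -- The summand 1 keeps the constant positive also when the index type is empty.
  refine ⟨(∑ k, C k) * P + 1, by positivity, fun Φ Ψ hΦ hΨ h hh => ?_⟩
  have hE : ∀ j, Sum.elim Φ Ψ j ∈ polAlg n ∧ SF.nrm m (Sum.elim Φ Ψ j) ≤ M := by
    rintro (j | j)
    exacts [hΦ j, hΨ j]
  have hd : ∀ k, Φ k - Ψ k ∈ polAlg n := fun k => sub_mem (hΦ k).1 (hΨ k).1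
  have hN : ∀ f : SF n, 0 ≤ SF.nrm m f := SF.nrm_nonneg m
  have hle : ∀ k, SF.nrm m (Φ k - Ψ k) ≤ ∑ j, SF.nrm m (Φ j - Ψ j) := fun k =>
    Finset.single_le_sum (fun j _ => hN (Φ j - Ψ j)) (Finset.mem_univ k)
  have hT : 0 ≤ ∑ j, SF.nrm m (Φ j - Ψ j) := Finset.sum_nonneg fun j _ => hN _
  rw [hsub, Finset.sum_mul]
  calc SF.nrm m (∑ k, SF.comp (H k) (hH k) (Sum.elim Φ Ψ) * (Φ k - Ψ k) * h)
      ≤ ∑ k, SF.nrm m (SF.comp (H k) (hH k) (Sum.elim Φ Ψ) * (Φ k - Ψ k) * h) :=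
        SF.nrm_sum_le _ _ _
    _ ≤ ∑ k, C k * (P * (∑ j, SF.nrm m (Φ j - Ψ j)) * SF.nrm m h) := by
        refine Finset.sum_le_sum fun k _ => ?_
        rw [mul_assoc]
        refine (hC' k _ hE _ (mul_mem (hd k) hh)).trans ?_
        refine mul_le_mul_of_nonneg_left ?_ (hC k).le
        have h1 := hP' _ (hd k) _ hh
        simp only [Nat.sub_zero] at h1
        refine h1.trans ?_
        gcongr
        · exact hN h
        · exact hle k
    _ = (∑ k, C k) * P * (∑ j, SF.nrm m (Φ j - Ψ j)) * SF.nrm m h := by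
        rw [← Finset.sum_mul]; ring
    _ ≤ _ := by
        have : 0 ≤ (∑ j, SF.nrm m (Φ j - Ψ j)) * SF.nrm m h := mul_nonneg hT (hN h)
        nlinarith

end Comp

/-- The position, the value and the rotational derivatives, as functions on the sphere. -/
def SF.jet (f : SF n) : JetIdx n → SF n :=
  Sum.elim SF.Y fun o => o.elim f fun i => SF.D i f

lemma SF.jet_zero_apply {y : Amb n} (hy : y ∈ roundSphere n) :
    (fun j => SF.jet (0 : SF n) j y) = jetZero y := by
  ext j
  rcases j with c | _ | i
  · exact SF.Y_apply_sphere c hy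
  · rfl
  · show (SF.D i 0) y = 0
    rw [map_zero]; rfl

lemma SF.jet_mem {f : SF n} (hf : f ∈ polAlg n) (j : JetIdx n) : SF.jet f j ∈ polAlg n := by
  rcases j with c | _ | i
  · exact ⟨1, homPol_le_pol le_rfl (Y_mem_homPol c)⟩
  · exact hf
  · exact D_mem_polAlg i hf

lemma SF.nrm_jet_sub_le (m : ℕ) (f g : SF n) (j : JetIdx n) :
    SF.nrm m (SF.jet f j - SF.jet g j) ≤ sobConst n * SF.nrm (m + 1) (f - g) := by
  rcases j with c | _ | i
  · show SF.nrm m (SF.Y c - SF.Y c) ≤ _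
    rw [sub_self, SF.nrm_zero_right]
    exact mul_nonneg (zero_le_one.trans one_le_sobConst) (SF.nrm_nonneg _ _)
  · exact SF.nrm_le_succ m (f - g)
  · show SF.nrm m (SF.D i f - SF.D i g) ≤ _
    rw [← map_sub]
    exact SF.nrm_D_le m i _

lemma SF.exists_nrm_jet_le (m : ℕ) : ∃ M : ℝ, ∀ f : SF n, SF.nrm (m + 1) f ≤ 1 →
    ∀ j, SF.nrm m (SF.jet f j) ≤ M := by
  refine ⟨∑ j, SF.nrm m (SF.jet (0 : SF n) j) + sobConst n, fun f hf j => ?_⟩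
  have h1 : SF.nrm m (SF.jet f j) ≤
      SF.nrm m (SF.jet (0 : SF n) j) + SF.nrm m (SF.jet f j - SF.jet 0 j) := by
    have := SF.nrm_add_le m (SF.jet (0 : SF n) j) (SF.jet f j - SF.jet 0 j)
    rwa [add_sub_cancel] at this
  have h2 := Finset.single_le_sum (f := fun j => SF.nrm m (SF.jet (0 : SF n) j))
    (fun j _ => SF.nrm_nonneg m _) (Finset.mem_univ j)
  have h3 := SF.nrm_jet_sub_le m f 0 j
  rw [sub_zero] at h3
  have h4 := mul_le_mul_of_nonneg_left hf (zero_le_one.trans (one_le_sobConst (n := n)))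
  linarith

lemma SF.sum_nrm_jet_sub_le (m : ℕ) (f g : SF n) : ∑ j, SF.nrm m (SF.jet f j - SF.jet g j) ≤
    Fintype.card (JetIdx n) * sobConst n * SF.nrm (m + 1) (f - g) := by
  refine (Finset.sum_le_sum fun j _ => SF.nrm_jet_sub_le m f g j).trans_eq ?_
  rw [Finset.sum_const, Finset.card_univ, nsmul_eq_mul, mul_assoc]

lemma exists_nrm_comp_jet_sub_mul_le {m : ℕ} (hm : n + 1 ≤ 2 * m) (G : (JetIdx n → ℝ) → ℝ)
    (hG : ContDiff ℝ ∞ G) : ∃ C : ℝ, 0 < C ∧ ∀ f ∈ polAlg n, ∀ g ∈ polAlg n,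
      SF.nrm (m + 1) f ≤ 1 → SF.nrm (m + 1) g ≤ 1 → ∀ h ∈ polAlg n,
      SF.nrm m ((SF.comp G hG (SF.jet f) - SF.comp G hG (SF.jet g)) * h) ≤
        C * SF.nrm (m + 1) (f - g) * SF.nrm m h := by
  obtain ⟨M, hM⟩ := SF.exists_nrm_jet_le (n := n) m
  obtain ⟨C, hC, hC'⟩ := exists_nrm_comp_sub_mul_le (n := n) hm M G hG
  have hK := zero_lt_one.trans_le (one_le_sobConst (n := n))
  have hc : (0 : ℝ) < Fintype.card (JetIdx n) := by exact_mod_cast Fintype.card_pos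
  refine ⟨C * (Fintype.card (JetIdx n) * sobConst n), by positivity,
    fun f hf g hg hf1 hg1 h hh => ?_⟩
  refine (hC' _ _ (fun j => ⟨SF.jet_mem hf j, hM f hf1 j⟩)
    (fun j => ⟨SF.jet_mem hg j, hM g hg1 j⟩) h hh).trans ?_
  have h1 := SF.sum_nrm_jet_sub_le m f g
  have h2 := SF.nrm_nonneg m h
  calc _ ≤ C * (Fintype.card (JetIdx n) * sobConst n * SF.nrm (m + 1) (f - g)) * SF.nrm m h := by
        gcongr
    _ = _ := by ring

lemma SF.comp_jet_zero {G : (JetIdx n → ℝ) → ℝ} (hG : ContDiff ℝ ∞ G)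
    (h : ∀ y ∈ roundSphere n, G (jetZero y) = 0) : SF.comp G hG (SF.jet 0) = 0 := by
  refine SF.ext_sphere fun y hy => ?_
  rw [SF.comp_apply, SF.jet_zero_apply hy, h y hy]
  rfl

/-- Hadamard's lemma is used twice. First F(jf) - F(jg) = ∑ H_k(jf, jg)(jf - jg)_k; then H_k
vanishes at the pair of zero jets, where it equals ∂_k F, so H_k(jf, jg) is itself of the size of f
and g. The position components of jf and jg cancel, so only jet directions k matter. -/
lemma exists_nrm_comp_jet_sub_le {m : ℕ} (hm : n + 1 ≤ 2 * m) (F : (JetIdx n → ℝ) → ℝ)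
    (hF : ContDiff ℝ ∞ F) (hF0 : ∀ y ∈ roundSphere n, ∀ k, pder (Sum.inr k) F (jetZero y) = 0) :
    ∃ C : ℝ, 0 < C ∧ ∀ f ∈ polAlg n, ∀ g ∈ polAlg n,
      SF.nrm (m + 1) f ≤ 1 → SF.nrm (m + 1) g ≤ 1 →
      SF.nrm m (SF.comp F hF (SF.jet f) - SF.comp F hF (SF.jet g)) ≤
        C * ((SF.nrm (m + 1) f + SF.nrm (m + 1) g) * SF.nrm (m + 1) (f - g)) := by
  obtain ⟨M, hM⟩ := SF.exists_nrm_jet_le (n := n) m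
  obtain ⟨H, hH, hsub, hdiag⟩ := SF.exists_comp_sub_comp (n := n) F hF
  choose C hC hC' using fun k => exists_nrm_comp_sub_mul_le (n := n) hm M (H k) (hH k)
  have hK := zero_lt_one.trans_le (one_le_sobConst (n := n))
  set c : ℝ := Fintype.card (JetIdx n) * sobConst n with hcdef
  have hc : 0 < c := mul_pos (by exact_mod_cast Fintype.card_pos) hK
  have hS : 0 ≤ ∑ k, C k := Finset.sum_nonneg fun k _ => (hC k).le
  refine ⟨(∑ k, C k) * (c * sobConst n) + 1, by positivity, fun f hf g hg hf1 hg1 => ?_⟩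
  have h01 : SF.nrm (m + 1) (0 : SF n) ≤ 1 := by rw [SF.nrm_zero_right]; exact zero_le_one
  have hb : ∀ f ∈ polAlg n, SF.nrm (m + 1) f ≤ 1 → ∀ j,
      SF.jet f j ∈ polAlg n ∧ SF.nrm m (SF.jet f j) ≤ M := fun f hf hf1 j =>
    ⟨SF.jet_mem hf j, hM f hf1 j⟩
  have hE : ∀ f ∈ polAlg n, SF.nrm (m + 1) f ≤ 1 → ∀ g ∈ polAlg n, SF.nrm (m + 1) g ≤ 1 → ∀ j,
      Sum.elim (SF.jet f) (SF.jet g) j ∈ polAlg n ∧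
        SF.nrm m (Sum.elim (SF.jet f) (SF.jet g) j) ≤ M := by
    rintro f hf hf1 g hg hg1 (j | j)
    exacts [hb f hf hf1 j, hb g hg hg1 j]
  have hterm : ∀ k, SF.nrm m (SF.comp (H k) (hH k) (Sum.elim (SF.jet f) (SF.jet g)) *
      (SF.jet f k - SF.jet g k)) ≤ C k * (c * sobConst n *
        ((SF.nrm (m + 1) f + SF.nrm (m + 1) g) * SF.nrm (m + 1) (f - g))) := by
    have hfg := SF.nrm_nonneg (m + 1) (f - g)
    have hf0 := SF.nrm_nonneg (m + 1) f
    have hg0 := SF.nrm_nonneg (m + 1) g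
    rintro (a | k)
    · have : SF.jet f (Sum.inl a) - SF.jet g (Sum.inl a) = 0 := sub_self _
      rw [this, mul_zero, SF.nrm_zero_right]
      have := (hC (Sum.inl a)).le
      positivity
    · have h0 : SF.comp (H (Sum.inr k)) (hH _) (Sum.elim (SF.jet 0) (SF.jet 0)) = 0 := by
        refine SF.ext_sphere fun y hy => ?_
        have : (fun j => (Sum.elim (SF.jet (0 : SF n)) (SF.jet 0) : _ → SF n) j y) =
            Sum.elim (jetZero y) (jetZero y) := by
          rw [← SF.jet_zero_apply hy]
          ext j; cases j <;> rfl
        rw [SF.comp_apply, this, hdiag, hF0 y hy]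
        rfl
      have h1 := hC' (Sum.inr k) _ _ (hE f hf hf1 g hg hg1)
        (hE 0 (zero_mem _) h01 0 (zero_mem _) h01) _
        (sub_mem (SF.jet_mem hf (Sum.inr k)) (SF.jet_mem hg (Sum.inr k)))
      rw [h0, sub_zero, Fintype.sum_sum_type] at h1
      simp only [Sum.elim_inl, Sum.elim_inr] at h1
      refine h1.trans ?_
      rw [mul_assoc]
      refine mul_le_mul_of_nonneg_left ?_ (hC _).le
      have h2 := SF.sum_nrm_jet_sub_le m f 0
      have h3 := SF.sum_nrm_jet_sub_le m g 0
      rw [sub_zero] at h2 h3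
      calc _ ≤ (c * SF.nrm (m + 1) f + c * SF.nrm (m + 1) g) *
            (sobConst n * SF.nrm (m + 1) (f - g)) := by
            gcongr
            · exact SF.nrm_nonneg _ _
            · exact SF.nrm_jet_sub_le m f g _
        _ = _ := by ring
  rw [hsub]
  refine (SF.nrm_sum_le _ _ _).trans ((Finset.sum_le_sum fun k _ => hterm k).trans ?_)
  rw [← Finset.sum_mul]
  have : 0 ≤ (SF.nrm (m + 1) f + SF.nrm (m + 1) g) * SF.nrm (m + 1) (f - g) :=
    mul_nonneg (add_nonneg (SF.nrm_nonneg _ _) (SF.nrm_nonneg _ _)) (SF.nrm_nonneg _ _)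
  nlinarith

/-- A quasilinear term with globally smooth coefficients, on smooth functions. -/
def SF.quasi (F : (JetIdx n → ℝ) → ℝ) (hF : ContDiff ℝ ∞ F)
    (G : RotIdx n × RotIdx n → (JetIdx n → ℝ) → ℝ) (hG : ∀ w, ContDiff ℝ ∞ (G w)) (f : SF n) :
    SF n :=
  SF.comp F hF (SF.jet f) + ∑ w, SF.comp (G w) (hG w) (SF.jet f) * SF.D w.1 (SF.D w.2 f)

lemma SF.nrm_D_D_le (m : ℕ) (i j : RotIdx n) (f : SF n) :
    SF.nrm m (SF.D i (SF.D j f)) ≤ sobConst n ^ 2 * SF.nrm (m + 2) f := by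
  have hK := zero_le_one.trans (one_le_sobConst (n := n))
  calc _ ≤ sobConst n * SF.nrm (m + 1) (SF.D j f) := SF.nrm_D_le m i _
    _ ≤ sobConst n * (sobConst n * SF.nrm (m + 2) f) := by
        gcongr
        exact SF.nrm_D_le (m + 1) j f
    _ = _ := by ring

/-- For the leading part write a(f) D²f - a(g) D²g = (a(f) - a(g)) D²f + a(g) D²(f - g) and use a(0)
= 0. The second derivatives enter linearly, so each product contains only one factor of order m + 2.
-/
theorem exists_nrm_quasi_sub_le {m : ℕ} (hm : n + 1 ≤ 2 * m) (F : (JetIdx n → ℝ) → ℝ)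
    (hF : ContDiff ℝ ∞ F) (G : RotIdx n × RotIdx n → (JetIdx n → ℝ) → ℝ)
    (hG : ∀ w, ContDiff ℝ ∞ (G w))
    (hF0 : ∀ y ∈ roundSphere n, ∀ k, pder (Sum.inr k) F (jetZero y) = 0)
    (hG0 : ∀ y ∈ roundSphere n, ∀ w, G w (jetZero y) = 0) :
    ∃ C : ℝ, 0 < C ∧ ∀ f ∈ polAlg n, ∀ g ∈ polAlg n,
      SF.nrm (m + 1) f ≤ 1 → SF.nrm (m + 1) g ≤ 1 →
      SF.nrm m (SF.quasi F hF G hG f - SF.quasi F hF G hG g) ≤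
        C * ((SF.nrm (m + 1) f + SF.nrm (m + 1) g) * SF.nrm (m + 2) (f - g) +
          (SF.nrm (m + 2) f + SF.nrm (m + 2) g) * SF.nrm (m + 1) (f - g)) := by
  obtain ⟨A, hA, hA'⟩ := exists_nrm_comp_jet_sub_le hm F hF hF0
  choose B hB hB' using fun w => exists_nrm_comp_jet_sub_mul_le (n := n) hm (G w) (hG w)
  set K := sobConst n with hKdef
  have hK : 1 ≤ K := one_le_sobConst
  have hK0 := zero_lt_one.trans_le hK
  have hS : 0 ≤ ∑ w, B w := Finset.sum_nonneg fun w _ => (hB w).le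
  refine ⟨A * K + (∑ w, B w) * K ^ 2, by positivity, fun f hf g hg hf1 hg1 => ?_⟩
  have hfg := SF.nrm_nonneg (m + 1) (f - g)
  have hfg2 := SF.nrm_nonneg (m + 2) (f - g)
  have hf0 := SF.nrm_nonneg (m + 1) f
  have hg0 := SF.nrm_nonneg (m + 1) g
  have hf2 := SF.nrm_nonneg (m + 2) f
  have hg2 := SF.nrm_nonneg (m + 2) g
  have h01 : SF.nrm (m + 1) (0 : SF n) ≤ 1 := by rw [SF.nrm_zero_right]; exact zero_le_one
  set X := (SF.nrm (m + 1) f + SF.nrm (m + 1) g) * SF.nrm (m + 2) (f - g) +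
    (SF.nrm (m + 2) f + SF.nrm (m + 2) g) * SF.nrm (m + 1) (f - g) with hX
  have hDD : ∀ w : RotIdx n × RotIdx n, ∀ f ∈ polAlg n, SF.D w.1 (SF.D w.2 f) ∈ polAlg n :=
    fun w f hf => D_mem_polAlg _ (D_mem_polAlg _ hf)
  have hterm : ∀ w : RotIdx n × RotIdx n,
      SF.nrm m (SF.comp (G w) (hG w) (SF.jet f) * SF.D w.1 (SF.D w.2 f) -
        SF.comp (G w) (hG w) (SF.jet g) * SF.D w.1 (SF.D w.2 g)) ≤ B w * (K ^ 2 * X) := by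
    intro w
    have e : SF.comp (G w) (hG w) (SF.jet f) * SF.D w.1 (SF.D w.2 f) -
        SF.comp (G w) (hG w) (SF.jet g) * SF.D w.1 (SF.D w.2 g) =
        (SF.comp (G w) (hG w) (SF.jet f) - SF.comp (G w) (hG w) (SF.jet g)) *
          SF.D w.1 (SF.D w.2 f) +
        (SF.comp (G w) (hG w) (SF.jet g) - SF.comp (G w) (hG w) (SF.jet 0)) *
          SF.D w.1 (SF.D w.2 (f - g)) := by
      rw [SF.comp_jet_zero (hG w) fun y hy => hG0 y hy w, map_sub, map_sub]
      ring
    rw [e]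
    refine (SF.nrm_add_le _ _ _).trans ?_
    have h1 := hB' w f hf g hg hf1 hg1 _ (hDD w f hf)
    have h2 := hB' w g hg 0 (zero_mem _) hg1 h01 _ (hDD w _ (sub_mem hf hg))
    rw [sub_zero] at h2
    have h3 := SF.nrm_D_D_le m w.1 w.2 f
    have h4 := SF.nrm_D_D_le m w.1 w.2 (f - g)
    have hBw := (hB w).le
    calc _ ≤ B w * SF.nrm (m + 1) (f - g) * (K ^ 2 * SF.nrm (m + 2) f) +
          B w * SF.nrm (m + 1) g * (K ^ 2 * SF.nrm (m + 2) (f - g)) := by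
          refine add_le_add (h1.trans ?_) (h2.trans ?_) <;> gcongr
      _ = B w * (K ^ 2 * (SF.nrm (m + 1) g * SF.nrm (m + 2) (f - g) +
          SF.nrm (m + 2) f * SF.nrm (m + 1) (f - g))) := by ring
      _ ≤ _ := by
          rw [hX]
          gcongr <;> linarith
  have hFt : SF.nrm m (SF.comp F hF (SF.jet f) - SF.comp F hF (SF.jet g)) ≤ A * (K * X) := by
    refine (hA' f hf g hg hf1 hg1).trans (mul_le_mul_of_nonneg_left ?_ hA.le)
    have h1 := SF.nrm_le_succ (m + 1) (f - g)
    calc (SF.nrm (m + 1) f + SF.nrm (m + 1) g) * SF.nrm (m + 1) (f - g)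
        ≤ (SF.nrm (m + 1) f + SF.nrm (m + 1) g) * (K * SF.nrm (m + 2) (f - g)) := by gcongr
      _ = K * ((SF.nrm (m + 1) f + SF.nrm (m + 1) g) * SF.nrm (m + 2) (f - g)) := by ring
      _ ≤ _ := by
        rw [hX]
        gcongr
        have := mul_nonneg (add_nonneg hf2 hg2) hfg
        linarith
  have e : SF.quasi F hF G hG f - SF.quasi F hF G hG g =
      (SF.comp F hF (SF.jet f) - SF.comp F hF (SF.jet g)) +
      ∑ w, (SF.comp (G w) (hG w) (SF.jet f) * SF.D w.1 (SF.D w.2 f) -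
        SF.comp (G w) (hG w) (SF.jet g) * SF.D w.1 (SF.D w.2 g)) := by
    rw [SF.quasi, SF.quasi, Finset.sum_sub_distrib]
    ring
  rw [e]
  calc _ ≤ A * (K * X) + ∑ w, B w * (K ^ 2 * X) :=
        (SF.nrm_add_le _ _ _).trans (add_le_add hFt
          ((SF.nrm_sum_le _ _ _).trans (Finset.sum_le_sum fun w _ => hterm w)))
    _ = _ := by rw [← Finset.sum_mul]; ring

/-- Near zero, a quasilinear term is approximated by a map `Q` of smooth functions which satisfies
a quadratic difference estimate. -/
theorem QuasilinearTerm.exists_smooth_approx (N : QuasilinearTerm n) {m : ℕ}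
    (hm : n + 1 ≤ 2 * m) :
    ∃ (ρ C : ℝ) (Q : SF n → SF n), 0 < ρ ∧ 0 < C ∧ Q 0 = 0 ∧
      (∀ f ∈ polAlg n, ∀ g ∈ polAlg n, SF.nrm (m + 1) f ≤ 1 → SF.nrm (m + 1) g ≤ 1 →
        SF.nrm m (Q f - Q g) ≤
          C * ((SF.nrm (m + 1) f + SF.nrm (m + 1) g) * SF.nrm (m + 2) (f - g) +
            (SF.nrm (m + 2) f + SF.nrm (m + 2) g) * SF.nrm (m + 1) (f - g))) ∧
      ∀ U, IsSphereFun 2 U → ∀ y ∈ roundSphere n, |U y| < ρ → (∀ i, |rotDeriv i U y| < ρ) →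
        ∀ f : ℕ → SF n, Tendsto (fun J => f J y) atTop (𝓝 (U y)) →
          (∀ i, Tendsto (fun J => SF.D i (f J) y) atTop (𝓝 (rotDeriv i U y))) →
          (∀ i j, Tendsto (fun J => SF.D i (SF.D j (f J)) y) atTop
            (𝓝 (rotDeriv i (rotDeriv j U) y))) →
          Tendsto (fun J => Q (f J) y) atTop (𝓝 (N.eval U y)) := by
  obtain ⟨ρ, F, G, hρ, hF, hG, h0, hN⟩ := N.exists_jet_repr
  obtain ⟨C, hC, hC'⟩ := exists_nrm_quasi_sub_le hm F hF G hG (fun y hy => (h0 y hy).2.1)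
    (fun y hy => (h0 y hy).2.2)
  refine ⟨ρ, C, SF.quasi F hF G hG, hρ, hC, ?_, hC', ?_⟩
  · rw [SF.quasi, SF.comp_jet_zero hF fun y hy => (h0 y hy).1]
    simp
  · intro U hU y hy hU0 hU1 f hf hf1 hf2
    have hjet : Tendsto (fun J => fun j => SF.jet (f J) j y) atTop (𝓝 (_root_.jet U y)) := by
      refine tendsto_pi_nhds.2 ?_
      rintro (c | _ | i)
      · show Tendsto (fun J => SF.Y c y) atTop (𝓝 (y c))
        rw [SF.Y_apply_sphere c hy]
        exact tendsto_const_nhds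
      · exact hf
      · exact hf1 i
    rw [hN U hU y hy (by rintro (_ | i); exacts [hU0, hU1 i])]
    have e : ∀ J, SF.quasi F hF G hG (f J) y = F (fun j => SF.jet (f J) j y) +
        ∑ w : RotIdx n × RotIdx n, G w (fun j => SF.jet (f J) j y) *
          SF.D w.1 (SF.D w.2 (f J)) y := fun J => by
      rw [SF.quasi, SF.add_apply, SF.sum_apply]
      rfl
    simp_rw [e]
    exact ((hF.continuous.tendsto _).comp hjet).add (tendsto_finsetSum _ fun w _ =>
      (((hG w).continuous.tendsto _).comp hjet).mul (hf2 w.1 w.2))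

end Nonlinearity

/-! ### Truncations and semicontinuity of the Sobolev norms -/

section Truncation

variable {n : ℕ} [NeZero n]

/-- The sum of the first components of the expansion into spherical harmonics. -/
def SF.trunc (J : ℕ) (u : L2Sphere n) : SF n := ∑ j ∈ Finset.range J, SF.proj j u

lemma SF.trunc_mem (J : ℕ) (u : L2Sphere n) : SF.trunc J u ∈ polAlg n :=
  sum_mem fun j _ => ⟨j, (mem_harm.1 (SF.proj_mem j u)).1⟩

lemma SF.cls_trunc (J : ℕ) (u : L2Sphere n) :
    SF.cls (SF.trunc J u) = ∑ j ∈ Finset.range J, eigProj n j u := by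
  simp only [SF.trunc, map_sum, SF.cls_proj]

lemma SF.trunc_sub (J : ℕ) (u v : L2Sphere n) :
    SF.trunc J (u - v) = SF.trunc J u - SF.trunc J v := by
  simp only [SF.trunc, map_sub, Finset.sum_sub_distrib]

lemma eigProj_cls_trunc (i J : ℕ) (u : L2Sphere n) :
    eigProj n i (SF.cls (SF.trunc J u)) = if i < J then eigProj n i u else 0 := by
  simp only [SF.cls_trunc, map_sum, eigProj_eigProj, Finset.sum_ite_eq, Finset.mem_range]

lemma tendsto_cls_trunc (u : L2Sphere n) :
    Tendsto (fun J => SF.cls (SF.trunc J u)) atTop (𝓝 u) := by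
  simp only [SF.cls_trunc]
  exact (hasSum_eigProj u).tendsto_sum_nat

lemma sobolevNorm_le_of_norm_le {l : ℕ} {u v : L2Sphere n}
    (h : ∀ j, ‖eigProj n j u‖ ≤ ‖eigProj n j v‖) : sobolevNorm l u ≤ sobolevNorm l v := by
  refine sobolevNorm_le_of_sq_le ?_
  rw [sobolevNorm_sq]
  exact ENNReal.tsum_le_tsum fun j => ENNReal.ofReal_le_ofReal
    (mul_le_mul_of_nonneg_left (pow_le_pow_left₀ (norm_nonneg _) (h j) 2) (by positivity))

lemma sobolevNorm_trunc_le (l J : ℕ) (u : L2Sphere n) :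
    sobolevNorm l (SF.cls (SF.trunc J u)) ≤ sobolevNorm l u := by
  refine sobolevNorm_le_of_norm_le fun j => ?_
  rw [eigProj_cls_trunc]
  split_ifs
  · exact le_rfl
  · rw [norm_zero]; exact norm_nonneg _

lemma tendsto_sobolevNorm_sub_trunc {l : ℕ} {u : L2Sphere n} (hu : sobolevNorm l u ≠ ⊤) :
    Tendsto (fun J => sobolevNorm l (u - SF.cls (SF.trunc J u))) atTop (𝓝 0) := by
  set a : ℕ → ℝ≥0∞ := fun j => ENNReal.ofReal (|eigval n j| ^ l * ‖eigProj n j u‖ ^ 2) with ha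
  have hfin : ∑' j, a j ≠ ⊤ := by
    rw [ha, ← sobolevNorm_sq]
    exact ENNReal.pow_ne_top hu
  have h1 : ∀ J, sobolevNorm l (u - SF.cls (SF.trunc J u)) ^ 2 = ∑' k, a (k + J) := fun J => by
    rw [sobolevNorm_sq, ← Summable.sum_add_tsum_nat_add' (k := J) ENNReal.summable,
      Finset.sum_eq_zero, zero_add]
    · refine tsum_congr fun k => ?_
      rw [map_sub, eigProj_cls_trunc, if_neg (by omega), sub_zero]
    · intro k hk
      rw [map_sub, eigProj_cls_trunc, if_pos (Finset.mem_range.1 hk), sub_self]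
      simp
  have h2 := ENNReal.tendsto_sum_nat_add a hfin
  have h3 := h2.ennrpow_const (1 / 2 : ℝ)
  rw [ENNReal.zero_rpow_of_pos (by norm_num)] at h3
  refine h3.congr fun J => ?_
  rw [← h1, ← ENNReal.rpow_natCast, ← ENNReal.rpow_mul]
  norm_num

/-- Lower semicontinuity: the squared norm is a supremum of finite sums, each of them continuous in
L². -/
lemma sobolevNorm_le_of_tendsto {l : ℕ} {u : L2Sphere n} {v : ℕ → L2Sphere n} {A : ℕ → ℝ≥0∞}
    {a : ℝ≥0∞} (hv : Tendsto v atTop (𝓝 u)) (hA : Tendsto A atTop (𝓝 a))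
    (h : ∀ᶠ J in atTop, sobolevNorm l (v J) ≤ A J) : sobolevNorm l u ≤ a := by
  refine sobolevNorm_le_of_sq_le ?_
  rw [ENNReal.tsum_eq_iSup_sum]
  refine iSup_le fun s => ?_
  have h1 : Tendsto (fun J => ∑ j ∈ s, ENNReal.ofReal (|eigval n j| ^ l * ‖eigProj n j (v J)‖ ^ 2))
      atTop (𝓝 (∑ j ∈ s, ENNReal.ofReal (|eigval n j| ^ l * ‖eigProj n j u‖ ^ 2))) :=
    tendsto_finsetSum _ fun j _ => ENNReal.tendsto_ofReal
      (((((eigProj n j).continuous.tendsto u).comp hv).norm.pow 2).const_mul _)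
  refine le_of_tendsto_of_tendsto h1 (ENNReal.Tendsto.pow (n := 2) hA) ?_
  filter_upwards [h] with J hJ
  refine le_trans ?_ (pow_le_pow_left' hJ 2)
  rw [sobolevNorm_sq]
  exact ENNReal.sum_le_tsum s

lemma aemeasurable_sobolevNorm (l : ℕ) {α : Type*} [MeasurableSpace α] {μ : Measure α}
    {v : α → L2Sphere n} (hv : AEStronglyMeasurable v μ) :
    AEMeasurable (fun s => sobolevNorm l (v s)) μ := by
  unfold sobolevNorm
  refine AEMeasurable.pow_const (AEMeasurable.tsum fun j => ?_) _
  exact ((((eigProj n j).continuous.comp_aestronglyMeasurable hv).enorm).pow_const 2).const_mul _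

/-- Elements of Sobolev spaces are determined by mean-square limits of pointwise convergent
sequences. -/
lemma ae_eq_of_tendsto_cls {f : ℕ → SF n} {g : L2Sphere n} {G : Amb n → ℝ}
    (hg : Tendsto (fun J => SF.cls (f J)) atTop (𝓝 g))
    (hG : ∀ᵐ x ∂surfaceMeasure n, Tendsto (fun J => f J x) atTop (𝓝 (G x))) :
    g =ᵐ[surfaceMeasure n] G := by
  obtain ⟨ns, hns, hlim⟩ := (tendstoInMeasure_of_tendsto_Lp hg).exists_seq_tendsto_ae
  have h : ∀ᵐ x ∂surfaceMeasure n, ∀ J, SF.cls (f J) x = f J x :=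
    ae_all_iff.2 fun J => (f J).coeFn_cls
  filter_upwards [hlim, hG, h] with x h1 h2 h3
  simp only [h3] at h1
  exact tendsto_nhds_unique h1 (h2.comp hns.tendsto_atTop)

end Truncation

/-! ### Sobolev regularity -/

section Regularity

variable {n : ℕ} [NeZero n]

lemma exists_tendstoUniformlyOn {f : ℕ → SF n}
    (h : ∀ ε > 0, ∃ J₀, ∀ J ≥ J₀, ∀ K ≥ J₀, ∀ x, x ≠ 0 → |f J x - f K x| < ε) :
    ∃ U : Amb n → ℝ, TendstoUniformlyOn (fun J x => f J x) U atTop {0}ᶜ := by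
  have hC : UniformCauchySeqOn (fun J x => f J x) atTop ({0}ᶜ : Set (Amb n)) := by
    refine Metric.uniformCauchySeqOn_iff.2 fun ε hε => ?_
    obtain ⟨J₀, hJ⟩ := h ε hε
    exact ⟨J₀, fun J hJ1 K hK1 x hx => hJ J hJ1 K hK1 x hx⟩
  have : ∀ x : Amb n, ∃ a : ℝ, x ≠ 0 → Tendsto (fun J => f J x) atTop (𝓝 a) := fun x => by
    by_cases hx : x = 0
    · exact ⟨0, fun h => absurd hx h⟩
    · obtain ⟨a, ha⟩ := cauchySeq_tendsto_of_complete (hC.cauchySeq hx)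
      exact ⟨a, fun _ => ha⟩
  choose U hU using this
  exact ⟨U, hC.tendstoUniformlyOn_of_tendsto fun x hx => hU x hx⟩

lemma smul_of_tendstoUniformlyOn {f : ℕ → SF n} {U : Amb n → ℝ}
    (hU : TendstoUniformlyOn (fun J x => f J x) U atTop {0}ᶜ) {c : ℝ} {x : Amb n} (hc : 0 < c)
    (hx : x ≠ 0) : U (c • x) = U x := by
  refine tendsto_nhds_unique (hU.tendsto_at (smul_ne_zero hc.ne' hx)) ?_
  simp only [(f _).isSphereFun.1 c x hc]
  exact hU.tendsto_at hx

/-- The derivative of a function on the sphere in terms of its rotational derivatives. -/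
def rotFDeriv (V : RotIdx n → ℝ) (x : Amb n) : Amb n →L[ℝ] ℝ :=
  ∑ i : RotIdx n, ((‖x‖ ^ 2)⁻¹ * x i.1 * V i) • (EuclideanSpace.proj i.2 : Amb n →L[ℝ] ℝ)

lemma IsSphereFun.fderiv_eq_rotFDeriv {m : WithTop ℕ∞} {U : Amb n → ℝ} (hU : IsSphereFun m U)
    (hm : 1 ≤ m) {x : Amb n} (hx : x ≠ 0) :
    fderiv ℝ U x = rotFDeriv (fun i => _root_.rotDeriv i U x) x := by
  ext1 v
  conv_lhs => rw [← sum_smul_single v]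
  rw [map_sum, rotFDeriv, Fintype.sum_prod_type_right]
  simp only [sum_apply]
  refine Finset.sum_congr rfl fun b _ => ?_
  rw [map_smul, hU.fderiv_single hm hx, smul_eq_mul, Finset.mul_sum, Finset.mul_sum]
  refine Finset.sum_congr rfl fun a _ => ?_
  simp
  ring

lemma norm_rotFDeriv_sub_le (V W : RotIdx n → ℝ) (x : Amb n) {e : ℝ} (h : ∀ i, |V i - W i| ≤ e) :
    ‖rotFDeriv V x - rotFDeriv W x‖ ≤ Fintype.card (RotIdx n) * (‖x‖⁻¹ * e) := by
  rw [rotFDeriv, rotFDeriv, ← Finset.sum_sub_distrib]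
  refine (norm_sum_le _ _).trans ?_
  rw [← nsmul_eq_mul, ← Finset.card_univ, ← Finset.sum_const]
  refine Finset.sum_le_sum fun i _ => ?_
  have e1 : ((‖x‖ ^ 2)⁻¹ * x i.1 * V i) • (EuclideanSpace.proj i.2 : Amb n →L[ℝ] ℝ) -
      ((‖x‖ ^ 2)⁻¹ * x i.1 * W i) • (EuclideanSpace.proj i.2 : Amb n →L[ℝ] ℝ) =
      ((‖x‖ ^ 2)⁻¹ * x i.1 * (V i - W i)) • (EuclideanSpace.proj i.2 : Amb n →L[ℝ] ℝ) := by
    ext v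
    simp
    ring
  rw [e1, norm_smul, norm_mul, norm_mul, norm_inv, norm_pow, norm_norm]
  have h1 : ‖(EuclideanSpace.proj i.2 : Amb n →L[ℝ] ℝ)‖ ≤ 1 :=
    ContinuousLinearMap.opNorm_le_bound _ zero_le_one fun v => by
      rw [one_mul]; exact PiLp.norm_apply_le v i.2
  have h2 : (‖x‖ ^ 2)⁻¹ * ‖x i.1‖ ≤ ‖x‖⁻¹ := by
    have h3 := PiLp.norm_apply_le x i.1
    rcases eq_or_lt_of_le (norm_nonneg x) with h0 | h0
    · simp [← h0]
    · calc (‖x‖ ^ 2)⁻¹ * ‖x i.1‖ ≤ (‖x‖ ^ 2)⁻¹ * ‖x‖ := by gcongr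
        _ = _ := by field_simp
  have he : ‖V i - W i‖ ≤ e := h i
  have he0 := (norm_nonneg _).trans he
  calc _ ≤ (‖x‖⁻¹ * e) * 1 := by gcongr
    _ = _ := mul_one _

lemma hasFDerivAt_of_tendstoUniformlyOn_rot {f : ℕ → SF n} {U : Amb n → ℝ}
    {V : RotIdx n → Amb n → ℝ} (hU : TendstoUniformlyOn (fun J x => f J x) U atTop {0}ᶜ)
    (hV : ∀ i, TendstoUniformlyOn (fun J x => SF.D i (f J) x) (V i) atTop {0}ᶜ) {x : Amb n}
    (hx : x ≠ 0) : HasFDerivAt U (rotFDeriv (fun i => V i x) x) x := by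
  refine hasFDerivAt_of_tendstoLocallyUniformlyOn (l := atTop)
    (f := fun J x => f J x) (f' := fun J x => rotFDeriv (fun i => SF.D i (f J) x) x)
    (g' := fun x => rotFDeriv (fun i => V i x) x) (isOpen_compl_singleton (x := (0 : Amb n)))
    ?_ ?_ (fun y hy => hU.tendsto_at hy) hx
  · refine Metric.tendstoLocallyUniformlyOn_iff.2 fun ε hε y hy => ?_
    have hy0 : 0 < ‖y‖ := norm_pos_iff.2 hy
    -- The differentials contain a factor of the size of 1/|z|, which is not bounded near the
    -- origin; convergence is therefore only locally uniform.
    refine ⟨{z | ‖y‖ / 2 < ‖z‖} ∩ {0}ᶜ, ?_, ?_⟩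
    · exact inter_mem (mem_nhdsWithin_of_mem_nhds
        ((isOpen_lt continuous_const continuous_norm).mem_nhds
          (by simp only [mem_ofPred_eq]; linarith))) self_mem_nhdsWithin
    · set e : ℝ := ε / 2 / (Fintype.card (RotIdx n) * (2 * ‖y‖⁻¹) + 1) with he
      have he0 : 0 < e := by positivity
      have h1 : ∀ᶠ J in atTop, ∀ i, ∀ z ∈ ({0}ᶜ : Set (Amb n)),
          dist (V i z) (SF.D i (f J) z) < e :=
        eventually_all.2 fun i => Metric.tendstoUniformlyOn_iff.1 (hV i) e he0
      filter_upwards [h1] with J hJ z hz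
      rw [dist_eq_norm]
      refine (norm_rotFDeriv_sub_le _ _ z fun i => (hJ i z hz.2).le).trans_lt ?_
      have h2 : ‖z‖⁻¹ ≤ 2 * ‖y‖⁻¹ := by
        have : ‖y‖ / 2 < ‖z‖ := hz.1
        calc ‖z‖⁻¹ ≤ (‖y‖ / 2)⁻¹ := inv_anti₀ (by positivity) this.le
          _ = _ := by field_simp
      calc _ ≤ Fintype.card (RotIdx n) * (2 * ‖y‖⁻¹ * e) := by gcongr
        _ ≤ (Fintype.card (RotIdx n) * (2 * ‖y‖⁻¹) + 1) * e := by nlinarith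
        _ = ε / 2 := by rw [he]; field_simp
        _ < ε := by linarith
  · intro J y hy
    have := ((f J).isSphereFun.differentiableAt (by simp) hy).hasFDerivAt
    rw [(f J).isSphereFun.fderiv_eq_rotFDeriv (by simp) hy] at this
    refine this.congr_fderiv ?_
    congr 1
    funext i
    exact (SF.D_apply i _ hy).symm

lemma rotDeriv_of_tendstoUniformlyOn {f : ℕ → SF n} {U : Amb n → ℝ}
    {V : RotIdx n → Amb n → ℝ} (hU : TendstoUniformlyOn (fun J x => f J x) U atTop {0}ᶜ)
    (hV : ∀ i, TendstoUniformlyOn (fun J x => SF.D i (f J) x) (V i) atTop {0}ᶜ) {x : Amb n}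
    (hx : x ≠ 0) (i : RotIdx n) : rotDeriv i U x = V i x := by
  rw [rotDeriv, (hasFDerivAt_of_tendstoUniformlyOn_rot hU hV hx).fderiv]
  refine tendsto_nhds_unique ?_ ((hV i).tendsto_at hx)
  have h : ∀ J, SF.D i (f J) x = rotFDeriv (fun i => SF.D i (f J) x) x (rotGen i x) := fun J => by
    have h1 := (f J).isSphereFun.fderiv_eq_rotFDeriv (by simp) hx
    rw [SF.D_apply i _ hx, rotDeriv, h1]
    congr 2
    funext k
    exact (SF.D_apply k _ hx).symm
  refine Tendsto.congr (fun J => (h J).symm) ?_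
  simp only [rotFDeriv, sum_apply, smul_apply]
  exact tendsto_finsetSum _ fun k _ =>
    (((hV k).tendsto_at hx).const_mul _).smul_const _

lemma contDiffOn_of_tendstoUniformlyOn {f : ℕ → SF n} {U : Amb n → ℝ}
    {V : RotIdx n → Amb n → ℝ} (hU : TendstoUniformlyOn (fun J x => f J x) U atTop {0}ᶜ)
    (hV : ∀ i, TendstoUniformlyOn (fun J x => SF.D i (f J) x) (V i) atTop {0}ᶜ) {k : ℕ}
    (hk : ∀ i, ContDiffOn ℝ k (V i) {0}ᶜ) : ContDiffOn ℝ (k + 1 : ℕ) U {0}ᶜ := by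
  push_cast
  refine (contDiffOn_succ_iff_hasFDerivWithinAt_of_uniqueDiffOn
    isOpen_compl_singleton.uniqueDiffOn).2 ⟨fun h => absurd h (by simp), _, ?_, fun x hx =>
      (hasFDerivAt_of_tendstoUniformlyOn_rot hU hV hx).hasFDerivWithinAt⟩
  refine ContDiffOn.sum fun i _ => ?_
  refine ContDiffOn.smul ((ContDiffOn.mul (ContDiffOn.inv ?_ ?_) ?_).mul (hk i)) contDiffOn_const
  · exact (contDiff_norm_sq ℝ).contDiffOn
  · exact fun x hx => pow_ne_zero 2 (norm_ne_zero_iff.2 hx)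
  · exact (EuclideanSpace.proj i.1 : Amb n →L[ℝ] ℝ).contDiff.contDiffOn

lemma SF.exists_nrm_trunc_sub_lt {l : ℕ} {u : L2Sphere n} (hu : sobolevNorm l u ≠ ⊤) {ε : ℝ}
    (hε : 0 < ε) : ∃ J₀, ∀ J ≥ J₀, ∀ K ≥ J₀, SF.nrm l (SF.trunc J u - SF.trunc K u) < ε := by
  have h := (tendsto_sobolevNorm_sub_trunc hu).eventually_lt_const
    (ENNReal.ofReal_pos.2 (half_pos hε))
  obtain ⟨J₀, hJ₀⟩ := eventually_atTop.1 h
  refine ⟨J₀, fun J hJ K hK => ?_⟩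
  rw [← ENNReal.ofReal_lt_ofReal_iff hε, SF.ofReal_nrm, map_sub]
  have e : SF.cls (SF.trunc J u) - SF.cls (SF.trunc K u) =
      (u - SF.cls (SF.trunc K u)) - (u - SF.cls (SF.trunc J u)) := by abel
  rw [e]
  refine (sobolevNorm_sub_le _ _ _).trans_lt ((ENNReal.add_lt_add (hJ₀ K hK) (hJ₀ J hJ)).trans_eq ?_)
  rw [← ENNReal.ofReal_add (by positivity) (by positivity), add_halves]

lemma SF.nrm_trunc_le {l : ℕ} {u : L2Sphere n} {A : ℝ} (hA : 0 ≤ A)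
    (hu : sobolevNorm l u ≤ ENNReal.ofReal A) (J : ℕ) : SF.nrm l (SF.trunc J u) ≤ A := by
  rw [← ENNReal.ofReal_le_ofReal_iff hA, SF.ofReal_nrm]
  exact (sobolevNorm_trunc_le l J u).trans hu

/-- A stands for the identity, one rotation field or two of them. At most two of the m + 2 orders
are spent on A, and the remaining m control the supremum. -/
lemma exists_tendstoUniformlyOn_trunc {m : ℕ} (hm : n + 1 ≤ 2 * m) {u : L2Sphere n}
    (hu : sobolevNorm (m + 2) u ≠ ⊤) (A : SF n → SF n) (hA0 : ∀ f g, A (f - g) = A f - A g)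
    (hA : ∀ f ∈ polAlg n, A f ∈ polAlg n)
    (hb : ∀ f, SF.nrm m (A f) ≤ sobConst n ^ 2 * SF.nrm (m + 2) f) :
    ∃ U : Amb n → ℝ, TendstoUniformlyOn (fun J x => A (SF.trunc J u) x) U atTop {0}ᶜ := by
  obtain ⟨C, hC, hsup⟩ := exists_sup_le (n := n) hm
  have hKp := zero_lt_one.trans_le (one_le_sobConst (n := n))
  refine exists_tendstoUniformlyOn (f := fun J => A (SF.trunc J u)) fun ε hε => ?_
  obtain ⟨J₀, hJ⟩ := SF.exists_nrm_trunc_sub_lt hu (ε := ε / (C * sobConst n ^ 2)) (by positivity)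
  refine ⟨J₀, fun J hJ1 L hL x hx => ?_⟩
  have h1 := hsup _ (hA _ (sub_mem (SF.trunc_mem J u) (SF.trunc_mem L u))) x hx
  rw [← SF.sub_apply, ← hA0]
  calc _ ≤ C * (sobConst n ^ 2 * SF.nrm (m + 2) (SF.trunc J u - SF.trunc L u)) :=
        h1.trans (by gcongr; exact hb _)
    _ < C * (sobConst n ^ 2 * (ε / (C * sobConst n ^ 2))) := by gcongr; exact hJ J hJ1 L hL
    _ = ε := by field_simp

/-- Functions in `H^{m+2}`, `2 m > n`, are of class `C²`. -/
theorem exists_isSphereFun_two {m : ℕ} (hm : n + 1 ≤ 2 * m) {u : L2Sphere n}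
    (hu : sobolevNorm (m + 2) u ≠ ⊤) :
    ∃ U : Amb n → ℝ, IsSphereFun 2 U ∧ u =ᵐ[surfaceMeasure n] U ∧ ∀ x, x ≠ 0 →
      Tendsto (fun J => SF.trunc J u x) atTop (𝓝 (U x)) ∧
      (∀ i, Tendsto (fun J => SF.D i (SF.trunc J u) x) atTop (𝓝 (rotDeriv i U x))) ∧
      ∀ i j, Tendsto (fun J => SF.D i (SF.D j (SF.trunc J u)) x) atTop
        (𝓝 (rotDeriv i (rotDeriv j U) x)) := by
  have hKp := zero_le_one.trans (one_le_sobConst (n := n))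
  have hK1 : ∀ f : SF n, sobConst n * SF.nrm (m + 1) f ≤ sobConst n ^ 2 * SF.nrm (m + 2) f :=
    fun f => by
      rw [pow_two, mul_assoc]
      exact mul_le_mul_of_nonneg_left (SF.nrm_le_succ _ f) hKp
  obtain ⟨U, hU⟩ := exists_tendstoUniformlyOn_trunc hm hu (fun f => f) (fun _ _ => rfl)
    (fun f hf => hf) fun f => (SF.nrm_le_succ m f).trans (hK1 f)
  have hV := fun i => exists_tendstoUniformlyOn_trunc hm hu (fun f => SF.D i f)
    (fun f g => map_sub _ f g) (fun f hf => D_mem_polAlg i hf)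
    fun f => (SF.nrm_D_le m i f).trans (hK1 f)
  have hW := fun i j => exists_tendstoUniformlyOn_trunc hm hu
    (fun f => SF.D i (SF.D j f)) (fun f g => by rw [map_sub, map_sub])
    (fun f hf => D_mem_polAlg i (D_mem_polAlg j hf)) fun f => SF.nrm_D_D_le m i j f
  choose V hV using hV
  choose W hW using hW
  -- Regularity is climbed from the top: the limits W of second derivatives are continuous, hence
  -- the limits V of first derivatives are C¹, hence U is C².
  have hWc : ∀ i j, ContDiffOn ℝ (0 : ℕ) (W i j) {0}ᶜ := fun i j => by
    rw [Nat.cast_zero, contDiffOn_zero]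
    exact (hW i j).continuousOn (Frequently.of_forall fun J => SF.isSphereFun _ |>.continuousOn)
  have hVc : ∀ i, ContDiffOn ℝ (1 : ℕ) (V i) {0}ᶜ := fun i =>
    contDiffOn_of_tendstoUniformlyOn (hV i) (fun j => hW j i) fun j => hWc j i
  have hUc : ContDiffOn ℝ (2 : ℕ) U {0}ᶜ := contDiffOn_of_tendstoUniformlyOn hU hV hVc
  have hUh : ∀ (c : ℝ) (x : Amb n), 0 < c → U (c • x) = U x := fun c x hc => by
    by_cases hx : x = 0
    · rw [hx, smul_zero]
    · exact smul_of_tendstoUniformlyOn hU hc hx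
  have hVU : ∀ i x, x ≠ 0 → rotDeriv i U x = V i x := fun i x hx =>
    rotDeriv_of_tendstoUniformlyOn hU hV hx i
  refine ⟨U, ⟨hUh, hUc⟩, ae_eq_of_tendsto_cls (tendsto_cls_trunc u)
    (ae_ne_zero.mono fun x hx => hU.tendsto_at hx), fun x hx => ⟨hU.tendsto_at hx, fun i => ?_,
      fun i j => ?_⟩⟩
  · rw [hVU i x hx]
    exact (hV i).tendsto_at hx
  · rw [rotDeriv_congr (fun y hy => hVU j y hy) i hx,
      rotDeriv_of_tendstoUniformlyOn (hV j) (fun i => hW i j) hx]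
    exact (hW i j).tendsto_at hx

/-- The values of `L` on functions of class `C²`. -/
lemma IsSphereFun.exists_isValueL {U : Amb n → ℝ} (hU : IsSphereFun 2 U) {u : L2Sphere n}
    (hu : u =ᵐ[surfaceMeasure n] U) : ∃ h, IsValueL u h := by
  have hm : ∀ i, IsSphereFun 0 (_root_.rotDeriv i (_root_.rotDeriv i U)) := fun i =>
    (hU.rotDeriv (m' := 1) (by norm_num) i).rotDeriv (by norm_num) i
  have h1 : MemLp (fun y => (4 * n : ℝ)⁻¹ * ∑ i, _root_.rotDeriv i (_root_.rotDeriv i U) y + U y) 2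
      (surfaceMeasure n) :=
    ((memLp_finsetSum _ fun i _ => (hm i).memLp 2).const_mul _).add (hU.memLp 2)
  refine ⟨h1.toLp _, U, hU, hu, h1.coeFn_toLp.trans ?_⟩
  filter_upwards [ae_mem_roundSphere] with y hy
  rw [hU.opL_eq le_rfl hy]

/-- Green's identity against harmonics of degree j. It turns the equation for a strong solution into
a linear ordinary differential equation in each mode. -/
lemma IsValueL.eigProj_eq {u h : L2Sphere n} (huh : IsValueL u h) (j : ℕ) :
    eigProj n j h = -eigval n j • eigProj n j u := by
  obtain ⟨U, hU, hu, hh⟩ := huh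
  refine eigProj_eq_of_inner (Submodule.smul_mem _ _ (eigProj_mem j u)) fun f hf => ?_
  have e : ∀ {w : L2Sphere n} {W : Amb n → ℝ}, w =ᵐ[surfaceMeasure n] W →
      ⟪SF.cls f, w⟫_ℝ = ∫ x, f x * W x ∂(surfaceMeasure n) := fun hw => by
    rw [L2.inner_def]
    refine integral_congr_ae ?_
    filter_upwards [f.coeFn_cls, hw] with x h1 h2
    rw [h1, h2]
    simp [mul_comm]
  rw [inner_smul_right, ← inner_eigProj_left, eigProj_eq_self (cls_mem_eigenspaceE hf), e hh, e hu,
    ← integral_const_mul]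
  have h1 := integral_opL_mul (f.isSphereFun_nat 2) hU
  rw [← h1]
  refine integral_congr_ae ?_
  filter_upwards [ae_mem_roundSphere] with x hx
  rw [opL_of_cas (mem_harm.1 hf).2 hx]
  ring

end Regularity

/-! ### Values of the quasilinear term on Sobolev spaces -/

section Values

variable {n : ℕ} [NeZero n]

lemma QuasilinearTerm.eval_congr (N : QuasilinearTerm n) {U V : Amb n → ℝ} (h : EqOn U V {0}ᶜ)
    {y : Amb n} (hy : y ≠ 0) : N.eval U y = N.eval V y := by
  have h1 : ∀ x : Amb n, x ≠ 0 → ∇ U x = ∇ V x := fun x hx => by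
    rw [gradient, gradient, Filter.EventuallyEq.fderiv_eq]
    filter_upwards [isOpen_compl_singleton.mem_nhds hx] with z hz using h hz
  have h2 : fderiv ℝ (fun x => ∇ U x) y = fderiv ℝ (fun x => ∇ V x) y := by
    refine Filter.EventuallyEq.fderiv_eq ?_
    filter_upwards [isOpen_compl_singleton.mem_nhds hy] with z hz using h1 z hz
  rw [QuasilinearTerm.eval, QuasilinearTerm.eval, sphereHessian, sphereHessian, h1 y hy, h2, h hy]

lemma QuasilinearTerm.IsValue.unique {N : QuasilinearTerm n} {u g g' : L2Sphere n}
    (h : N.IsValue u g) (h' : N.IsValue u g') : g = g' := by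
  obtain ⟨U, hU, hu, hg⟩ := h
  obtain ⟨V, hV, hv, hg'⟩ := h'
  have hUV : EqOn U V {0}ᶜ := hU.eqOn_compl hV
    (eqOn_roundSphere_of_ae_eq hU.continuousOn hV.continuousOn (hu.symm.trans hv))
  refine Lp.ext (hg.trans (EventuallyEq.trans ?_ hg'.symm))
  filter_upwards [ae_ne_zero] with y hy using N.eval_congr hUV hy

lemma SF.norm_cls_le_nrm (m : ℕ) (f : SF n) : ‖SF.cls f‖ ≤ sobConst n ^ m * SF.nrm m f := by
  induction m with
  | zero => rw [pow_zero, one_mul, SF.nrm_zero_left]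
  | succ m ih =>
    refine ih.trans ?_
    rw [pow_succ, mul_assoc]
    exact mul_le_mul_of_nonneg_left (SF.nrm_le_succ m f)
      (pow_nonneg (zero_le_one.trans one_le_sobConst) m)

lemma continuous_nrm_trunc (l J : ℕ) : Continuous fun u : L2Sphere n => SF.nrm l (SF.trunc J u) := by
  have h : ∀ u : L2Sphere n, SF.nrm l (SF.trunc J u) =
      Real.sqrt (∑ j ∈ Finset.range J, |eigval n j| ^ l * ‖eigProj n j u‖ ^ 2) := fun u => by
    have h1 : ENNReal.ofReal (SF.nrm l (SF.trunc J u) ^ 2) =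
        ENNReal.ofReal (∑ j ∈ Finset.range J, |eigval n j| ^ l * ‖eigProj n j u‖ ^ 2) := by
      rw [ENNReal.ofReal_pow (SF.nrm_nonneg _ _), SF.ofReal_nrm, sobolevNorm_sq,
        tsum_eq_sum (s := Finset.range J), ENNReal.ofReal_sum_of_nonneg fun j _ => by positivity]
      · refine Finset.sum_congr rfl fun j hj => ?_
        rw [eigProj_cls_trunc, if_pos (Finset.mem_range.1 hj)]
      · intro j hj
        rw [eigProj_cls_trunc, if_neg fun h => hj (Finset.mem_range.2 h)]
        simp
    rw [ENNReal.ofReal_eq_ofReal_iff (by positivity)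
      (Finset.sum_nonneg fun j _ => by positivity)] at h1
    rw [← h1, Real.sqrt_sq (SF.nrm_nonneg _ _)]
  simp_rw [h]
  exact Real.continuous_sqrt.comp (continuous_finsetSum _ fun j _ =>
    continuous_const.mul ((eigProj n j).continuous.norm.pow 2))

instance : SecondCountableTopology (L2Sphere n) := by
  have : Fact ((2 : ℝ≥0∞) ≠ ⊤) := ⟨by simp⟩
  infer_instance

/-- Outside the closed set S the map is replaced by zero, which makes it Borel measurable. -/
lemma ContinuousOn.comp_aestronglyMeasurable_of_isClosed {E F α : Type*} [TopologicalSpace E]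
    [TopologicalSpace.PseudoMetrizableSpace E] [TopologicalSpace F] [Zero F]
    [TopologicalSpace.PseudoMetrizableSpace F] [SecondCountableTopology F]
    {ψ : E → F} {S : Set E} (hψ : ContinuousOn ψ S) (hS : IsClosed S) [MeasurableSpace α]
    {μ : Measure α} {v : α → E} (hv : AEStronglyMeasurable v μ) (hvS : ∀ᵐ a ∂μ, v a ∈ S) :
    AEStronglyMeasurable (fun a => ψ (v a)) μ := by
  classical
  borelize E
  borelize F
  have h1 : Measurable (S.piecewise ψ 0) :=
    hψ.measurable_piecewise continuousOn_const hS.measurableSet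
  have h2 : AEStronglyMeasurable (fun a => S.piecewise ψ 0 (v a)) μ :=
    (h1.comp_aemeasurable hv.aemeasurable).aestronglyMeasurable
  refine h2.congr ?_
  filter_upwards [hvS] with a ha
  rw [Set.piecewise_eq_of_mem _ _ _ ha]

/-- On functions in `H^{m+2}` which are small in `H^{m+1}`, `2 m > n`, the quasilinear term is a
map `Φ` into `H^m` which satisfies a quadratic difference estimate. -/
theorem QuasilinearTerm.exists_sobolev_estimate (N : QuasilinearTerm n) {m : ℕ}
    (hm : n + 1 ≤ 2 * m) :
    ∃ (η C : ℝ) (Φ : L2Sphere n → L2Sphere n), 0 < η ∧ 0 < C ∧ Φ 0 = 0 ∧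
      (∀ u, sobolevNorm (m + 2) u ≠ ⊤ → sobolevNorm (m + 1) u ≤ ENNReal.ofReal η →
        N.IsValue u (Φ u)) ∧
      (∀ u w, sobolevNorm (m + 2) u ≠ ⊤ → sobolevNorm (m + 1) u ≤ ENNReal.ofReal η →
        sobolevNorm (m + 2) w ≠ ⊤ → sobolevNorm (m + 1) w ≤ ENNReal.ofReal η →
        sobolevNorm m (Φ u - Φ w) ≤ ENNReal.ofReal C *
          ((sobolevNorm (m + 1) u + sobolevNorm (m + 1) w) * sobolevNorm (m + 2) (u - w) +
            (sobolevNorm (m + 2) u + sobolevNorm (m + 2) w) * sobolevNorm (m + 1) (u - w))) ∧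
      ∀ (μ : Measure ℝ) (v : ℝ → L2Sphere n), AEStronglyMeasurable v μ →
        (∀ᵐ s ∂μ, sobolevNorm (m + 2) (v s) ≠ ⊤ ∧
          sobolevNorm (m + 1) (v s) ≤ ENNReal.ofReal η) →
        AEStronglyMeasurable (fun s => Φ (v s)) μ := by
  obtain ⟨ρ, C, Q, hρ, hC, hQ0, hQ, hlim⟩ := N.exists_smooth_approx hm
  obtain ⟨S, hS, hsup⟩ := exists_sup_le (n := n) hm
  set K := sobConst n with hKdef
  have hK1 : 1 ≤ K := one_le_sobConst
  have hK := zero_lt_one.trans_le hK1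
  -- The bound 1 is needed for the estimate of Q. The other bound gives |U| and |D_i U| at most S K
  -- η ≤ ρ/2, within the range where Q represents N: one factor K for the loss of one order, S for
  -- the sup embedding.
  set η : ℝ := min 1 (ρ / (2 * (S * K))) with hη
  have hη0 : 0 < η := lt_min one_pos (by positivity)
  have hη1 : η ≤ 1 := min_le_left _ _
  have hηρ : S * K * η < ρ := by
    calc S * K * η ≤ S * K * (ρ / (2 * (S * K))) := by gcongr; exact min_le_right _ _
      _ = ρ / 2 := by field_simp
      _ < ρ := by linarith
  have hN : ∀ {u : L2Sphere n}, sobolevNorm (m + 1) u ≤ ENNReal.ofReal η → ∀ J,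
      SF.nrm (m + 1) (SF.trunc J u) ≤ η := fun hu J => SF.nrm_trunc_le hη0.le hu J
  -- convergence of the approximations
  have hconv : ∀ u : L2Sphere n, ∃ g, sobolevNorm (m + 2) u ≠ ⊤ →
      sobolevNorm (m + 1) u ≤ ENNReal.ofReal η →
      Tendsto (fun J => SF.cls (Q (SF.trunc J u))) atTop (𝓝 g) := by
    intro u
    by_cases hu2 : sobolevNorm (m + 2) u ≠ ⊤
    swap
    · exact ⟨0, fun h => absurd h hu2⟩
    by_cases hu1 : sobolevNorm (m + 1) u ≤ ENNReal.ofReal η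
    swap
    · exact ⟨0, fun _ h => absurd h hu1⟩
    set B := (sobolevNorm (m + 2) u).toReal with hB
    have hB0 : 0 ≤ B := ENNReal.toReal_nonneg
    have hBn : ∀ J, SF.nrm (m + 2) (SF.trunc J u) ≤ B := fun J =>
      SF.nrm_trunc_le hB0 (ENNReal.ofReal_toReal hu2).ge J
    have hcs : CauchySeq fun J => SF.cls (Q (SF.trunc J u)) := by
      refine Metric.cauchySeq_iff.2 fun ε hε => ?_
      -- The norms of order m + 1 are at most 1, those of order m + 2 at most B, and K bounds the
      -- difference in order m + 1 by that in order m + 2; K^m passes from order m to L².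
      set D : ℝ := K ^ m * (C * (2 + 2 * B * K)) with hD
      have hD0 : 0 < D := by positivity
      obtain ⟨J₀, hJ₀⟩ := SF.exists_nrm_trunc_sub_lt hu2 (ε := ε / D) (by positivity)
      refine ⟨J₀, fun J hJ L hL => ?_⟩
      have hd := hJ₀ J hJ L hL
      set d := SF.nrm (m + 2) (SF.trunc J u - SF.trunc L u) with hdd
      have hd0 : 0 ≤ d := SF.nrm_nonneg _ _
      have h1 := hQ _ (SF.trunc_mem J u) _ (SF.trunc_mem L u) ((hN hu1 J).trans hη1)
        ((hN hu1 L).trans hη1)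
      have h2 : SF.nrm (m + 1) (SF.trunc J u - SF.trunc L u) ≤ K * d := SF.nrm_le_succ _ _
      rw [dist_eq_norm, ← map_sub]
      calc ‖SF.cls (Q (SF.trunc J u) - Q (SF.trunc L u))‖
          ≤ K ^ m * SF.nrm m (Q (SF.trunc J u) - Q (SF.trunc L u)) := SF.norm_cls_le_nrm m _
        _ ≤ K ^ m * (C * ((1 + 1) * d + (B + B) * (K * d))) := by
            refine mul_le_mul_of_nonneg_left (h1.trans ?_) (by positivity)
            refine mul_le_mul_of_nonneg_left (add_le_add ?_ ?_) hC.le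
            · exact mul_le_mul_of_nonneg_right (add_le_add ((hN hu1 J).trans hη1)
                ((hN hu1 L).trans hη1)) hd0
            · exact mul_le_mul (add_le_add (hBn J) (hBn L)) h2 (SF.nrm_nonneg _ _)
                (by positivity)
        _ = D * d := by rw [hD]; ring
        _ < D * (ε / D) := by gcongr
        _ = ε := by field_simp
    obtain ⟨g, hg⟩ := cauchySeq_tendsto_of_complete hcs
    exact ⟨g, fun _ _ => hg⟩
  choose Φ hΦ using hconv
  -- Each truncated map is continuous on L² where its difference estimate holds, since a truncation
  -- has finitely many modes. Measurability of Φ along a path follows by passing to the limit.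
  have hcont : ∀ J, ContinuousOn (fun u : L2Sphere n => SF.cls (Q (SF.trunc J u)))
      {u | SF.nrm (m + 1) (SF.trunc J u) ≤ 1} := by
    intro J u hu
    have hb : Tendsto (fun w : L2Sphere n => K ^ m * (C *
        ((SF.nrm (m + 1) (SF.trunc J w) + SF.nrm (m + 1) (SF.trunc J u)) *
          SF.nrm (m + 2) (SF.trunc J (w - u)) +
        (SF.nrm (m + 2) (SF.trunc J w) + SF.nrm (m + 2) (SF.trunc J u)) *
          SF.nrm (m + 1) (SF.trunc J (w - u)))))
        (𝓝[{u | SF.nrm (m + 1) (SF.trunc J u) ≤ 1}] u) (𝓝 0) := by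
      have hc1 := continuous_nrm_trunc (n := n) (m + 1) J
      have hc2 := continuous_nrm_trunc (n := n) (m + 2) J
      have hc : Continuous fun w : L2Sphere n => K ^ m * (C *
        ((SF.nrm (m + 1) (SF.trunc J w) + SF.nrm (m + 1) (SF.trunc J u)) *
          SF.nrm (m + 2) (SF.trunc J (w - u)) +
        (SF.nrm (m + 2) (SF.trunc J w) + SF.nrm (m + 2) (SF.trunc J u)) *
          SF.nrm (m + 1) (SF.trunc J (w - u)))) :=
        continuous_const.mul (continuous_const.mul
          (((hc1.add continuous_const).mul (hc2.comp (continuous_id.sub continuous_const))).add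
          ((hc2.add continuous_const).mul (hc1.comp (continuous_id.sub continuous_const)))))
      have h0 := hc.tendsto u
      have hz : ∀ l, SF.nrm l (SF.trunc J (u - u)) = 0 := fun l => by
        rw [SF.trunc_sub, sub_self, SF.nrm_zero_right]
      simp only [hz, mul_zero, add_zero] at h0
      exact h0.mono_left nhdsWithin_le_nhds
    refine tendsto_iff_norm_sub_tendsto_zero.2
      (squeeze_zero' (Eventually.of_forall fun w => norm_nonneg _) ?_ hb)
    filter_upwards [self_mem_nhdsWithin] with w hw
    rw [← map_sub, SF.trunc_sub]
    exact (SF.norm_cls_le_nrm m _).trans (mul_le_mul_of_nonneg_left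
      (hQ _ (SF.trunc_mem J w) _ (SF.trunc_mem J u) hw hu) (by positivity))
  refine ⟨η, C, Φ, hη0, hC, ?_, ?_, ?_, ?_⟩
  · have h0 := hΦ 0 (by rw [sobolevNorm_zero_right]; exact ENNReal.zero_ne_top)
      (by rw [sobolevNorm_zero_right]; exact zero_le)
    have : ∀ J, SF.trunc J (0 : L2Sphere n) = 0 := fun J => by simp [SF.trunc]
    simp only [this, hQ0, map_zero] at h0
    exact (tendsto_nhds_unique tendsto_const_nhds h0).symm
  · intro u hu2 hu1
    obtain ⟨U, hU, huU, hUlim⟩ := exists_isSphereFun_two hm hu2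
    refine ⟨U, hU, huU, ae_eq_of_tendsto_cls (hΦ u hu2 hu1) ?_⟩
    filter_upwards [ae_mem_roundSphere] with y hy
    have hy0 := ne_zero_of_mem_roundSphere hy
    obtain ⟨h1, h2, h3⟩ := hUlim y hy0
    have hs : ∀ f ∈ polAlg n, SF.nrm m f ≤ K * η → |f y| ≤ S * K * η := fun f hf hfb => by
      rw [mul_assoc]
      exact (hsup f hf y hy0).trans (by gcongr)
    refine hlim U hU y hy ?_ (fun i => ?_) _ h1 h2 h3
    · refine (le_of_tendsto h1.abs (Eventually.of_forall fun J => ?_)).trans_lt hηρ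
      exact hs _ (SF.trunc_mem J u) ((SF.nrm_le_succ m _).trans (by gcongr; exact hN hu1 J))
    · refine (le_of_tendsto (h2 i).abs (Eventually.of_forall fun J => ?_)).trans_lt hηρ
      exact hs _ (D_mem_polAlg i (SF.trunc_mem J u))
        ((SF.nrm_D_le m i _).trans (by gcongr; exact hN hu1 J))
  · intro u w hu2 hu1 hw2 hw1
    -- The estimate holds for the truncations with a right-hand side bounded uniformly in J;
    -- semicontinuity passes it to the limit.
    refine sobolevNorm_le_of_tendsto ((hΦ u hu2 hu1).sub (hΦ w hw2 hw1)) tendsto_const_nhds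
      (Eventually.of_forall fun J => ?_)
    rw [← map_sub, ← SF.ofReal_nrm]
    refine (ENNReal.ofReal_le_ofReal (hQ _ (SF.trunc_mem J u) _ (SF.trunc_mem J w)
      ((hN hu1 J).trans hη1) ((hN hw1 J).trans hη1))).trans ?_
    have hn : ∀ (l : ℕ) (f : SF n), 0 ≤ SF.nrm l f := SF.nrm_nonneg
    have ht : ∀ (l : ℕ) (u : L2Sphere n), ENNReal.ofReal (SF.nrm l (SF.trunc J u)) ≤
        sobolevNorm l u := fun l u => by rw [SF.ofReal_nrm]; exact sobolevNorm_trunc_le l J u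
    rw [← SF.trunc_sub, ENNReal.ofReal_mul hC.le,
      ENNReal.ofReal_add (mul_nonneg (add_nonneg (hn _ _) (hn _ _)) (hn _ _))
        (mul_nonneg (add_nonneg (hn _ _) (hn _ _)) (hn _ _)),
      ENNReal.ofReal_mul (add_nonneg (hn _ _) (hn _ _)),
      ENNReal.ofReal_mul (add_nonneg (hn _ _) (hn _ _)),
      ENNReal.ofReal_add (hn _ _) (hn _ _), ENNReal.ofReal_add (hn _ _) (hn _ _)]
    gcongr <;> exact ht _ _
  · intro μ v hv hvs
    refine aestronglyMeasurable_of_tendsto_ae atTop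
      (f := fun J s => SF.cls (Q (SF.trunc J (v s)))) (fun J => ?_) ?_
    · refine (hcont J).comp_aestronglyMeasurable_of_isClosed
        (isClosed_le (continuous_nrm_trunc (m + 1) J) continuous_const) hv ?_
      filter_upwards [hvs] with s hs
      exact (hN hs.2 J).trans hη1
    · filter_upwards [hvs] with s hs
      exact hΦ _ hs.1 hs.2

end Values

/-! ### Exponential kernels -/

section Kernel

/-- The kernel `e^{-κ |t|}`. -/
def expKernel (κ t : ℝ) : ℝ≥0∞ := ENNReal.ofReal (Real.exp (-(κ * |t|)))

lemma measurable_expKernel (κ : ℝ) : Measurable (expKernel κ) := by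
  unfold expKernel
  fun_prop

lemma expKernel_le_one {κ : ℝ} (hκ : 0 < κ) (t : ℝ) : expKernel κ t ≤ 1 := by
  rw [expKernel, ENNReal.ofReal_le_one, Real.exp_le_one_iff]
  have := abs_nonneg t
  nlinarith

lemma lintegral_exp_neg_Ioi {κ : ℝ} (hκ : 0 < κ) :
    ∫⁻ s in Ioi (0 : ℝ), ENNReal.ofReal (Real.exp (-(κ * s))) = ENNReal.ofReal (1 / κ) := by
  have h1 := integrableOn_exp_mul_Ioi (neg_lt_zero.2 hκ) 0
  have h2 := integral_exp_mul_Ioi (neg_lt_zero.2 hκ) 0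
  simp only [neg_mul] at h1 h2
  rw [← ofReal_integral_eq_lintegral_ofReal h1 (ae_of_all _ fun x => (Real.exp_pos _).le), h2]
  congr 1
  simp

lemma lintegral_expKernel {κ : ℝ} (hκ : 0 < κ) : ∫⁻ t, expKernel κ t = ENNReal.ofReal (2 / κ) := by
  have h2 := integral_exp_mul_Ioi (neg_lt_zero.2 hκ) 0
  simp only [neg_mul] at h2
  have h3 : ∫ t : ℝ, Real.exp (-(κ * |t|)) = 2 / κ := by
    rw [integral_comp_abs (f := fun x => Real.exp (-(κ * x))), h2]
    simp
    ring
  have h1 : Integrable fun t : ℝ => Real.exp (-(κ * |t|)) := by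
    refine Integrable.of_integral_ne_zero ?_
    rw [h3]
    positivity
  unfold expKernel
  rw [← ofReal_integral_eq_lintegral_ofReal h1 (ae_of_all _ fun x => (Real.exp_pos _).le), h3]

lemma lintegral_expKernel_sub_left_le {κ : ℝ} (hκ : 0 < κ) (s : ℝ) (S : Set ℝ) :
    ∫⁻ τ in S, expKernel κ (s - τ) ≤ ENNReal.ofReal (2 / κ) := by
  refine (setLIntegral_le_lintegral _ _).trans ?_
  rw [lintegral_sub_left_eq_self (expKernel κ) s, lintegral_expKernel hκ]

lemma lintegral_expKernel_sub_right_le {κ : ℝ} (hκ : 0 < κ) (s : ℝ) (S : Set ℝ) :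
    ∫⁻ τ in S, expKernel κ (τ - s) ≤ ENNReal.ofReal (2 / κ) := by
  refine (setLIntegral_le_lintegral _ _).trans ?_
  rw [lintegral_sub_right_eq_self (expKernel κ) s, lintegral_expKernel hκ]

/-- Cauchy-Schwarz with the kernel split into two square roots. -/
lemma sq_lintegral_mul_le {α : Type*} [MeasurableSpace α] {μ : Measure α} {k γ : α → ℝ≥0∞}
    (hk : AEMeasurable k μ) (hγ : AEMeasurable γ μ) :
    (∫⁻ a, k a * γ a ∂μ) ^ 2 ≤ (∫⁻ a, k a ∂μ) * ∫⁻ a, k a * γ a ^ 2 ∂μ := by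
  have h := ENNReal.lintegral_mul_le_Lp_mul_Lq μ Real.HolderConjugate.two_two
    (hk.pow_const (1 / 2 : ℝ)) ((hk.pow_const (1 / 2 : ℝ)).mul hγ)
  have e1 : ∀ x : ℝ≥0∞, (x ^ (1 / 2 : ℝ)) ^ (2 : ℝ) = x := fun x => by
    rw [← ENNReal.rpow_mul]; norm_num
  have e2 : ∀ x : ℝ≥0∞, x ^ (1 / 2 : ℝ) * x ^ (1 / 2 : ℝ) = x := fun x => by
    rw [← pow_two, ← ENNReal.rpow_natCast, ← ENNReal.rpow_mul]; norm_num
  simp only [Pi.mul_apply, ENNReal.mul_rpow_of_nonneg _ _ zero_le_two, e1, ← mul_assoc, e2,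
    ENNReal.rpow_two] at h
  refine (pow_le_pow_left' h 2).trans_eq ?_
  rw [mul_pow, ← ENNReal.rpow_two, ← ENNReal.rpow_two, e1, e1]

variable {γ : ℝ → ℝ≥0∞}

lemma aemeasurable_expKernel_sub (κ s : ℝ) {μ : Measure ℝ} :
    AEMeasurable (fun τ => expKernel κ (s - τ)) μ :=
  ((measurable_expKernel κ).comp (measurable_const.sub measurable_id)).aemeasurable

lemma sq_lintegral_expKernel_le (hγ : AEMeasurable γ (volume.restrict (Ioi 0))) {κ : ℝ}
    (hκ : 0 < κ) (s : ℝ) : (∫⁻ τ in Ioi (0 : ℝ), expKernel κ (s - τ) * γ τ) ^ 2 ≤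
      ENNReal.ofReal (2 / κ) * ∫⁻ τ in Ioi (0 : ℝ), expKernel κ (s - τ) * γ τ ^ 2 :=
  (sq_lintegral_mul_le (aemeasurable_expKernel_sub κ s) hγ).trans
    (mul_le_mul_left (lintegral_expKernel_sub_left_le hκ s _) _)

lemma sq_lintegral_expKernel_le_sup (hγ : AEMeasurable γ (volume.restrict (Ioi 0))) {κ : ℝ}
    (hκ : 0 < κ) (s : ℝ) : (∫⁻ τ in Ioi (0 : ℝ), expKernel κ (s - τ) * γ τ) ^ 2 ≤
      ENNReal.ofReal (2 / κ) * ∫⁻ τ in Ioi (0 : ℝ), γ τ ^ 2 :=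
  (sq_lintegral_expKernel_le hγ hκ s).trans (mul_le_mul_right (lintegral_mono fun _ =>
    mul_le_of_le_one_left' (expKernel_le_one hκ _)) _)

/-- Schur's test: after Cauchy-Schwarz, Tonelli integrates the kernel a second time, in the other
variable, which gives a second factor 2/κ. -/
lemma lintegral_sq_lintegral_expKernel_le (hγ : AEMeasurable γ (volume.restrict (Ioi 0))) {κ : ℝ}
    (hκ : 0 < κ) :
    ∫⁻ s in Ioi (0 : ℝ), (∫⁻ τ in Ioi (0 : ℝ), expKernel κ (s - τ) * γ τ) ^ 2 ≤
      ENNReal.ofReal (2 / κ) ^ 2 * ∫⁻ τ in Ioi (0 : ℝ), γ τ ^ 2 := by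
  have hm : AEMeasurable (Function.uncurry fun s τ => expKernel κ (s - τ) * γ τ ^ 2)
      ((volume.restrict (Ioi (0 : ℝ))).prod (volume.restrict (Ioi (0 : ℝ)))) :=
    ((measurable_expKernel κ).comp (measurable_fst.sub measurable_snd)).aemeasurable.mul
      ((hγ.comp_snd).pow_const 2)
  calc _ ≤ ∫⁻ s in Ioi (0 : ℝ), ENNReal.ofReal (2 / κ) *
        ∫⁻ τ in Ioi (0 : ℝ), expKernel κ (s - τ) * γ τ ^ 2 :=
        lintegral_mono fun s => sq_lintegral_expKernel_le hγ hκ s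
    _ = ENNReal.ofReal (2 / κ) * ∫⁻ τ in Ioi (0 : ℝ), ∫⁻ s in Ioi (0 : ℝ),
        expKernel κ (s - τ) * γ τ ^ 2 := by
        rw [lintegral_const_mul' _ _ ENNReal.ofReal_ne_top, lintegral_lintegral_swap hm]
    _ ≤ ENNReal.ofReal (2 / κ) * ∫⁻ τ in Ioi (0 : ℝ), ENNReal.ofReal (2 / κ) * γ τ ^ 2 := by
        gcongr with τ
        have hmk : Measurable fun s => expKernel κ (s - τ) :=
          (measurable_expKernel κ).comp (measurable_id.sub measurable_const)
        rw [lintegral_mul_const _ hmk]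
        gcongr
        exact lintegral_expKernel_sub_right_le hκ τ _
    _ = _ := by
        rw [lintegral_const_mul' _ _ ENNReal.ofReal_ne_top, ← mul_assoc, pow_two]

lemma add_sq_le_two_mul (a b : ℝ≥0∞) : (a + b) ^ 2 ≤ 2 * (a ^ 2 + b ^ 2) := by
  have h := ENNReal.rpow_add_le_mul_rpow_add_rpow a b (p := 2) (by norm_num)
  simpa [show (2 : ℝ) - 1 = 1 by norm_num] using h

/-- Bounds for quantities controlled by an exponentially decaying initial value and an
exponential kernel. -/
lemma bounds_of_le_expKernel (hγ : AEMeasurable γ (volume.restrict (Ioi 0))) {κ : ℝ} (hκ : 0 < κ)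
    {c : ℝ≥0∞} {A : ℝ → ℝ≥0∞} (hA : ∀ s, 0 ≤ s → A s ≤ ENNReal.ofReal (Real.exp (-(κ * s))) * c +
      ∫⁻ τ in Ioi (0 : ℝ), expKernel κ (s - τ) * γ τ) :
    (∀ s, 0 ≤ s → A s ^ 2 ≤ 2 * (c ^ 2 + ENNReal.ofReal (2 / κ) * ∫⁻ τ in Ioi (0 : ℝ), γ τ ^ 2)) ∧
      ∫⁻ s in Ioi (0 : ℝ), A s ^ 2 ≤ 2 * (ENNReal.ofReal (1 / κ) * c ^ 2 +
        ENNReal.ofReal (2 / κ) ^ 2 * ∫⁻ τ in Ioi (0 : ℝ), γ τ ^ 2) := by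
  have he : ∀ s, 0 ≤ s → ENNReal.ofReal (Real.exp (-(κ * s))) ≤ 1 := fun s hs => by
    rw [ENNReal.ofReal_le_one, Real.exp_le_one_iff]
    nlinarith
  have h2 : ∀ s, 0 ≤ s → A s ^ 2 ≤ 2 * (ENNReal.ofReal (Real.exp (-(κ * s))) * c ^ 2 +
      (∫⁻ τ in Ioi (0 : ℝ), expKernel κ (s - τ) * γ τ) ^ 2) := fun s hs => by
    refine ((pow_le_pow_left' (hA s hs) 2).trans (add_sq_le_two_mul _ _)).trans ?_
    rw [mul_pow]
    gcongr
    rw [pow_two]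
    exact mul_le_of_le_one_left' (he s hs)
  refine ⟨fun s hs => (h2 s hs).trans ?_, ?_⟩
  · gcongr
    · exact mul_le_of_le_one_left' (he s hs)
    · exact sq_lintegral_expKernel_le_sup hγ hκ s
  · have hm : Measurable fun s : ℝ => ENNReal.ofReal (Real.exp (-(κ * s))) * c ^ 2 := by fun_prop
    calc _ ≤ ∫⁻ s in Ioi (0 : ℝ), 2 * (ENNReal.ofReal (Real.exp (-(κ * s))) * c ^ 2 +
          (∫⁻ τ in Ioi (0 : ℝ), expKernel κ (s - τ) * γ τ) ^ 2) :=
          setLIntegral_mono' measurableSet_Ioi fun s hs => h2 s (le_of_lt hs)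
      _ = 2 * (ENNReal.ofReal (1 / κ) * c ^ 2 + ∫⁻ s in Ioi (0 : ℝ),
          (∫⁻ τ in Ioi (0 : ℝ), expKernel κ (s - τ) * γ τ) ^ 2) := by
          rw [lintegral_const_mul' _ _ ENNReal.ofNat_ne_top, lintegral_add_left hm,
            lintegral_mul_const _ (by fun_prop), lintegral_exp_neg_Ioi hκ]
      _ ≤ _ := by
          gcongr
          exact lintegral_sq_lintegral_expKernel_le hγ hκ

end Kernel

/-! ### The variation of constants formula -/

section Duhamel

variable {H : Type*} [NormedAddCommGroup H] [InnerProductSpace ℝ H] [CompleteSpace H]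

/-- The solution of `x' = -l x + a`, `x(0) = c`. -/
def duhamel (l : ℝ) (c : H) (a : ℝ → H) (s : ℝ) : H :=
  Real.exp (-(l * s)) • (c + ∫ τ in (0 : ℝ)..s, Real.exp (l * τ) • a τ)

lemma duhamel_zero (l : ℝ) (c : H) (a : ℝ → H) : duhamel l c a 0 = c := by
  simp [duhamel]

lemma intervalIntegrable_exp_smul {l : ℝ} {a : ℝ → H} {s t : ℝ}
    (ha : IntervalIntegrable a volume s t) :
    IntervalIntegrable (fun τ => Real.exp (l * τ) • a τ) volume s t :=
  ha.continuousOn_smul (by fun_prop)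

lemma continuousOn_duhamel (l : ℝ) (c : H) {a : ℝ → H} {s : ℝ}
    (ha : IntervalIntegrable a volume 0 s) : ContinuousOn (duhamel l c a) (uIcc 0 s) := by
  unfold duhamel
  refine ContinuousOn.smul (by fun_prop) (continuousOn_const.add ?_)
  exact intervalIntegral.continuousOn_primitive_interval' (intervalIntegrable_exp_smul ha)
    left_mem_uIcc

/-- Since a is only integrable, the equation holds in integrated form. Tested against a vector e,
the formula is a product of two absolutely continuous real functions, and integrating the derivative
of the product gives the claim. -/
lemma duhamel_eq_integral (l : ℝ) (c : H) {a : ℝ → H} {s : ℝ}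
    (ha : IntervalIntegrable a volume 0 s) :
    duhamel l c a s = c + ∫ τ in (0 : ℝ)..s, (-l • duhamel l c a τ + a τ) := by
  have hI : IntervalIntegrable (fun τ => -l • duhamel l c a τ + a τ) volume 0 s :=
    (((continuousOn_duhamel l c ha).const_smul (-l)).intervalIntegrable).add ha
  refine ext_inner_left ℝ fun e => ?_
  have hp := intervalIntegrable_exp_smul (l := l) ha
  have hpe : IntervalIntegrable (fun τ => ⟪e, Real.exp (l * τ) • a τ⟫_ℝ) volume 0 s :=
    ⟨(innerSL ℝ e).integrable_comp hp.1, (innerSL ℝ e).integrable_comp hp.2⟩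
  have hsub : ∀ t ∈ uIcc 0 s, IntervalIntegrable (fun τ => Real.exp (l * τ) • a τ) volume 0 t :=
    fun t ht => hp.mono_set (uIcc_subset_uIcc left_mem_uIcc ht)
  set f : ℝ → ℝ := fun t => Real.exp (-(l * t)) with hf
  set g : ℝ → ℝ := fun t => ⟪e, c⟫_ℝ + ∫ τ in (0 : ℝ)..t, ⟪e, Real.exp (l * τ) • a τ⟫_ℝ with hg
  have hfd : ∀ t, HasDerivAt f (-l * f t) t := fun t => by
    have h : HasDerivAt (fun t => -(l * t)) (-l) t := by
      simpa using ((hasDerivAt_id t).const_mul l).fun_neg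
    rw [mul_comm]
    exact h.exp
  have hfac : AbsolutelyContinuousOnInterval f 0 s :=
    ContDiffOn.absolutelyContinuousOnInterval (by fun_prop)
  have hconst : AbsolutelyContinuousOnInterval (fun _ : ℝ => ⟪e, c⟫_ℝ) 0 s :=
    ContDiffOn.absolutelyContinuousOnInterval contDiffOn_const
  have hgac : AbsolutelyContinuousOnInterval g 0 s :=
    hconst.fun_add (hpe.absolutelyContinuousOnInterval_intervalIntegral left_mem_uIcc)
  have hgd : ∀ t ∈ uIcc 0 s, f t * g t = ⟪e, duhamel l c a t⟫_ℝ := fun t ht => by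
    have h1 : ∫ τ in (0 : ℝ)..t, ⟪e, Real.exp (l * τ) • a τ⟫_ℝ =
        ⟪e, ∫ τ in (0 : ℝ)..t, Real.exp (l * τ) • a τ⟫_ℝ :=
      (innerSL ℝ e).intervalIntegral_comp_comm (hsub t ht)
    rw [duhamel, inner_smul_right, inner_add_right, ← h1]
  have hmain := hfac.integral_deriv_mul_eq_sub hgac
  rw [hgd s right_mem_uIcc, hgd 0 left_mem_uIcc, duhamel_zero] at hmain
  have h2 : ∫ τ in (0 : ℝ)..s, ⟪e, -l • duhamel l c a τ + a τ⟫_ℝ =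
      ⟪e, ∫ τ in (0 : ℝ)..s, (-l • duhamel l c a τ + a τ)⟫_ℝ :=
    (innerSL ℝ e).intervalIntegral_comp_comm hI
  rw [inner_add_right, ← h2]
  have h3 : ∫ τ in (0 : ℝ)..s, (deriv f τ * g τ + f τ * deriv g τ) =
      ∫ τ in (0 : ℝ)..s, ⟪e, -l • duhamel l c a τ + a τ⟫_ℝ := by
    refine intervalIntegral.integral_congr_ae ?_
    filter_upwards [hpe.ae_hasDerivAt_integral] with τ hτ hτs
    have hτ' : τ ∈ uIcc 0 s := uIoc_subset_uIcc hτs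
    have h4 : deriv g τ = ⟪e, Real.exp (l * τ) • a τ⟫_ℝ :=
      ((hτ hτ' 0 left_mem_uIcc).const_add _).deriv
    rw [(hfd τ).deriv, h4, mul_assoc, hgd τ hτ', inner_add_right, inner_smul_right,
      inner_smul_right, ← mul_assoc, ← Real.exp_add, neg_add_cancel, Real.exp_zero, one_mul]
  linarith

/-- The weight changes the rate l to l - σ. On 0 < τ ≤ s the weighted propagator is exactly
`expKernel (l - σ) (s - τ)`, and the integral may be enlarged to all τ > 0. -/
lemma ofReal_exp_mul_enorm_duhamel_le {l σ : ℝ} (c : H) (a : ℝ → H) {s : ℝ}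
    (hs : 0 ≤ s) : ENNReal.ofReal (Real.exp (σ * s)) * ‖duhamel l c a s‖ₑ ≤
      ENNReal.ofReal (Real.exp (-((l - σ) * s))) * ‖c‖ₑ +
      ∫⁻ τ in Ioi (0 : ℝ), expKernel (l - σ) (s - τ) *
        (ENNReal.ofReal (Real.exp (σ * τ)) * ‖a τ‖ₑ) := by
  have e1 : ∀ t : ℝ, ‖Real.exp t‖ₑ = ENNReal.ofReal (Real.exp t) := fun t =>
    Real.enorm_of_nonneg (Real.exp_pos t).le
  have e2 : ENNReal.ofReal (Real.exp (σ * s)) * ENNReal.ofReal (Real.exp (-(l * s))) =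
      ENNReal.ofReal (Real.exp (-((l - σ) * s))) := by
    rw [← ENNReal.ofReal_mul (Real.exp_pos _).le, ← Real.exp_add]
    congr 2
    ring
  rw [duhamel, enorm_smul, e1, ← mul_assoc, e2]
  refine (mul_le_mul_right (enorm_add_le _ _) _).trans ?_
  rw [mul_add]
  gcongr
  rw [intervalIntegral.integral_of_le hs]
  refine (mul_le_mul_right (enorm_integral_le_lintegral_enorm _) _).trans ?_
  rw [← lintegral_const_mul' _ _ ENNReal.ofReal_ne_top]
  refine le_trans ?_ (lintegral_mono_set (fun τ hτ => hτ.1 : Ioc 0 s ⊆ Ioi 0))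
  refine setLIntegral_mono' measurableSet_Ioc fun τ hτ => ?_
  rw [enorm_smul, e1, ← mul_assoc, ← mul_assoc, expKernel, abs_of_nonneg (sub_nonneg.2 hτ.2),
    ← ENNReal.ofReal_mul (Real.exp_pos _).le, ← ENNReal.ofReal_mul (Real.exp_pos _).le,
    ← Real.exp_add, ← Real.exp_add]
  refine le_of_eq ?_
  congr 3
  ring

/-- This initial value cancels the integral over (0, s) and leaves minus the integral over (s, ∞),
so no homogeneous term remains. On τ > s the weighted propagator is the kernel with rate σ - l. -/
lemma ofReal_exp_mul_enorm_duhamel_le_of_backward {l σ : ℝ} {a : ℝ → H}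
    (ha : IntegrableOn (fun τ => Real.exp (l * τ) • a τ) (Ioi 0)) {s : ℝ} (hs : 0 ≤ s) :
    ENNReal.ofReal (Real.exp (σ * s)) *
      ‖duhamel l (-∫ τ in Ioi (0 : ℝ), Real.exp (l * τ) • a τ) a s‖ₑ ≤
      ∫⁻ τ in Ioi (0 : ℝ), expKernel (σ - l) (s - τ) *
        (ENNReal.ofReal (Real.exp (σ * τ)) * ‖a τ‖ₑ) := by
  have e1 : ∀ t : ℝ, ‖Real.exp t‖ₑ = ENNReal.ofReal (Real.exp t) := fun t =>
    Real.enorm_of_nonneg (Real.exp_pos t).le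
  have e2 : ENNReal.ofReal (Real.exp (σ * s)) * ENNReal.ofReal (Real.exp (-(l * s))) =
      ENNReal.ofReal (Real.exp ((σ - l) * s)) := by
    rw [← ENNReal.ofReal_mul (Real.exp_pos _).le, ← Real.exp_add]
    congr 2
    ring
  have e3 : -(∫ τ in Ioi (0 : ℝ), Real.exp (l * τ) • a τ) + ∫ τ in (0 : ℝ)..s, Real.exp (l * τ) • a τ
      = -∫ τ in Ioi s, Real.exp (l * τ) • a τ := by
    rw [← intervalIntegral.integral_Ioi_sub_Ioi ha hs]
    abel
  rw [duhamel, e3, enorm_smul, e1, ← mul_assoc, e2, enorm_neg]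
  refine (mul_le_mul_right (enorm_integral_le_lintegral_enorm _) _).trans ?_
  rw [← lintegral_const_mul' _ _ ENNReal.ofReal_ne_top]
  refine le_trans ?_ (lintegral_mono_set (Ioi_subset_Ioi hs))
  refine setLIntegral_mono' measurableSet_Ioi fun τ hτ => ?_
  rw [enorm_smul, e1, ← mul_assoc, ← mul_assoc, expKernel,
    abs_of_nonpos (sub_nonpos.2 (le_of_lt hτ)),
    ← ENNReal.ofReal_mul (Real.exp_pos _).le, ← ENNReal.ofReal_mul (Real.exp_pos _).le,
    ← Real.exp_add, ← Real.exp_add]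
  refine le_of_eq ?_
  congr 3
  ring

end Duhamel

/-! ### The linear problem -/

section Linear

variable {n : ℕ} [NeZero n]

lemma eigval_strictMono : StrictMono (eigval n) := fun i j hij => by
  have h := casEig_strictMono (n := n) hij
  have hn : (0 : ℝ) < n := by exact_mod_cast Nat.pos_of_ne_zero (NeZero.ne n)
  rw [eigval_eq, eigval_eq]
  gcongr

lemma neg_one_le_eigval (j : ℕ) : -1 ≤ eigval n j := by
  have hn : (0 : ℝ) < n := by exact_mod_cast Nat.pos_of_ne_zero (NeZero.ne n)
  have h := casEig_nonneg (n := n) j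
  rw [eigval_eq]
  have : 0 ≤ (2 * n : ℝ)⁻¹ * casEig n j := by positivity
  linarith

variable {k : ℕ} {σ : ℝ}

lemma eigval_lt_of_lt (hσ1 : eigval n (k - 1) < σ) {j : ℕ} (hj : j < k) : eigval n j < σ :=
  (eigval_strictMono.monotone (by omega)).trans_lt hσ1

lemma lt_eigval_of_le (hσ2 : σ < eigval n k) {j : ℕ} (hj : k ≤ j) : σ < eigval n j :=
  hσ2.trans_le (eigval_strictMono.monotone hj)

lemma abs_eigval_sub_pos (hσ1 : eigval n (k - 1) < σ) (hσ2 : σ < eigval n k) (j : ℕ) :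
    0 < |eigval n j - σ| := by
  refine abs_pos.2 (sub_ne_zero.2 ?_)
  rcases lt_or_ge j k with h | h
  · exact (eigval_lt_of_lt hσ1 h).ne
  · exact (lt_eigval_of_le hσ2 h).ne'

/-- Below k, |λ_j| ≤ 1 + σ while the distance to σ is at least σ - λ_{k-1}. From k on, λ_j - σ ≥ (1
- σ/λ_k) λ_j. -/
lemma exists_spectral_gap (hσ0 : 0 < σ) (hσ1 : eigval n (k - 1) < σ) (hσ2 : σ < eigval n k) :
    ∃ c : ℝ, 0 < c ∧ ∀ j, c * |eigval n j| ≤ |eigval n j - σ| := by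
  set a := (σ - eigval n (k - 1)) / (1 + σ) with ha
  set b := 1 - σ / eigval n k with hb
  have hk : 0 < eigval n k := hσ0.trans hσ2
  have ha0 : 0 < a := div_pos (sub_pos.2 hσ1) (by positivity)
  have hb0 : 0 < b := sub_pos.2 ((div_lt_one hk).2 hσ2)
  refine ⟨min a b, lt_min ha0 hb0, fun j => ?_⟩
  rcases lt_or_ge j k with h | h
  · have h1 := eigval_lt_of_lt hσ1 h
    have h2 := neg_one_le_eigval (n := n) j
    have h3 : eigval n j ≤ eigval n (k - 1) := eigval_strictMono.monotone (by omega)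
    have h4 : |eigval n j| ≤ 1 + σ := abs_le.2 ⟨by linarith, by linarith⟩
    calc min a b * |eigval n j| ≤ a * (1 + σ) := by
          gcongr
          exact min_le_left _ _
      _ = σ - eigval n (k - 1) := by rw [ha]; field_simp
      _ ≤ |eigval n j - σ| := by
          rw [abs_sub_comm]
          exact le_trans (by linarith) (le_abs_self _)
  · have h1 := lt_eigval_of_le hσ2 h
    have h3 : eigval n k ≤ eigval n j := eigval_strictMono.monotone h
    rw [abs_of_pos (hσ0.trans h1), abs_of_pos (sub_pos.2 h1)]
    calc min a b * eigval n j ≤ b * eigval n j := by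
          have := hσ0.trans h1
          gcongr
          exact min_le_right _ _
      _ = eigval n j - σ * (eigval n j / eigval n k) := by rw [hb]; ring
      _ ≤ eigval n j - σ * 1 := by
          gcongr
          exact (one_le_div hk).2 h3
      _ = _ := by ring

/-- The initial value of a component of the solution. -/
def solInit (k : ℕ) (u₀ : L2Sphere n) (g : ℝ → L2Sphere n) (j : ℕ) : L2Sphere n :=
  if k ≤ j then eigProj n j u₀
  else -∫ τ in Ioi (0 : ℝ), Real.exp (eigval n j * τ) • eigProj n j (g τ)

/-- The components of the solution. -/
def solComp (k : ℕ) (u₀ : L2Sphere n) (g : ℝ → L2Sphere n) (j : ℕ) (s : ℝ) : L2Sphere n :=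
  duhamel (eigval n j) (solInit k u₀ g j) (fun τ => eigProj n j (g τ)) s

/-- The solution of the linear problem. -/
def solPath (k : ℕ) (u₀ : L2Sphere n) (g : ℝ → L2Sphere n) (s : ℝ) : L2Sphere n :=
  ∑' j, solComp k u₀ g j s

/-- The square of the norm of a path in the weighted space `L²(e^{2σs} ds; H^m)`. -/
def weightSq (m : ℕ) (σ : ℝ) (g : ℝ → L2Sphere n) : ℝ≥0∞ :=
  ∫⁻ s in Ioi (0 : ℝ), (ENNReal.ofReal (Real.exp (σ * s)) * sobolevNorm m (g s)) ^ 2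

/-- The weighted size of a component of a path. -/
def weightComp (σ : ℝ) (g : ℝ → L2Sphere n) (j : ℕ) (τ : ℝ) : ℝ≥0∞ :=
  ENNReal.ofReal (Real.exp (σ * τ)) * ‖eigProj n j (g τ)‖ₑ

lemma sobolevNorm_sq' (l : ℕ) (u : L2Sphere n) :
    sobolevNorm l u ^ 2 = ∑' j, ENNReal.ofReal (|eigval n j| ^ l) * ‖eigProj n j u‖ₑ ^ 2 := by
  rw [sobolevNorm_sq]
  refine tsum_congr fun j => ?_
  rw [ENNReal.ofReal_mul (by positivity), ENNReal.ofReal_pow (norm_nonneg _), ofReal_norm]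

variable {m : ℕ} {g : ℝ → L2Sphere n} {u₀ : L2Sphere n}

lemma aemeasurable_weightComp (hg : AEStronglyMeasurable g (volume.restrict (Ioi 0))) (j : ℕ) :
    AEMeasurable (weightComp σ g j) (volume.restrict (Ioi 0)) := by
  have h : Measurable fun τ : ℝ => ENNReal.ofReal (Real.exp (σ * τ)) := by fun_prop
  exact h.aemeasurable.mul ((eigProj n j).continuous.comp_aestronglyMeasurable hg).enorm

lemma weightSq_eq (hg : AEStronglyMeasurable g (volume.restrict (Ioi 0))) :
    weightSq m σ g = ∑' j, ENNReal.ofReal (|eigval n j| ^ m) *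
      ∫⁻ τ in Ioi (0 : ℝ), weightComp σ g j τ ^ 2 := by
  rw [weightSq]
  have h : ∀ s, (ENNReal.ofReal (Real.exp (σ * s)) * sobolevNorm m (g s)) ^ 2 =
      ∑' j, ENNReal.ofReal (|eigval n j| ^ m) * weightComp σ g j s ^ 2 := fun s => by
    rw [mul_pow, sobolevNorm_sq', ← ENNReal.tsum_mul_left]
    refine tsum_congr fun j => ?_
    rw [weightComp, mul_pow]
    ring
  simp_rw [h]
  rw [lintegral_tsum fun j => ((aemeasurable_weightComp hg j).pow_const 2).const_mul _]
  exact tsum_congr fun j => lintegral_const_mul' _ _ ENNReal.ofReal_ne_top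

lemma lintegral_weightComp_ne_top (hg : AEStronglyMeasurable g (volume.restrict (Ioi 0)))
    (hgw : weightSq m σ g ≠ ⊤) (j : ℕ) : ∫⁻ τ in Ioi (0 : ℝ), weightComp σ g j τ ^ 2 ≠ ⊤ := by
  rw [weightSq_eq hg] at hgw
  have h1 := ENNReal.ne_top_of_tsum_ne_top hgw j
  -- No eigenvalue is zero, so the weighted sum controls every single mode.
  have h2 : ENNReal.ofReal (|eigval n j| ^ m) ≠ 0 :=
    (ENNReal.ofReal_pos.2 (pow_pos (abs_eigval_pos j) m)).ne'
  intro h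
  rw [h, ENNReal.mul_top h2] at h1
  exact h1 rfl

lemma memLp_two_of_sobolevNorm {g : ℝ → L2Sphere n}
    (hg : AEStronglyMeasurable g (volume.restrict (Ioi 0))) {l : ℕ}
    (h : ∫⁻ s in Ioi (0 : ℝ), sobolevNorm l (g s) ^ 2 ≠ ⊤) : MemLp g 2 (volume.restrict (Ioi 0)) := by
  refine ⟨hg, ?_⟩
  rw [eLpNorm_lt_top_iff_lintegral_rpow_enorm_lt_top two_ne_zero ENNReal.ofNat_ne_top]
  simp only [ENNReal.toReal_ofNat, ENNReal.rpow_two]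
  calc ∫⁻ s in Ioi (0 : ℝ), ‖g s‖ₑ ^ 2
      ≤ ∫⁻ s in Ioi (0 : ℝ), (ENNReal.ofReal (sobConst n) ^ l) ^ 2 * sobolevNorm l (g s) ^ 2 := by
        refine lintegral_mono fun s => ?_
        rw [← mul_pow, ← sobolevNorm_zero_left]
        exact pow_le_pow_left' (sobolevNorm_mono (Nat.zero_le l) (g s)) 2
    _ = (ENNReal.ofReal (sobConst n) ^ l) ^ 2 * ∫⁻ s in Ioi (0 : ℝ), sobolevNorm l (g s) ^ 2 :=
        lintegral_const_mul' _ _ (by finiteness)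
    _ < ⊤ := ENNReal.mul_lt_top (by finiteness) (lt_top_iff_ne_top.2 h)

lemma lintegral_sq_le_weightSq (hσ0 : 0 < σ) :
    ∫⁻ s in Ioi (0 : ℝ), sobolevNorm m (g s) ^ 2 ≤ weightSq m σ g := by
  refine setLIntegral_mono' measurableSet_Ioi fun s hs => pow_le_pow_left' ?_ 2
  refine le_mul_of_one_le_left' ?_
  rw [ENNReal.one_le_ofReal, Real.one_le_exp_iff]
  exact mul_nonneg hσ0.le (le_of_lt hs)

lemma MemLp.intervalIntegrable_zero {E : Type*} [NormedAddCommGroup E] {f : ℝ → E}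
    (hf : MemLp f 2 (volume.restrict (Ioi 0))) {s : ℝ} (hs : 0 ≤ s) :
    IntervalIntegrable f volume 0 s := by
  rw [intervalIntegrable_iff_integrableOn_Ioc_of_le hs]
  have : MemLp f 2 (volume.restrict (Ioc 0 s)) :=
    hf.mono_measure (Measure.restrict_mono (fun τ hτ => hτ.1) le_rfl)
  exact this.integrable one_le_two

lemma memLp_of_weightSq (hσ0 : 0 < σ) (hg : AEStronglyMeasurable g (volume.restrict (Ioi 0)))
    (hgw : weightSq m σ g ≠ ⊤) : MemLp g 2 (volume.restrict (Ioi 0)) :=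
  memLp_two_of_sobolevNorm hg (ne_top_of_le_ne_top hgw (lintegral_sq_le_weightSq hσ0))

lemma intervalIntegrable_eigProj (hσ0 : 0 < σ)
    (hg : AEStronglyMeasurable g (volume.restrict (Ioi 0))) (hgw : weightSq m σ g ≠ ⊤) (j : ℕ)
    {s : ℝ} (hs : 0 ≤ s) : IntervalIntegrable (fun τ => eigProj n j (g τ)) volume 0 s := by
  have h := MemLp.intervalIntegrable_zero (memLp_of_weightSq hσ0 hg hgw) hs
  exact ⟨(eigProj n j).integrable_comp h.1, (eigProj n j).integrable_comp h.2⟩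

/-- Write e^{λ_jτ} = e^{-(σ-λ_j)τ} e^{στ}: the first factor is the kernel at s = 0 and the second is
absorbed by the weighted L² norm. This is the convergence of the integral that defines T(0). -/
lemma integrableOn_exp_smul_eigProj (hg : AEStronglyMeasurable g (volume.restrict (Ioi 0)))
    (hgw : weightSq m σ g ≠ ⊤) {j : ℕ} (hj : eigval n j < σ) :
    IntegrableOn (fun τ => Real.exp (eigval n j * τ) • eigProj n j (g τ)) (Ioi 0) := by
  have hm : AEStronglyMeasurable (fun τ => Real.exp (eigval n j * τ) • eigProj n j (g τ))
      (volume.restrict (Ioi 0)) := by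
    have h : Continuous fun τ : ℝ => Real.exp (eigval n j * τ) := by fun_prop
    exact h.aestronglyMeasurable.smul ((eigProj n j).continuous.comp_aestronglyMeasurable hg)
  refine ⟨hm, ?_⟩
  have hκ := sub_pos.2 hj
  have h1 := sq_lintegral_expKernel_le_sup (aemeasurable_weightComp (σ := σ) hg j) hκ 0
  have h2 : (∫⁻ τ in Ioi (0 : ℝ), expKernel (σ - eigval n j) (0 - τ) * weightComp σ g j τ) < ⊤ := by
    have := h1.trans_lt (ENNReal.mul_lt_top ENNReal.ofReal_lt_top
      (lt_top_iff_ne_top.2 (lintegral_weightComp_ne_top hg hgw j)))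
    rw [lt_top_iff_ne_top] at this ⊢
    exact fun h => this (by rw [h]; rfl)
  refine lt_of_le_of_lt ?_ h2
  refine setLIntegral_mono' measurableSet_Ioi fun τ hτ => ?_
  rw [enorm_smul, Real.enorm_of_nonneg (Real.exp_pos _).le, weightComp, ← mul_assoc, expKernel,
    zero_sub, abs_neg, abs_of_pos hτ, ← ENNReal.ofReal_mul (Real.exp_pos _).le, ← Real.exp_add]
  refine le_of_eq ?_
  congr 3
  ring

lemma ofReal_exp_mul_enorm_solComp_le (hg : AEStronglyMeasurable g (volume.restrict (Ioi 0)))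
    (hgw : weightSq m σ g ≠ ⊤) (hσ1 : eigval n (k - 1) < σ) (hσ2 : σ < eigval n k) (j : ℕ) {s : ℝ}
    (hs : 0 ≤ s) :
    ENNReal.ofReal (Real.exp (σ * s)) * ‖solComp k u₀ g j s‖ₑ ≤
      ENNReal.ofReal (Real.exp (-(|eigval n j - σ| * s))) * ‖eigProj n j u₀‖ₑ +
      ∫⁻ τ in Ioi (0 : ℝ), expKernel |eigval n j - σ| (s - τ) * weightComp σ g j τ := by
  rw [solComp, solInit]
  split_ifs with h
  · rw [abs_of_pos (sub_pos.2 (lt_eigval_of_le hσ2 h))]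
    exact ofReal_exp_mul_enorm_duhamel_le _ _ hs
  · have hj := eigval_lt_of_lt hσ1 (not_le.1 h)
    rw [abs_sub_comm, abs_of_pos (sub_pos.2 hj)]
    exact (ofReal_exp_mul_enorm_duhamel_le_of_backward
      (integrableOn_exp_smul_eigProj hg hgw hj) hs).trans le_add_self

lemma continuousOn_solComp (hσ0 : 0 < σ) (hg : AEStronglyMeasurable g (volume.restrict (Ioi 0)))
    (hgw : weightSq m σ g ≠ ⊤) (j : ℕ) : ContinuousOn (solComp k u₀ g j) (Ici 0) := by
  intro s hs
  have h := continuousOn_duhamel (eigval n j) (solInit k u₀ g j)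
    (intervalIntegrable_eigProj hσ0 hg hgw j (s := s + 1) (by linarith [mem_Ici.1 hs]))
  rw [uIcc_of_le (by linarith [mem_Ici.1 hs])] at h
  refine (h s ⟨hs, by linarith⟩).mono_of_mem_nhdsWithin ?_
  rw [← Ici_inter_Iic]
  exact inter_mem self_mem_nhdsWithin (mem_nhdsWithin_of_mem_nhds (Iic_mem_nhds (by linarith)))

/-- The constant in the estimates for the linear problem. -/
def linConst (c : ℝ) : ℝ≥0∞ := ENNReal.ofReal (2 + 6 / c + 8 / c ^ 2)

lemma ofReal_pow_succ_mul_le {a b c : ℝ} (hc : 0 < c) (hb : 0 < b) (ha : 0 ≤ a) (hab : c * a ≤ b)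
    (q : ℝ) (hq : 0 ≤ q) (l : ℕ) :
    ENNReal.ofReal (a ^ (l + 1)) * ENNReal.ofReal (q / b) ≤
      ENNReal.ofReal (q / c) * ENNReal.ofReal (a ^ l) := by
  rw [← ENNReal.ofReal_mul (by positivity), ← ENNReal.ofReal_mul (by positivity)]
  refine ENNReal.ofReal_le_ofReal ?_
  rw [pow_succ, div_mul_eq_mul_div, mul_div_assoc', div_le_div_iff₀ hb hc]
  have : 0 ≤ q * a ^ l := by positivity
  nlinarith

/-- Sum the scalar bounds over the modes. Since |λ_j - σ| ≥ c|λ_j|, each factor 1/|λ_j - σ| is worth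
one power of |λ_j|, which is one order of the Sobolev norm: one order for g in the supremum, two for
g and one for u₀ in L² of time. `linConst` dominates the numerical factors 2, 4/c, 2/c and 8/c² that
occur. -/
lemma tsum_solComp_le {c : ℝ} (hc : 0 < c) (hcl : ∀ j, c * |eigval n j| ≤ |eigval n j - σ|)
    (hg : AEStronglyMeasurable g (volume.restrict (Ioi 0))) (hgw : weightSq m σ g ≠ ⊤)
    (hσ1 : eigval n (k - 1) < σ) (hσ2 : σ < eigval n k) :
    (∀ s, 0 ≤ s → ∑' j, ENNReal.ofReal (|eigval n j| ^ (m + 1)) *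
        (ENNReal.ofReal (Real.exp (σ * s)) * ‖solComp k u₀ g j s‖ₑ) ^ 2 ≤
      linConst c * (sobolevNorm (m + 1) u₀ ^ 2 + weightSq m σ g)) ∧
    ∑' j, ∫⁻ s in Ioi (0 : ℝ), ENNReal.ofReal (|eigval n j| ^ (m + 2)) *
        (ENNReal.ofReal (Real.exp (σ * s)) * ‖solComp k u₀ g j s‖ₑ) ^ 2 ≤
      linConst c * (sobolevNorm (m + 1) u₀ ^ 2 + weightSq m σ g) := by
  have hb : ∀ j, _ := fun j => bounds_of_le_expKernel (aemeasurable_weightComp (σ := σ) hg j)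
    (abs_eigval_sub_pos hσ1 hσ2 j) (fun s hs =>
      ofReal_exp_mul_enorm_solComp_le (u₀ := u₀) hg hgw hσ1 hσ2 j hs)
  have hX : sobolevNorm (m + 1) u₀ ^ 2 + weightSq m σ g =
      ∑' j, (ENNReal.ofReal (|eigval n j| ^ (m + 1)) * ‖eigProj n j u₀‖ₑ ^ 2 +
        ENNReal.ofReal (|eigval n j| ^ m) * ∫⁻ τ in Ioi (0 : ℝ), weightComp σ g j τ ^ 2) := by
    rw [sobolevNorm_sq', weightSq_eq hg, ENNReal.tsum_add]
  have hD1 : (2 : ℝ≥0∞) ≤ linConst c := by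
    rw [linConst, ← ENNReal.ofReal_ofNat 2]
    refine ENNReal.ofReal_le_ofReal ?_
    have : 0 ≤ 6 / c + 8 / c ^ 2 := by positivity
    linarith
  have hD2 : ENNReal.ofReal (6 / c) ≤ linConst c := by
    refine ENNReal.ofReal_le_ofReal ?_
    have : 0 ≤ 8 / c ^ 2 := by positivity
    linarith
  have hD3 : ENNReal.ofReal (8 / c ^ 2) ≤ linConst c := by
    refine ENNReal.ofReal_le_ofReal ?_
    have : 0 ≤ 6 / c := by positivity
    linarith
  have h2 : ∀ q : ℝ, 0 ≤ q → 2 * ENNReal.ofReal q = ENNReal.ofReal (2 * q) := fun q hq => by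
    rw [ENNReal.ofReal_mul zero_le_two, ENNReal.ofReal_ofNat]
  rw [hX, ← ENNReal.tsum_mul_left]
  refine ⟨fun s hs => ENNReal.tsum_le_tsum fun j => ?_, ENNReal.tsum_le_tsum fun j => ?_⟩
  · have hκ := abs_eigval_sub_pos hσ1 hσ2 j
    have h3 := ofReal_pow_succ_mul_le hc hκ (abs_nonneg _) (hcl j) 2 zero_le_two m
    refine (mul_le_mul_right ((hb j).1 s hs) _).trans ?_
    set w := ∫⁻ τ in Ioi (0 : ℝ), weightComp σ g j τ ^ 2
    set x := ‖eigProj n j u₀‖ₑ ^ 2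
    calc _ = 2 * (ENNReal.ofReal (|eigval n j| ^ (m + 1)) * x) +
          2 * (ENNReal.ofReal (|eigval n j| ^ (m + 1)) *
            ENNReal.ofReal (2 / |eigval n j - σ|)) * w := by ring
      _ ≤ linConst c * (ENNReal.ofReal (|eigval n j| ^ (m + 1)) * x) +
          2 * (ENNReal.ofReal (2 / c) * ENNReal.ofReal (|eigval n j| ^ m)) * w := by gcongr
      _ = linConst c * (ENNReal.ofReal (|eigval n j| ^ (m + 1)) * x) +
          ENNReal.ofReal (4 / c) * (ENNReal.ofReal (|eigval n j| ^ m) * w) := by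
          rw [← mul_assoc 2, h2 _ (by positivity)]
          rw [show 2 * (2 / c) = 4 / c by ring]
          ring
      _ ≤ linConst c * (ENNReal.ofReal (|eigval n j| ^ (m + 1)) * x) +
          linConst c * (ENNReal.ofReal (|eigval n j| ^ m) * w) := by
          gcongr
          refine le_trans (ENNReal.ofReal_le_ofReal ?_) hD2
          gcongr
          norm_num
      _ = _ := by ring
  · have hκ := abs_eigval_sub_pos hσ1 hσ2 j
    have h3 := ofReal_pow_succ_mul_le hc hκ (abs_nonneg _) (hcl j) 2 zero_le_two m
    have h4 := ofReal_pow_succ_mul_le hc hκ (abs_nonneg _) (hcl j) 2 zero_le_two (m + 1)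
    have h5 := ofReal_pow_succ_mul_le hc hκ (abs_nonneg _) (hcl j) 1 zero_le_one (m + 1)
    rw [lintegral_const_mul' _ _ ENNReal.ofReal_ne_top]
    refine (mul_le_mul_right (hb j).2 _).trans ?_
    set w := ∫⁻ τ in Ioi (0 : ℝ), weightComp σ g j τ ^ 2
    set x := ‖eigProj n j u₀‖ₑ ^ 2
    calc _ = 2 * (ENNReal.ofReal (|eigval n j| ^ (m + 1 + 1)) *
            ENNReal.ofReal (1 / |eigval n j - σ|)) * x +
          2 * ((ENNReal.ofReal (|eigval n j| ^ (m + 1 + 1)) *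
            ENNReal.ofReal (2 / |eigval n j - σ|)) * ENNReal.ofReal (2 / |eigval n j - σ|)) * w := by
          ring
      _ ≤ 2 * (ENNReal.ofReal (1 / c) * ENNReal.ofReal (|eigval n j| ^ (m + 1))) * x +
          2 * ((ENNReal.ofReal (2 / c) * ENNReal.ofReal (|eigval n j| ^ (m + 1))) *
            ENNReal.ofReal (2 / |eigval n j - σ|)) * w := by gcongr
      _ = 2 * (ENNReal.ofReal (1 / c) * ENNReal.ofReal (|eigval n j| ^ (m + 1))) * x +
          2 * (ENNReal.ofReal (2 / c) * (ENNReal.ofReal (|eigval n j| ^ (m + 1)) *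
            ENNReal.ofReal (2 / |eigval n j - σ|))) * w := by ring
      _ ≤ 2 * (ENNReal.ofReal (1 / c) * ENNReal.ofReal (|eigval n j| ^ (m + 1))) * x +
          2 * (ENNReal.ofReal (2 / c) * (ENNReal.ofReal (2 / c) *
            ENNReal.ofReal (|eigval n j| ^ m))) * w := by gcongr
      _ = ENNReal.ofReal (2 / c) * (ENNReal.ofReal (|eigval n j| ^ (m + 1)) * x) +
          ENNReal.ofReal (8 / c ^ 2) * (ENNReal.ofReal (|eigval n j| ^ m) * w) := by
          rw [show (8 / c ^ 2 : ℝ) = 2 * (2 / c * (2 / c)) by field_simp; norm_num,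
            show (2 / c : ℝ) = 2 * (1 / c) by ring, ENNReal.ofReal_mul zero_le_two,
            ENNReal.ofReal_mul zero_le_two, ENNReal.ofReal_ofNat,
            ENNReal.ofReal_mul (p := 2 * (1 / c)) (by positivity), ENNReal.ofReal_mul zero_le_two,
            ENNReal.ofReal_ofNat]
          ring
      _ ≤ linConst c * (ENNReal.ofReal (|eigval n j| ^ (m + 1)) * x) +
          linConst c * (ENNReal.ofReal (|eigval n j| ^ m) * w) := by
          gcongr
          refine le_trans (ENNReal.ofReal_le_ofReal ?_) hD2
          gcongr
          norm_num
      _ = _ := by ring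

/-! ### Assembly of the components into a path. -/

lemma integral_mem_eigenspaceE {α : Type*} [MeasurableSpace α] (μ : Measure α) {j : ℕ}
    {f : α → L2Sphere n} (hf : ∀ a, f a ∈ eigenspaceE n j) : ∫ a, f a ∂μ ∈ eigenspaceE n j := by
  by_cases h : Integrable f μ
  · have h1 := (eigProj n j).integral_comp_comm h
    simp only [eigProj_eq_self (hf _)] at h1
    rw [h1]
    exact eigProj_mem j _
  · rw [integral_undef h]
    exact zero_mem _

lemma solComp_mem (k : ℕ) (u₀ : L2Sphere n) (g : ℝ → L2Sphere n) (j : ℕ) (s : ℝ) :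
    solComp k u₀ g j s ∈ eigenspaceE n j := by
  have h : ∀ τ : ℝ, Real.exp (eigval n j * τ) • eigProj n j (g τ) ∈ eigenspaceE n j := fun τ =>
    Submodule.smul_mem _ _ (eigProj_mem j _)
  refine Submodule.smul_mem _ _ (add_mem ?_ (sub_mem (integral_mem_eigenspaceE _ h)
    (integral_mem_eigenspaceE _ h)))
  rw [solInit]
  split_ifs
  · exact eigProj_mem j u₀
  · exact neg_mem (integral_mem_eigenspaceE _ h)

/-- The data of the linear problem: a spectral gap, and admissible initial values and
inhomogeneities. -/
structure LinearData (k m : ℕ) (σ c : ℝ) (u₀ : L2Sphere n) (g : ℝ → L2Sphere n) : Prop where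
  pos : 0 < σ
  lower : eigval n (k - 1) < σ
  upper : σ < eigval n k
  gap_pos : 0 < c
  gap : ∀ j, c * |eigval n j| ≤ |eigval n j - σ|
  measurable : AEStronglyMeasurable g (volume.restrict (Ioi 0))
  weight : weightSq m σ g ≠ ⊤
  initial : sobolevNorm (m + 1) u₀ ≠ ⊤

namespace LinearData

variable {c : ℝ}

lemma bound_ne_top (h : LinearData k m σ c u₀ g) :
    linConst c * (sobolevNorm (m + 1) u₀ ^ 2 + weightSq m σ g) ≠ ⊤ :=
  ENNReal.mul_ne_top ENNReal.ofReal_ne_top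
    (ENNReal.add_ne_top.2 ⟨ENNReal.pow_ne_top h.initial, h.weight⟩)

lemma summable_solComp (h : LinearData k m σ c u₀ g) {s : ℝ} (hs : 0 ≤ s) :
    Summable fun j => solComp k u₀ g j s := by
  refine summable_of_mem_eigenspaceE (fun j => solComp_mem k u₀ g j s) ?_
  have h1 := (tsum_solComp_le (u₀ := u₀) h.gap_pos h.gap h.measurable h.weight h.lower h.upper).1
    s hs
  have h2 : ∑' j, ‖solComp k u₀ g j s‖ₑ ^ 2 ≠ ⊤ := by
    refine ne_top_of_le_ne_top (ENNReal.mul_ne_top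
      (ENNReal.ofReal_ne_top (r := (9 * n : ℝ) ^ (m + 1)))
      (ne_top_of_le_ne_top h.bound_ne_top h1)) ?_
    rw [← ENNReal.tsum_mul_left]
    refine ENNReal.tsum_le_tsum fun j => ?_
    rw [← mul_assoc, ← ENNReal.ofReal_mul (by positivity), ← mul_pow]
    refine le_mul_of_one_le_of_le ?_ (pow_le_pow_left' (le_mul_of_one_le_left' ?_) 2)
    · rw [ENNReal.one_le_ofReal]
      exact one_le_pow₀ (one_le_abs_eigval j)
    · rw [ENNReal.one_le_ofReal, Real.one_le_exp_iff]
      exact mul_nonneg h.pos.le hs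
  have h3 := ENNReal.summable_toReal h2
  refine h3.congr fun j => ?_
  rw [ENNReal.toReal_pow, toReal_enorm]

lemma eigProj_solPath (h : LinearData k m σ c u₀ g) {s : ℝ} (hs : 0 ≤ s) (i : ℕ) :
    eigProj n i (solPath k u₀ g s) = solComp k u₀ g i s :=
  eigProj_tsum (fun j => solComp_mem k u₀ g j s) (h.summable_solComp hs) i

lemma aestronglyMeasurable_solComp (h : LinearData k m σ c u₀ g) (j : ℕ) :
    AEStronglyMeasurable (solComp k u₀ g j) (volume.restrict (Ioi 0)) :=
  ((continuousOn_solComp h.pos h.measurable h.weight j).mono Ioi_subset_Ici_self).aestronglyMeasurable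
    measurableSet_Ioi

lemma aestronglyMeasurable_solPath (h : LinearData k m σ c u₀ g) :
    AEStronglyMeasurable (solPath k u₀ g) (volume.restrict (Ioi 0)) := by
  refine aestronglyMeasurable_of_tendsto_ae atTop
    (f := fun J s => ∑ j ∈ Finset.range J, solComp k u₀ g j s)
    (fun J => Finset.aestronglyMeasurable_fun_sum _ fun j _ => h.aestronglyMeasurable_solComp j) ?_
  filter_upwards [ae_restrict_mem measurableSet_Ioi] with s hs
  exact (h.summable_solComp (le_of_lt hs)).hasSum.tendsto_sum_nat

/-- Stated for any path T with the given components, so that it applies also to the difference of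
two solutions. -/
lemma sq_sup_le (h : LinearData k m σ c u₀ g) {T : ℝ → L2Sphere n}
    (hT : ∀ s, 0 ≤ s → ∀ j, eigProj n j (T s) = solComp k u₀ g j s) {s : ℝ} (hs : 0 ≤ s) :
    (ENNReal.ofReal (Real.exp (σ * s)) * sobolevNorm (m + 1) (T s)) ^ 2 ≤
      linConst c * (sobolevNorm (m + 1) u₀ ^ 2 + weightSq m σ g) := by
  refine le_trans (le_of_eq ?_) ((tsum_solComp_le h.gap_pos h.gap h.measurable h.weight h.lower
    h.upper).1 s hs)
  rw [mul_pow, sobolevNorm_sq', ← ENNReal.tsum_mul_left]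
  refine tsum_congr fun j => ?_
  rw [hT s hs, mul_pow]
  ring

lemma lintegral_sq_le (h : LinearData k m σ c u₀ g) {T : ℝ → L2Sphere n}
    (hT : ∀ s, 0 ≤ s → ∀ j, eigProj n j (T s) = solComp k u₀ g j s) :
    ∫⁻ s in Ioi (0 : ℝ), sobolevNorm (m + 2) (T s) ^ 2 ≤
      linConst c * (sobolevNorm (m + 1) u₀ ^ 2 + weightSq m σ g) := by
  refine le_trans ?_ (tsum_solComp_le h.gap_pos h.gap h.measurable h.weight h.lower h.upper).2
  have hm : Measurable fun s : ℝ => ENNReal.ofReal (Real.exp (σ * s)) := by fun_prop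
  have hmeas : ∀ j, AEMeasurable (fun s => ENNReal.ofReal (|eigval n j| ^ (m + 2)) *
      (ENNReal.ofReal (Real.exp (σ * s)) * ‖solComp k u₀ g j s‖ₑ) ^ 2)
      (volume.restrict (Ioi 0)) := fun j => ((hm.aemeasurable.mul
    (h.aestronglyMeasurable_solComp j).enorm).pow_const 2).const_mul _
  rw [← lintegral_tsum hmeas]
  refine setLIntegral_mono' measurableSet_Ioi fun s hs => ?_
  rw [sobolevNorm_sq']
  refine ENNReal.tsum_le_tsum fun j => ?_
  rw [hT s (le_of_lt hs)]
  refine mul_le_mul_right (pow_le_pow_left' (le_mul_of_one_le_left' ?_) 2) _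
  rw [ENNReal.one_le_ofReal, Real.one_le_exp_iff]
  exact mul_nonneg h.pos.le (le_of_lt hs)

lemma le_rpow_half_of_sq_le {a b : ℝ≥0∞} (h : a ^ 2 ≤ b) : a ≤ b ^ (1 / 2 : ℝ) := by
  rw [← ENNReal.rpow_two] at h
  have := ENNReal.rpow_le_rpow h (z := 1 / 2) (by norm_num)
  rwa [← ENNReal.rpow_mul, mul_one_div_cancel two_ne_zero, ENNReal.rpow_one] at this

lemma pathNorm_le (h : LinearData k m σ c u₀ g) {T : ℝ → L2Sphere n}
    (hT : ∀ s, 0 ≤ s → ∀ j, eigProj n j (T s) = solComp k u₀ g j s) :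
    pathNorm (m + 1) σ T ≤
      2 * (linConst c * (sobolevNorm (m + 1) u₀ ^ 2 + weightSq m σ g)) ^ (1 / 2 : ℝ) := by
  rw [pathNorm, two_mul]
  refine add_le_add (ENNReal.rpow_le_rpow (h.lintegral_sq_le hT) (by norm_num))
    (iSup₂_le fun s hs => ?_)
  exact le_rpow_half_of_sq_le (h.sq_sup_le hT hs)

end LinearData

/-! ### The initial value, existence and uniqueness. -/

lemma eigProj_of_mem_spaceF {u : L2Sphere n} (hu : u ∈ spaceF n k) {j : ℕ} (hj : j < k) :
    eigProj n j u = 0 := by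
  have h : spaceF n k ≤ LinearMap.ker (eigProj n j : L2Sphere n →ₗ[ℝ] L2Sphere n) := by
    refine Submodule.topologicalClosure_minimal _ (iSup₂_le fun i hi w hw => ?_)
      (eigProj n j).isClosed_ker
    exact eigProj_of_ne (by omega) hw
  exact h hu

lemma eigProj_projF {w : L2Sphere n} {j : ℕ} (hj : j < k) : eigProj n j (projF n k w) = 0 :=
  haveI : CompleteSpace (spaceF n k) := Submodule.topologicalClosure.completeSpace _
  eigProj_of_mem_spaceF (Submodule.starProjection_apply_mem (spaceF n k) w) hj

lemma backwardLow_eq (τ : ℝ) (w : L2Sphere n) : backwardLow n k τ w =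
    ∑ j ∈ Finset.range k, Real.exp (eigval n j * τ) • eigProj n j w := by
  refine Finset.sum_congr rfl fun j hj => ?_
  rw [map_sub, eigProj_projF (Finset.mem_range.1 hj), sub_zero]

lemma eigProj_sum_range_of_mem {x : ℕ → L2Sphere n} (hx : ∀ j, x j ∈ eigenspaceE n j) (i : ℕ) :
    eigProj n i (∑ j ∈ Finset.range k, x j) = if i < k then x i else 0 := by
  have h2 : ∀ j, eigProj n i (x j) = if i = j then x j else 0 := by
    intro j
    split_ifs with hij
    · subst hij
      exact eigProj_eq_self (hx i)
    · exact eigProj_of_ne (Ne.symm hij) (hx j)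
  rw [map_sum, Finset.sum_congr rfl fun j _ => h2 j, Finset.sum_ite_eq]
  simp only [Finset.mem_range]

namespace LinearData

variable {c : ℝ}

/-- Compare modes: u₀ has no components below k, and the integral of `backwardLow` has none from k
on. -/
lemma solPath_zero (h : LinearData k m σ c u₀ g) (hu₀ : u₀ ∈ spaceF n k) :
    IntegrableOn (fun τ => backwardLow n k τ (g τ)) (Ioi (0 : ℝ)) ∧
      solPath k u₀ g 0 = u₀ - ∫ τ in Ioi (0 : ℝ), backwardLow n k τ (g τ) := by
  have h1 : ∀ j ∈ Finset.range k, IntegrableOn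
      (fun τ => Real.exp (eigval n j * τ) • eigProj n j (g τ)) (Ioi 0) := fun j hj =>
    integrableOn_exp_smul_eigProj h.measurable h.weight
      (eigval_lt_of_lt h.lower (Finset.mem_range.1 hj))
  simp only [backwardLow_eq]
  refine ⟨integrable_finsetSum _ h1, eq_of_eigProj_eq fun i => ?_⟩
  have hmem : ∀ j, ∫ τ in Ioi (0 : ℝ), Real.exp (eigval n j * τ) • eigProj n j (g τ) ∈
      eigenspaceE n j := fun j => integral_mem_eigenspaceE (volume.restrict (Ioi (0 : ℝ))) (j := j)
      (f := fun τ => Real.exp (eigval n j * τ) • eigProj n j (g τ))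
      fun τ => Submodule.smul_mem _ _ (eigProj_mem j _)
  have h0 : eigProj n i (solPath k u₀ g 0) = solInit k u₀ g i :=
    (h.eigProj_solPath le_rfl i).trans (duhamel_zero _ _ _)
  rw [h0, integral_finsetSum _ h1, map_sub, eigProj_sum_range_of_mem hmem, solInit]
  by_cases h3 : i < k
  · rw [if_pos h3, eigProj_of_mem_spaceF hu₀ h3]
    rw [if_neg (by omega), zero_sub]
  · rw [if_neg h3, sub_zero]
    rw [if_pos (by omega)]

/-- The path `solPath` solves the initial value problem. -/
theorem isSolutionPath (h : LinearData k m σ c u₀ g) (hm : n + 1 ≤ 2 * m) (hu₀ : u₀ ∈ spaceF n k)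
    {N : QuasilinearTerm n} {v : ℝ → L2Sphere n}
    (hv : ∀ᵐ τ ∂(volume.restrict (Ioi (0 : ℝ))), N.IsValue (v τ) (g τ)) :
    IsSolutionPath N k u₀ v (solPath k u₀ g) := by
  classical
  set T := solPath k u₀ g with hTdef
  have hT : ∀ s, 0 ≤ s → ∀ j, eigProj n j (T s) = solComp k u₀ g j s := fun s hs j =>
    h.eigProj_solPath hs j
  have hL := h.lintegral_sq_le hT
  have hfin : ∀ᵐ s ∂(volume.restrict (Ioi (0 : ℝ))), sobolevNorm (m + 2) (T s) ≠ ⊤ := by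
    have h1 := ae_lt_top' ((aemeasurable_sobolevNorm (m + 2)
      h.aestronglyMeasurable_solPath).pow_const 2) (ne_top_of_le_ne_top h.bound_ne_top hL)
    filter_upwards [h1] with s hs hs'
    rw [← hTdef, hs'] at hs
    simp at hs
  -- H is L T, chosen at the times where it exists and zero at the others. Almost every time is of
  -- the first kind, since there T has finite norm of order m + 2 and is therefore C².
  set H : ℝ → L2Sphere n := fun s => if hs : ∃ w, IsValueL (T s) w then hs.choose else 0 with hH
  have hval : ∀ᵐ s ∂(volume.restrict (Ioi (0 : ℝ))), IsValueL (T s) (H s) := by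
    filter_upwards [hfin] with s hs
    obtain ⟨U, hU, hTU, -⟩ := exists_isSphereFun_two hm hs
    have hex := hU.exists_isValueL hTU
    simp only [hH, dif_pos hex]
    exact hex.choose_spec
  have hHj : ∀ᵐ s ∂(volume.restrict (Ioi (0 : ℝ))), ∀ j,
      eigProj n j (H s) = -eigval n j • solComp k u₀ g j s := by
    filter_upwards [hval, ae_restrict_mem measurableSet_Ioi] with s hs hs0 j
    rw [hs.eigProj_eq j, hT s (le_of_lt hs0)]
  have hHm : AEStronglyMeasurable H (volume.restrict (Ioi (0 : ℝ))) := by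
    refine aestronglyMeasurable_of_tendsto_ae atTop
      (f := fun J s => ∑ j ∈ Finset.range J, -eigval n j • solComp k u₀ g j s)
      (fun J => Finset.aestronglyMeasurable_fun_sum _ fun j _ =>
        (h.aestronglyMeasurable_solComp j).fun_const_smul _) ?_
    filter_upwards [hHj] with s hs
    have := (hasSum_eigProj (H s)).tendsto_sum_nat
    simpa only [hs] using this
  have hH2 : MemLp H 2 (volume.restrict (Ioi (0 : ℝ))) := by
    refine memLp_two_of_sobolevNorm (l := 0) hHm ?_
    have hle : ∫⁻ s in Ioi (0 : ℝ), sobolevNorm 0 (H s) ^ 2 ≤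
        ∫⁻ s in Ioi (0 : ℝ), (ENNReal.ofReal (sobConst n) ^ (m + 2 - 2)) ^ 2 *
          sobolevNorm (m + 2) (T s) ^ 2 := by
      refine lintegral_mono_ae ?_
      filter_upwards [hHj, ae_restrict_mem measurableSet_Ioi] with s hs hs0
      -- The norms are defined through |L|, so the L² norm of L T is exactly the norm of T of order
      -- 2, which order m + 2 controls.
      have e : sobolevNorm 0 (H s) ^ 2 = sobolevNorm 2 (T s) ^ 2 := by
        rw [sobolevNorm_sq', sobolevNorm_sq']
        refine tsum_congr fun j => ?_
        rw [hs j, hT s (le_of_lt hs0), enorm_smul, mul_pow, pow_zero, ENNReal.ofReal_one, one_mul,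
          enorm_neg, ENNReal.ofReal_pow (abs_nonneg _), Real.enorm_eq_ofReal_abs]
      rw [e, ← mul_pow]
      exact pow_le_pow_left' (sobolevNorm_mono (by omega) _) 2
    refine ne_top_of_le_ne_top ?_ hle
    rw [lintegral_const_mul' _ _ (by finiteness)]
    exact ENNReal.mul_ne_top (by finiteness) (ne_top_of_le_ne_top h.bound_ne_top hL)
  have hg2 := memLp_of_weightSq h.pos h.measurable h.weight
  obtain ⟨hB1, hB2⟩ := h.solPath_zero hu₀
  refine ⟨g, H, hv, hval, fun s hs => ?_, hB1, hB2⟩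
  have hI : IntervalIntegrable (fun τ => H τ + g τ) volume 0 s :=
    (MemLp.intervalIntegrable_zero hH2 hs).add (MemLp.intervalIntegrable_zero hg2 hs)
  -- In each mode the integrated equation is Duhamel's formula, with L acting as -λ_j.
  refine ⟨hI, eq_of_eigProj_eq fun j => ?_⟩
  rw [map_add, hT s hs, hT 0 le_rfl, ← (eigProj n j).intervalIntegral_comp_comm hI]
  have h1 := duhamel_eq_integral (eigval n j) (solInit k u₀ g j)
    (intervalIntegrable_eigProj h.pos h.measurable h.weight j hs)
  have h2 : solComp k u₀ g j 0 = solInit k u₀ g j := duhamel_zero _ _ _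
  rw [h2]
  refine h1.trans ?_
  congr 1
  rw [intervalIntegral.integral_of_le hs, intervalIntegral.integral_of_le hs]
  refine integral_congr_ae ?_
  have h3 := ae_mono (Measure.restrict_mono (fun τ hτ => hτ.1 : Ioc 0 s ⊆ Ioi 0) le_rfl) hHj
  filter_upwards [h3] with τ hτ
  rw [map_add, hτ j]
  rfl

end LinearData

/-- The strong solution of the initial value problem is unique. -/
theorem IsSolutionPath.eqOn {N : QuasilinearTerm n} {v T₁ T₂ : ℝ → L2Sphere n}
    (hT₁ : IsSolutionPath N k u₀ v T₁) (hT₂ : IsSolutionPath N k u₀ v T₂) :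
    EqOn T₁ T₂ (Ici 0) := by
  obtain ⟨g₁, h₁, hg₁, hh₁, hi₁, -, hz₁⟩ := hT₁
  obtain ⟨g₂, h₂, hg₂, hh₂, hi₂, -, hz₂⟩ := hT₂
  have hg : ∀ᵐ τ ∂(volume.restrict (Ioi (0 : ℝ))), g₁ τ = g₂ τ := by
    filter_upwards [hg₁, hg₂] with τ a b using a.unique b
  have h0 : T₁ 0 = T₂ 0 := by
    rw [hz₁, hz₂]
    congr 1
    refine integral_congr_ae ?_
    filter_upwards [hg] with τ hτ
    rw [hτ]
  intro b hb'
  have hb : (0 : ℝ) ≤ b := hb'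
  refine eq_of_eigProj_eq fun j => sub_eq_zero.1 ?_
  rw [← map_sub]
  -- In mode j the inhomogeneities cancel, since N(v) is unique. The difference x of the solutions
  -- thus has x(0) = 0 and derivative -l x almost everywhere, and Grönwall's inequality on [0, b]
  -- gives x = 0.
  set l := eigval n j
  set x : ℝ → L2Sphere n := fun s => eigProj n j (T₁ s - T₂ s) with hx
  set y : ℝ → L2Sphere n := fun τ => eigProj n j ((h₁ τ + g₁ τ) - (h₂ τ + g₂ τ)) with hy
  have hyI : ∀ s, 0 ≤ s → IntervalIntegrable y volume 0 s := fun s hs => by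
    have h := (hi₁ s hs).1.sub (hi₂ s hs).1
    exact ⟨(eigProj n j).integrable_comp h.1, (eigProj n j).integrable_comp h.2⟩
  have hxy : ∀ s, 0 ≤ s → x s = ∫ τ in (0 : ℝ)..s, y τ := fun s hs => by
    have h := (hi₁ s hs).1.sub (hi₂ s hs).1
    rw [hx, hy, (eigProj n j).intervalIntegral_comp_comm h,
      intervalIntegral.integral_sub (hi₁ s hs).1 (hi₂ s hs).1]
    dsimp only
    rw [(hi₁ s hs).2, (hi₂ s hs).2, h0]
    congr 1
    abel
  have hyx : ∀ᵐ τ ∂(volume.restrict (Ioi (0 : ℝ))), y τ = -l • x τ := by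
    filter_upwards [hg, hh₁, hh₂] with τ a b c
    rw [hy, hx]
    dsimp only
    rw [a, add_sub_add_right_eq_sub, map_sub, map_sub, b.eigProj_eq, c.eigProj_eq, ← smul_sub]
  have hxc : ContinuousOn x (Icc 0 b) := by
    have h := intervalIntegral.continuousOn_primitive_interval' (hyI b hb) left_mem_uIcc
    rw [uIcc_of_le hb] at h
    exact h.congr fun s hs => hxy s hs.1
  -- Extending x from [0, b] to a continuous function on the line makes its primitive F
  -- differentiable everywhere; F agrees with x on [0, b].
  set z : ℝ → L2Sphere n := IccExtend hb ((Icc 0 b).domRestrict x) with hz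
  have hzc : Continuous z := (continuousOn_iff_continuous_domRestrict.1 hxc).Icc_extend'
  have hzx : ∀ s ∈ Icc 0 b, z s = x s := fun s hs => by
    rw [hz, IccExtend_of_mem _ _ hs]; rfl
  set F : ℝ → L2Sphere n := fun s => ∫ τ in (0 : ℝ)..s, -l • z τ with hF
  have hFd : ∀ s, HasDerivAt F (-l • z s) s := fun s =>
    ((hzc.const_smul (-l)).integral_hasStrictDerivAt 0 s).hasDerivAt
  have hFx : ∀ s ∈ Icc 0 b, F s = x s := fun s hs => by
    rw [hxy s hs.1, hF]
    dsimp only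
    rw [intervalIntegral.integral_of_le hs.1, intervalIntegral.integral_of_le hs.1]
    refine integral_congr_ae ?_
    have h3 := ae_mono (Measure.restrict_mono (fun τ hτ => hτ.1 : Ioc 0 s ⊆ Ioi 0) le_rfl) hyx
    filter_upwards [h3, ae_restrict_mem measurableSet_Ioc] with τ hτ hτs
    rw [hτ, hzx τ ⟨hτs.1.le, hτs.2.trans hs.2⟩]
  have h := eq_zero_of_abs_deriv_le_mul_abs_self_of_eq_zero_right (f := F) (K := |l|)
    (fun s _ => (hFd s).continuousAt.continuousWithinAt)
    (fun s _ => (hFd s).hasDerivWithinAt) (by simp [hF])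
    (fun s hs => by
      rw [hFx s ⟨hs.1, hs.2.le⟩, hzx s ⟨hs.1, hs.2.le⟩, norm_smul, norm_neg, Real.norm_eq_abs])
    b (right_mem_Icc.2 hb)
  rw [hFx b (right_mem_Icc.2 hb)] at h
  exact h

end Linear

/-! ### The path spaces -/

section Paths

variable {n : ℕ} [NeZero n] {r : ℕ} {σ : ℝ}

lemma pathNorm_congr {v w : ℝ → L2Sphere n} (h : EqOn v w (Ici 0)) :
    pathNorm r σ v = pathNorm r σ w := by
  have h1 : ∫⁻ s in Ioi (0 : ℝ), sobolevNorm (r + 1) (v s) ^ 2 =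
      ∫⁻ s in Ioi (0 : ℝ), sobolevNorm (r + 1) (w s) ^ 2 :=
    setLIntegral_congr_fun measurableSet_Ioi fun s hs => by
      rw [h (Ioi_subset_Ici_self hs)]
  rw [pathNorm, pathNorm, h1]
  congr 1
  exact iSup_congr fun s => iSup_congr fun hs => by rw [h (mem_Ici.2 hs)]

lemma pathNorm_zero : pathNorm r σ (0 : ℝ → L2Sphere n) = 0 := by
  simp [pathNorm, sobolevNorm_zero_right]

lemma zero_mem_pathBall (δ : ℝ) : (0 : ℝ → L2Sphere n) ∈ pathBall n r σ δ :=
  ⟨aestronglyMeasurable_const, by rw [pathNorm_zero]; exact zero_le⟩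

lemma exp_mul_sobolevNorm_le_pathNorm (v : ℝ → L2Sphere n) {s : ℝ} (hs : 0 ≤ s) :
    ENNReal.ofReal (Real.exp (σ * s)) * sobolevNorm r (v s) ≤ pathNorm r σ v :=
  (le_iSup₂ (f := fun s (_ : (0 : ℝ) ≤ s) =>
    ENNReal.ofReal (Real.exp (σ * s)) * sobolevNorm r (v s)) s hs).trans le_add_self

lemma sobolevNorm_le_pathNorm (hσ : 0 < σ) (v : ℝ → L2Sphere n) {s : ℝ} (hs : 0 ≤ s) :
    sobolevNorm r (v s) ≤ pathNorm r σ v := by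
  refine (le_mul_of_one_le_left' ?_).trans (exp_mul_sobolevNorm_le_pathNorm v hs)
  rw [ENNReal.one_le_ofReal, Real.one_le_exp_iff]
  exact mul_nonneg hσ.le hs

lemma lintegral_sq_le_pathNorm_sq (v : ℝ → L2Sphere n) :
    ∫⁻ s in Ioi (0 : ℝ), sobolevNorm (r + 1) (v s) ^ 2 ≤ pathNorm r σ v ^ 2 := by
  have h : (∫⁻ s in Ioi (0 : ℝ), sobolevNorm (r + 1) (v s) ^ 2) ^ (1 / 2 : ℝ) ≤
    pathNorm r σ v := le_self_add
  refine le_trans (le_of_eq ?_) (pow_le_pow_left' h 2)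
  rw [← ENNReal.rpow_two, ← ENNReal.rpow_mul, one_div_mul_cancel two_ne_zero, ENNReal.rpow_one]

lemma enorm_le_pathNorm (hσ : 0 < σ) (v : ℝ → L2Sphere n) {s : ℝ} (hs : 0 ≤ s) :
    ‖v s‖ₑ ≤ ENNReal.ofReal (sobConst n) ^ r * pathNorm r σ v := by
  rw [← sobolevNorm_zero_left]
  refine (sobolevNorm_mono (Nat.zero_le r) _).trans ?_
  rw [Nat.sub_zero]
  gcongr
  exact sobolevNorm_le_pathNorm hσ v hs

lemma sobolevNorm_le_liminf (l : ℕ) {v : ℕ → L2Sphere n} {u : L2Sphere n}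
    (h : Tendsto v atTop (𝓝 u)) :
    sobolevNorm l u ≤ liminf (fun i => sobolevNorm l (v i)) atTop := by
  have hcl : ∀ b, IsClosed {w : L2Sphere n | sobolevNorm l w ≤ b} := fun b =>
    IsSeqClosed.isClosed fun x w hx hw =>
      sobolevNorm_le_of_tendsto hw tendsto_const_nhds (Eventually.of_forall hx)
  have hlsc : LowerSemicontinuous (sobolevNorm (n := n) l) :=
    lowerSemicontinuous_iff_isClosed_preimage.2 hcl
  exact (lowerSemicontinuousAt_iff_le_liminf.1 (hlsc u)).trans (liminf_le_liminf_of_le h)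

lemma ennreal_liminf_add_le (a b : ℕ → ℝ≥0∞) :
    liminf a atTop + liminf b atTop ≤ liminf (fun i => a i + b i) atTop := by
  simp only [liminf_eq_iSup_iInf_of_nat]
  rw [ENNReal.iSup_add_iSup_of_monotone]
  · refine iSup_mono fun N => le_iInf₂ fun i hi => add_le_add (iInf₂_le i hi) (iInf₂_le i hi)
  · exact fun N M h => le_iInf₂ fun i hi => iInf₂_le i (h.trans hi)
  · exact fun N M h => le_iInf₂ fun i hi => iInf₂_le i (h.trans hi)

/-- The norm of the path space is lower semicontinuous under pointwise convergence. -/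
lemma pathNorm_le_of_tendsto {v : ℕ → ℝ → L2Sphere n} {w : ℝ → L2Sphere n} {A : ℝ≥0∞}
    (hv : ∀ i, AEStronglyMeasurable (v i) (volume.restrict (Ioi (0 : ℝ))))
    (h : ∀ s, 0 ≤ s → Tendsto (fun i => v i s) atTop (𝓝 (w s)))
    (hA : ∀ᶠ i in atTop, pathNorm r σ (v i) ≤ A) : pathNorm r σ w ≤ A := by
  have hpow : Monotone fun x : ℝ≥0∞ => x ^ 2 := fun _ _ hab => pow_le_pow_left' hab 2
  have hroot : Monotone fun x : ℝ≥0∞ => x ^ (1 / 2 : ℝ) := fun _ _ hab =>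
    ENNReal.rpow_le_rpow hab (by norm_num)
  have h1 : (∫⁻ s in Ioi (0 : ℝ), sobolevNorm (r + 1) (w s) ^ 2) ^ (1 / 2 : ℝ) ≤
      liminf (fun i => (∫⁻ s in Ioi (0 : ℝ), sobolevNorm (r + 1) (v i s) ^ 2) ^ (1 / 2 : ℝ))
        atTop := by
    have e := hroot.map_liminf_of_continuousAt (F := atTop)
      (fun i => ∫⁻ s in Ioi (0 : ℝ), sobolevNorm (r + 1) (v i s) ^ 2)
      (ENNReal.continuous_rpow_const.continuousAt)
    refine le_trans (hroot ?_) (le_of_eq e)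
    refine le_trans (setLIntegral_mono' measurableSet_Ioi fun s hs => ?_)
      (lintegral_liminf_le' fun i => (aemeasurable_sobolevNorm (r + 1) (hv i)).pow_const 2)
    have e' := hpow.map_liminf_of_continuousAt (F := atTop)
      (fun i => sobolevNorm (r + 1) (v i s)) ((ENNReal.continuous_pow 2).continuousAt)
    exact le_trans (hpow (sobolevNorm_le_liminf (r + 1) (h s (le_of_lt hs)))) (le_of_eq e')
  have h2 : (⨆ s : ℝ, ⨆ _ : 0 ≤ s, ENNReal.ofReal (Real.exp (σ * s)) * sobolevNorm r (w s)) ≤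
      liminf (fun i => ⨆ s : ℝ, ⨆ _ : 0 ≤ s,
        ENNReal.ofReal (Real.exp (σ * s)) * sobolevNorm r (v i s)) atTop := by
    refine iSup₂_le fun s hs => ?_
    have hmul : Monotone fun x : ℝ≥0∞ => ENNReal.ofReal (Real.exp (σ * s)) * x := fun _ _ hab =>
      mul_le_mul_right hab _
    have e := hmul.map_liminf_of_continuousAt (F := atTop) (fun i => sobolevNorm r (v i s))
      ((ENNReal.continuous_const_mul ENNReal.ofReal_ne_top).continuousAt)
    refine le_trans (hmul (sobolevNorm_le_liminf r (h s hs))) (le_trans (le_of_eq e) ?_)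
    exact liminf_le_liminf (Eventually.of_forall fun i => le_iSup₂ (f := fun s (_ : (0 : ℝ) ≤ s) =>
      ENNReal.ofReal (Real.exp (σ * s)) * sobolevNorm r (v i s)) s hs)
  refine (add_le_add h1 h2).trans ?_
  refine le_trans (ennreal_liminf_add_le _ _) ?_
  exact (liminf_le_limsup).trans (limsup_le_of_le (h := hA))

/-- A contraction of the ball of the path space has exactly one fixed point. -/
theorem exists_unique_fixed_path (hσ : 0 < σ) {δ q : ℝ} (hq : q < 1)
    {T : (ℝ → L2Sphere n) → ℝ → L2Sphere n}
    (hmaps : MapsTo T (pathBall n r σ δ) (pathBall n r σ δ))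
    (hT : ∀ v ∈ pathBall n r σ δ, ∀ w ∈ pathBall n r σ δ,
      pathNorm r σ (T v - T w) ≤ ENNReal.ofReal q * pathNorm r σ (v - w)) :
    ∃ v ∈ pathBall n r σ δ, EqOn (T v) v (Ici 0) ∧
      ∀ w ∈ pathBall n r σ δ, EqOn (T w) w (Ici 0) → EqOn w v (Ici 0) := by
  -- Picard iterates from zero. Any other orbit in the ball starts within δ of x 0 = 0, so its
  -- distance from x after j steps is at most D j = q^j δ. Existence and uniqueness both follow from
  -- this comparison.
  set x : ℕ → ℝ → L2Sphere n := fun j => T^[j] 0 with hx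
  have hxs : ∀ j, x (j + 1) = T (x j) := fun j => Function.iterate_succ_apply' T j 0
  have hxB : ∀ j, x j ∈ pathBall n r σ δ := fun j => by
    induction j with
    | zero => exact zero_mem_pathBall δ
    | succ j ih => rw [hxs]; exact hmaps ih
  set D : ℕ → ℝ≥0∞ := fun j => ENNReal.ofReal q ^ j * ENNReal.ofReal δ with hD
  have hD0 : Tendsto D atTop (𝓝 0) := by
    have h1 : ENNReal.ofReal q < 1 := by
      rw [← ENNReal.ofReal_one]; exact (ENNReal.ofReal_lt_ofReal_iff one_pos).2 hq
    have h := ENNReal.Tendsto.mul_const (ENNReal.tendsto_pow_atTop_nhds_zero_of_lt_one h1)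
      (b := ENNReal.ofReal δ) (Or.inr ENNReal.ofReal_ne_top)
    rwa [zero_mul] at h
  -- approximate orbits of the contraction
  have horb : ∀ y : ℕ → ℝ → L2Sphere n, (∀ j, y j ∈ pathBall n r σ δ) →
      (∀ j, EqOn (T (y j)) (y (j + 1)) (Ici 0)) →
      ∀ j, pathNorm r σ (y j - x j) ≤ D j := by
    intro y hy hTy j
    induction j with
    | zero =>
      have : y 0 - x 0 = y 0 := sub_zero _
      rw [this, hD]
      simpa using (hy 0).2
    | succ j ih =>
      have e : pathNorm r σ (y (j + 1) - x (j + 1)) = pathNorm r σ (T (y j) - T (x j)) :=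
        pathNorm_congr fun s hs => by
          rw [Pi.sub_apply, Pi.sub_apply, hTy j hs, hxs]
      rw [e]
      refine (hT _ (hy j) _ (hxB j)).trans ?_
      rw [hD]
      dsimp only
      rw [pow_succ', mul_assoc]
      gcongr
  set K : ℝ≥0∞ := ENNReal.ofReal (sobConst n) ^ r with hK
  have hKD : Tendsto (fun j => K * D j) atTop (𝓝 0) := by
    have h := ENNReal.Tendsto.const_mul hD0 (a := K)
      (Or.inr (ENNReal.pow_ne_top ENNReal.ofReal_ne_top))
    rwa [mul_zero] at h
  have hclose : ∀ (y : ℕ → ℝ → L2Sphere n), (∀ j, pathNorm r σ (y j - x j) ≤ D j) →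
      ∀ s, 0 ≤ s → Tendsto (fun j => ‖y j s - x j s‖ₑ) atTop (𝓝 0) := fun y hy s hs =>
    tendsto_of_tendsto_of_tendsto_of_le_of_le tendsto_const_nhds hKD (fun _ => zero_le) fun j =>
      (enorm_le_pathNorm hσ (y j - x j) hs).trans (mul_le_mul_right (hy j) _)
  have hcauchy : ∀ s, 0 ≤ s → ∃ a, Tendsto (fun j => x j s) atTop (𝓝 a) := by
    intro s hs
    refine cauchySeq_tendsto_of_complete (EMetric.cauchySeq_iff_le_tendsto_0.2
      ⟨fun j => K * D j + K * D j, fun i j N hi hj => ?_, ?_⟩)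
    · have key : ∀ i, N ≤ i → edist (x i s) (x N s) ≤ K * D N := fun i hi => by
        obtain ⟨p, rfl⟩ := Nat.exists_eq_add_of_le hi
        rw [edist_eq_enorm_sub]
        -- The shifted sequence x (· + p) is again an orbit in the ball; its comparison with x is
        -- the Cauchy estimate.
        have := horb (fun j => x (j + p)) (fun j => hxB _) (fun j s _ => by
          rw [← hxs, Nat.add_right_comm]) N
        exact (enorm_le_pathNorm hσ (x (N + p) - x N) hs).trans (mul_le_mul_right this _)
      exact (edist_triangle_right _ _ _).trans (add_le_add (key i hi) (key j hj))
    · simpa using hKD.add hKD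
  choose! v hv using hcauchy
  have hvm : AEStronglyMeasurable v (volume.restrict (Ioi (0 : ℝ))) := by
    refine aestronglyMeasurable_of_tendsto_ae atTop (fun j => (hxB j).1) ?_
    filter_upwards [ae_restrict_mem measurableSet_Ioi] with s hs using hv s (le_of_lt hs)
  have hvB : v ∈ pathBall n r σ δ :=
    ⟨hvm, pathNorm_le_of_tendsto (fun j => (hxB j).1) hv (Eventually.of_forall fun j => (hxB j).2)⟩
  have hvx : ∀ j, pathNorm r σ (v - x j) ≤ D j := by
    intro j
    refine pathNorm_le_of_tendsto (v := fun p => x (j + p) - x j)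
      (fun p => (hxB _).1.sub (hxB j).1) (fun s hs => ?_) (Eventually.of_forall fun p => ?_)
    · have h1 : Tendsto (fun p => x (j + p) s) atTop (𝓝 (v s)) := by
        have := (hv s hs).comp (tendsto_add_atTop_nat j)
        refine this.congr fun p => ?_
        rw [Function.comp_apply, add_comm]
      exact h1.sub tendsto_const_nhds
    · exact horb (fun j => x (j + p)) (fun j => hxB _) (fun j s _ => by
          rw [← hxs, Nat.add_right_comm]) j
  have hlim : ∀ y : ℕ → ℝ → L2Sphere n, (∀ j, pathNorm r σ (y j - x j) ≤ D j) →
      ∀ s, 0 ≤ s → Tendsto (fun j => y j s) atTop (𝓝 (v s)) := fun y hy s hs => by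
    have h1 : Tendsto (fun j => y j s - x j s) atTop (𝓝 0) := by
      rw [tendsto_iff_edist_tendsto_0]
      simpa only [edist_zero_right] using hclose y hy s hs
    simpa using h1.add (hv s hs)
  refine ⟨v, hvB, fun s hs => ?_, fun w hw hTw s hs => ?_⟩
  · have h1 : Tendsto (fun j => ‖T v s - x (j + 1) s‖ₑ) atTop (𝓝 0) := by
      refine tendsto_of_tendsto_of_tendsto_of_le_of_le tendsto_const_nhds
        (hKD.comp (tendsto_add_atTop_nat 1)) (fun _ => zero_le) fun j => ?_
      refine (enorm_le_pathNorm hσ (T v - x (j + 1)) hs).trans (mul_le_mul_right ?_ _)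
      rw [hxs]
      refine (hT _ hvB _ (hxB j)).trans ?_
      rw [hD]
      dsimp only
      rw [pow_succ', mul_assoc]
      gcongr
      exact hvx j
    have h2 : Tendsto (fun j => x (j + 1) s) atTop (𝓝 (T v s)) := by
      rw [tendsto_iff_edist_tendsto_0]
      simpa only [edist_eq_enorm_sub, enorm_sub_rev] using h1
    exact tendsto_nhds_unique h2 ((hv s hs).comp (tendsto_add_atTop_nat 1))
  -- A fixed path is a constant orbit, so it is the limit v of every orbit.
  · exact tendsto_nhds_unique tendsto_const_nhds
      (hlim (fun _ => w) (horb (fun _ => w) (fun _ => hw) fun _ => hTw) s hs)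

end Paths

/-! ### The nonlinear problem -/

section Nonlinear

variable {n : ℕ} [NeZero n] {m k : ℕ} {σ : ℝ}

lemma ae_of_mem_pathBall (hσ : 0 < σ) {δ η : ℝ} (hδ : δ ≤ η) {v : ℝ → L2Sphere n}
    (hv : v ∈ pathBall n (m + 1) σ δ) :
    ∀ᵐ s ∂(volume.restrict (Ioi (0 : ℝ))), sobolevNorm (m + 2) (v s) ≠ ⊤ ∧
      sobolevNorm (m + 1) (v s) ≤ ENNReal.ofReal η := by
  have hfin : pathNorm (m + 1) σ v ^ 2 ≠ ⊤ :=
    ENNReal.pow_ne_top (ne_top_of_le_ne_top ENNReal.ofReal_ne_top hv.2)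
  have h1 := ae_lt_top' ((aemeasurable_sobolevNorm (m + 2) hv.1).pow_const 2)
    (ne_top_of_le_ne_top hfin (lintegral_sq_le_pathNorm_sq v))
  filter_upwards [h1, ae_restrict_mem measurableSet_Ioi] with s hs hs0
  refine ⟨fun h => ?_, (sobolevNorm_le_pathNorm hσ v (le_of_lt hs0)).trans
    (hv.2.trans (ENNReal.ofReal_le_ofReal hδ))⟩
  rw [h] at hs
  simp at hs

/-- The quadratic difference estimate in weighted spaces of paths, from the pointwise one. -/
lemma weightSq_sub_le {g v w : ℝ → L2Sphere n} {C : ℝ≥0∞}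
    (hv : AEStronglyMeasurable v (volume.restrict (Ioi (0 : ℝ))))
    (hw : AEStronglyMeasurable w (volume.restrict (Ioi (0 : ℝ))))
    (hg : ∀ᵐ s ∂(volume.restrict (Ioi (0 : ℝ))), sobolevNorm m (g s) ≤ C *
      ((sobolevNorm (m + 1) (v s) + sobolevNorm (m + 1) (w s)) * sobolevNorm (m + 2) (v s - w s) +
        (sobolevNorm (m + 2) (v s) + sobolevNorm (m + 2) (w s)) *
          sobolevNorm (m + 1) (v s - w s))) :
    weightSq m σ g ≤ (3 * C * (pathNorm (m + 1) σ v + pathNorm (m + 1) σ w) *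
      pathNorm (m + 1) σ (v - w)) ^ 2 := by
  set A := pathNorm (m + 1) σ v
  set B := pathNorm (m + 1) σ w
  set D := pathNorm (m + 1) σ (v - w)
  set a : ℝ → ℝ≥0∞ := fun s => sobolevNorm (m + 2) (v s)
  set b : ℝ → ℝ≥0∞ := fun s => sobolevNorm (m + 2) (w s)
  set d : ℝ → ℝ≥0∞ := fun s => sobolevNorm (m + 2) (v s - w s)
  have ham : AEMeasurable (fun s => a s ^ 2) (volume.restrict (Ioi 0)) :=
    (aemeasurable_sobolevNorm (m + 2) hv).pow_const 2
  have hdm : AEMeasurable (fun s => d s ^ 2) (volume.restrict (Ioi 0)) :=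
    (aemeasurable_sobolevNorm (m + 2) (hv.sub hw)).pow_const 2
  have ha : ∫⁻ s in Ioi (0 : ℝ), a s ^ 2 ≤ A ^ 2 := lintegral_sq_le_pathNorm_sq v
  have hb : ∫⁻ s in Ioi (0 : ℝ), b s ^ 2 ≤ B ^ 2 := lintegral_sq_le_pathNorm_sq w
  have hd : ∫⁻ s in Ioi (0 : ℝ), d s ^ 2 ≤ D ^ 2 := lintegral_sq_le_pathNorm_sq (v - w)
  have hpt : ∀ᵐ s ∂(volume.restrict (Ioi (0 : ℝ))),
      (ENNReal.ofReal (Real.exp (σ * s)) * sobolevNorm m (g s)) ^ 2 ≤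
        2 * C ^ 2 * (A + B) ^ 2 * d s ^ 2 +
          (4 * C ^ 2 * D ^ 2 * a s ^ 2 + 4 * C ^ 2 * D ^ 2 * b s ^ 2) := by
    filter_upwards [hg, ae_restrict_mem measurableSet_Ioi] with s hs hs0
    set e := ENNReal.ofReal (Real.exp (σ * s))
    have h1 : e * sobolevNorm (m + 1) (v s) ≤ A :=
      exp_mul_sobolevNorm_le_pathNorm v (le_of_lt hs0)
    have h2 : e * sobolevNorm (m + 1) (w s) ≤ B :=
      exp_mul_sobolevNorm_le_pathNorm w (le_of_lt hs0)
    have h3 : e * sobolevNorm (m + 1) (v s - w s) ≤ D :=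
      exp_mul_sobolevNorm_le_pathNorm (v - w) (le_of_lt hs0)
    -- The exponential weight is given to the factors of order m + 1, where the supremum part of the
    -- path norm absorbs it; the factors of order m + 2 remain unweighted and are square integrable.
    have h4 : e * sobolevNorm m (g s) ≤ C * ((A + B) * d s + (a s + b s) * D) := by
      calc e * sobolevNorm m (g s) ≤ e * (C *
            ((sobolevNorm (m + 1) (v s) + sobolevNorm (m + 1) (w s)) * d s +
              (a s + b s) * sobolevNorm (m + 1) (v s - w s))) := mul_le_mul_right hs e
        _ = C * ((e * sobolevNorm (m + 1) (v s) + e * sobolevNorm (m + 1) (w s)) * d s +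
              (a s + b s) * (e * sobolevNorm (m + 1) (v s - w s))) := by ring
        _ ≤ C * ((A + B) * d s + (a s + b s) * D) := by gcongr
    calc (e * sobolevNorm m (g s)) ^ 2 ≤ (C * ((A + B) * d s + (a s + b s) * D)) ^ 2 :=
          pow_le_pow_left' h4 2
      _ = C ^ 2 * ((A + B) * d s + (a s + b s) * D) ^ 2 := mul_pow _ _ _
      _ ≤ C ^ 2 * (2 * (((A + B) * d s) ^ 2 + ((a s + b s) * D) ^ 2)) := by
          gcongr; exact add_sq_le_two_mul _ _
      _ = C ^ 2 * (2 * (((A + B) * d s) ^ 2 + (a s + b s) ^ 2 * D ^ 2)) := by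
          rw [mul_pow (a s + b s)]
      _ ≤ C ^ 2 * (2 * (((A + B) * d s) ^ 2 + 2 * (a s ^ 2 + b s ^ 2) * D ^ 2)) := by
          gcongr; exact add_sq_le_two_mul _ _
      _ = _ := by ring
  refine (lintegral_mono_ae hpt).trans ?_
  rw [lintegral_add_left' (hdm.const_mul _), lintegral_add_left' (ham.const_mul _),
    lintegral_const_mul'' _ hdm, lintegral_const_mul'' _ ham,
    lintegral_const_mul'' _ ((aemeasurable_sobolevNorm (m + 2) hw).pow_const 2)]
  calc 2 * C ^ 2 * (A + B) ^ 2 * (∫⁻ s in Ioi (0 : ℝ), d s ^ 2) +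
        (4 * C ^ 2 * D ^ 2 * (∫⁻ s in Ioi (0 : ℝ), a s ^ 2) +
          4 * C ^ 2 * D ^ 2 * ∫⁻ s in Ioi (0 : ℝ), b s ^ 2)
      ≤ 2 * C ^ 2 * (A + B) ^ 2 * D ^ 2 +
        (4 * C ^ 2 * D ^ 2 * A ^ 2 + 4 * C ^ 2 * D ^ 2 * B ^ 2) := by gcongr
    _ ≤ (3 * C * (A + B) * D) ^ 2 := by
        -- The nonnegative gap between the two sides is exhibited as an explicit summand, in place
        -- of a subtraction in `ℝ≥0∞`.
        have : 2 * C ^ 2 * (A + B) ^ 2 * D ^ 2 +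
            (4 * C ^ 2 * D ^ 2 * A ^ 2 + 4 * C ^ 2 * D ^ 2 * B ^ 2) +
            (C ^ 2 * D ^ 2 * (3 * A ^ 2 + 14 * A * B + 3 * B ^ 2)) =
            (3 * C * (A + B) * D) ^ 2 := by ring
        rw [← this]
        exact le_self_add

lemma weightSq_sub_ne_top {g₁ g₂ : ℝ → L2Sphere n}
    (hg₁ : AEStronglyMeasurable g₁ (volume.restrict (Ioi 0)))
    (hw₁ : weightSq m σ g₁ ≠ ⊤) (hw₂ : weightSq m σ g₂ ≠ ⊤) :
    weightSq m σ (fun s => g₁ s - g₂ s) ≠ ⊤ := by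
  have hm : AEMeasurable (fun s => (ENNReal.ofReal (Real.exp (σ * s)) * sobolevNorm m (g₁ s)) ^ 2)
      (volume.restrict (Ioi 0)) := by
    have h : Measurable fun s : ℝ => ENNReal.ofReal (Real.exp (σ * s)) := by fun_prop
    exact (h.aemeasurable.mul (aemeasurable_sobolevNorm m hg₁)).pow_const 2
  have hle : weightSq m σ (fun s => g₁ s - g₂ s) ≤ 2 * (weightSq m σ g₁ + weightSq m σ g₂) := by
    rw [weightSq, weightSq, weightSq, ← lintegral_add_left' hm,
      ← lintegral_const_mul' _ _ (by finiteness)]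
    refine lintegral_mono fun s => (pow_le_pow_left' ?_ 2).trans (add_sq_le_two_mul _ _)
    rw [← mul_add]
    gcongr
    exact sobolevNorm_sub_le m _ _
  exact ne_top_of_le_ne_top (ENNReal.mul_ne_top (by finiteness)
    (ENNReal.add_ne_top.2 ⟨hw₁, hw₂⟩)) hle

lemma solComp_sub (hσ0 : 0 < σ) (hσ1 : eigval n (k - 1) < σ) {u₀ : L2Sphere n}
    {g₁ g₂ : ℝ → L2Sphere n} (hg₁ : AEStronglyMeasurable g₁ (volume.restrict (Ioi 0)))
    (hg₂ : AEStronglyMeasurable g₂ (volume.restrict (Ioi 0)))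
    (hw₁ : weightSq m σ g₁ ≠ ⊤) (hw₂ : weightSq m σ g₂ ≠ ⊤) (j : ℕ) {s : ℝ} (hs : 0 ≤ s) :
    solComp k u₀ g₁ j s - solComp k u₀ g₂ j s = solComp k 0 (fun τ => g₁ τ - g₂ τ) j s := by
  have h1 := intervalIntegrable_exp_smul (l := eigval n j)
    (intervalIntegrable_eigProj hσ0 hg₁ hw₁ j hs)
  have h2 := intervalIntegrable_exp_smul (l := eigval n j)
    (intervalIntegrable_eigProj hσ0 hg₂ hw₂ j hs)
  have h3 : solInit k u₀ g₁ j - solInit k u₀ g₂ j =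
      solInit k 0 (fun τ => g₁ τ - g₂ τ) j := by
    simp only [solInit]
    split_ifs with h
    · rw [sub_self, map_zero]
    · have hj := eigval_lt_of_lt hσ1 (not_le.1 h)
      simp only [map_sub, smul_sub]
      rw [integral_sub (integrableOn_exp_smul_eigProj hg₁ hw₁ hj)
        (integrableOn_exp_smul_eigProj hg₂ hw₂ hj)]
      abel
  simp only [solComp, duhamel]
  rw [← h3]
  simp only [map_sub, smul_sub]
  rw [intervalIntegral.integral_sub h1 h2, ← smul_sub]
  congr 1
  abel

lemma two_mul_rpow_half_le {K e X : ℝ≥0∞} (hK : 1 ≤ K) :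
    2 * (K * (e ^ 2 + X ^ 2)) ^ (1 / 2 : ℝ) ≤ 2 * K * e + 2 * K * X := by
  have h : K * (e ^ 2 + X ^ 2) ≤ (K * (e + X)) ^ 2 := by
    calc K * (e ^ 2 + X ^ 2) ≤ K * K * (e ^ 2 + X ^ 2 + 2 * e * X) :=
          mul_le_mul' (le_mul_of_one_le_left' hK) le_self_add
      _ = (K * (e + X)) ^ 2 := by ring
  have h2 := ENNReal.rpow_le_rpow h (z := 1 / 2) (by norm_num)
  rw [← ENNReal.rpow_two (K * (e + X)), ← ENNReal.rpow_mul, mul_one_div_cancel two_ne_zero,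
    ENNReal.rpow_one] at h2
  calc 2 * (K * (e ^ 2 + X ^ 2)) ^ (1 / 2 : ℝ) ≤ 2 * (K * (e + X)) := by gcongr
    _ = _ := by ring

lemma one_le_linConst {c : ℝ} (hc : 0 < c) : 1 ≤ linConst c := by
  rw [linConst, ENNReal.one_le_ofReal]
  have : 0 ≤ 6 / c + 8 / c ^ 2 := by positivity
  linarith

/-- The solution operator of the linearized problem on a small ball of the path space. -/
theorem QuasilinearTerm.exists_solution_operator (N : QuasilinearTerm n) (hm : n + 1 ≤ 2 * m)
    (hσ0 : 0 < σ) (hσ1 : eigval n (k - 1) < σ) (hσ2 : σ < eigval n k) :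
    ∃ η C K : ℝ, 0 < η ∧ 0 < C ∧ 0 < K ∧ ∀ u₀ ∈ spaceF n k, sobolevNorm (m + 1) u₀ ≠ ⊤ →
      ∃ T : (ℝ → L2Sphere n) → ℝ → L2Sphere n, ∀ δ ≤ η, ∀ v ∈ pathBall n (m + 1) σ δ,
        IsSolutionPath N k u₀ v (T v) ∧
        AEStronglyMeasurable (T v) (volume.restrict (Ioi (0 : ℝ))) ∧
        pathNorm (m + 1) σ (T v) ≤ ENNReal.ofReal K * sobolevNorm (m + 1) u₀ +
          ENNReal.ofReal C * pathNorm (m + 1) σ v ^ 2 ∧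
        ∀ w ∈ pathBall n (m + 1) σ δ, pathNorm (m + 1) σ (T v - T w) ≤
          ENNReal.ofReal C * (pathNorm (m + 1) σ v + pathNorm (m + 1) σ w) *
            pathNorm (m + 1) σ (v - w) := by
  obtain ⟨η, C, Φ, hη, hC, hΦ0, hval, hdiff, hmeas⟩ := N.exists_sobolev_estimate hm
  obtain ⟨c, hc, hgap⟩ := exists_spectral_gap hσ0 hσ1 hσ2
  set κ : ℝ := 2 + 6 / c + 8 / c ^ 2 with hκ
  have hκ0 : 0 < κ := by positivity
  have hlin : linConst c = ENNReal.ofReal κ := rfl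
  have hκ1 := one_le_linConst hc
  -- The constant is 2κ · 3C: the factor 2κ comes from taking square roots in the linear estimate
  -- (`two_mul_rpow_half_le`, as κ ≥ 1), the factor 3C from `weightSq_sub_le`.
  have hC1 : ENNReal.ofReal (6 * κ * C) = 6 * linConst c * ENNReal.ofReal C := by
    rw [ENNReal.ofReal_mul (by positivity), ENNReal.ofReal_mul (by positivity), hlin,
      ENNReal.ofReal_ofNat]
  have hK1 : ENNReal.ofReal (2 * κ) = 2 * linConst c := by
    rw [ENNReal.ofReal_mul (by positivity), hlin, ENNReal.ofReal_ofNat]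
  refine ⟨η, 6 * κ * C, 2 * κ, hη, by positivity, by positivity, fun u₀ hu₀ hu₀fin =>
    ⟨fun v => solPath k u₀ fun s => Φ (v s), fun δ hδ v hv => ?_⟩⟩
  have hfin : ∀ {v}, v ∈ pathBall n (m + 1) σ δ → pathNorm (m + 1) σ v ≠ ⊤ := fun hv =>
    ne_top_of_le_ne_top ENNReal.ofReal_ne_top hv.2
  have hgm : ∀ {v}, v ∈ pathBall n (m + 1) σ δ →
      AEStronglyMeasurable (fun s => Φ (v s)) (volume.restrict (Ioi (0 : ℝ))) := fun hv =>
    hmeas _ _ hv.1 (ae_of_mem_pathBall hσ0 hδ hv)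
  have hgd : ∀ {v w}, v ∈ pathBall n (m + 1) σ δ → w ∈ pathBall n (m + 1) σ δ →
      weightSq m σ (fun s => Φ (v s) - Φ (w s)) ≤ (3 * ENNReal.ofReal C *
        (pathNorm (m + 1) σ v + pathNorm (m + 1) σ w) * pathNorm (m + 1) σ (v - w)) ^ 2 := by
    intro v w hv hw
    refine weightSq_sub_le hv.1 hw.1 ?_
    filter_upwards [ae_of_mem_pathBall hσ0 hδ hv, ae_of_mem_pathBall hσ0 hδ hw] with s h1 h2
    exact hdiff _ _ h1.1 h1.2 h2.1 h2.2
  have hg0 : ∀ {v}, v ∈ pathBall n (m + 1) σ δ → weightSq m σ (fun s => Φ (v s)) ≤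
      (3 * ENNReal.ofReal C * pathNorm (m + 1) σ v * pathNorm (m + 1) σ v) ^ 2 := by
    intro v hv
    have h := hgd hv (zero_mem_pathBall δ)
    simpa only [Pi.zero_apply, hΦ0, sub_zero, pathNorm_zero, add_zero] using h
  have hgw : ∀ {v}, v ∈ pathBall n (m + 1) σ δ → weightSq m σ (fun s => Φ (v s)) ≠ ⊤ := fun hv =>
    ne_top_of_le_ne_top (ENNReal.pow_ne_top (ENNReal.mul_ne_top (ENNReal.mul_ne_top
      (by finiteness) (hfin hv)) (hfin hv))) (hg0 hv)
  have hdata : ∀ {v}, v ∈ pathBall n (m + 1) σ δ →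
      LinearData k m σ c u₀ (fun s => Φ (v s)) := fun hv =>
    ⟨hσ0, hσ1, hσ2, hc, hgap, hgm hv, hgw hv, hu₀fin⟩
  have hD := hdata hv
  refine ⟨hD.isSolutionPath hm hu₀ ?_, hD.aestronglyMeasurable_solPath, ?_, fun w hw => ?_⟩
  · filter_upwards [ae_of_mem_pathBall hσ0 hδ hv] with s h1
    exact hval _ h1.1 h1.2
  · refine (hD.pathNorm_le fun s hs j => hD.eigProj_solPath hs j).trans ?_
    refine le_trans ?_ ((two_mul_rpow_half_le (K := linConst c) (e := sobolevNorm (m + 1) u₀)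
      (X := 3 * ENNReal.ofReal C * pathNorm (m + 1) σ v * pathNorm (m + 1) σ v) hκ1).trans ?_)
    · gcongr
      exact hg0 hv
    · rw [hC1, hK1]
      refine le_of_eq ?_
      ring
  · have hE := hdata hw
    have hsub : LinearData k m σ c (0 : L2Sphere n) (fun s => Φ (v s) - Φ (w s)) := by
      refine ⟨hσ0, hσ1, hσ2, hc, hgap, (hgm hv).sub (hgm hw),
        weightSq_sub_ne_top (hgm hv) (hgw hv) (hgw hw), ?_⟩
      rw [sobolevNorm_zero_right]
      exact ENNReal.zero_ne_top
    refine (hsub.pathNorm_le fun s hs j => ?_).trans ?_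
    · rw [Pi.sub_apply, map_sub, hD.eigProj_solPath hs, hE.eigProj_solPath hs]
      exact solComp_sub hσ0 hσ1 hD.measurable hE.measurable hD.weight hE.weight j hs
    · refine le_trans ?_ ((two_mul_rpow_half_le (K := linConst c)
        (e := sobolevNorm (m + 1) (0 : L2Sphere n))
        (X := 3 * ENNReal.ofReal C * (pathNorm (m + 1) σ v + pathNorm (m + 1) σ w) *
          pathNorm (m + 1) σ (v - w)) hκ1).trans ?_)
      · gcongr
        exact hgd hv hw
      · rw [hC1, sobolevNorm_zero_right, mul_zero, zero_add]
        refine le_of_eq ?_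
        ring

end Nonlinear

end

theorem theorem3p7 (n : ℕ) (hn : 1 ≤ n) (N : QuasilinearTerm n) (k : ℕ) (hk : 2 ≤ k)
    (r : ℕ) (hr : (n : ℝ) / 2 + 1 < (r : ℝ)) (σ : ℝ) (hσ0 : 0 < σ)
    (hσ1 : eigval n (k - 1) < σ) (hσ2 : σ < eigval n k) :
    ∃ C δ₀ : ℝ, 0 < C ∧ 0 < δ₀ ∧ ∀ δ : ℝ, 0 < δ → δ ≤ δ₀ →
      ∃ ε : ℝ, 0 < ε ∧ ∀ u₀ : L2Sphere n, u₀ ∈ spaceF n k →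
        sobolevNorm r u₀ ≤ ENNReal.ofReal ε →
        ∃ T : (ℝ → L2Sphere n) → (ℝ → L2Sphere n),
          -- `T v` is the unique solution of the initial value problem defining `T(v; u₀)`
          (∀ v ∈ pathBall n r σ δ, IsSolutionPath N k u₀ v (T v) ∧
            ∀ S : ℝ → L2Sphere n, IsSolutionPath N k u₀ v S → Set.EqOn S (T v) (Set.Ici 0)) ∧
          -- it maps the ball into itself
          Set.MapsTo T (pathBall n r σ δ) (pathBall n r σ δ) ∧
          -- the quadratic difference estimate
          (∀ v ∈ pathBall n r σ δ, ∀ w ∈ pathBall n r σ δ,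
            pathNorm r σ (T v - T w) ≤
              ENNReal.ofReal C * (pathNorm r σ v + pathNorm r σ w) * pathNorm r σ (v - w)) ∧
          -- it is a contraction
          (∃ q : ℝ, 0 < q ∧ q < 1 ∧ ∀ v ∈ pathBall n r σ δ, ∀ w ∈ pathBall n r σ δ,
            pathNorm r σ (T v - T w) ≤ ENNReal.ofReal q * pathNorm r σ (v - w)) ∧
          -- it has exactly one fixed point in the ball (paths are compared on `[0, ∞)`)
          (∃ v ∈ pathBall n r σ δ, Set.EqOn (T v) v (Set.Ici 0) ∧
            ∀ w ∈ pathBall n r σ δ, Set.EqOn (T w) w (Set.Ici 0) →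
              Set.EqOn w v (Set.Ici 0)) := by
  have : NeZero n := ⟨by omega⟩
  -- N(v) is measured in order m = r - 1, the order for which r > n/2 + 1 gives 2m > n, that is n +
  -- 1 ≤ 2m.
  obtain ⟨m, rfl⟩ : ∃ m, r = m + 1 := by
    refine ⟨r - 1, (Nat.succ_pred_eq_of_pos (Nat.pos_of_ne_zero ?_)).symm⟩
    rintro rfl
    have : (0 : ℝ) ≤ (n : ℝ) / 2 := by positivity
    push_cast at hr
    linarith
  have hm : n + 1 ≤ 2 * m := by
    have h : (n : ℝ) < 2 * m := by push_cast at hr; linarith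
    exact_mod_cast h
  obtain ⟨η, C, K, hη, hC, hK, hop⟩ := N.exists_solution_operator hm hσ0 hσ1 hσ2
  -- With δ ≤ 1/(4C) the contraction factor C(δ + δ) is at most 1/2. With ε = δ/(2K) the initial
  -- value contributes at most δ/2 and the quadratic term Cδ² at most δ/4, so the ball is preserved.
  refine ⟨C, min η (1 / (4 * C)), hC, lt_min hη (by positivity), fun δ hδ hδ₀ =>
    ⟨δ / (2 * K), by positivity, fun u₀ hu₀ hu₀ε => ?_⟩⟩
  obtain ⟨T, hT⟩ := hop u₀ hu₀ (ne_top_of_le_ne_top ENNReal.ofReal_ne_top hu₀ε)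
  have hδη : δ ≤ η := hδ₀.trans (min_le_left _ _)
  have hδC : C * δ ≤ 1 / 4 := by
    have h := hδ₀.trans (min_le_right _ _)
    rw [le_div_iff₀ (by positivity)] at h
    linarith
  have hmaps : MapsTo T (pathBall n (m + 1) σ δ) (pathBall n (m + 1) σ δ) := fun v hv => by
    obtain ⟨-, h1, h2, -⟩ := hT δ hδη v hv
    refine ⟨h1, h2.trans ?_⟩
    calc ENNReal.ofReal K * sobolevNorm (m + 1) u₀ +
          ENNReal.ofReal C * pathNorm (m + 1) σ v ^ 2
        ≤ ENNReal.ofReal K * ENNReal.ofReal (δ / (2 * K)) +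
          ENNReal.ofReal C * ENNReal.ofReal δ ^ 2 := by
            gcongr
            exact hv.2
      _ = ENNReal.ofReal (K * (δ / (2 * K)) + C * δ ^ 2) := by
            rw [← ENNReal.ofReal_mul hK.le, ← ENNReal.ofReal_pow hδ.le,
              ← ENNReal.ofReal_mul hC.le, ← ENNReal.ofReal_add (by positivity) (by positivity)]
      _ ≤ ENNReal.ofReal δ := by
            refine ENNReal.ofReal_le_ofReal ?_
            have e : K * (δ / (2 * K)) = δ / 2 := by field_simp
            rw [e]
            nlinarith
  have hcontr : ∀ v ∈ pathBall n (m + 1) σ δ, ∀ w ∈ pathBall n (m + 1) σ δ,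
      pathNorm (m + 1) σ (T v - T w) ≤
        ENNReal.ofReal (1 / 2) * pathNorm (m + 1) σ (v - w) := fun v hv w hw => by
    refine ((hT δ hδη v hv).2.2.2 w hw).trans ?_
    gcongr
    calc ENNReal.ofReal C * (pathNorm (m + 1) σ v + pathNorm (m + 1) σ w)
        ≤ ENNReal.ofReal C * (ENNReal.ofReal δ + ENNReal.ofReal δ) := by
          gcongr
          exacts [hv.2, hw.2]
      _ = ENNReal.ofReal (C * (δ + δ)) := by
          rw [← ENNReal.ofReal_add hδ.le hδ.le, ← ENNReal.ofReal_mul hC.le]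
      _ ≤ ENNReal.ofReal (1 / 2) := ENNReal.ofReal_le_ofReal (by linarith)
  exact ⟨T, fun v hv => ⟨(hT δ hδη v hv).1, fun S hS => hS.eqOn (hT δ hδη v hv).1⟩, hmaps,
    fun v hv => (hT δ hδη v hv).2.2.2, ⟨1 / 2, by norm_num, by norm_num, hcontr⟩,
    exists_unique_fixed_path hσ0 (by norm_num) hmaps hcontr⟩
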